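/- Let $\mathbb K=\mathbb R$ or $\mathbb C$, $\lambda,\mu\in\mathbb K$ and $k\ge 0$ an integer. For a weight $\nu\in\mathbb K$ let $\mathcal F_\nu(S^1)$ be the space of $\nu$-densities $\phi(x)(dx)^\nu$ on $S^1=\mathbb R/\mathbb Z$, $\phi\in C^\infty(S^1,\mathbb K)$, on which an orientation-preserving diffeomorphism $f$ of $S^1$ acts by $\rho^\nu_{f^{-1}}:\phi\,(dx)^\nu\mapsto (f')^\nu\,(\phi\circ f)\,(dx)^\nu$. Let $\mathcal D^k_{\lambda,\mu}(S^1)$ be the $\mathbb K$-vector space of linear differential operators $A=\sum_{i=0}^k a_i(x)\,\frac{d^i}{dx^i}:\mathcal F_\lambda(S^1)\to\mathcal F_\mu(S^1)$ with smooth coefficients, with the action $A\mapsto \rho^\mu_f\circ A\circ\rho^\lambda_{f^{-1}}$. Let ${\mathcal I^{k}_{\lambda,\mu}}^{\rm loc}(S^1)$ be the algebra of $\mathbb K$-linear maps $T:\mathcal D^k_{\lambda,\mu}(S^1)\to\mathcal D^k_{\lambda,\mu}(S^1)$ that commute with this action of all orientation-preserving diffeomorphisms of $S^1$ and are local, i.e.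 $\mathrm{Supp}(T(A))\subset\mathrm{Supp}(A)$ for all $A$. Then $\dim_{\mathbb K}{\mathcal I^{k}_{\lambda,\mu}}^{\rm loc}(S^1)$ is given by the following table. $$ \begin{array}{|l|c|c|c|c|c|c|} \hline k & 0&1&2&3&4&\ge5\\ \hline (\lambda,\mu)\text{ in none of the rows below}&1&2&2&1&1&1\\ \hline \lambda=0\text{ or }\mu=1,\text{ generic}&1&2&3&3&2&2\\ \hline \lambda+\mu=1,\text{ generic}&1&2&2&2&2&2\\ \hline (3\lambda+1)(3\mu-4)=-1\text{ or }\mu-\lambda=2,\text{ generic}&1&2&2&2&1&1\\ \hline \mu-\lambda=2\text{ and }2\lambda^2+2\lambda+1=0&1&2&2&2&2&1\\ \hline (\lambda,\mu)=(-\tfrac14,1),\,(-2,1),\,(0,\tfrac54),\,(0,3)&1&2&3&3&3&2\\ \hline (\lambda,\mu)=(0,0),\,(1,1)&1&2&3&3&3&3\\ \hline (\lambda,\mu)=(-\tfrac23,\tfrac53)&1&2&2&3&3&2\\ \hline (\lambda,\mu)=(-\tfrac12,\tfrac32)&1&2&3&3&2&2\\ \hline (\lambda,\mu)=(0,1)&1&3&4&5&5&5\\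 \hline \end{array} $$ Here "generic" means: in the row "$\lambda=0$ or $\mu=1$", that $(\lambda,\mu)$ is none of $(-\frac14,1),(-2,1),(0,\frac54),(0,3),(0,0),(1,1),(0,1)$; in the row "$\lambda+\mu=1$", that $(\lambda,\mu)$ is none of $(-\frac23,\frac53),(-\frac12,\frac32),(0,1)$; in the row "$(3\lambda+1)(3\mu-4)=-1$ or $\mu-\lambda=2$", that $\lambda\ne0$, $\mu\ne1$, $\lambda+\mu\neq1$ and $(\lambda,\mu)$ is not one of the two points $\left(\frac{-1\pm i}{2},\frac{3\pm i}{2}\right)$ of the row below it, which contains no real point. -/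

import Mathlib

open scoped ContDiff

namespace CircleDensity

/-- Smooth `𝕜`-valued functions on the circle `S¹ = ℝ/ℤ`, written in the coordinate `x` as smooth
`1`-periodic functions on `ℝ`. For every weight `lam`, the space `F_lam(S¹)` of densities
`φ(x) (dx)^lam` is identified with this space through the coefficient `φ`; the weight enters in the
action of diffeomorphisms (`densityPull` below). -/
def Smooth (𝕜 : Type*) [RCLike 𝕜] : Subalgebra 𝕜 (ℝ → 𝕜) where
  carrier := {φ | ContDiff ℝ ∞ φ ∧ ∀ x, φ (x + 1) = φ x}
  mul_mem' := fun {a b} ha hb =>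
    ⟨ha.1.mul hb.1, fun x => by simp only [Pi.mul_apply, ha.2 x, hb.2 x]⟩
  add_mem' := fun {a b} ha hb =>
    ⟨ha.1.add hb.1, fun x => by simp only [Pi.add_apply, ha.2 x, hb.2 x]⟩
  algebraMap_mem' := fun r => ⟨contDiff_const (c := r), fun _ => rfl⟩

variable {𝕜 : Type*} [RCLike 𝕜]

/-- The derivative `d/dx` on smooth functions on the circle. -/
noncomputable def D : Smooth 𝕜 →ₗ[𝕜] Smooth 𝕜 where
  toFun φ := ⟨deriv (φ : ℝ → 𝕜),
    (contDiff_infty_iff_deriv.1 φ.2.1).2, fun x => by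
      rw [← deriv_comp_add_const]
      exact congrArg (fun g => deriv g x) (funext φ.2.2)⟩
  map_add' φ ψ := Subtype.ext <| funext fun x =>
    deriv_add (φ.2.1.differentiable (by simp) x) (ψ.2.1.differentiable (by simp) x)
  map_smul' c φ := Subtype.ext <| funext fun x =>
    deriv_const_mul c (φ.2.1.differentiable (by simp) x)

/-- An orientation-preserving smooth diffeomorphism of `S¹ = ℝ/ℤ`, given by a lift to `ℝ`: a smooth
diffeomorphism `f` of `ℝ` with `f (x + 1) = f x + 1` and `f' > 0`. -/
structure Diffeo where
  /-- the lift, a bijection of `ℝ` -/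
  toEquiv : ℝ ≃ ℝ
  smooth : ContDiff ℝ ∞ toEquiv
  smooth_symm : ContDiff ℝ ∞ toEquiv.symm
  map_add_one : ∀ x, toEquiv (x + 1) = toEquiv x + 1
  deriv_pos : ∀ x, 0 < deriv toEquiv x

namespace Diffeo

/-- The inverse diffeomorphism. -/
def inv (f : Diffeo) : Diffeo where
  toEquiv := f.toEquiv.symm
  smooth := f.smooth_symm
  smooth_symm := f.smooth
  map_add_one x := by
    rw [Equiv.symm_apply_eq, f.map_add_one, Equiv.apply_symm_apply]
  deriv_pos x := by
    have h : HasDerivAt (fun y => f.toEquiv (f.toEquiv.symm y))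
        (deriv f.toEquiv (f.toEquiv.symm x) * deriv f.toEquiv.symm x) x :=
      HasDerivAt.comp x (f.smooth.differentiable (by simp) _).hasDerivAt
        (f.smooth_symm.differentiable (by simp) x).hasDerivAt
    have h1 : deriv f.toEquiv (f.toEquiv.symm x) * deriv f.toEquiv.symm x = 1 := by
      simp only [Equiv.apply_symm_apply] at h
      exact h.unique (hasDerivAt_id x)
    have h2 := f.deriv_pos (f.toEquiv.symm x)
    by_contra hc
    nlinarith [mul_nonneg h2.le (neg_nonneg.2 (not_lt.1 hc))]

end Diffeo

/-- Composition of a function on the circle with a diffeomorphism. -/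
def pull (f : Diffeo) : Smooth 𝕜 →ₐ[𝕜] Smooth 𝕜 where
  toFun φ := ⟨fun x => (φ : ℝ → 𝕜) (f.toEquiv x), φ.2.1.comp f.smooth, fun x => by
    simp only [f.map_add_one, φ.2.2]⟩
  map_one' := rfl
  map_mul' _ _ := rfl
  map_zero' := rfl
  map_add' _ _ := rfl
  commutes' _ := rfl

theorem deriv_add_one (f : Diffeo) (x : ℝ) : deriv f.toEquiv (x + 1) = deriv f.toEquiv x := by
  rw [← deriv_comp_add_const, funext f.map_add_one, deriv_add_const]

/-- The function `(f')^lam`, the power of the positive function `f'` being `exp (lam * log f')`. -/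
noncomputable def jac (lam : 𝕜) (f : Diffeo) : Smooth 𝕜 :=
  ⟨fun x => NormedSpace.exp (lam * ((Real.log (deriv f.toEquiv x) : ℝ) : 𝕜)), by
    have he : ContDiff ℝ ∞ (NormedSpace.exp : 𝕜 → 𝕜) :=
      contDiff_iff_contDiffAt.2 fun x => (NormedSpace.exp_analytic (𝕂 := ℝ) x).contDiffAt
    have hd : ContDiff ℝ ∞ (fun x => Real.log (deriv f.toEquiv x)) :=
      (contDiff_infty_iff_deriv.1 f.smooth).2.log fun x => (f.deriv_pos x).ne'
    exact he.comp (contDiff_const.mul ((RCLike.ofRealCLM (K := 𝕜)).contDiff.comp hd)), fun x => by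
    simp only [deriv_add_one]⟩

/-- Pull-back of densities of weight `lam` by `f`: `φ (dx)^lam ↦ (f')^lam φ(f(x)) (dx)^lam`. -/
noncomputable def densityPull (lam : 𝕜) (f : Diffeo) : Smooth 𝕜 →ₗ[𝕜] Smooth 𝕜 :=
  LinearMap.mulLeft 𝕜 (jac lam f) ∘ₗ (pull f).toLinearMap

/-- The action of a diffeomorphism `f` on densities of weight `lam`: pull-back by `f⁻¹`. -/
noncomputable def densityAct (lam : 𝕜) (f : Diffeo) : Smooth 𝕜 →ₗ[𝕜] Smooth 𝕜 :=
  densityPull lam f.inv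

variable (𝕜) in
/-- Linear differential operators of order at most `k` on the circle,
`A = a_k (d/dx)^k + ⋯ + a_1 (d/dx) + a_0` with smooth coefficients. -/
def DiffOp (k : ℕ) : Submodule 𝕜 (Smooth 𝕜 →ₗ[𝕜] Smooth 𝕜) where
  carrier := {A | ∃ a : ℕ → Smooth 𝕜, ∀ φ, A φ = ∑ i ∈ Finset.range (k + 1), a i * (D ^ i) φ}
  add_mem' := by
    rintro A B ⟨a, ha⟩ ⟨b, hb⟩
    exact ⟨a + b, fun φ => by
      simp only [LinearMap.add_apply, ha, hb, Pi.add_apply, add_mul, Finset.sum_add_distrib]⟩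
  zero_mem' := ⟨0, fun φ => by simp⟩
  smul_mem' := by
    rintro c A ⟨a, ha⟩
    exact ⟨c • a, fun φ => by
      simp only [LinearMap.smul_apply, ha, Pi.smul_apply, smul_mul_assoc, Finset.smul_sum]⟩

/-- The action `A ↦ ρ^mu_f ∘ A ∘ ρ^lam_{f⁻¹}` of a diffeomorphism `f` on linear maps from densities
of weight `lam` to densities of weight `mu`. -/
noncomputable def opAct (lam mu : 𝕜) (f : Diffeo) :
    (Smooth 𝕜 →ₗ[𝕜] Smooth 𝕜) →ₗ[𝕜] (Smooth 𝕜 →ₗ[𝕜] Smooth 𝕜) where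
  toFun A := densityAct mu f ∘ₗ A ∘ₗ densityAct lam f.inv
  map_add' A B := by rw [LinearMap.add_comp, LinearMap.comp_add]
  map_smul' c A := by rw [LinearMap.smul_comp, LinearMap.comp_smul, RingHom.id_apply]

theorem D_mul (φ ψ : Smooth 𝕜) : D (φ * ψ) = D φ * ψ + φ * D ψ :=
  Subtype.ext <| funext fun x =>
    deriv_mul (φ.2.1.differentiable (by simp) x) (ψ.2.1.differentiable (by simp) x)

theorem exists_D_pull (f : Diffeo) :
    ∃ g : Smooth 𝕜, ∀ φ : Smooth 𝕜, D (pull f φ) = g * pull f (D φ) := by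
  refine ⟨⟨fun x => ((deriv f.toEquiv x : ℝ) : 𝕜), (RCLike.ofRealCLM (K := 𝕜)).contDiff.comp
    (contDiff_infty_iff_deriv.1 f.smooth).2, fun x => by simp only [deriv_add_one]⟩, fun φ => ?_⟩
  refine Subtype.ext (funext fun x => ?_)
  have h := (φ.2.1.differentiable (by simp) (f.toEquiv x)).hasDerivAt.scomp x
    (f.smooth.differentiable (by simp) x).hasDerivAt
  refine h.deriv.trans ?_
  rw [RCLike.real_smul_eq_coe_mul]
  rfl

theorem exists_D_pow (f : Diffeo) (w : Smooth 𝕜) (i : ℕ) :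
    ∃ b : ℕ → Smooth 𝕜, (∀ j, i < j → b j = 0) ∧ ∀ (φ : Smooth 𝕜) (n : ℕ), i < n →
      (D ^ i) (w * pull f φ) = ∑ j ∈ Finset.range n, b j * pull f ((D ^ j) φ) := by
  obtain ⟨g, hg⟩ := exists_D_pull (𝕜 := 𝕜) f
  induction i with
  | zero =>
    refine ⟨fun j => if j = 0 then w else 0, fun j hj => if_neg hj.ne', fun φ n hn => ?_⟩
    rw [Finset.sum_eq_single 0 (fun j _ hj => by simp [hj])
      (fun h => absurd (Finset.mem_range.2 hn) h)]
    simp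
  | succ i ih =>
    obtain ⟨b, hb0, hb⟩ := ih
    refine ⟨fun j => D (b j) + (if j = 0 then 0 else b (j - 1) * g), fun j hj => ?_,
      fun φ n hn => ?_⟩
    · change D (b j) + (if j = 0 then 0 else b (j - 1) * g) = 0
      rw [hb0 j (by omega), hb0 (j - 1) (by omega)]
      simp
    · obtain ⟨m, rfl⟩ : ∃ m, n = m + 1 := ⟨n - 1, by omega⟩
      rw [pow_succ', Module.End.mul_apply, hb φ (m + 1) (by omega), map_sum]
      simp only [D_mul, hg, add_mul, Finset.sum_add_distrib]
      congr 1
      rw [Finset.sum_range_succ, hb0 m (by omega), Finset.sum_range_succ' _ m]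
      simp [pow_succ', mul_assoc]

theorem opAct_mem (lam mu : 𝕜) (f : Diffeo) (k : ℕ) (A : Smooth 𝕜 →ₗ[𝕜] Smooth 𝕜)
    (hA : A ∈ DiffOp 𝕜 k) : opAct lam mu f A ∈ DiffOp 𝕜 k := by
  obtain ⟨a, ha⟩ := hA
  choose b _ hb using exists_D_pow f.inv.inv (jac lam f.inv.inv)
  refine ⟨fun j => jac mu f.inv * pull f.inv (∑ i ∈ Finset.range (k + 1), a i * b i j),
    fun φ => ?_⟩
  have hinv : ∀ ψ : Smooth 𝕜, pull f.inv (pull f.inv.inv ψ) = ψ := fun ψ =>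
    Subtype.ext <| funext fun x => congrArg (ψ : ℝ → 𝕜) (f.toEquiv.apply_symm_apply x)
  have h1 : A (jac lam f.inv.inv * pull f.inv.inv φ) = ∑ j ∈ Finset.range (k + 1),
      (∑ i ∈ Finset.range (k + 1), a i * b i j) * pull f.inv.inv ((D ^ j) φ) := by
    rw [ha, Finset.sum_congr rfl fun i hi => by
      rw [hb i φ (k + 1) (Finset.mem_range.1 hi), Finset.mul_sum], Finset.sum_comm]
    simp only [Finset.sum_mul, mul_assoc]
  change jac mu f.inv * pull f.inv (A (jac lam f.inv.inv * pull f.inv.inv φ)) = _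
  rw [h1, map_sum, Finset.mul_sum]
  simp only [map_mul, hinv, mul_assoc]

/-- The action of `f` on the module `D^k_{lam,mu}(S¹)` of differential operators of order `≤ k` from
densities of weight `lam` to densities of weight `mu`. -/
noncomputable def diffOpAct (k : ℕ) (lam mu : 𝕜) (f : Diffeo) : DiffOp 𝕜 k →ₗ[𝕜] DiffOp 𝕜 k :=
  (opAct lam mu f).restrict (opAct_mem lam mu f k)

/-- The support of an operator `A` (as a periodic subset of `ℝ`): the closure of the set of points
at which `A` does not vanish, i.e. at which some `A φ`, equivalently some coefficient of `A`, is
non-zero. -/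
def supp {k : ℕ} (A : DiffOp 𝕜 k) : Set ℝ :=
  closure {x | ∃ φ : Smooth 𝕜, (A.1 φ : ℝ → 𝕜) x ≠ 0}

/-- The algebra of local symmetries of `D^k_{lam,mu}(S¹)`: the linear maps `T` from this space to
itself with `supp (T A) ⊆ supp A` which commute with the action of all diffeomorphisms. -/
noncomputable def localSymmetries (k : ℕ) (lam mu : 𝕜) :
    Subalgebra 𝕜 (Module.End 𝕜 (DiffOp 𝕜 k)) where
  carrier := {T | (∀ A, supp (T A) ⊆ supp A) ∧
    ∀ (f : Diffeo) (A : DiffOp 𝕜 k), T (diffOpAct k lam mu f A) = diffOpAct k lam mu f (T A)}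
  mul_mem' := by
    rintro S T ⟨hS, hS'⟩ ⟨hT, hT'⟩
    exact ⟨fun A => (hS _).trans (hT A), fun f A => by
      simp only [Module.End.mul_apply, hT', hS']⟩
  add_mem' := by
    rintro S T ⟨hS, hS'⟩ ⟨hT, hT'⟩
    refine ⟨fun A => ?_, fun f A => by simp only [LinearMap.add_apply, hT', hS', map_add]⟩
    refine closure_minimal ?_ isClosed_closure
    rintro x ⟨φ, hx⟩
    by_contra hc
    have h1 : ((S A).1 φ : ℝ → 𝕜) x = 0 := by
      by_contra h
      exact hc (hS A (subset_closure ⟨φ, h⟩))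
    have h2 : ((T A).1 φ : ℝ → 𝕜) x = 0 := by
      by_contra h
      exact hc (hT A (subset_closure ⟨φ, h⟩))
    refine hx ?_
    change ((S A).1 φ : ℝ → 𝕜) x + ((T A).1 φ : ℝ → 𝕜) x = 0
    rw [h1, h2, add_zero]
  algebraMap_mem' := by
    intro r
    refine ⟨fun A => closure_mono ?_, fun f A => by
      simp only [Module.algebraMap_end_apply, map_smul]⟩
    rintro x ⟨φ, hx⟩
    refine ⟨φ, fun h => hx ?_⟩
    change r * (A.1 φ : ℝ → 𝕜) x = 0
    rw [h, mul_zero]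

/-- A row of the table of dimensions: the entries are the values for `k = 0, 1, 2, 3, 4` and for all
`k ≥ 5`. -/
def row (d₀ d₁ d₂ d₃ d₄ d₅ : ℕ) : ℕ → ℕ
  | 0 => d₀
  | 1 => d₁
  | 2 => d₂
  | 3 => d₃
  | 4 => d₄
  | _ + 5 => d₅

end CircleDensity

/-! Write ∂ for `d/dx` and δ for `mu - lam`.

A local symmetry T is a finite matrix of scalars. The coefficient of order j of T(a ∂^i) at the
point 0 is linear in a and depends only on the germ of a. Equivariance under a diffeomorphism equal
to x/2 near 0 makes it homogeneous of degree i - j in a. Such a functional is a multiple of the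
derivative of order n = i - j at 0: if a vanishes to order n + 1 there, then near 0 it equals ψ(x) -
2^n ψ(x/2), where ψ is a convergent sum of dilates of a, and homogeneity gives the value 0. No
continuity of T is needed (`exists_eq_deriv_of_homogeneous`). Translations carry the constants to
every point, so T(a ∂^i) = Σ_p t_ip a^(i-p) ∂^p (`exists_symOf_eq`).

Next, equivariance is turned into linear equations on t. With h = g''/g', pulling back by g turns
∂^n on densities of weight w into E_n = (∂ - (w+n-1)h) ⋯ (∂ - w h). Commutation with g therefore
says that certain differential polynomials in h and in a coefficient b vanish; these are `defect`.
The derivative of a defect with respect to h is a combination of defects, namely the same one at the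
varied b and those of lower index, and of terms E_l(b) E_m(δh) E_p whose scalar coefficients are
`symEq` (`delta_defect`). At h = 0 the defect vanishes. Integrating along s ↦ s h shows that the
equations `symEq = 0` suffice (`defect_eq_zero`), and differentiating at s = 0 shows that they are
necessary (`sum_symEq_eq_zero`, `symEq_of_comm`). So the dimension is that of the solution space
`symMat` (`rank_localSymmetries`).

What remains is linear algebra. From order four on, a solution with only its last row non-zero is
zero (`eq_zero_of_truncate_eq_zero`), so the dimension does not increase from order three on and
upper bounds are needed only up to order five. Lower bounds come from explicit invariants. Some
exist in every order: the identity, A ↦ A(1) for lam = 0, A ↦ A*(1) for mu = 1, conjugation for lam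
+ mu = 1, and those obtained at (0,0), (0,1), (1,1) by factoring out ∂ on the right. The others
exist only in low order: they build a density from the coefficients of A and apply an invariant
bidifferential operator to it. Upper bounds are Gaussian eliminations, whose pivots are polynomials
in the weights vanishing on the curves and points of the table. -/

namespace CircleDensity

/-! ### Twisted derivatives and their variation -/

section Covariant

variable {K S M : Type*} [Field K] [CommRing S] [Algebra K S] [AddCommGroup M] [Module K M]
  [Module S M] [IsScalarTower K S M]

/-- The `n`-fold covariant derivative `(∇ - (w + n - 1) h) ⋯ (∇ - (w + 1) h) (∇ - w h)`. -/
def covPow (nabla : M →ₗ[K] M) (h : S) (w : K) : ℕ → M →ₗ[K] M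
  | 0 => LinearMap.id
  | n + 1 => (nabla - (w + n) • Algebra.lsmul K K M h) ∘ₗ covPow nabla h w n

theorem covPow_zero (nabla : M →ₗ[K] M) (h : S) (w : K) (m : M) :
    covPow nabla h w 0 m = m := rfl

theorem covPow_succ (nabla : M →ₗ[K] M) (h : S) (w : K) (n : ℕ) (m : M) :
    covPow nabla h w (n + 1) m =
      nabla (covPow nabla h w n m) - (w + n) • h • covPow nabla h w n m := rfl

/-- The weight rises by one with each factor, so the last n of k + n factors form a product that
starts at weight `w + k`. -/
theorem covPow_covPow (nabla : M →ₗ[K] M) (h : S) (w : K) (k n : ℕ) (m : M) :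
    covPow nabla h (w + k) n (covPow nabla h w k m) = covPow nabla h w (k + n) m := by
  induction n with
  | zero => rfl
  | succ n ih =>
    rw [covPow_succ, ih, ← add_assoc, covPow_succ]
    push_cast
    rw [add_assoc]

/-- Weights add under multiplication, so each twisted factor obeys the Leibniz rule and the usual
binomial induction applies. -/
theorem covPow_mul (dx : Derivation K S S) (h : S) (u v : K) (n : ℕ) (b c : S) :
    covPow (dx : S →ₗ[K] S) h (u + v) n (b * c) =
      ∑ ij ∈ Finset.HasAntidiagonal.antidiagonal n, (n.choose ij.1 : S) *
        (covPow (dx : S →ₗ[K] S) h u ij.1 b * covPow (dx : S →ₗ[K] S) h v ij.2 c) := by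
  induction n with
  | zero => simp [covPow_zero]
  | succ n ih =>
    rw [Finset.sum_antidiagonal_choose_succ_mul (fun i j =>
      covPow (dx : S →ₗ[K] S) h u i b * covPow (dx : S →ₗ[K] S) h v j c), covPow_succ, ih,
      map_sum, Finset.smul_sum, Finset.smul_sum, ← Finset.sum_sub_distrib,
      ← Finset.sum_add_distrib]
    refine Finset.sum_congr rfl fun ij hij => ?_
    have hn : (n.choose ij.2 : S) = n.choose ij.1 := by
      rw [← Finset.HasAntidiagonal.mem_antidiagonal.1 hij, Nat.choose_symm_add]
    -- The weight `u + v + n` of the new factor splits as `(u + i) + (v + j)`, one summand for each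
    -- side of the product.
    have hc : ((n : ℕ) : K) = ij.1 + ij.2 := by
      rw [← Finset.HasAntidiagonal.mem_antidiagonal.1 hij]; push_cast; rfl
    rw [hn, covPow_succ, covPow_succ, hc]
    simp only [Derivation.coeFn_coe, Derivation.leibniz, Derivation.map_natCast, smul_eq_mul,
      mul_zero, add_zero, Algebra.smul_def, map_add]
    ring

/-- The coefficient with which the `r`-th covariant derivative appears in the variation of the
`n`-th one, for the weight `w`. -/
def varCoeff (w : K) (n : ℕ) : ℕ → K
  | 0 => w
  | r + 1 => n.choose r + w * n.choose (r + 1)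

theorem varCoeff_self (w : K) (n : ℕ) : varCoeff w n n = w + n := by
  cases n with
  | zero => simp [varCoeff]
  | succ n => simp [varCoeff, add_comm]

/-- Pascal's rule. With `varCoeff_self` it is the recursion that one more factor imposes on the
coefficients in `delta_covPow`. -/
theorem varCoeff_succ_succ (w : K) (n r : ℕ) :
    varCoeff w (n + 1) (r + 1) = varCoeff w n (r + 1) + varCoeff w n r := by
  cases r with
  | zero => simp [varCoeff]; ring
  | succ r => simp only [varCoeff, Nat.choose_succ_succ]; push_cast; ring


/-- The variation of a covariant derivative. -/
theorem delta_covPow (dx ds : Derivation K S S) (nabla delta : M →ₗ[K] M)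
    (hcomm : ∀ m, delta (nabla m) = nabla (delta m))
    (hn : ∀ (s : S) m, nabla (s • m) = dx s • m + s • nabla m)
    (hd : ∀ (s : S) m, delta (s • m) = ds s • m + s • delta m)
    (h : S) (w : K) (n : ℕ) (m : M) :
    delta (covPow nabla h w n m) = covPow nabla h w n (delta m) -
      ∑ r ∈ Finset.range n, varCoeff w n r •
        covPow (dx : S →ₗ[K] S) h 1 (n - r - 1) (ds h) • covPow nabla h w r m := by
  set Z := fun k => covPow (dx : S →ₗ[K] S) h (1 : K) k (ds h) with hZ
  induction n with
  | zero => simp [covPow_zero]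
  | succ n ih =>
    -- The new factor acts by Leibniz on `Z (n - r - 1)`, of weight n - r, and on the r-th twisted
    -- derivative, of weight `w + r`. These weights add up to `w + n`, so each half raises one
    -- index.
    have key : ∀ r ∈ Finset.range n,
        nabla (varCoeff w n r • Z (n - r - 1) • covPow nabla h w r m) -
          (w + n) • h • (varCoeff w n r • Z (n - r - 1) • covPow nabla h w r m) =
        varCoeff w n r • Z (n - r) • covPow nabla h w r m +
          varCoeff w n r • Z (n - r - 1) • covPow nabla h w (r + 1) m := by
      intro r hr
      obtain ⟨k, rfl⟩ : ∃ k, n = r + k + 1 :=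
        ⟨n - r - 1, by have := Finset.mem_range.1 hr; omega⟩
      have e1 : r + k + 1 - r - 1 = k := by omega
      have e2 : r + k + 1 - r = k + 1 := by omega
      rw [e1, e2, map_smul, hn]
      have e3 : dx (Z k) = Z (k + 1) + (1 + k : K) • (h * Z k) := by
        simp only [hZ, covPow_succ]; simp
      have e4 : nabla (covPow nabla h w r m) = covPow nabla h w (r + 1) m +
          (w + r) • h • covPow nabla h w r m := by rw [covPow_succ]; simp
      rw [e3, e4]
      push_cast
      simp only [← algebraMap_smul (R := K) S]
      module
    rw [covPow_succ, map_sub, hcomm, map_smul, hd, ih, covPow_succ, smul_add, smul_sub, map_sub,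
      smul_sub, map_sum, Finset.smul_sum, Finset.smul_sum]
    have h2 := Finset.sum_congr rfl key
    rw [Finset.sum_sub_distrib, Finset.sum_add_distrib] at h2
    -- The first term on the right comes from varying h in the new factor itself. It joins the first
    -- sum as its term r = n, and Pascal's rule merges the two sums.
    have h3 : ∑ r ∈ Finset.range (n + 1), varCoeff w (n + 1) r • Z (n + 1 - r - 1) •
          covPow nabla h w r m = (w + n) • Z 0 • covPow nabla h w n m +
        (∑ r ∈ Finset.range n, varCoeff w n r • Z (n - r) • covPow nabla h w r m +
          ∑ r ∈ Finset.range n, varCoeff w n r • Z (n - r - 1) •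
            covPow nabla h w (r + 1) m) := by
      have h4 : (w + n) • Z 0 • covPow nabla h w n m +
          ∑ r ∈ Finset.range n, varCoeff w n r • Z (n - r) • covPow nabla h w r m =
          ∑ r ∈ Finset.range (n + 1), varCoeff w n r • Z (n - r) • covPow nabla h w r m := by
        rw [Finset.sum_range_succ, varCoeff_self, Nat.sub_self, add_comm]
      rw [← add_assoc, h4, Finset.sum_range_succ', Finset.sum_range_succ' _ n]
      rw [add_right_comm, ← Finset.sum_add_distrib]
      congr 1
      refine Finset.sum_congr rfl fun r _ => ?_
      have e1 : n + 1 - (r + 1) - 1 = n - r - 1 := by omega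
      have e2 : n - (r + 1) = n - r - 1 := by omega
      rw [e1, e2, varCoeff_succ_succ, add_smul]
    rw [h3, ← h2]
    simp only [hZ, covPow_zero]
    abel

end Covariant

end CircleDensity

/-! ### Coefficient sequences of operators and the defect of invariance -/

namespace CircleDensity

section Defect

variable {K S : Type*} [Field K] [CommRing S] [Algebra K S]

/-- Composition with the derivation on the left, on sequences of coefficients of operators. -/
def symNabla (dx : Derivation K S S) : (ℕ → S) →ₗ[K] (ℕ → S) where
  toFun v
    | 0 => dx (v 0)
    | q + 1 => dx (v (q + 1)) + v q
  map_add' v w := by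
    ext q
    cases q with
    | zero => simp
    | succ q => simp only [Pi.add_apply, map_add]; abel
  map_smul' c v := by
    ext q
    cases q with
    | zero => simp
    | succ q => simp

theorem symNabla_apply_zero (dx : Derivation K S S) (v : ℕ → S) : symNabla dx v 0 = dx (v 0) := rfl

theorem symNabla_apply_succ (dx : Derivation K S S) (v : ℕ → S) (q : ℕ) :
    symNabla dx v (q + 1) = dx (v (q + 1)) + v q := rfl

theorem symNabla_smul (dx : Derivation K S S) (s : S) (v : ℕ → S) :
    symNabla dx (s • v) = dx s • v + s • symNabla dx v := by
  ext q
  cases q with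
  | zero => simp [symNabla]; ring
  | succ q => simp [symNabla]; ring

/-- The coefficients of the operator `(d - (lam + p - 1) h) ⋯ (d - lam h)`. -/
def symE (dx : Derivation K S S) (h : S) (lam : K) (p : ℕ) : ℕ → S :=
  covPow (symNabla dx) h lam p (Pi.single 0 1)

/-- The map on sequences of coefficients with the matrix `t`, whose `(p, j)` entry is multiplied by
`d ^ (p - j)`. -/
def matOp (dx : Derivation K S S) (t : ℕ → ℕ → K) (N : ℕ) : (ℕ → S) →ₗ[K] (ℕ → S) where
  toFun v j := ∑ p ∈ Finset.range N, t p j • ((dx : S →ₗ[K] S) ^ (p - j)) (v p)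
  map_add' v w := by
    ext j
    simp only [Pi.add_apply, map_add, smul_add, Finset.sum_add_distrib]
  map_smul' c v := by
    ext j
    simp only [Pi.smul_apply, map_smul, RingHom.id_apply, Finset.smul_sum]
    exact Finset.sum_congr rfl fun p _ => smul_comm _ _ _

/-- The failure of `matOp` to commute with a change of variables of second logarithmic derivative
`h`, on the operators `b d^i`. -/
def defect (dx : Derivation K S S) (t : ℕ → ℕ → K) (N : ℕ) (lam delta : K) (h : S) (i : ℕ) :
    S →ₗ[K] (ℕ → S) where
  toFun b := matOp dx t N (b • symE dx h lam i) - ∑ p ∈ Finset.range N,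
    t i p • covPow (dx : S →ₗ[K] S) h (delta - i) (i - p) b • symE dx h lam p
  map_add' b c := by
    simp only [add_smul, map_add, smul_add, Finset.sum_add_distrib]
    abel
  map_smul' r b := by
    simp only [smul_assoc, map_smul, RingHom.id_apply, smul_sub, Finset.smul_sum]
    congr 1
    exact Finset.sum_congr rfl fun p _ => smul_comm _ _ _

/-- The linear equations on `t` expressing infinitesimal invariance. -/
def symEq (t : ℕ → ℕ → K) (lam delta : K) (i p l : ℕ) : K :=
  t i p * varCoeff (delta - i) (i - p) l + t i (i - l) * varCoeff lam (i - l) p -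
    ∑ r ∈ Finset.range i, varCoeff lam i r * t r p * ((r - p).choose l)

theorem defect_apply (dx : Derivation K S S) (t : ℕ → ℕ → K) (N : ℕ) (lam delta : K) (h : S)
    (i : ℕ) (b : S) : defect dx t N lam delta h i b = matOp dx t N (b • symE dx h lam i) -
      ∑ p ∈ Finset.range N,
        t i p • covPow (dx : S →ₗ[K] S) h (delta - i) (i - p) b • symE dx h lam p := rfl

/-- This is `delta_covPow` in the module of coefficient sequences. The starting vector, the operator
1, has constant coefficients, so only the variation of h contributes. -/
theorem delta_symE (dx ds : Derivation K S S) (hcomm : ∀ s, ds (dx s) = dx (ds s))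
    (h : S) (lam : K) (p : ℕ) :
    (ds : S →ₗ[K] S).compLeft ℕ (symE dx h lam p) = - ∑ r ∈ Finset.range p, varCoeff lam p r •
      covPow (dx : S →ₗ[K] S) h 1 (p - r - 1) (ds h) • symE dx h lam r := by
  refine (delta_covPow dx ds (symNabla dx) ((ds : S →ₗ[K] S).compLeft ℕ) ?_
    (symNabla_smul dx) ?_ h lam p _).trans ?_
  · intro v
    ext q
    cases q with
    | zero => simp [symNabla, hcomm]
    | succ q => simp [symNabla, hcomm]
  · intro s v
    ext q
    simp; ring
  · have : (ds : S →ₗ[K] S).compLeft ℕ (Pi.single 0 1 : ℕ → S) = 0 := by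
      ext q
      cases q <;> simp
    rw [this, map_zero, zero_sub]
    rfl

theorem delta_matOp (dx ds : Derivation K S S) (hcomm : ∀ s, ds (dx s) = dx (ds s))
    (t : ℕ → ℕ → K) (N : ℕ) (v : ℕ → S) :
    (ds : S →ₗ[K] S).compLeft ℕ (matOp dx t N v) =
      matOp dx t N ((ds : S →ₗ[K] S).compLeft ℕ v) := by
  have hp : ∀ (n : ℕ) (s : S), ds (((dx : S →ₗ[K] S) ^ n) s) = ((dx : S →ₗ[K] S) ^ n) (ds s) := by
    intro n s
    induction n with
    | zero => rfl
    | succ n ih => simp only [pow_succ', Module.End.mul_apply, Derivation.coeFn_coe, hcomm, ih]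
  ext j
  simp [matOp, hp]

end Defect

end CircleDensity

/-! ### First variation of the defect -/

namespace CircleDensity

/-- Puts sums of different lengths on one range, so that double sums can be exchanged and compared
term by term. -/
theorem sum_range_eq_sum_ite {A : Type*} [AddCommMonoid A] {n N : ℕ} (hn : n ≤ N) (f : ℕ → A) :
    ∑ r ∈ Finset.range n, f r = ∑ r ∈ Finset.range N, if r < n then f r else 0 := by
  rw [← Finset.sum_filter]
  refine Finset.sum_congr ?_ fun _ _ => rfl
  ext r
  simp only [Finset.mem_range, Finset.mem_filter]
  omega

section Defect

variable {K S : Type*} [Field K] [CommRing S] [Algebra K S]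

/-- The terms `E_l(b) ζ E_p` in the variation of the defect. -/
def varTerm (dx ds : Derivation K S S) (lam w : K) (h : S) (i : ℕ) (b : S) (p l : ℕ) : ℕ → S :=
  (covPow (dx : S →ₗ[K] S) h w l b *
    covPow (dx : S →ₗ[K] S) h (1 : K) (i - p - l - 1) (ds h)) • symE dx h lam p

/-- First of the three contributions to the variation of the defect, all expanded in the same terms
`varTerm`. This one comes from varying the twisted derivative of b. -/
theorem sum_varTerm_left (dx ds : Derivation K S S) (t : ℕ → ℕ → K) (N : ℕ) (lam w : K) (h : S)
    (i : ℕ) (hi : i < N) (b : S) :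
    ∑ p ∈ Finset.range N, t i p • (∑ r ∈ Finset.range (i - p), varCoeff w (i - p) r •
        covPow (dx : S →ₗ[K] S) h (1 : K) (i - p - r - 1) (ds h) •
          covPow (dx : S →ₗ[K] S) h w r b) • symE dx h lam p =
      ∑ p ∈ Finset.range N, ∑ l ∈ Finset.range N, if p + l < i then
        (t i p * varCoeff w (i - p) l) • varTerm dx ds lam w h i b p l else 0 := by
  refine Finset.sum_congr rfl fun p _ => ?_
  rw [sum_range_eq_sum_ite (show i - p ≤ N by omega), Finset.sum_smul, Finset.smul_sum]
  refine Finset.sum_congr rfl fun l _ => ?_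
  have : l < i - p ↔ p + l < i := by omega
  simp only [this]
  split_ifs
  · rw [varTerm, mul_smul (t i p), smul_eq_mul, smul_assoc, mul_comm]
  · simp

/-- Contribution of varying the operators E_q. The substitution q = i - l turns the twisted
derivative of b of order i - q into one of order l. -/
theorem sum_varTerm_right (dx ds : Derivation K S S) (t : ℕ → ℕ → K)
    (ht : ∀ i p, i < p → t i p = 0) (N : ℕ) (lam w : K) (h : S)
    (i : ℕ) (hi : i < N) (b : S) :
    ∑ q ∈ Finset.range N, t i q • covPow (dx : S →ₗ[K] S) h w (i - q) b •
        (∑ p ∈ Finset.range q, varCoeff lam q p •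
          covPow (dx : S →ₗ[K] S) h (1 : K) (q - p - 1) (ds h) • symE dx h lam p) =
      ∑ p ∈ Finset.range N, ∑ l ∈ Finset.range N, if p + l < i then
        (t i (i - l) * varCoeff lam (i - l) p) • varTerm dx ds lam w h i b p l else 0 := by
  have h1 : ∀ f : ℕ → (ℕ → S), ∑ q ∈ Finset.range N, t i q • f q =
      ∑ l ∈ Finset.range (i + 1), t i (i - l) • f (i - l) := by
    intro f
    have := Finset.sum_range_reflect (fun q => t i q • f q) (i + 1)
    simp only [Nat.add_sub_cancel] at this
    rw [this]
    refine (Finset.sum_subset (Finset.range_mono (by omega)) fun q _ hq => ?_).symm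
    rw [ht i q (by simpa using hq), zero_smul]
  rw [h1 (fun q => covPow (dx : S →ₗ[K] S) h w (i - q) b •
        (∑ p ∈ Finset.range q, varCoeff lam q p •
          covPow (dx : S →ₗ[K] S) h (1 : K) (q - p - 1) (ds h) • symE dx h lam p)),
    sum_range_eq_sum_ite (show i + 1 ≤ N by omega), Finset.sum_comm]
  refine Finset.sum_congr rfl fun l _ => ?_
  split_ifs with hl
  · rw [sum_range_eq_sum_ite (show i - l ≤ N by omega), Finset.smul_sum, Finset.smul_sum]
    refine Finset.sum_congr rfl fun p _ => ?_
    have : p < i - l ↔ p + l < i := by omega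
    simp only [this]
    split_ifs with hp
    · have e1 : i - (i - l) = l := by omega
      have e2 : i - l - p - 1 = i - p - l - 1 := by omega
      rw [varTerm, e1, e2, mul_smul (t i (i - l)), mul_smul (covPow _ _ _ _ _),
        smul_comm (varCoeff lam (i - l) p) (covPow (dx : S →ₗ[K] S) h w l b)]
    · simp
  · refine (Finset.sum_eq_zero fun p _ => if_neg ?_).symm
    omega

/-- Varying E_i inside `matOp` produces operators (b ζ) E_r with r < i and ζ a twisted derivative of
the variation of h. Replacing `matOp` of these by a defect of index r leaves the sum treated here,
in which the twisted Leibniz rule separates b from ζ. -/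
theorem sum_varTerm_mul (dx ds : Derivation K S S) (t : ℕ → ℕ → K)
    (ht : ∀ i p, i < p → t i p = 0) (N : ℕ) (lam delta : K) (h : S)
    (i : ℕ) (hi : i < N) (b : S) :
    ∑ r ∈ Finset.range i, varCoeff lam i r • ∑ p ∈ Finset.range N,
        t r p • covPow (dx : S →ₗ[K] S) h (delta - r) (r - p)
          (b * covPow (dx : S →ₗ[K] S) h (1 : K) (i - r - 1) (ds h)) • symE dx h lam p =
      ∑ p ∈ Finset.range N, ∑ l ∈ Finset.range N, if p + l < i then
        (∑ r ∈ Finset.range i, varCoeff lam i r * t r p * ((r - p).choose l)) •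
          varTerm dx ds lam (delta - i) h i b p l else 0 := by
  have h1 : ∀ r ∈ Finset.range i, ∀ p ∈ Finset.range N,
      varCoeff lam i r • t r p • covPow (dx : S →ₗ[K] S) h (delta - r) (r - p)
          (b * covPow (dx : S →ₗ[K] S) h (1 : K) (i - r - 1) (ds h)) • symE dx h lam p =
      ∑ l ∈ Finset.range N, if p + l < i then (varCoeff lam i r * t r p * ((r - p).choose l)) •
          varTerm dx ds lam (delta - i) h i b p l else 0 := by
    intro r hr p _
    have hr := Finset.mem_range.1 hr
    rcases lt_or_ge r p with hrp | hrp
    · simp [ht r p hrp]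
    -- The weight is split between b, of weight `delta - i`, and ζ, of weight 1 + (i - r - 1), as
    -- `covPow_mul` requires.
    have hw : delta - r = (delta - i) + (1 + (i - r - 1 : ℕ)) := by
      rw [Nat.sub_sub, Nat.cast_sub (by omega)]; push_cast; ring
    rw [hw, covPow_mul, Finset.Nat.sum_antidiagonal_eq_sum_range_succ_mk,
      sum_range_eq_sum_ite (show (r - p).succ ≤ N by omega), Finset.sum_smul, Finset.smul_sum,
      Finset.smul_sum]
    refine Finset.sum_congr rfl fun l _ => ?_
    rcases le_or_gt l (r - p) with hl | hl
    · have e1 : i - r - 1 + (r - p - l) = i - p - l - 1 := by omega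
      rw [if_pos (by omega), if_pos (by omega), covPow_covPow, e1, varTerm, mul_smul (_ * _),
        mul_smul (varCoeff lam i r), mul_smul ((Nat.choose (r - p) l : ℕ) : S), Nat.cast_smul_eq_nsmul,
        Nat.cast_smul_eq_nsmul]
    · rw [if_neg (by omega), Nat.choose_eq_zero_of_lt hl]
      simp
  simp only [Finset.smul_sum]
  rw [Finset.sum_congr rfl fun r hr => Finset.sum_congr rfl (h1 r hr), Finset.sum_comm]
  refine Finset.sum_congr rfl fun p _ => ?_
  rw [Finset.sum_comm]
  refine Finset.sum_congr rfl fun l _ => ?_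
  split_ifs
  · rw [Finset.sum_smul]
  · simp

/-- The variation of the defect. -/
theorem delta_defect (dx ds : Derivation K S S) (hcomm : ∀ s, ds (dx s) = dx (ds s))
    (t : ℕ → ℕ → K) (ht : ∀ i p, i < p → t i p = 0) (N : ℕ) (lam delta : K) (h : S)
    (i : ℕ) (hi : i < N) (b : S) :
    (ds : S →ₗ[K] S).compLeft ℕ (defect dx t N lam delta h i b) =
      defect dx t N lam delta h i (ds b) -
      ∑ r ∈ Finset.range i, varCoeff lam i r • defect dx t N lam delta h r
        (b * covPow (dx : S →ₗ[K] S) h (1 : K) (i - r - 1) (ds h)) +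
      ∑ p ∈ Finset.range N, ∑ l ∈ Finset.range N, if p + l < i then
        symEq t lam delta i p l • varTerm dx ds lam (delta - i) h i b p l else 0 := by
  have hsm : ∀ (s : S) (v : ℕ → S), (ds : S →ₗ[K] S).compLeft ℕ (s • v) =
      ds s • v + s • (ds : S →ₗ[K] S).compLeft ℕ v := by
    intro s v
    ext q
    simp; ring
  have hvar : ∀ (w : K) (n : ℕ), ds (covPow (dx : S →ₗ[K] S) h w n b) =
      covPow (dx : S →ₗ[K] S) h w n (ds b) - ∑ r ∈ Finset.range n, varCoeff w n r •
        covPow (dx : S →ₗ[K] S) h 1 (n - r - 1) (ds h) • covPow (dx : S →ₗ[K] S) h w r b :=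
    fun w n => delta_covPow dx ds (dx : S →ₗ[K] S) (ds : S →ₗ[K] S) hcomm
      (fun s m => by simp; ring) (fun s m => by simp; ring) h w n b
  -- `symEq` is by definition the total coefficient of `varTerm` in the three contributions.
  have hsplit : ∑ p ∈ Finset.range N, ∑ l ∈ Finset.range N, (if p + l < i then
        symEq t lam delta i p l • varTerm dx ds lam (delta - i) h i b p l else 0) =
      ∑ p ∈ Finset.range N, ∑ l ∈ Finset.range N, (if p + l < i then
        (t i p * varCoeff (delta - i) (i - p) l) • varTerm dx ds lam (delta - i) h i b p l
          else 0) +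
      ∑ p ∈ Finset.range N, ∑ l ∈ Finset.range N, (if p + l < i then
        (t i (i - l) * varCoeff lam (i - l) p) • varTerm dx ds lam (delta - i) h i b p l
          else 0) -
      ∑ p ∈ Finset.range N, ∑ l ∈ Finset.range N, if p + l < i then
        (∑ r ∈ Finset.range i, varCoeff lam i r * t r p * ((r - p).choose l)) •
          varTerm dx ds lam (delta - i) h i b p l else 0 := by
    rw [← Finset.sum_add_distrib, ← Finset.sum_sub_distrib]
    refine Finset.sum_congr rfl fun p _ => ?_
    rw [← Finset.sum_add_distrib, ← Finset.sum_sub_distrib]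
    refine Finset.sum_congr rfl fun l _ => ?_
    split_ifs
    · rw [symEq, sub_smul, add_smul]
    · simp
  rw [hsplit, ← sum_varTerm_left dx ds t N lam _ h i hi, ← sum_varTerm_right dx ds t ht N lam _ h i hi,
    ← sum_varTerm_mul dx ds t ht N lam delta h i hi]
  simp only [defect_apply, map_sub, map_sum, map_smul, hsm, delta_matOp dx ds hcomm, hvar,
    delta_symE dx ds hcomm, smul_sub, sub_smul, smul_add, map_add, Finset.sum_sub_distrib,
    Finset.sum_add_distrib, map_neg, smul_neg, Finset.sum_neg_distrib, Finset.smul_sum (r := b)]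
  have hL : ∑ r ∈ Finset.range i, matOp dx t N (b • varCoeff lam i r •
        covPow (dx : S →ₗ[K] S) h 1 (i - r - 1) (ds h) • symE dx h lam r) =
      ∑ r ∈ Finset.range i, varCoeff lam i r • matOp dx t N
        ((b * covPow (dx : S →ₗ[K] S) h 1 (i - r - 1) (ds h)) • symE dx h lam r) := by
    refine Finset.sum_congr rfl fun r _ => ?_
    rw [smul_comm, map_smul, mul_smul]
  rw [hL]
  abel

end Defect

end CircleDensity

/-! ### Functoriality of the defect and its vanishing at h = 0 -/

namespace CircleDensity

section Functoriality

variable {K S S' : Type*} [Field K] [CommRing S] [Algebra K S] [CommRing S'] [Algebra K S']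

theorem map_covPow (dx : Derivation K S S) (dx' : Derivation K S' S') (φ : S →ₐ[K] S')
    (hφ : ∀ s, φ (dx s) = dx' (φ s)) (h : S) (w : K) (n : ℕ) (b : S) :
    φ (covPow (dx : S →ₗ[K] S) h w n b) = covPow (dx' : S' →ₗ[K] S') (φ h) w n (φ b) := by
  induction n with
  | zero => rfl
  | succ n ih => simp [covPow_succ, hφ, ih]

theorem map_symE (dx : Derivation K S S) (dx' : Derivation K S' S') (φ : S →ₐ[K] S')
    (hφ : ∀ s, φ (dx s) = dx' (φ s)) (h : S) (lam : K) (p q : ℕ) :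
    φ (symE dx h lam p q) = symE dx' (φ h) lam p q := by
  unfold symE
  induction p generalizing q with
  | zero => by_cases hq : q = 0 <;> simp [covPow_zero, hq]
  | succ p ih =>
    rw [covPow_succ, covPow_succ]
    cases q <;> simp [symNabla_apply_zero, symNabla_apply_succ, hφ, ih]

theorem map_pow_derivation (dx : Derivation K S S) (dx' : Derivation K S' S') (φ : S →ₐ[K] S')
    (hφ : ∀ s, φ (dx s) = dx' (φ s)) (n : ℕ) (s : S) :
    φ (((dx : S →ₗ[K] S) ^ n) s) = ((dx' : S' →ₗ[K] S') ^ n) (φ s) := by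
  induction n with
  | zero => rfl
  | succ n ih => simp only [pow_succ', Module.End.mul_apply, Derivation.coeFn_coe, hφ, ih]

/-- The defect is a universal differential polynomial in h and b. This makes it possible to deform h
over a polynomial ring and then specialise. -/
theorem map_defect (dx : Derivation K S S) (dx' : Derivation K S' S') (φ : S →ₐ[K] S')
    (hφ : ∀ s, φ (dx s) = dx' (φ s)) (t : ℕ → ℕ → K) (N : ℕ) (lam delta : K) (h : S) (i : ℕ)
    (b : S) (q : ℕ) : φ (defect dx t N lam delta h i b q) =
      defect dx' t N lam delta (φ h) i (φ b) q := by
  simp [defect_apply, matOp, map_covPow dx dx' φ hφ, map_symE dx dx' φ hφ,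
    map_pow_derivation dx dx' φ hφ]

theorem covPow_const_mul (dx : Derivation K S S) (h : S) (w : K) (n : ℕ) (c b : S)
    (hc : dx c = 0) : covPow (dx : S →ₗ[K] S) h w n (c * b) =
      c * covPow (dx : S →ₗ[K] S) h w n b := by
  induction n with
  | zero => rfl
  | succ n ih =>
    rw [covPow_succ, ih, covPow_succ]
    simp [hc, Algebra.smul_def]
    ring

theorem pow_const_mul (dx : Derivation K S S) (n : ℕ) (c b : S)
    (hc : dx c = 0) : ((dx : S →ₗ[K] S) ^ n) (c * b) = c * ((dx : S →ₗ[K] S) ^ n) b := by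
  induction n with
  | zero => rfl
  | succ n ih => simp [pow_succ', ih, hc]

/-- Every operation in the defect is linear over constants of the derivation. It serves to pull out
powers of X, which are constants for `coeffDer`. -/
theorem defect_const_mul (dx : Derivation K S S) (t : ℕ → ℕ → K) (N : ℕ) (lam delta : K) (h : S)
    (i : ℕ) (c b : S) (hc : dx c = 0) :
    defect dx t N lam delta h i (c * b) = c • defect dx t N lam delta h i b := by
  ext q
  simp [defect_apply, matOp, covPow_const_mul dx _ _ _ _ _ hc, mul_assoc,
    pow_const_mul dx _ _ _ hc, mul_sub, Finset.mul_sum]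

theorem covPow_flat (dx : Derivation K S S) (w : K) (n : ℕ) (b : S) :
    covPow (dx : S →ₗ[K] S) (0 : S) w n b = ((dx : S →ₗ[K] S) ^ n) b := by
  induction n with
  | zero => rfl
  | succ n ih => simp [covPow_succ, ih, pow_succ']

theorem symE_flat (dx : Derivation K S S) (lam : K) (p : ℕ) :
    symE dx (0 : S) lam p = Pi.single p 1 := by
  unfold symE
  induction p with
  | zero => rfl
  | succ p ih =>
    rw [covPow_succ, ih]
    ext q
    cases q with
    | zero => by_cases h : p = 0 <;> simp [symNabla_apply_zero, h]
    | succ q => by_cases h : q = p <;> simp [symNabla_apply_succ, h, Pi.single_apply, apply_ite dx]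

/-- For h = 0 the twisted derivatives are powers of ∂ and E_p is ∂^p, so both halves of the defect
have the entries t_ip ∂^(i-p) b. -/
theorem defect_flat (dx : Derivation K S S) (t : ℕ → ℕ → K) (ht : ∀ i p, i < p → t i p = 0)
    (N : ℕ) (lam delta : K) (i : ℕ) (hi : i < N) (b : S) :
    defect dx t N lam delta (0 : S) i b = 0 := by
  ext q
  have h0 : ∀ n x : ℕ, ((dx : S →ₗ[K] S) ^ n) (if x = i then b else 0) =
      if x = i then ((dx : S →ₗ[K] S) ^ n) b else 0 := by
    intro n x
    split_ifs <;> simp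
  simp only [defect_apply, symE_flat, covPow_flat, matOp, LinearMap.coe_mk, AddHom.coe_mk,
    Pi.sub_apply, Finset.sum_apply, Pi.smul_apply, Pi.single_apply, smul_eq_mul, mul_ite, mul_one,
    mul_zero, h0, smul_ite, smul_zero]
  rw [Finset.sum_ite_eq' _ i, if_pos (Finset.mem_range.2 hi), Finset.sum_ite_eq]
  split_ifs with hq
  · simp
  · rw [ht i q (by rw [Finset.mem_range] at hq; omega)]
    simp

end Functoriality

/-! ### Deformation from 0 to h over a polynomial ring -/

section Polynomial

open Polynomial

variable {K R : Type*} [Field K] [CommRing R] [Algebra K R]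

/-- The coefficientwise extension of a derivation to polynomials. -/
noncomputable def coeffDer (D : Derivation K R R) : Derivation K R[X] R[X] :=
  (PolynomialModule.equivPolynomialSelf (R := R)).toLinearMap.compDer D.mapCoeffs

theorem coeff_coeffDer (D : Derivation K R R) (p : R[X]) (n : ℕ) :
    (coeffDer D p).coeff n = D (p.coeff n) := rfl

theorem coeffDer_X (D : Derivation K R R) : coeffDer D X = 0 := by
  ext n
  rw [coeff_coeffDer, coeff_X]
  split_ifs <;> simp

theorem coeffDer_C (D : Derivation K R R) (a : R) : coeffDer D (C a) = C (D a) := by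
  ext n
  rw [coeff_coeffDer, coeff_C, coeff_C]
  split_ifs <;> simp

/-- The derivative of polynomials as a derivation over the ground field. -/
noncomputable def formalDer (K R : Type*) [Field K] [CommRing R] [Algebra K R] :
    Derivation K R[X] R[X] :=
  (Polynomial.derivative' (R := R)).restrictScalars K

theorem formalDer_apply (p : R[X]) : formalDer K R p = derivative p := rfl

theorem formalDer_coeffDer (D : Derivation K R R) (p : R[X]) :
    formalDer K R (coeffDer D p) = coeffDer D (formalDer K R p) := by
  ext n
  simp [formalDer_apply, coeff_coeffDer, coeff_derivative, mul_comm]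

/-- Evaluation of polynomials at a scalar. -/
noncomputable def evalScalar (R : Type*) [CommRing R] [Algebra K R] (s : K) : R[X] →ₐ[K] R :=
  (aeval (algebraMap K R s)).restrictScalars K

theorem evalScalar_apply (s : K) (p : R[X]) : evalScalar R s p = p.eval (algebraMap K R s) := by
  simp [evalScalar, aeval_def, eval₂_eq_eval_map]

theorem evalScalar_coeffDer (D : Derivation K R R) (s : K) (p : R[X]) :
    evalScalar R s (coeffDer D p) = D (evalScalar R s p) := by
  induction p using Polynomial.induction_on' with
  | add p q hp hq => simp only [map_add, hp, hq]
  | monomial n a =>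
    rw [← C_mul_X_pow_eq_monomial, Derivation.leibniz, Derivation.leibniz_pow, coeffDer_X,
      coeffDer_C]
    simp [evalScalar_apply]
    rw [← map_pow, mul_comm]

theorem eq_C_of_formalDer_eq_zero [CharZero K] (p : R[X]) (hp : formalDer K R p = 0) :
    p = C (evalScalar R (0 : K) p) := by
  ext n
  cases n with
  | zero => simp [evalScalar_apply, coeff_zero_eq_eval_zero]
  | succ n =>
    have h1 : (derivative p).coeff n = 0 := by
      rw [← formalDer_apply (K := K), hp, coeff_zero]
    rw [coeff_derivative] at h1
    have h2 : ((n + 1 : K)) • p.coeff (n + 1) = 0 := by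
      rw [Algebra.smul_def, mul_comm]; simpa using h1
    rw [coeff_C_succ]
    exact (smul_eq_zero_iff_right (by exact_mod_cast n.succ_ne_zero)).1 h2

/-- Differentiation in X varies `X * C h` and commutes with `coeffDer`, so `delta_defect` applies.
Lower defects vanish by induction and the remaining terms by the equations. For b constant in X the
defect is therefore constant in X, and its value at X = 0 is the flat one. -/
theorem defect_polynomial_eq_zero [CharZero K] (D : Derivation K R R) (t : ℕ → ℕ → K)
    (ht : ∀ i p, i < p → t i p = 0) (N : ℕ) (lam delta : K)
    (heq : ∀ i p l, i < N → p + l < i → symEq t lam delta i p l = 0) (h : R) (i : ℕ) (hi : i < N)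
    (b : R[X]) : defect (coeffDer D) t N lam delta (X * C h) i b = 0 := by
  induction i using Nat.strong_induction_on generalizing b with
  | _ i ih =>
    have hder : ∀ a : R[X], (formalDer K R : R[X] →ₗ[K] R[X]).compLeft ℕ
        (defect (coeffDer D) t N lam delta (X * C h) i a) =
        defect (coeffDer D) t N lam delta (X * C h) i (formalDer K R a) := by
      intro a
      rw [delta_defect (coeffDer D) (formalDer K R) (formalDer_coeffDer D) t ht N lam delta _ i hi,
        Finset.sum_eq_zero fun r hr => by
          rw [ih r (Finset.mem_range.1 hr) ((Finset.mem_range.1 hr).trans hi), smul_zero],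
        Finset.sum_eq_zero fun p _ => Finset.sum_eq_zero fun l _ => ?_]
      · simp
      · split_ifs with hpl
        · rw [heq i p l hi hpl, zero_smul]
        · rfl
    have hC : ∀ a : R, defect (coeffDer D) t N lam delta (X * C h) i (C a) = 0 := by
      intro a
      ext1 q
      have h1 := congrFun (hder (C a)) q
      rw [formalDer_apply, derivative_C, map_zero] at h1
      rw [eq_C_of_formalDer_eq_zero (K := K) _ h1, map_defect (coeffDer D) D (evalScalar R (0 : K))
        (evalScalar_coeffDer D 0)]
      have h2 : evalScalar R (0 : K) (X * C h) = 0 := by simp [evalScalar_apply]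
      rw [h2, defect_flat D t ht N lam delta i hi]
      simp
    induction b using Polynomial.induction_on' with
    | add p q hp hq => rw [map_add, hp, hq, add_zero]
    -- X is a constant for `coeffDer`, so a monomial reduces to its coefficient.
    | monomial n a =>
      rw [← C_mul_X_pow_eq_monomial, mul_comm (C a), defect_const_mul _ _ _ _ _ _ _ _ _ (by
        rw [Derivation.leibniz_pow, coeffDer_X]; simp), hC, smul_zero]

/-- The infinitesimal equations imply invariance. -/
theorem defect_eq_zero [CharZero K] (D : Derivation K R R) (t : ℕ → ℕ → K)
    (ht : ∀ i p, i < p → t i p = 0) (N : ℕ) (lam delta : K)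
    (heq : ∀ i p l, i < N → p + l < i → symEq t lam delta i p l = 0) (h : R) (i : ℕ) (hi : i < N)
    (b : R) : defect D t N lam delta h i b = 0 := by
  ext q
  -- The given h is the value of `X * C h` at X = 1.
  have h1 := map_defect (coeffDer D) D (evalScalar R (1 : K)) (evalScalar_coeffDer D 1) t N lam
    delta (X * C h) i (C b) q
  rw [defect_polynomial_eq_zero D t ht N lam delta heq h i hi] at h1
  simpa [evalScalar_apply] using h1.symm

/-- A linear functional on R turns p into a polynomial over the field with infinitely many roots,
and functionals separate the points of R. -/
theorem eq_zero_of_infinite_evalScalar (p : R[X]) (s : Set K) (hs : s.Infinite)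
    (h : ∀ x ∈ s, evalScalar R x p = 0) : p = 0 := by
  ext n
  rw [coeff_zero, ← Module.forall_dual_apply_eq_zero_iff K]
  intro f
  have h1 : (∑ m ∈ Finset.range (p.natDegree + 1), monomial m (f (p.coeff m)) : K[X]) = 0 := by
    refine eq_zero_of_infinite_isRoot _ (hs.mono fun x hx => ?_)
    have h2 := congrArg f (h x hx)
    rw [evalScalar_apply, eval_eq_sum_range, map_sum, map_zero] at h2
    rw [Set.mem_ofPred_eq, IsRoot, eval_finsetSum, ← h2]
    refine Finset.sum_congr rfl fun m _ => ?_
    rw [eval_monomial, ← map_pow, mul_comm (p.coeff m), ← Algebra.smul_def, map_smul, smul_eq_mul,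
      mul_comm]
  have h2 := congrArg (fun q => q.coeff n) h1
  simp only [finsetSum_coeff, coeff_monomial, coeff_zero, Finset.sum_ite_eq', Finset.mem_range] at h2
  by_cases hn : n < p.natDegree + 1
  · simpa [hn] using h2
  · rw [coeff_eq_zero_of_natDegree_lt (by omega), map_zero]

/-- Invariance implies the infinitesimal equations. -/
theorem sum_symEq_eq_zero [CharZero K] (D : Derivation K R R) (t : ℕ → ℕ → K)
    (ht : ∀ i p, i < p → t i p = 0) (N : ℕ) (lam delta : K) (h : R) (s : Set K) (hs : s.Infinite)
    (hF : ∀ x ∈ s, ∀ i < N, ∀ b, defect D t N lam delta (x • h) i b = 0) (i : ℕ) (hi : i < N)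
    (b : R) (p : ℕ) (hp : p < N) :
    ∑ l ∈ Finset.range N, (if p + l < i then symEq t lam delta i p l •
      (((D : R →ₗ[K] R) ^ l) b * ((D : R →ₗ[K] R) ^ (i - p - l - 1)) h) else 0) = 0 := by
  -- The defect for `X * C h` is a polynomial in X that vanishes at every point of the infinite set
  -- s.
  have hC : ∀ i < N, ∀ a : R, defect (coeffDer D) t N lam delta (X * C h) i (C a) = 0 := by
    intro i hi a
    ext1 q
    refine eq_zero_of_infinite_evalScalar _ s hs fun x hx => ?_
    rw [map_defect (coeffDer D) D (evalScalar R x) (evalScalar_coeffDer D x)]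
    have h2 : evalScalar R x (X * C h) = x • h := by
      simp [evalScalar_apply, Algebra.smul_def, mul_comm (algebraMap K R x)]
    rw [h2, hF x hx i hi]
    rfl
  have hall : ∀ i < N, ∀ a : R[X], defect (coeffDer D) t N lam delta (X * C h) i a = 0 := by
    intro i hi a
    induction a using Polynomial.induction_on' with
    | add p q hp hq => rw [map_add, hp, hq, add_zero]
    | monomial n a =>
      rw [← C_mul_X_pow_eq_monomial, mul_comm (C a), defect_const_mul _ _ _ _ _ _ _ _ _ (by
        rw [Derivation.leibniz_pow, coeffDer_X]; simp), hC i hi, smul_zero]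
  -- Differentiating in X kills all defects and leaves the terms with `symEq`. At X = 0 these
  -- contain only ordinary derivatives, and E_p becomes ∂^p, so the p-th component selects one value
  -- of p.
  have h1 := delta_defect (coeffDer D) (formalDer K R) (formalDer_coeffDer D) t ht N lam delta
    (X * C h) i hi (C b)
  rw [Finset.sum_eq_zero fun r hr => by
          rw [hall r ((Finset.mem_range.1 hr).trans hi), smul_zero], hall i hi, hall i hi, map_zero,
    sub_zero, zero_add] at h1
  have h2 := congrArg (fun v => evalScalar R (0 : K) (v p)) h1
  have h3 : evalScalar R (0 : K) X * evalScalar R (0 : K) (C h) = 0 := by simp [evalScalar_apply]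
  simp only [Finset.sum_apply, map_sum, varTerm, Pi.zero_apply, map_zero, apply_ite (fun v : ℕ → R[X] => v p),
    apply_ite (evalScalar R (0 : K)), Pi.smul_apply, map_smul, smul_eq_mul, map_mul (evalScalar R (0 : K)),
    map_covPow (coeffDer D) D (evalScalar R (0 : K)) (evalScalar_coeffDer D 0),
    map_symE (coeffDer D) D (evalScalar R (0 : K)) (evalScalar_coeffDer D 0), h3, covPow_flat,
    symE_flat, formalDer_apply] at h2
  rw [Finset.sum_eq_single p (fun q _ hq => ?_) (fun hq => absurd (Finset.mem_range.2 hp) hq)] at h2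
  · simpa [evalScalar_apply] using h2.symm
  · refine Finset.sum_eq_zero fun l _ => ?_
    simp [hq.symm]

end Polynomial

end CircleDensity

/-! ### Diffeomorphisms with given derivative, a local coordinate, the contraction -/

namespace CircleDensity

open Filter Topology MeasureTheory

theorem contDiff_primitive {v : ℝ → ℝ} (hv : ContDiff ℝ ∞ v) :
    ContDiff ℝ ∞ (fun x => ∫ t in (0 : ℝ)..x, v t) := by
  have hd : deriv (fun x => ∫ t in (0 : ℝ)..x, v t) = v :=
    funext fun x => hv.continuous.deriv_integral _ _ _
  refine contDiff_infty_iff_deriv.2 ⟨fun x => ?_, by rwa [hd]⟩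
  exact (hv.continuous.integral_hasStrictDerivAt 0 x).hasDerivAt.differentiableAt

theorem primitive_add_one {v : ℝ → ℝ} (hv : Continuous v) (hp : ∀ x, v (x + 1) = v x) (x : ℝ) :
    ∫ t in (0 : ℝ)..(x + 1), v t = (∫ t in (0 : ℝ)..x, v t) + ∫ t in (0 : ℝ)..1, v t := by
  have h1 := Function.Periodic.intervalIntegral_add_eq (f := v) (T := 1) hp x 0
  rw [zero_add] at h1
  rw [← h1, intervalIntegral.integral_add_adjacent_intervals (hv.intervalIntegrable _ _)
    (hv.intervalIntegrable _ _)]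

/-- The diffeomorphism with a given positive periodic derivative of mean one. -/
noncomputable def Diffeo.ofDeriv (v : ℝ → ℝ) (hv : ContDiff ℝ ∞ v) (hp : ∀ x, v (x + 1) = v x)
    (hpos : ∀ x, 0 < v x) (hone : ∫ t in (0 : ℝ)..1, v t = 1) : Diffeo := by
  have hd : deriv (fun x => ∫ t in (0 : ℝ)..x, v t) = v :=
    funext fun x => hv.continuous.deriv_integral _ _ _
  have hder : ∀ x, HasDerivAt (fun x => ∫ t in (0 : ℝ)..x, v t) (v x) x := fun x =>
    (hv.continuous.integral_hasStrictDerivAt 0 x).hasDerivAt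
  have hmono : StrictMono (fun x => ∫ t in (0 : ℝ)..x, v t) :=
    strictMono_of_deriv_pos fun x => by rw [hd]; exact hpos x
  have hadd : ∀ x, ∫ t in (0 : ℝ)..(x + 1), v t = (∫ t in (0 : ℝ)..x, v t) + 1 := fun x => by
    rw [primitive_add_one hv.continuous hp, hone]
  -- Mean one fixes the values of the primitive at the integers, so it is unbounded in both
  -- directions and hence surjective.
  have hnat : ∀ n : ℕ, ∫ t in (0 : ℝ)..n, v t = n := by
    intro n
    induction n with
    | zero => simp
    | succ n ih => push_cast; rw [hadd, ih]
  have hneg : ∀ n : ℕ, ∫ t in (0 : ℝ)..(-n), v t = -n := by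
    intro n
    induction n with
    | zero => simp
    | succ n ih =>
      have h1 := hadd (-((n + 1 : ℕ) : ℝ))
      have h2 : -((n + 1 : ℕ) : ℝ) + 1 = -n := by push_cast; ring
      rw [h2, ih] at h1
      push_cast at h1 ⊢
      linarith
  have hsurj : Function.Surjective (fun x => ∫ t in (0 : ℝ)..x, v t) := by
    refine Continuous.surjective (contDiff_primitive hv).continuous ?_ ?_
    · refine hmono.monotone.tendsto_atTop_atTop fun b => ?_
      obtain ⟨n, hn⟩ := exists_nat_ge b
      exact ⟨n, by simpa [hnat] using hn⟩
    · refine hmono.monotone.tendsto_atBot_atBot fun b => ?_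
      obtain ⟨n, hn⟩ := exists_nat_ge (-b)
      exact ⟨-n, by simp only [hneg]; linarith⟩
  let e := hmono.orderIsoOfSurjective _ hsurj
  exact
  { toEquiv := e.toEquiv
    smooth := contDiff_primitive hv
    smooth_symm := e.toHomeomorph.contDiff_symm_deriv (f' := v) (fun x => (hpos x).ne')
      hder (contDiff_primitive hv)
    map_add_one := hadd
    deriv_pos := fun x => by
      change 0 < deriv (fun x => ∫ t in (0 : ℝ)..x, v t) x
      rw [hd]
      exact hpos x }

theorem Diffeo.ofDeriv_apply (v : ℝ → ℝ) (hv : ContDiff ℝ ∞ v) (hp : ∀ x, v (x + 1) = v x)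
    (hpos : ∀ x, 0 < v x) (hone : ∫ t in (0 : ℝ)..1, v t = 1) (x : ℝ) :
    (Diffeo.ofDeriv v hv hp hpos hone).toEquiv x = ∫ t in (0 : ℝ)..x, v t := rfl

theorem Diffeo.deriv_ofDeriv (v : ℝ → ℝ) (hv : ContDiff ℝ ∞ v) (hp : ∀ x, v (x + 1) = v x)
    (hpos : ∀ x, 0 < v x) (hone : ∫ t in (0 : ℝ)..1, v t = 1) (x : ℝ) :
    deriv (Diffeo.ofDeriv v hv hp hpos hone).toEquiv x = v x :=
  hv.continuous.deriv_integral _ _ _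

/-- A translation of the circle. -/
def Diffeo.shift (s : ℝ) : Diffeo where
  toEquiv := Equiv.addRight s
  smooth := contDiff_id.add contDiff_const
  smooth_symm := contDiff_id.add contDiff_const
  map_add_one x := by simp only [Equiv.coe_addRight]; ring
  deriv_pos x := by
    have : deriv (fun y : ℝ => y + s) x = 1 := by simp
    exact this ▸ one_pos

/-- The derivative of `localCoord`. -/
noncomputable def localCoordDeriv (x : ℝ) : ℝ :=
  Real.smoothTransition (2 * Real.cos (2 * Real.pi * x)) -
    Real.smoothTransition (-(2 * Real.cos (2 * Real.pi * x)))

theorem contDiff_localCoordDeriv : ContDiff ℝ ∞ localCoordDeriv := by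
  have h : ContDiff ℝ ∞ (fun x : ℝ => 2 * Real.cos (2 * Real.pi * x)) := by fun_prop
  exact (Real.smoothTransition.contDiff.comp h).sub (Real.smoothTransition.contDiff.comp h.neg)

theorem localCoordDeriv_add_one (x : ℝ) : localCoordDeriv (x + 1) = localCoordDeriv x := by
  have : Real.cos (2 * Real.pi * (x + 1)) = Real.cos (2 * Real.pi * x) := by
    rw [mul_add, mul_one, Real.cos_add_two_pi]
  simp only [localCoordDeriv, this]

/-- The cosine changes sign over half a period, which exchanges the two transition functions. The
function thus has mean zero and its primitive is periodic. -/
theorem localCoordDeriv_add_half (x : ℝ) : localCoordDeriv (x + 1 / 2) = -localCoordDeriv x := by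
  have : Real.cos (2 * Real.pi * (x + 1 / 2)) = -Real.cos (2 * Real.pi * x) := by
    rw [← Real.cos_add_pi]
    congr 1
    ring
  simp only [localCoordDeriv, this]
  simp

theorem integral_localCoordDeriv : ∫ t in (0 : ℝ)..1, localCoordDeriv t = 0 := by
  have hc := contDiff_localCoordDeriv.continuous
  have h1 : ∫ t in (0 : ℝ)..1, localCoordDeriv (t + 1 / 2) = ∫ t in (0 : ℝ)..1, localCoordDeriv t := by
    rw [intervalIntegral.integral_comp_add_right]
    have := Function.Periodic.intervalIntegral_add_eq (f := localCoordDeriv) (T := 1)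
      localCoordDeriv_add_one (1 / 2) 0
    rw [zero_add] at this
    rw [← this]
    congr 1 <;> ring
  simp only [localCoordDeriv_add_half, intervalIntegral.integral_neg] at h1
  linarith

/-- Keeps the derivative `1 - localCoordDeriv x / 2` of the contraction positive. -/
theorem localCoordDeriv_le_one (x : ℝ) : localCoordDeriv x ≤ 1 := by
  have h1 := Real.smoothTransition.le_one (2 * Real.cos (2 * Real.pi * x))
  have h2 := Real.smoothTransition.nonneg (-(2 * Real.cos (2 * Real.pi * x)))
  unfold localCoordDeriv
  linarith

theorem eventually_localCoordDeriv : ∀ᶠ x in 𝓝 (0 : ℝ), localCoordDeriv x = 1 := by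
  have hc : ContinuousAt (fun x : ℝ => 2 * Real.cos (2 * Real.pi * x)) 0 := by fun_prop
  have h0 : (1 : ℝ) < 2 * Real.cos (2 * Real.pi * 0) := by simp
  filter_upwards [hc.eventually (lt_mem_nhds h0)] with x hx
  rw [localCoordDeriv, Real.smoothTransition.one_of_one_le hx.le,
    Real.smoothTransition.zero_of_nonpos (by linarith), sub_zero]

/-- A smooth periodic function which is the identity near `0`. -/
noncomputable def localCoord (x : ℝ) : ℝ := ∫ t in (0 : ℝ)..x, localCoordDeriv t

theorem contDiff_localCoord : ContDiff ℝ ∞ localCoord := contDiff_primitive contDiff_localCoordDeriv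

theorem localCoord_add_one (x : ℝ) : localCoord (x + 1) = localCoord x := by
  have := primitive_add_one contDiff_localCoordDeriv.continuous localCoordDeriv_add_one x
  rwa [integral_localCoordDeriv, add_zero] at this

theorem eventually_localCoord : ∀ᶠ x in 𝓝 (0 : ℝ), localCoord x = x := by
  obtain ⟨e, he, h⟩ := Metric.eventually_nhds_iff_ball.1 eventually_localCoordDeriv
  filter_upwards [Metric.ball_mem_nhds (0 : ℝ) he] with x hx
  have h1 : ∫ t in (0 : ℝ)..x, localCoordDeriv t = ∫ _ in (0 : ℝ)..x, (1 : ℝ) := by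
    refine intervalIntegral.integral_congr fun t ht => h t ?_
    rw [Metric.mem_ball, dist_zero_right, Real.norm_eq_abs] at hx ⊢
    have h2 := Set.abs_sub_left_of_mem_uIcc ht
    simp only [sub_zero] at h2
    exact h2.trans_lt hx
  rw [localCoord, h1]
  simp

/-- A diffeomorphism which is `x ↦ x / 2` near `0`. -/
noncomputable def Diffeo.contraction : Diffeo :=
  Diffeo.ofDeriv (fun x => 1 - localCoordDeriv x / 2)
    (contDiff_const.sub (contDiff_localCoordDeriv.div_const 2))
    (fun x => by rw [localCoordDeriv_add_one])
    (fun x => by linarith [localCoordDeriv_le_one x])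
    (by
      rw [intervalIntegral.integral_sub (by simp)
        ((contDiff_localCoordDeriv.continuous.div_const 2).intervalIntegrable _ _),
        intervalIntegral.integral_div, integral_localCoordDeriv]
      simp)

theorem Diffeo.eventually_contraction :
    ∀ᶠ x in 𝓝 (0 : ℝ), Diffeo.contraction.toEquiv x = x / 2 := by
  filter_upwards [eventually_localCoord] with x hx
  rw [Diffeo.contraction, Diffeo.ofDeriv_apply, intervalIntegral.integral_sub (by simp)
        ((contDiff_localCoordDeriv.continuous.div_const 2).intervalIntegrable _ _),
        intervalIntegral.integral_div]
  change _ - localCoord x / 2 = _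
  rw [hx]
  simp
  ring

variable {𝕜 : Type*} [RCLike 𝕜]

/-- The derivation `d/dx` of the algebra of smooth functions on the circle. -/
noncomputable def derD (𝕜 : Type*) [RCLike 𝕜] : Derivation 𝕜 (Smooth 𝕜) (Smooth 𝕜) :=
  Derivation.mk' D fun a b => by
    rw [D_mul, smul_eq_mul, smul_eq_mul, mul_comm (D a), add_comm]

theorem coe_derD : (derD 𝕜 : Smooth 𝕜 →ₗ[𝕜] Smooth 𝕜) = D := rfl

/-- A real smooth periodic function as an element of `Smooth 𝕜`. -/
noncomputable def ofRealSmooth (u : Smooth ℝ) : Smooth 𝕜 :=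
  ⟨fun x => ((u : ℝ → ℝ) x : 𝕜), (RCLike.ofRealCLM (K := 𝕜)).contDiff.comp u.2.1,
    fun x => by simp only [u.2.2 x]⟩

theorem D_ofRealSmooth (u : Smooth ℝ) : D (ofRealSmooth (𝕜 := 𝕜) u) = ofRealSmooth (D u) :=
  Subtype.ext <| funext fun x => by
    have h := (u.2.1.differentiable (by simp) x).hasDerivAt
    exact ((RCLike.ofRealCLM (K := 𝕜)).hasFDerivAt.comp_hasDerivAt x h).deriv

/-- `localCoord` as an element of `Smooth 𝕜`. -/
noncomputable def coordS (𝕜 : Type*) [RCLike 𝕜] : Smooth 𝕜 :=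
  ofRealSmooth ⟨localCoord, contDiff_localCoord, localCoord_add_one⟩

theorem eventually_coordS_pow (j : ℕ) :
    ((coordS 𝕜 ^ j : Smooth 𝕜) : ℝ → 𝕜) =ᶠ[𝓝 0] fun x => (x : 𝕜) ^ j := by
  filter_upwards [eventually_localCoord] with x hx
  change ((localCoord x : ℝ) : 𝕜) ^ j = _
  rw [hx]

theorem eventuallyEq_D_pow {a b : Smooth 𝕜} {x : ℝ} (h : (a : ℝ → 𝕜) =ᶠ[𝓝 x] b) (n : ℕ) :
    ((D ^ n) a : ℝ → 𝕜) =ᶠ[𝓝 x] ((D ^ n) b : Smooth 𝕜) := by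
  induction n with
  | zero => exact h
  | succ n ih =>
    rw [pow_succ']
    exact ih.deriv

theorem eventuallyEq_D_pow_coordS_pow (n j : ℕ) :
    ((D ^ n) (coordS 𝕜 ^ j) : ℝ → 𝕜) =ᶠ[𝓝 0]
      fun x => (j.descFactorial n : 𝕜) * (x : 𝕜) ^ (j - n) := by
  induction n with
  | zero => simpa using eventually_coordS_pow j
  | succ n ih =>
    rw [pow_succ']
    refine (ih.deriv).trans (Eventually.of_forall fun x => ?_)
    have h1 : HasDerivAt (fun x : ℝ => (x : 𝕜)) 1 x := by
      simpa using (RCLike.ofRealCLM (K := 𝕜)).hasDerivAt (x := x)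
    have h2 := (h1.fun_pow (j - n)).const_mul (j.descFactorial n : 𝕜)
    rw [h2.deriv, Nat.descFactorial_succ, Nat.sub_add_eq]
    push_cast
    ring

/-- Powers of the coordinate are dual, up to factorials, to the derivatives at 0. They are the test
functions used below to read off coefficients. -/
theorem D_pow_coordS_pow_zero (n j : ℕ) :
    ((D ^ n) (coordS 𝕜 ^ j) : ℝ → 𝕜) 0 = if n = j then (j.factorial : 𝕜) else 0 := by
  rw [(eventuallyEq_D_pow_coordS_pow n j).eq_of_nhds]
  split_ifs with h
  · subst h
    simp [Nat.descFactorial_self]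
  · rcases lt_or_gt_of_ne h with h | h
    · simp [Nat.sub_ne_zero_of_lt h]
    · rw [Nat.descFactorial_of_lt h]
      simp

end CircleDensity

/-! ### Coefficients of differential operators and the action on them -/

namespace CircleDensity

open Filter Topology MeasureTheory

section Symbols

variable {K S : Type*} [Field K] [CommRing S] [Algebra K S]

theorem symE_of_lt (dx : Derivation K S S) (h : S) (lam : K) (p q : ℕ) (hq : p < q) :
    symE dx h lam p q = 0 := by
  unfold symE
  induction p generalizing q with
  | zero => simp [covPow_zero, hq.ne']
  | succ p ih =>
    obtain ⟨q, rfl⟩ : ∃ r, q = r + 1 := ⟨q - 1, by omega⟩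
    rw [covPow_succ]
    simp [symNabla_apply_succ, ih q (by omega), ih (q + 1) (by omega)]

/-- `symNabla` is left composition with ∂ written on coefficients, so the recursions of the two
sides agree. This is what justifies calling `symE` the coefficients of an operator. -/
theorem covPow_eq_sum (dx : Derivation K S S) (h : S) (lam : K) (N p : ℕ) (hp : p < N) (b : S) :
    covPow (dx : S →ₗ[K] S) h lam p b =
      ∑ q ∈ Finset.range N, symE dx h lam p q * ((dx : S →ₗ[K] S) ^ q) b := by
  induction p with
  | zero =>
    rw [Finset.sum_eq_single 0 (fun q _ hq => ?_) (fun h0 => absurd (Finset.mem_range.2 hp) h0)]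
    · simp [symE, covPow_zero]
    · simp [symE, covPow_zero, hq]
  | succ p ih =>
    obtain ⟨m, rfl⟩ : ∃ m, N = m + 1 := ⟨N - 1, by omega⟩
    have h1 : ∑ q ∈ Finset.range (m + 1), symNabla dx (symE dx h lam p) q *
        ((dx : S →ₗ[K] S) ^ q) b = dx (∑ q ∈ Finset.range (m + 1), symE dx h lam p q *
          ((dx : S →ₗ[K] S) ^ q) b) := by
      rw [map_sum]
      simp only [Derivation.leibniz, smul_eq_mul]
      rw [Finset.sum_add_distrib, Finset.sum_range_succ', Finset.sum_range_succ (n := m),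
        symE_of_lt dx h lam p m (by omega), zero_mul, add_zero]
      simp only [symNabla_apply_succ, symNabla_apply_zero, add_mul, Finset.sum_add_distrib]
      rw [add_comm (∑ q ∈ Finset.range m, dx (symE dx h lam p (q + 1)) * _), add_assoc,
        ← Finset.sum_range_succ' (fun q => dx (symE dx h lam p q) * ((dx : S →ₗ[K] S) ^ q) b)]
      congr 1
      · exact Finset.sum_congr rfl fun q _ => by
          rw [pow_succ', Module.End.mul_apply, Derivation.coeFn_coe]
      · exact Finset.sum_congr rfl fun q _ => mul_comm _ _
    rw [covPow_succ, ih (by omega), Derivation.coeFn_coe, ← h1, smul_eq_mul, Finset.mul_sum,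
      Finset.smul_sum, ← Finset.sum_sub_distrib]
    refine Finset.sum_congr rfl fun q _ => ?_
    have h2 : symE dx h lam (p + 1) q = symNabla dx (symE dx h lam p) q -
        (lam + p) • (h * symE dx h lam p q) := rfl
    rw [h2, sub_mul, ← mul_assoc, smul_mul_assoc]

end Symbols

variable {𝕜 : Type*} [RCLike 𝕜]

theorem D_pull_shift (s : ℝ) (φ : Smooth 𝕜) :
    D (pull (Diffeo.shift s) φ) = pull (Diffeo.shift s) (D φ) :=
  Subtype.ext <| funext fun x => deriv_comp_add_const (φ : ℝ → 𝕜) s x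

theorem D_pow_pull_shift (s : ℝ) (φ : Smooth 𝕜) (n : ℕ) :
    (D ^ n) (pull (Diffeo.shift s) φ) = pull (Diffeo.shift s) ((D ^ n) φ) := by
  induction n with
  | zero => rfl
  | succ n ih => simp only [pow_succ', Module.End.mul_apply, ih, D_pull_shift]

/-- The differential operator with given coefficients. -/
noncomputable def opOf (k : ℕ) : (ℕ → Smooth 𝕜) →ₗ[𝕜] DiffOp 𝕜 k where
  toFun a := ⟨∑ i ∈ Finset.range (k + 1), LinearMap.mulLeft 𝕜 (a i) ∘ₗ (D ^ i), a, fun φ => by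
    simp⟩
  map_add' a b := Subtype.ext <| LinearMap.ext fun φ => by
    simp [add_mul, Finset.sum_add_distrib]
  map_smul' c a := Subtype.ext <| LinearMap.ext fun φ => by
    simp [Finset.smul_sum]

theorem opOf_apply (k : ℕ) (a : ℕ → Smooth 𝕜) (φ : Smooth 𝕜) :
    (opOf k a).1 φ = ∑ i ∈ Finset.range (k + 1), a i * (D ^ i) φ := by
  simp [opOf]

theorem sum_apply (s : Finset ℕ) (f : ℕ → Smooth 𝕜) (x : ℝ) :
    ((∑ i ∈ s, f i : Smooth 𝕜) : ℝ → 𝕜) x = ∑ i ∈ s, (f i : ℝ → 𝕜) x := by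
  rw [AddSubmonoidClass.coe_finsetSum, Finset.sum_apply]

/-- Testing on the j-th power of the coordinate centred at x leaves only j! times the j-th
coefficient at x. -/
theorem coeff_apply_eq_zero (k : ℕ) (a : ℕ → Smooth 𝕜) (x : ℝ)
    (h : ∀ φ, ((opOf k a).1 φ : ℝ → 𝕜) x = 0) (j : ℕ) (hj : j < k + 1) : (a j : ℝ → 𝕜) x = 0 := by
  have h1 := h (pull (Diffeo.shift (-x)) (coordS 𝕜 ^ j))
  rw [opOf_apply, sum_apply] at h1
  have h2 : ∀ i, ((a i * (D ^ i) (pull (Diffeo.shift (-x)) (coordS 𝕜 ^ j)) : Smooth 𝕜) : ℝ → 𝕜) x =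
      (a i : ℝ → 𝕜) x * if i = j then (j.factorial : 𝕜) else 0 := by
    intro i
    rw [D_pow_pull_shift, ← D_pow_coordS_pow_zero]
    change (a i : ℝ → 𝕜) x * ((D ^ i) (coordS 𝕜 ^ j) : ℝ → 𝕜) (x + -x) = _
    rw [add_neg_cancel]
  simp only [h2, mul_ite, mul_zero, Finset.sum_ite_eq', Finset.mem_range, hj, if_true] at h1
  exact (mul_eq_zero.1 h1).resolve_right (by exact_mod_cast j.factorial_ne_zero)

theorem opOf_inj (k : ℕ) (a b : ℕ → Smooth 𝕜) (h : opOf k a = opOf k b) (j : ℕ)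
    (hj : j < k + 1) : a j = b j := by
  rw [← sub_eq_zero]
  refine Subtype.ext <| funext fun x => coeff_apply_eq_zero k (a - b) x (fun φ => ?_) j hj
  have h1 : (opOf k (a - b)).1 φ = (opOf k a).1 φ - (opOf k b).1 φ := by
    simp only [opOf_apply, Pi.sub_apply, sub_mul, Finset.sum_sub_distrib]
  rw [h1, h, sub_self]
  rfl

theorem opOf_congr (k : ℕ) (a b : ℕ → Smooth 𝕜) (h : ∀ j < k + 1, a j = b j) :
    opOf k a = opOf k b := by
  refine Subtype.ext <| LinearMap.ext fun φ => ?_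
  rw [opOf_apply, opOf_apply]
  exact Finset.sum_congr rfl fun j hj => by rw [h j (Finset.mem_range.1 hj)]

theorem exists_opOf {k : ℕ} (A : DiffOp 𝕜 k) : ∃ a : ℕ → Smooth 𝕜, (∀ j, k < j → a j = 0) ∧
    opOf k a = A := by
  obtain ⟨A, a, ha⟩ := A
  refine ⟨fun j => if j < k + 1 then a j else 0, fun j hj => if_neg (by omega), ?_⟩
  rw [opOf_congr k _ a fun j hj => if_pos hj]
  exact Subtype.ext <| LinearMap.ext fun φ => by rw [opOf_apply, ha]

/-- The coefficients of a differential operator. -/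
noncomputable def coef {k : ℕ} : DiffOp 𝕜 k →ₗ[𝕜] (ℕ → Smooth 𝕜) where
  toFun A := (exists_opOf A).choose
  map_add' A B := by
    ext1 j
    by_cases hj : j < k + 1
    · refine opOf_inj k _ _ ?_ j hj
      rw [map_add, (exists_opOf A).choose_spec.2, (exists_opOf B).choose_spec.2,
        (exists_opOf (A + B)).choose_spec.2]
    · rw [Pi.add_apply, (exists_opOf A).choose_spec.1 j (by omega),
        (exists_opOf B).choose_spec.1 j (by omega),
        (exists_opOf (A + B)).choose_spec.1 j (by omega), add_zero]
  map_smul' c A := by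
    ext1 j
    by_cases hj : j < k + 1
    · refine opOf_inj k _ _ ?_ j hj
      rw [map_smul, (exists_opOf A).choose_spec.2,
        (exists_opOf (c • A)).choose_spec.2, RingHom.id_apply]
    · rw [Pi.smul_apply, (exists_opOf A).choose_spec.1 j (by omega),
        (exists_opOf (c • A)).choose_spec.1 j (by omega), smul_zero]

theorem opOf_coef {k : ℕ} (A : DiffOp 𝕜 k) : opOf k (coef A) = A := (exists_opOf A).choose_spec.2

theorem coef_of_lt {k : ℕ} (A : DiffOp 𝕜 k) (j : ℕ) (hj : k < j) : coef A j = 0 :=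
  (exists_opOf A).choose_spec.1 j hj

theorem coef_opOf (k : ℕ) (a : ℕ → Smooth 𝕜) (j : ℕ) (hj : j < k + 1) :
    coef (opOf k a) j = a j :=
  opOf_inj k _ _ (opOf_coef _) j hj

theorem jac_add (a b : 𝕜) (g : Diffeo) : jac (a + b) g = jac a g * jac b g :=
  Subtype.ext <| funext fun x => by
    change NormedSpace.exp (_ : 𝕜) = NormedSpace.exp (_ : 𝕜) * NormedSpace.exp (_ : 𝕜)
    rw [add_mul, NormedSpace.exp_add]

theorem jac_zero (g : Diffeo) : jac (0 : 𝕜) g = 1 :=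
  Subtype.ext <| funext fun x => by
    change NormedSpace.exp _ = _
    rw [zero_mul, NormedSpace.exp_zero]
    rfl

/-- The logarithm of the derivative of a diffeomorphism. -/
noncomputable def logDeriv (g : Diffeo) : Smooth ℝ :=
  ⟨fun x => Real.log (deriv g.toEquiv x),
    (contDiff_infty_iff_deriv.1 g.smooth).2.log fun x => (g.deriv_pos x).ne',
    fun x => by simp only [deriv_add_one]⟩

theorem D_jac (w : 𝕜) (g : Diffeo) :
    D (jac w g) = w • (ofRealSmooth (D (logDeriv g)) * jac w g) :=
  Subtype.ext <| funext fun x => by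
    have h1 : HasDerivAt (fun x => ((logDeriv g : ℝ → ℝ) x : 𝕜))
        ((D (ofRealSmooth (𝕜 := 𝕜) (logDeriv g)) : ℝ → 𝕜) x) x :=
      ((ofRealSmooth (𝕜 := 𝕜) (logDeriv g)).2.1.differentiable (by simp) x).hasDerivAt
    have h2 := (hasDerivAt_exp (𝕂 := 𝕜) (x := w * ((logDeriv g : ℝ → ℝ) x : 𝕜))).scomp x
      (h1.const_mul w)
    rw [D_ofRealSmooth] at h2
    refine h2.deriv.trans ?_
    rw [smul_eq_mul, mul_assoc]
    rfl

theorem jac_one_apply (g : Diffeo) (x : ℝ) :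
    (jac (1 : 𝕜) g : ℝ → 𝕜) x = ((deriv g.toEquiv x : ℝ) : 𝕜) := by
  change NormedSpace.exp (1 * ((Real.log (deriv g.toEquiv x) : ℝ) : 𝕜)) = _
  rw [one_mul]
  have := NormedSpace.algebraMap_exp_comm (𝕂 := ℝ) (𝔸 := 𝕜) (Real.log (deriv g.toEquiv x))
  rw [← Real.exp_eq_exp_ℝ, Real.exp_log (g.deriv_pos x), RCLike.algebraMap_eq_ofReal] at this
  exact this.symm

theorem D_pull (g : Diffeo) (φ : Smooth 𝕜) : D (pull g φ) = jac 1 g * pull g (D φ) :=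
  Subtype.ext <| funext fun x => by
    have h := (φ.2.1.differentiable (by simp) (g.toEquiv x)).hasDerivAt.scomp x
      (g.smooth.differentiable (by simp) x).hasDerivAt
    refine h.deriv.trans ?_
    rw [RCLike.real_smul_eq_coe_mul, ← jac_one_apply]
    rfl

/-- The logarithmic derivative `g'' / g'`. -/
noncomputable def schw (𝕜 : Type*) [RCLike 𝕜] (g : Diffeo) : Smooth 𝕜 :=
  ofRealSmooth (D (logDeriv g))

/-- Since ∂ (g')^w = w h (g')^w, the factor ∂ - w h sends (g')^w φ∘g to (g')^(w+1) φ'∘g, and the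
next factor has to start from weight w + 1. This explains the form of `covPow`. -/
theorem covPow_jac_mul_pull (g : Diffeo) (w : 𝕜) (n : ℕ) (φ : Smooth 𝕜) :
    covPow (derD 𝕜 : Smooth 𝕜 →ₗ[𝕜] Smooth 𝕜) (schw 𝕜 g) w n (jac w g * pull g φ) =
      jac (w + n) g * pull g ((D ^ n) φ) := by
  induction n with
  | zero => simp [covPow_zero]
  | succ n ih =>
    rw [covPow_succ, ih, coe_derD, D_mul, D_pull, D_jac, Nat.cast_succ, ← add_assoc, jac_add _ 1,
      pow_succ']
    simp only [Algebra.smul_def, Algebra.algebraMap_self, RingHom.id_apply, Module.End.mul_apply, schw]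
    ring

theorem pull_inv_pull (g : Diffeo) (φ : Smooth 𝕜) : pull g (pull g.inv φ) = φ :=
  Subtype.ext <| funext fun x => congrArg (φ : ℝ → 𝕜) (g.toEquiv.symm_apply_apply x)

theorem deriv_mul_deriv_inv (g : Diffeo) (x : ℝ) :
    deriv g.inv.toEquiv (g.toEquiv x) * deriv g.toEquiv x = 1 := by
  have h : HasDerivAt (fun y => g.toEquiv.symm (g.toEquiv y))
      (deriv g.toEquiv.symm (g.toEquiv x) * deriv g.toEquiv x) x :=
    HasDerivAt.comp x (g.smooth_symm.differentiable (by simp) _).hasDerivAt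
      (g.smooth.differentiable (by simp) x).hasDerivAt
  simp only [Equiv.symm_apply_apply] at h
  exact h.unique (hasDerivAt_id x)

theorem jac_mul_pull_jac_inv (g : Diffeo) (w : 𝕜) : jac w g * pull g (jac w g.inv) = 1 :=
  Subtype.ext <| funext fun x => by
    change NormedSpace.exp (w * ((Real.log (deriv g.toEquiv x) : ℝ) : 𝕜)) *
      NormedSpace.exp (w * ((Real.log (deriv g.inv.toEquiv (g.toEquiv x)) : ℝ) : 𝕜)) = 1
    rw [← NormedSpace.exp_add, ← mul_add, ← RCLike.ofReal_add, ← Real.log_mul (g.deriv_pos x).ne'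
      (g.inv.deriv_pos _).ne', mul_comm (deriv _ _), deriv_mul_deriv_inv]
    simp

theorem densityPull_densityPull_inv (g : Diffeo) (w : 𝕜) (φ : Smooth 𝕜) :
    jac w g * pull g (densityPull w g.inv φ) = φ := by
  change jac w g * pull g (jac w g.inv * pull g.inv φ) = φ
  rw [map_mul, ← mul_assoc, jac_mul_pull_jac_inv, one_mul, pull_inv_pull]

/-- The action of a diffeomorphism on the coefficients of an operator. -/
theorem diffOpAct_opOf (k : ℕ) (lam mu : 𝕜) (f : Diffeo) (a : ℕ → Smooth 𝕜) :
    diffOpAct k lam mu f (opOf k a) = opOf k (∑ i ∈ Finset.range (k + 1),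
      (jac (mu - lam - i) f.inv * pull f.inv (a i)) • symE (derD 𝕜) (schw 𝕜 f.inv) lam i) := by
  refine Subtype.ext <| LinearMap.ext fun ψ => ?_
  set g := f.inv
  set φ := densityPull lam g.inv ψ with hφ
  have h1 : (diffOpAct k lam mu f (opOf k a)).1 ψ = jac mu g * pull g ((opOf k a).1 φ) := rfl
  have h2 : ∀ i ∈ Finset.range (k + 1), jac mu g * pull g (a i * (D ^ i) φ) =
      ∑ q ∈ Finset.range (k + 1), (jac (mu - lam - i) g * pull g (a i)) *
        symE (derD 𝕜) (schw 𝕜 g) lam i q * (D ^ q) ψ := by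
    intro i hi
    -- As ψ = (g')^lam φ∘g, applying E_i to ψ gives (g')^(lam+i) times the pull-back of ∂^i φ.
    have h3 := covPow_eq_sum (derD 𝕜) (schw 𝕜 g) lam (k + 1) i (Finset.mem_range.1 hi) ψ
    rw [← densityPull_densityPull_inv g lam ψ, covPow_jac_mul_pull, densityPull_densityPull_inv,
      ← hφ, coe_derD] at h3
    simp only [mul_assoc]
    rw [← Finset.mul_sum, ← Finset.mul_sum, ← h3]
    -- One factor of (g')^mu goes with the coefficient a_i, which behaves as a density of weight δ -
    -- i; the other is produced by E_i.
    have h4 : mu = (mu - lam - i) + (lam + i) := by ring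
    conv_lhs => rw [h4, jac_add, map_mul]
    ring
  rw [h1, opOf_apply, opOf_apply, map_sum, Finset.mul_sum, Finset.sum_congr rfl h2,
    Finset.sum_comm]
  refine Finset.sum_congr rfl fun q _ => ?_
  simp only [Finset.sum_apply, Pi.smul_apply, smul_eq_mul, Finset.sum_mul]

end CircleDensity

/-! ### Invariance of the operator given by a matrix of scalars -/

namespace CircleDensity

open Filter Topology MeasureTheory

variable {𝕜 : Type*} [RCLike 𝕜]

/-- The operator on differential operators with the matrix `t`. -/
noncomputable def symOf (k : ℕ) (t : ℕ → ℕ → 𝕜) : Module.End 𝕜 (DiffOp 𝕜 k) :=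
  opOf k ∘ₗ matOp (derD 𝕜) t (k + 1) ∘ₗ coef

theorem symOf_opOf (k : ℕ) (t : ℕ → ℕ → 𝕜) (a : ℕ → Smooth 𝕜) :
    symOf k t (opOf k a) = opOf k (matOp (derD 𝕜) t (k + 1) a) := by
  refine opOf_congr k _ _ fun j _ => ?_
  change ∑ p ∈ Finset.range (k + 1), t p _ • ((derD 𝕜 : Smooth 𝕜 →ₗ[𝕜] Smooth 𝕜) ^ _)
    (coef (opOf k a) p) = ∑ p ∈ Finset.range (k + 1), t p _ •
      ((derD 𝕜 : Smooth 𝕜 →ₗ[𝕜] Smooth 𝕜) ^ _) (a p)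
  refine Finset.sum_congr rfl fun p hp => ?_
  rw [coef_opOf k a p (Finset.mem_range.1 hp)]

theorem defect_of_le (t : ℕ → ℕ → 𝕜) (ht : ∀ i p, i < p → t i p = 0) (N : ℕ) (lam delta : 𝕜)
    (h : Smooth 𝕜) (i : ℕ) (b : Smooth 𝕜) (q : ℕ) (hq : N ≤ q) :
    defect (derD 𝕜) t N lam delta h i b q = 0 := by
  rw [defect_apply]
  simp only [matOp, LinearMap.coe_mk, AddHom.coe_mk, Pi.sub_apply, Finset.sum_apply, Pi.smul_apply]
  rw [Finset.sum_eq_zero fun p hp => ?_, Finset.sum_eq_zero fun p hp => ?_, sub_zero]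
  · rw [symE_of_lt _ _ _ _ _ ((Finset.mem_range.1 hp).trans_le hq), smul_zero, smul_zero]
  · rw [ht _ _ ((Finset.mem_range.1 hp).trans_le hq), zero_smul]

theorem diffOpAct_symOf (k : ℕ) (lam mu : 𝕜) (t : ℕ → ℕ → 𝕜) (ht : ∀ i p, i < p → t i p = 0)
    (f : Diffeo) (a : ℕ → Smooth 𝕜) :
    diffOpAct k lam mu f (symOf k t (opOf k a)) = opOf k (∑ i ∈ Finset.range (k + 1),
      ∑ p ∈ Finset.range (k + 1), t i p • covPow (derD 𝕜 : Smooth 𝕜 →ₗ[𝕜] Smooth 𝕜)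
        (schw 𝕜 f.inv) (mu - lam - i) (i - p) (jac (mu - lam - i) f.inv * pull f.inv (a i)) •
          symE (derD 𝕜) (schw 𝕜 f.inv) lam p) := by
  rw [symOf_opOf, diffOpAct_opOf, Finset.sum_comm]
  congr 1
  refine Finset.sum_congr rfl fun p _ => ?_
  have h1 : matOp (derD 𝕜) t (k + 1) a p =
      ∑ i ∈ Finset.range (k + 1), t i p • (D ^ (i - p)) (a i) := rfl
  rw [h1, map_sum, Finset.mul_sum, Finset.sum_smul]
  refine Finset.sum_congr rfl fun i _ => ?_
  rcases lt_or_ge i p with hip | hip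
  · simp [ht i p hip]
  -- The twisted derivative of order i - p of a density of weight δ - i has weight δ - p, as needed
  -- for a coefficient of ∂^p.
  · rw [covPow_jac_mul_pull, Nat.cast_sub hip, map_smul, mul_smul_comm, smul_assoc]
    congr 4
    ring

/-- Together with `diffOpAct_symOf` this shows that the failure to commute is the sum over i of the
defects at the transported coefficients. -/
theorem symOf_diffOpAct (k : ℕ) (lam mu : 𝕜) (t : ℕ → ℕ → 𝕜) (f : Diffeo) (a : ℕ → Smooth 𝕜) :
    symOf k t (diffOpAct k lam mu f (opOf k a)) = opOf k (∑ i ∈ Finset.range (k + 1),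
      matOp (derD 𝕜) t (k + 1) ((jac (mu - lam - i) f.inv * pull f.inv (a i)) •
        symE (derD 𝕜) (schw 𝕜 f.inv) lam i)) := by
  rw [diffOpAct_opOf, symOf_opOf, map_sum]

theorem symOf_comm (k : ℕ) (lam mu : 𝕜) (t : ℕ → ℕ → 𝕜) (ht : ∀ i p, i < p → t i p = 0)
    (heq : ∀ i p l, i < k + 1 → p + l < i → symEq t lam (mu - lam) i p l = 0)
    (f : Diffeo) (A : DiffOp 𝕜 k) :
    symOf k t (diffOpAct k lam mu f A) = diffOpAct k lam mu f (symOf k t A) := by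
  rw [← opOf_coef A, diffOpAct_symOf k lam mu t ht, symOf_diffOpAct]
  congr 1
  refine Finset.sum_congr rfl fun i hi => ?_
  rw [← sub_eq_zero]
  exact defect_eq_zero (derD 𝕜) t ht (k + 1) lam (mu - lam) heq _ i (Finset.mem_range.1 hi) _

/-- The coefficients of the image are combinations of derivatives of those of A, which vanish on a
neighbourhood of any point outside the support. -/
theorem supp_symOf (k : ℕ) (t : ℕ → ℕ → 𝕜) (A : DiffOp 𝕜 k) : supp (symOf k t A) ⊆ supp A := by
  refine closure_minimal ?_ isClosed_closure
  rintro x ⟨φ, hx⟩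
  by_contra hc
  refine hx ?_
  have hU : ∀ᶠ y in 𝓝 x, y ∉ supp A := isClosed_closure.isOpen_compl.mem_nhds hc
  have h1 : ∀ j < k + 1, (coef A j : ℝ → 𝕜) =ᶠ[𝓝 x] ((0 : Smooth 𝕜) : ℝ → 𝕜) := by
    intro j hj
    filter_upwards [hU] with y hy
    refine coeff_apply_eq_zero k (coef A) y (fun ψ => ?_) j hj
    by_contra h
    rw [opOf_coef] at h
    exact hy (subset_closure ⟨ψ, h⟩)
  rw [← opOf_coef A, symOf_opOf, opOf_apply, sum_apply]
  refine Finset.sum_eq_zero fun j _ => ?_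
  have h2 : (matOp (derD 𝕜) t (k + 1) (coef A) j : ℝ → 𝕜) x = 0 := by
    have h3 : matOp (derD 𝕜) t (k + 1) (coef A) j =
      ∑ i ∈ Finset.range (k + 1), t i j • (D ^ (i - j)) (coef A i) := rfl
    rw [h3, sum_apply]
    refine Finset.sum_eq_zero fun i hi => ?_
    have h4 := (eventuallyEq_D_pow (h1 i (Finset.mem_range.1 hi)) (i - j)).eq_of_nhds
    change t i j * ((D ^ (i - j)) (coef A i) : ℝ → 𝕜) x = 0
    rw [h4, map_zero]
    exact mul_zero _
  change (matOp (derD 𝕜) t (k + 1) (coef A) j : ℝ → 𝕜) x * _ = 0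
  rw [h2, zero_mul]

/-- Every multiple of a derivative is the logarithmic derivative `g'' / g'` of a diffeomorphism. -/
theorem exists_diffeo_schw (H : Smooth ℝ) :
    ∃ g : Diffeo, schw 𝕜 g = ofRealSmooth (D H) := by
  have hs : ContDiff ℝ ∞ (fun x => Real.exp ((H : ℝ → ℝ) x)) := Real.contDiff_exp.comp H.2.1
  -- The diffeomorphism has g' = e^H / Z. Dividing by Z makes the mean one and does not change (log
  -- g')'.
  set Z := ∫ t in (0 : ℝ)..1, Real.exp ((H : ℝ → ℝ) t) with hZ
  have hZpos : 0 < Z := intervalIntegral.intervalIntegral_pos_of_pos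
    (hs.continuous.intervalIntegrable _ _) (fun x => Real.exp_pos _) one_pos
  refine ⟨Diffeo.ofDeriv (fun x => Real.exp ((H : ℝ → ℝ) x) / Z) (hs.div_const Z)
    (fun x => by rw [H.2.2 x]) (fun x => div_pos (Real.exp_pos _) hZpos) ?_, ?_⟩
  · rw [intervalIntegral.integral_div, div_self hZpos.ne']
  · rw [schw]
    congr 1
    refine Subtype.ext <| funext fun x => ?_
    have h1 : ∀ g : Diffeo, (∀ y, deriv g.toEquiv y = Real.exp ((H : ℝ → ℝ) y) / Z) →
        (logDeriv g : ℝ → ℝ) = fun y => (H : ℝ → ℝ) y - Real.log Z := by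
      intro g hg
      funext y
      change Real.log (deriv g.toEquiv y) = _
      rw [hg, Real.log_div (Real.exp_pos _).ne' hZpos.ne', Real.log_exp]
    change deriv (logDeriv _ : ℝ → ℝ) x = deriv (H : ℝ → ℝ) x
    rw [h1 _ (Diffeo.deriv_ofDeriv _ _ _ _ _), deriv_sub_const]

theorem ofRealSmooth_smul (s : ℝ) (u : Smooth ℝ) :
    ofRealSmooth (𝕜 := 𝕜) (s • u) = (s : 𝕜) • ofRealSmooth u :=
  Subtype.ext <| funext fun _ => RCLike.ofReal_mul s _

/-- Every derivative ∂H is some g''/g', so commutation makes the defect vanish for all real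
multiples of h = ∂(u^n), and `sum_symEq_eq_zero` applies. Taking b = u^l, where u is the coordinate
at 0, and evaluating at 0 isolates a single equation. -/
theorem symEq_of_comm (k : ℕ) (lam mu : 𝕜) (t : ℕ → ℕ → 𝕜) (ht : ∀ i p, i < p → t i p = 0)
    (hcomm : ∀ (f : Diffeo) (A : DiffOp 𝕜 k),
      symOf k t (diffOpAct k lam mu f A) = diffOpAct k lam mu f (symOf k t A))
    (i p l : ℕ) (hi : i < k + 1) (hpl : p + l < i) : symEq t lam (mu - lam) i p l = 0 := by
  have hdef : ∀ (g : Diffeo) (i : ℕ), i < k + 1 → ∀ b : Smooth 𝕜,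
      defect (derD 𝕜) t (k + 1) lam (mu - lam) (schw 𝕜 g) i b = 0 := by
    intro g i hi b
    -- Chosen so that the transported coefficient `jac * pull g (a i)` is exactly b.
    set a : ℕ → Smooth 𝕜 := Pi.single i (pull g.inv (jac (-(mu - lam - i)) g * b)) with ha
    have h1 := hcomm g.inv (opOf k a)
    rw [diffOpAct_symOf k lam mu t ht, symOf_diffOpAct] at h1
    change opOf k (∑ i ∈ Finset.range (k + 1), matOp (derD 𝕜) t (k + 1)
      ((jac (mu - lam - i) g * pull g (a i)) • symE (derD 𝕜) (schw 𝕜 g) lam i)) =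
      opOf k (∑ i ∈ Finset.range (k + 1),
      ∑ p ∈ Finset.range (k + 1), t i p • covPow (derD 𝕜 : Smooth 𝕜 →ₗ[𝕜] Smooth 𝕜)
        (schw 𝕜 g) (mu - lam - i) (i - p) (jac (mu - lam - i) g * pull g (a i)) •
          symE (derD 𝕜) (schw 𝕜 g) lam p) at h1
    have h2 : jac (mu - lam - i) g * pull g (a i) = b := by
      rw [ha, Pi.single_eq_same, pull_inv_pull, ← mul_assoc, ← jac_add, add_neg_cancel, jac_zero,
        one_mul]
    have h3 : ∀ r, r ≠ i → a r = 0 := fun r hr => Pi.single_eq_of_ne hr _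
    rw [Finset.sum_eq_single i (fun r _ hr => by simp [h3 r hr])
      (fun h => absurd (Finset.mem_range.2 hi) h), Finset.sum_eq_single i
      (fun r _ hr => by simp [h3 r hr]) (fun h => absurd (Finset.mem_range.2 hi) h), h2] at h1
    ext1 q
    rcases lt_or_ge q (k + 1) with hq | hq
    · have h4 := opOf_inj k _ _ h1 q hq
      rw [defect_apply, Pi.sub_apply, h4, sub_self]
      rfl
    · rw [defect_of_le t ht _ _ _ _ _ _ _ hq]
      rfl
  set u : Smooth ℝ := ⟨localCoord, contDiff_localCoord, localCoord_add_one⟩ with hu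
  -- With this exponent, the derivative of order i - p - l - 1 of h = ∂(u^n) is n! at 0.
  set n := i - p - l with hn
  have hupow : ofRealSmooth (𝕜 := 𝕜) (u ^ n) = coordS 𝕜 ^ n :=
    Subtype.ext <| funext fun x => RCLike.ofReal_pow _ _
  have hs : (Set.range ((↑) : ℝ → 𝕜)).Infinite :=
    Set.infinite_range_of_injective RCLike.ofReal_injective
  have h1 := sum_symEq_eq_zero (derD 𝕜) t ht (k + 1) lam (mu - lam)
    (ofRealSmooth (D (u ^ n))) _ hs (by
      rintro _ ⟨s, rfl⟩ i hi b
      obtain ⟨g, hg⟩ := exists_diffeo_schw (𝕜 := 𝕜) (s • (u ^ n))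
      rw [map_smul, ofRealSmooth_smul] at hg
      rw [← hg]
      exact hdef g i hi b) i hi (coordS 𝕜 ^ l) p (by omega)
  have h2 := congrArg (fun v : Smooth 𝕜 => (v : ℝ → 𝕜) 0) h1
  rw [sum_apply, Finset.sum_eq_single l (fun m _ hm => ?_)
    (fun h => absurd (Finset.mem_range.2 (by omega)) h), if_pos hpl] at h2
  · change symEq t lam (mu - lam) i p l * (((D ^ l) (coordS 𝕜 ^ l) : ℝ → 𝕜) 0 *
      ((D ^ (i - p - l - 1)) (ofRealSmooth (D (u ^ n)) : Smooth 𝕜) : ℝ → 𝕜) 0) = 0 at h2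
    rw [D_pow_coordS_pow_zero, if_pos rfl, ← D_ofRealSmooth, ← Module.End.mul_apply, ← pow_succ,
      hupow, D_pow_coordS_pow_zero, if_pos (by omega)] at h2
    refine (mul_eq_zero.1 h2).resolve_right (mul_ne_zero ?_ ?_) <;>
    exact_mod_cast Nat.factorial_ne_zero _
  · split_ifs
    · change symEq t lam (mu - lam) i p m * (((D ^ m) (coordS 𝕜 ^ l) : ℝ → 𝕜) 0 * _) = 0
      rw [D_pow_coordS_pow_zero, if_neg hm, zero_mul, mul_zero]
    · rfl

end CircleDensity

/-! ### Functionals on germs that are homogeneous under the contraction -/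

namespace CircleDensity

open Filter Topology MeasureTheory

variable {𝕜 : Type*} [RCLike 𝕜]

/-- Taylor's estimate, by the mean value inequality applied to the bound for the derivative.
Periodicity makes the bound valid on all of ℝ. -/
theorem exists_bound_of_vanishing (m : ℕ) (a : Smooth 𝕜)
    (ha : ∀ l < m, ((D ^ l) a : ℝ → 𝕜) 0 = 0) :
    ∃ C : ℝ, 0 ≤ C ∧ ∀ y, ‖(a : ℝ → 𝕜) y‖ ≤ C * |y| ^ m := by
  induction m generalizing a with
  | zero =>
    obtain ⟨C, hC⟩ := (isCompact_Icc (a := (0 : ℝ)) (b := 1)).exists_bound_of_continuousOn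
      a.2.1.continuous.continuousOn
    refine ⟨C, (norm_nonneg _).trans (hC 0 (by simp)), fun y => ?_⟩
    obtain ⟨z, hz, hyz⟩ := (show Function.Periodic (a : ℝ → 𝕜) 1 from a.2.2).exists_mem_Ico₀
      one_pos y
    rw [hyz, pow_zero, mul_one]
    exact hC z ⟨hz.1, hz.2.le⟩
  | succ m ih =>
    obtain ⟨C, hC0, hC⟩ := ih (D a) fun l hl => by
      have := ha (l + 1) (by omega)
      rwa [pow_succ] at this
    refine ⟨C, hC0, fun y => ?_⟩
    have h0 : (a : ℝ → 𝕜) 0 = 0 := ha 0 (by omega)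
    have h1 := (convex_closedBall (0 : ℝ) |y|).norm_image_sub_le_of_norm_deriv_le
      (f := (a : ℝ → 𝕜)) (C := C * |y| ^ m) (x := 0) (y := y)
      (fun x _ => a.2.1.differentiable (by simp) x) (fun x hx => (hC x).trans ?_)
      (by simp) (by simp)
    · rw [h0, sub_zero, sub_zero, Real.norm_eq_abs, mul_assoc, ← pow_succ] at h1
      exact h1
    · rw [mem_closedBall_zero_iff, Real.norm_eq_abs] at hx
      gcongr

theorem norm_dilation_le (m : ℕ) (a : Smooth 𝕜) (C : ℝ) (hC : ∀ y, ‖(a : ℝ → 𝕜) y‖ ≤ C * |y| ^ m)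
    (hC0 : 0 ≤ C) (ρ R x : ℝ) (hρ : 0 ≤ ρ) (hx : |x| ≤ R) (r : ℕ) :
    ‖((ρ ^ r : ℝ) : 𝕜) * (a : ℝ → 𝕜) (x / 2 ^ r)‖ ≤ C * R ^ m * (ρ / 2 ^ m) ^ r := by
  rw [norm_mul, RCLike.norm_ofReal, abs_of_nonneg (by positivity)]
  calc ρ ^ r * ‖(a : ℝ → 𝕜) (x / 2 ^ r)‖ ≤ ρ ^ r * (C * |x / 2 ^ r| ^ m) := by gcongr; exact hC _
    _ = C * |x| ^ m * (ρ / 2 ^ m) ^ r := by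
      rw [abs_div, abs_of_pos (show (0 : ℝ) < 2 ^ r by positivity), div_pow, div_pow, ← pow_mul,
        ← pow_mul, mul_comm r m]
      ring
    _ ≤ _ := by gcongr

theorem summable_dilation_bound (m : ℕ) (C R ρ : ℝ) (hρ : 0 ≤ ρ) (hρm : ρ < 2 ^ m) :
    Summable fun r : ℕ => C * R ^ m * (ρ / 2 ^ m) ^ r :=
  (summable_geometric_of_lt_one (by positivity) ((div_lt_one (by positivity)).2 hρm)).mul_left _

theorem summable_dilation (m : ℕ) (a : Smooth 𝕜) (ha : ∀ l < m, ((D ^ l) a : ℝ → 𝕜) 0 = 0) (ρ : ℝ)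
    (hρ : 0 ≤ ρ) (hρm : ρ < 2 ^ m) (x : ℝ) :
    Summable fun r : ℕ => ((ρ ^ r : ℝ) : 𝕜) * (a : ℝ → 𝕜) (x / 2 ^ r) := by
  obtain ⟨C, hC0, hC⟩ := exists_bound_of_vanishing m a ha
  exact Summable.of_norm_bounded (summable_dilation_bound m C |x| ρ hρ hρm)
    fun r => norm_dilation_le m a C hC hC0 ρ |x| x hρ le_rfl r

/-- Each differentiation costs one order of vanishing but also halves ρ, so the geometric ratio
stays below one and the series may be differentiated term by term. -/
theorem hasDerivAt_dilation_sum (m : ℕ) (a : Smooth 𝕜) (ha : ∀ l < m, ((D ^ l) a : ℝ → 𝕜) 0 = 0)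
    (ρ : ℝ) (hρ : 0 ≤ ρ) (hρm : ρ < 2 ^ m) (x : ℝ) :
    HasDerivAt (fun x => ∑' r : ℕ, ((ρ ^ r : ℝ) : 𝕜) * (a : ℝ → 𝕜) (x / 2 ^ r))
      (∑' r : ℕ, (((ρ / 2) ^ r : ℝ) : 𝕜) * (D a : ℝ → 𝕜) (x / 2 ^ r)) x := by
  have ha' : ∀ l < m - 1, ((D ^ l) (D a) : ℝ → 𝕜) 0 = 0 := fun l hl => by
    have := ha (l + 1) (by omega)
    rwa [pow_succ] at this
  -- For m = 0 the truncated m - 1 is again 0, and ρ < 1 already suffices.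
  have hρ' : ρ / 2 < 2 ^ (m - 1) := by
    cases m with
    | zero => simp at hρm ⊢; linarith
    | succ m => rw [pow_succ] at hρm; simp; linarith
  obtain ⟨C, hC0, hC⟩ := exists_bound_of_vanishing (m - 1) (D a) ha'
  have hd : ∀ (r : ℕ) (y : ℝ), HasDerivAt
      (fun y : ℝ => ((ρ ^ r : ℝ) : 𝕜) * (a : ℝ → 𝕜) (y / 2 ^ r))
      ((((ρ / 2) ^ r : ℝ) : 𝕜) * (D a : ℝ → 𝕜) (y / 2 ^ r)) y := by
    intro r y
    have h1 : HasDerivAt (fun y : ℝ => y / 2 ^ r) (1 / 2 ^ r) y := (hasDerivAt_id y).div_const _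
    have h2 := ((a.2.1.differentiable (by simp) (y / 2 ^ r)).hasDerivAt.scomp y h1).const_mul
      ((ρ ^ r : ℝ) : 𝕜)
    have h3 : (((ρ / 2) ^ r : ℝ) : 𝕜) * (D a : ℝ → 𝕜) (y / 2 ^ r) =
        ((ρ ^ r : ℝ) : 𝕜) * ((1 / 2 ^ r : ℝ) • deriv (a : ℝ → 𝕜) (y / 2 ^ r)) := by
      rw [RCLike.real_smul_eq_coe_mul, ← mul_assoc, ← RCLike.ofReal_mul, div_pow, mul_one_div]
      rfl
    rw [h3]
    exact h2
  have hx : x ∈ Metric.ball (0 : ℝ) (|x| + 1) := by simp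
  have h0 : (0 : ℝ) ∈ Metric.ball (0 : ℝ) (|x| + 1) := by
    rw [Metric.mem_ball, dist_self]
    positivity
  exact hasDerivAt_tsum_of_isPreconnected
    (summable_dilation_bound (m - 1) C (|x| + 1) (ρ / 2) (by positivity) hρ') Metric.isOpen_ball
    (convex_ball _ _).isPreconnected (fun r y _ => hd r y) (fun r y hy => by
      rw [mem_ball_zero_iff, Real.norm_eq_abs] at hy
      exact norm_dilation_le (m - 1) (D a) C hC hC0 (ρ / 2) (|x| + 1) y (by positivity) hy.le r)
    h0 (summable_dilation m a ha ρ hρ hρm 0) hx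

theorem contDiff_dilation_sum (n : ℕ) (m : ℕ) (a : Smooth 𝕜)
    (ha : ∀ l < m, ((D ^ l) a : ℝ → 𝕜) 0 = 0) (ρ : ℝ) (hρ : 0 ≤ ρ) (hρm : ρ < 2 ^ m) :
    ContDiff ℝ n (fun x => ∑' r : ℕ, ((ρ ^ r : ℝ) : 𝕜) * (a : ℝ → 𝕜) (x / 2 ^ r)) := by
  have hd := hasDerivAt_dilation_sum m a ha ρ hρ hρm
  induction n generalizing m a ρ with
  | zero => exact contDiff_zero.2 (continuous_iff_continuousAt.2 fun x => (hd x).continuousAt)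
  | succ n ih =>
    refine (contDiff_succ_iff_deriv (n := n)).2 ⟨fun x => (hd x).differentiableAt, by simp, ?_⟩
    rw [funext fun x => (hd x).deriv]
    have ha' : ∀ l < m - 1, ((D ^ l) (D a) : ℝ → 𝕜) 0 = 0 := fun l hl => by
      have := ha (l + 1) (by omega)
      rwa [pow_succ] at this
    have hρ' : ρ / 2 < 2 ^ (m - 1) := by
      cases m with
      | zero => simp at hρm ⊢; linarith
      | succ m => rw [pow_succ] at hρm; simp; linarith
    exact ih (m - 1) (D a) ha' (ρ / 2) (by positivity) hρ'
      (hasDerivAt_dilation_sum (m - 1) (D a) ha' (ρ / 2) (by positivity) hρ')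

/-- The periodic function with the germ of a given smooth function at `0`. -/
noncomputable def periodize (u : ℝ → 𝕜) (hu : ContDiff ℝ ∞ u) : Smooth 𝕜 :=
  ⟨fun x => u (localCoord x), hu.comp contDiff_localCoord, fun x => by
    simp only [localCoord_add_one]⟩

theorem eventually_periodize (u : ℝ → 𝕜) (hu : ContDiff ℝ ∞ u) :
    (periodize u hu : ℝ → 𝕜) =ᶠ[𝓝 0] u := by
  filter_upwards [eventually_localCoord] with x hx
  change u (localCoord x) = u x
  rw [hx]

/-- If `a` vanishes to order `m` at `0` and `0 ≤ ρ < 2 ^ m`, then near `0` the function `a` has the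
form `ψ(x) - ρ ψ(x / 2)`. -/
theorem exists_dilation_primitive (m : ℕ) (a : Smooth 𝕜)
    (ha : ∀ l < m, ((D ^ l) a : ℝ → 𝕜) 0 = 0) (ρ : ℝ) (hρ : 0 ≤ ρ) (hρm : ρ < 2 ^ m) :
    ∃ ψ : Smooth 𝕜, (ψ : ℝ → 𝕜) =ᶠ[𝓝 0]
      ((a + (ρ : 𝕜) • pull Diffeo.contraction ψ : Smooth 𝕜) : ℝ → 𝕜) := by
  -- The solution is Σ_r ρ^r a(x/2^r): its term r = 0 is a, and the rest is ρ times the same sum at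
  -- x/2.
  have hu : ContDiff ℝ ∞ (fun x => ∑' r : ℕ, ((ρ ^ r : ℝ) : 𝕜) * (a : ℝ → 𝕜) (x / 2 ^ r)) :=
    contDiff_infty.2 fun n => contDiff_dilation_sum n m a ha ρ hρ hρm
  refine ⟨periodize _ hu, ?_⟩
  have h0 : Tendsto (fun x : ℝ => x / 2) (𝓝 0) (𝓝 0) := by
    have : ContinuousAt (fun x : ℝ => x / 2) 0 := by fun_prop
    simpa [ContinuousAt] using this
  filter_upwards [eventually_periodize _ hu, h0.eventually (eventually_periodize _ hu),
    Diffeo.eventually_contraction] with x h1 h2 h3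
  rw [h1]
  change _ = (a : ℝ → 𝕜) x + (ρ : 𝕜) * (periodize _ hu : ℝ → 𝕜) (Diffeo.contraction.toEquiv x)
  rw [h3, h2, (summable_dilation m a ha ρ hρ hρm x).tsum_eq_zero_add, ← tsum_mul_left]
  simp only [pow_zero, RCLike.ofReal_one, one_mul, div_one]
  congr 1
  refine tsum_congr fun r => ?_
  rw [pow_succ', pow_succ', RCLike.ofReal_mul, mul_assoc, div_mul_eq_div_div]

theorem eventually_pull_contraction_coordS_pow (l : ℕ) :
    (pull Diffeo.contraction (coordS 𝕜 ^ l) : ℝ → 𝕜) =ᶠ[𝓝 0]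
      (((1 / 2 : 𝕜) ^ l • coordS 𝕜 ^ l : Smooth 𝕜) : ℝ → 𝕜) := by
  have h0 : Tendsto (fun x : ℝ => x / 2) (𝓝 0) (𝓝 0) := by
    have : ContinuousAt (fun x : ℝ => x / 2) 0 := by fun_prop
    simpa [ContinuousAt] using this
  filter_upwards [eventually_coordS_pow (𝕜 := 𝕜) l, h0.eventually (eventually_coordS_pow (𝕜 := 𝕜) l),
    Diffeo.eventually_contraction] with x h1 h2 h3
  change ((coordS 𝕜 ^ l : Smooth 𝕜) : ℝ → 𝕜) (Diffeo.contraction.toEquiv x) =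
    (1 / 2 : 𝕜) ^ l * ((coordS 𝕜 ^ l : Smooth 𝕜) : ℝ → 𝕜) x
  rw [h3, h2, h1, ← mul_pow]
  congr 1
  push_cast
  ring

/-- A germ-local functional which is homogeneous under the contraction is a multiple of a derivative
at `0`. -/
theorem exists_eq_deriv_of_homogeneous (ell : Smooth 𝕜 →ₗ[𝕜] 𝕜) (i j : ℕ)
    (hloc : ∀ a b : Smooth 𝕜, (a : ℝ → 𝕜) =ᶠ[𝓝 0] b → ell a = ell b)
    (hhom : ∀ a, (2 : 𝕜) ^ i * ell (pull Diffeo.contraction a) = 2 ^ j * ell a) :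
    ∃ τ : 𝕜, (i < j → τ = 0) ∧ ∀ a, ell a = τ * ((D ^ (i - j)) a : ℝ → 𝕜) 0 := by
  have h2 : ∀ n : ℕ, (2 : 𝕜) ^ n ≠ 0 := fun n => pow_ne_zero n two_ne_zero
  rcases lt_or_ge i j with hij | hij
  · refine ⟨0, fun _ => rfl, fun a => ?_⟩
    obtain ⟨m, rfl⟩ : ∃ m, j = i + m + 1 := ⟨j - i - 1, by omega⟩
    -- The choice ρ = 2^(i-j) < 1 requires no vanishing of a. Homogeneity then cancels ψ and leaves
    -- ell a = 0.
    obtain ⟨ψ, hψ⟩ := exists_dilation_primitive 0 a (by simp) ((1 / 2) ^ (m + 1)) (by positivity)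
      (by rw [pow_zero]; exact pow_lt_one₀ (by norm_num) (by norm_num) (by omega))
    have h3 := hloc _ _ hψ
    rw [map_add, map_smul, smul_eq_mul] at h3
    have h4 : ell (pull Diffeo.contraction ψ) = 2 ^ (m + 1) * ell ψ := by
      have := hhom ψ
      rw [add_assoc, pow_add, mul_assoc] at this
      exact mul_left_cancel₀ (h2 i) this
    rw [h4, ← mul_assoc] at h3
    have h5 : (((1 / 2) ^ (m + 1) : ℝ) : 𝕜) * 2 ^ (m + 1) = 1 := by
      push_cast
      rw [← mul_pow]
      norm_num
    rw [h5, one_mul] at h3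
    rw [zero_mul]
    linear_combination -h3
  · obtain ⟨n, rfl⟩ : ∃ n, i = j + n := ⟨i - j, by omega⟩
    have hn : ∀ a, (2 : 𝕜) ^ n * ell (pull Diffeo.contraction a) = ell a := fun a => by
      have := hhom a
      rw [pow_add, mul_assoc] at this
      exact mul_left_cancel₀ (h2 j) this
    -- With ρ = 2^n, the relation a = ψ - 2^n ψ(x/2) and homogeneity give ell a = ell ψ - ell ψ.
    have hvan : ∀ a : Smooth 𝕜, (∀ l < n + 1, ((D ^ l) a : ℝ → 𝕜) 0 = 0) → ell a = 0 := by
      intro a ha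
      obtain ⟨ψ, hψ⟩ := exists_dilation_primitive (n + 1) a ha (2 ^ n) (by positivity)
        (pow_lt_pow_right₀ (by norm_num) (by omega))
      have h3 := hloc _ _ hψ
      rw [map_add, map_smul, smul_eq_mul] at h3
      have h4 := hn ψ
      push_cast at h3
      linear_combination -h3 - h4
    -- x^l is an eigenvector of the contraction with eigenvalue 2^(-l), while homogeneity allows
    -- only 2^(-n) where ell is not zero.
    have hpow : ∀ l < n, ell (coordS 𝕜 ^ l) = 0 := by
      intro l hl
      have h3 := hn (coordS 𝕜 ^ l)
      rw [hloc _ _ (eventually_pull_contraction_coordS_pow l), map_smul, smul_eq_mul,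
        ← mul_assoc] at h3
      obtain ⟨m, rfl⟩ : ∃ m, n = l + (m + 1) := ⟨n - l - 1, by omega⟩
      have h4 : (2 : 𝕜) ^ (l + (m + 1)) * (1 / 2) ^ l = 2 ^ (m + 1) := by
        rw [pow_add, mul_right_comm, ← mul_pow]
        norm_num
      have h5 : (2 : 𝕜) ^ (m + 1) ≠ 1 := by
        have : (2 : ℕ) ^ (m + 1) ≠ 1 := (Nat.one_lt_two_pow (by omega)).ne'
        exact_mod_cast this
      rw [h4] at h3
      have h6 : ((2 : 𝕜) ^ (m + 1) - 1) * ell (coordS 𝕜 ^ l) = 0 := by linear_combination h3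
      exact (mul_eq_zero.1 h6).resolve_left (sub_ne_zero.2 h5)
    refine ⟨ell (coordS 𝕜 ^ n) / n.factorial, fun h => absurd h (by omega), fun a => ?_⟩
    rw [Nat.add_sub_cancel_left]
    -- Subtract the Taylor polynomial of degree n; of its terms only x^n is seen by ell.
    have h3 := hvan (a - ∑ l ∈ Finset.range (n + 1),
      (((D ^ l) a : ℝ → 𝕜) 0 / l.factorial) • coordS 𝕜 ^ l) (by
        intro r hr
        rw [map_sub, map_sum]
        change ((D ^ r) a : ℝ → 𝕜) 0 - ((∑ l ∈ Finset.range (n + 1), (D ^ r)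
          ((((D ^ l) a : ℝ → 𝕜) 0 / l.factorial) • coordS 𝕜 ^ l) : Smooth 𝕜) : ℝ → 𝕜) 0 = 0
        rw [sum_apply, Finset.sum_eq_single r (fun l _ hl => ?_)
          (fun h => absurd (Finset.mem_range.2 hr) h)]
        · rw [map_smul]
          change _ - _ * ((D ^ r) (coordS 𝕜 ^ r) : ℝ → 𝕜) 0 = 0
          rw [D_pow_coordS_pow_zero, if_pos rfl, div_mul_cancel₀ _
            (by exact_mod_cast r.factorial_ne_zero), sub_self]
        · rw [map_smul]
          change _ * ((D ^ r) (coordS 𝕜 ^ l) : ℝ → 𝕜) 0 = 0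
          rw [D_pow_coordS_pow_zero, if_neg hl.symm, mul_zero])
    rw [map_sub, map_sum, Finset.sum_eq_single n (fun l hl hln => by
      rw [map_smul, hpow l (by have := Finset.mem_range.1 hl; omega), smul_zero])
      (fun h => absurd (Finset.mem_range.2 (by omega)) h), map_smul, smul_eq_mul] at h3
    linear_combination h3

end CircleDensity

/-! ### Local symmetries are given by matrices of scalars -/

namespace CircleDensity

open Filter Topology MeasureTheory

variable {𝕜 : Type*} [RCLike 𝕜]

/-- A point near which all coefficients vanish lies outside the support of the operator, hence
outside the support of its image. -/
theorem coef_apply_eq_zero_of_eventually {k : ℕ} (T : Module.End 𝕜 (DiffOp 𝕜 k))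
    (hT : ∀ A, supp (T A) ⊆ supp A) (a : ℕ → Smooth 𝕜) (x : ℝ)
    (ha : ∀ j < k + 1, (a j : ℝ → 𝕜) =ᶠ[𝓝 x] ((0 : Smooth 𝕜) : ℝ → 𝕜)) (j : ℕ) :
    (coef (T (opOf k a)) j : ℝ → 𝕜) x = 0 := by
  rcases le_or_gt (k + 1) j with hj | hj
  · rw [coef_of_lt _ j hj]
    rfl
  have h1 : x ∉ supp (opOf k a) := by
    intro hx
    have h2 : ∀ᶠ y in 𝓝 x, ∀ i ∈ Finset.range (k + 1), (a i : ℝ → 𝕜) y = 0 :=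
      (Filter.eventually_all_finset _).2 fun i hi => ha i (Finset.mem_range.1 hi)
    obtain ⟨y, hy, φ, hφ⟩ := mem_closure_iff_nhds.1 hx _ h2
    refine hφ ?_
    rw [opOf_apply, sum_apply]
    refine Finset.sum_eq_zero fun i hi => ?_
    change (a i : ℝ → 𝕜) y * _ = 0
    rw [hy i hi, zero_mul]
  refine coeff_apply_eq_zero k _ x (fun φ => ?_) j hj
  rw [opOf_coef]
  by_contra h
  exact h1 (hT _ (subset_closure ⟨φ, h⟩))

theorem coef_apply_congr {k : ℕ} (T : Module.End 𝕜 (DiffOp 𝕜 k))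
    (hT : ∀ A, supp (T A) ⊆ supp A) (a b : ℕ → Smooth 𝕜) (x : ℝ)
    (hab : ∀ j < k + 1, (a j : ℝ → 𝕜) =ᶠ[𝓝 x] b j) (j : ℕ) :
    (coef (T (opOf k a)) j : ℝ → 𝕜) x = (coef (T (opOf k b)) j : ℝ → 𝕜) x := by
  have h1 := coef_apply_eq_zero_of_eventually T hT (a - b) x (fun j hj => by
    filter_upwards [hab j hj] with y hy
    change (a j : ℝ → 𝕜) y - (b j : ℝ → 𝕜) y = 0
    rw [hy, sub_self]) j
  have h2 : opOf k a = opOf k (a - b) + opOf k b := by rw [← map_add, sub_add_cancel]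
  rw [h2, map_add, map_add]
  change (coef (T (opOf k (a - b))) j : ℝ → 𝕜) x + _ = _
  rw [h1, zero_add]

/-- Where h vanishes the twisted factors are plain derivatives. This applies to the contraction,
which is linear near 0. -/
theorem eventually_symE_of_eventually_zero (h : Smooth 𝕜) (lam : 𝕜) (x : ℝ)
    (hh : (h : ℝ → 𝕜) =ᶠ[𝓝 x] ((0 : Smooth 𝕜) : ℝ → 𝕜)) (p q : ℕ) :
    ((symE (derD 𝕜) h lam p q : Smooth 𝕜) : ℝ → 𝕜) =ᶠ[𝓝 x] ((Pi.single p 1 : ℕ → Smooth 𝕜) q : ℝ → 𝕜) := by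
  rw [← symE_flat (derD 𝕜) lam p]
  induction p generalizing q with
  | zero => rfl
  | succ p ih =>
    have hstep : ∀ (w : Smooth 𝕜), symE (derD 𝕜) w lam (p + 1) q =
        symNabla (derD 𝕜) (symE (derD 𝕜) w lam p) q -
          (lam + p) • (w * symE (derD 𝕜) w lam p q) := fun w => rfl
    rw [hstep, hstep]
    have h1 : (symNabla (derD 𝕜) (symE (derD 𝕜) h lam p) q : ℝ → 𝕜) =ᶠ[𝓝 x]
        (symNabla (derD 𝕜) (symE (derD 𝕜) (0 : Smooth 𝕜) lam p) q : Smooth 𝕜) := by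
      cases q with
      | zero => exact eventuallyEq_D_pow (ih 0) 1
      | succ q => exact (eventuallyEq_D_pow (ih (q + 1)) 1).add (ih q)
    exact h1.sub ((hh.mul (ih q)).const_smul (lam + p))

theorem eventually_deriv_contraction :
    ∀ᶠ x in 𝓝 (0 : ℝ), deriv Diffeo.contraction.toEquiv x = 1 / 2 := by
  filter_upwards [eventually_localCoordDeriv] with x hx
  rw [Diffeo.contraction, Diffeo.deriv_ofDeriv, hx]
  norm_num

theorem eventually_schw_contraction :
    (schw 𝕜 Diffeo.contraction : ℝ → 𝕜) =ᶠ[𝓝 0] ((0 : Smooth 𝕜) : ℝ → 𝕜) := by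
  have h1 : (logDeriv Diffeo.contraction : ℝ → ℝ) =ᶠ[𝓝 0] fun _ => Real.log (1 / 2) := by
    filter_upwards [eventually_deriv_contraction] with x hx
    change Real.log (deriv Diffeo.contraction.toEquiv x) = _
    rw [hx]
  filter_upwards [h1.deriv] with x hx
  change ((deriv (logDeriv Diffeo.contraction : ℝ → ℝ) x : ℝ) : 𝕜) = 0
  rw [hx]
  simp

theorem eventually_jac_contraction (w : 𝕜) : (jac w Diffeo.contraction : ℝ → 𝕜) =ᶠ[𝓝 0]
    fun _ => NormedSpace.exp (w * ((Real.log (1 / 2) : ℝ) : 𝕜)) := by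
  filter_upwards [eventually_deriv_contraction] with x hx
  change NormedSpace.exp (w * ((Real.log (deriv Diffeo.contraction.toEquiv x) : ℝ) : 𝕜)) = _
  rw [hx]

/-- (1/2)^(w-i) = (1/2)^w 2^i: the common factor (1/2)^w cancels later, and only the powers of 2 in
`homogeneous_of_comm` remain. -/
theorem exp_sub_nat_mul_log_half (w : 𝕜) (i : ℕ) :
    (NormedSpace.exp ((w - i) * ((Real.log (1 / 2) : ℝ) : 𝕜)) : 𝕜) =
      NormedSpace.exp (w * ((Real.log (1 / 2) : ℝ) : 𝕜)) * 2 ^ i := by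
  have h1 : (w - i) * ((Real.log (1 / 2) : ℝ) : 𝕜) =
      w * ((Real.log (1 / 2) : ℝ) : 𝕜) + i • ((Real.log 2 : ℝ) : 𝕜) := by
    rw [one_div, Real.log_inv, nsmul_eq_mul]
    push_cast
    ring
  have h2 := NormedSpace.algebraMap_exp_comm (𝕂 := ℝ) (𝔸 := 𝕜) (Real.log 2)
  rw [← Real.exp_eq_exp_ℝ, Real.exp_log two_pos, RCLike.algebraMap_eq_ofReal] at h2
  rw [h1, NormedSpace.exp_add, NormedSpace.exp_nsmul, ← h2]
  push_cast
  rfl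

theorem contraction_zero : Diffeo.contraction.toEquiv 0 = 0 := by
  rw [Diffeo.eventually_contraction.self_of_nhds, zero_div]

/-- A local symmetry is homogeneous under the contraction. -/
theorem homogeneous_of_comm {k : ℕ} (lam mu : 𝕜) (T : Module.End 𝕜 (DiffOp 𝕜 k))
    (hT : ∀ A, supp (T A) ⊆ supp A)
    (hcomm : ∀ (f : Diffeo) (A : DiffOp 𝕜 k), T (diffOpAct k lam mu f A) =
      diffOpAct k lam mu f (T A)) (i j : ℕ) (hi : i < k + 1) (hj : j < k + 1) (a : Smooth 𝕜) :
    (2 : 𝕜) ^ i * (coef (T (opOf k (Pi.single i (pull Diffeo.contraction a)))) j : ℝ → 𝕜) 0 =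
      2 ^ j * (coef (T (opOf k (Pi.single i a))) j : ℝ → 𝕜) 0 := by
  set E : 𝕜 := ((Real.log (1 / 2) : ℝ) : 𝕜) with hE
  set c := Diffeo.contraction with hc
  set B := T (opOf k (Pi.single i a)) with hB
  have h1 : T (opOf k (∑ r ∈ Finset.range (k + 1), (jac (mu - lam - r) c *
      pull c ((Pi.single i a : ℕ → Smooth 𝕜) r)) • symE (derD 𝕜) (schw 𝕜 c) lam r)) =
      opOf k (∑ r ∈ Finset.range (k + 1), (jac (mu - lam - r) c * pull c (coef B r)) •
        symE (derD 𝕜) (schw 𝕜 c) lam r) := by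
    have h2 := hcomm c.inv (opOf k (Pi.single i a))
    rw [diffOpAct_opOf, ← hB, ← opOf_coef B, diffOpAct_opOf] at h2
    exact h2
  have h3 := congrArg (fun A => (coef A j : ℝ → 𝕜) 0) h1
  rw [coef_opOf k _ j hj, Finset.sum_eq_single i (fun r _ hr => by
    rw [Pi.single_eq_of_ne hr, map_zero, mul_zero, zero_smul])
    (fun h => absurd (Finset.mem_range.2 hi) h), Pi.single_eq_same] at h3
  -- Near 0 the transported operator is a constant times a(x/2) ∂^i, and by locality it may be
  -- replaced by that.
  have h4 := coef_apply_congr T hT ((jac (mu - lam - i) c * pull c a) •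
      symE (derD 𝕜) (schw 𝕜 c) lam i) ((NormedSpace.exp ((mu - lam - i) * E) : 𝕜) •
        (Pi.single i (pull c a) : ℕ → Smooth 𝕜)) 0 (fun q hq => by
      filter_upwards [eventually_symE_of_eventually_zero (schw 𝕜 c) lam 0
        eventually_schw_contraction i q, eventually_jac_contraction (mu - lam - i)] with y h5 h6
      change (jac (mu - lam - i) c : ℝ → 𝕜) y * (pull c a : ℝ → 𝕜) y *
        ((symE (derD 𝕜) (schw 𝕜 c) lam i q : Smooth 𝕜) : ℝ → 𝕜) y = NormedSpace.exp ((mu - lam - i) * E) *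
          ((Pi.single i (pull c a) : ℕ → Smooth 𝕜) q : ℝ → 𝕜) y
      rw [h5, h6]
      by_cases hqi : q = i
      · subst hqi
        rw [Pi.single_eq_same, Pi.single_eq_same]
        change _ * _ * (1 : 𝕜) = _
        rw [mul_one]
      · rw [Pi.single_eq_of_ne hqi, Pi.single_eq_of_ne hqi]
        exact (mul_zero _).trans (mul_zero _).symm) j
  rw [h4, map_smul, map_smul, map_smul, Finset.sum_apply, sum_apply,
    Finset.sum_eq_single j (fun r _ hr => ?_) (fun h => absurd (Finset.mem_range.2 hj) h)] at h3
  · change NormedSpace.exp ((mu - lam - i) * E) * _ =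
      (jac (mu - lam - j) c : ℝ → 𝕜) 0 * (coef B j : ℝ → 𝕜) (c.toEquiv 0) *
        ((symE (derD 𝕜) (schw 𝕜 c) lam j j : Smooth 𝕜) : ℝ → 𝕜) 0 at h3
    rw [(eventually_symE_of_eventually_zero (schw 𝕜 c) lam 0
      eventually_schw_contraction j j).eq_of_nhds, (eventually_jac_contraction
      (mu - lam - j)).eq_of_nhds, contraction_zero, Pi.single_eq_same,
      exp_sub_nat_mul_log_half, exp_sub_nat_mul_log_half, mul_assoc, mul_assoc, mul_assoc] at h3
    have h5 : (((1 : Smooth 𝕜) : ℝ → 𝕜) 0) = 1 := rfl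
    rw [h5, mul_one] at h3
    have h6 : (NormedSpace.exp ((mu - lam) * E) : 𝕜) ≠ 0 := by
      intro h0
      have h7 := NormedSpace.exp_add (x := (mu - lam) * E) (y := -((mu - lam) * E))
      rw [add_neg_cancel, NormedSpace.exp_zero, h0, zero_mul] at h7
      exact one_ne_zero h7
    exact mul_left_cancel₀ h6 h3
  · change _ * ((symE (derD 𝕜) (schw 𝕜 c) lam r j : Smooth 𝕜) : ℝ → 𝕜) 0 = 0
    rw [(eventually_symE_of_eventually_zero (schw 𝕜 c) lam 0
      eventually_schw_contraction r j).eq_of_nhds, Pi.single_eq_of_ne hr.symm]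
    exact mul_zero _

theorem diffOpAct_shift (k : ℕ) (lam mu : 𝕜) (s : ℝ) (a : ℕ → Smooth 𝕜) :
    diffOpAct k lam mu (Diffeo.shift s).inv (opOf k a) =
      opOf k (fun i => pull (Diffeo.shift s) (a i)) := by
  rw [diffOpAct_opOf]
  change opOf k (∑ i ∈ Finset.range (k + 1), (jac (mu - lam - i) (Diffeo.shift s) *
    pull (Diffeo.shift s) (a i)) • symE (derD 𝕜) (schw 𝕜 (Diffeo.shift s)) lam i) = _
  have hd : ∀ x, deriv (Diffeo.shift s).toEquiv x = 1 := fun x => by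
    change deriv (fun y : ℝ => y + s) x = 1
    simp
  have hl : logDeriv (Diffeo.shift s) = 0 := Subtype.ext <| funext fun x => by
    change Real.log (deriv (Diffeo.shift s).toEquiv x) = 0
    rw [hd, Real.log_one]
  have hs : schw 𝕜 (Diffeo.shift s) = 0 := by
    rw [schw, hl, map_zero]
    exact Subtype.ext <| funext fun x => RCLike.ofReal_zero
  have hj : ∀ w : 𝕜, jac w (Diffeo.shift s) = 1 := fun w => Subtype.ext <| funext fun x => by
    change NormedSpace.exp (w * ((Real.log (deriv (Diffeo.shift s).toEquiv x) : ℝ) : 𝕜)) = 1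
    rw [hd, Real.log_one]
    simp
  refine opOf_congr k _ _ fun q hq => ?_
  simp only [hs, hj, symE_flat, one_mul, Finset.sum_apply, Pi.smul_apply, Pi.single_apply,
    smul_eq_mul, mul_ite, mul_one, mul_zero]
  rw [Finset.sum_ite_eq, if_pos (Finset.mem_range.2 hq)]

/-- Local symmetries are given by matrices of scalars. -/
theorem exists_symOf_eq {k : ℕ} (lam mu : 𝕜) (T : Module.End 𝕜 (DiffOp 𝕜 k))
    (hT : ∀ A, supp (T A) ⊆ supp A)
    (hcomm : ∀ (f : Diffeo) (A : DiffOp 𝕜 k), T (diffOpAct k lam mu f A) =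
      diffOpAct k lam mu f (T A)) :
    ∃ t : ℕ → ℕ → 𝕜, (∀ i p, ¬ (p ≤ i ∧ i ≤ k) → t i p = 0) ∧ symOf k t = T := by
  -- At the point 0, each coefficient of T(a ∂^i) is a homogeneous germ functional of a, so the
  -- scalars t_ij can be read off there.
  have h1 : ∀ i j, ∃ τ : 𝕜, (¬ (j ≤ i ∧ i ≤ k) → τ = 0) ∧ (i < k + 1 → j < k + 1 → ∀ a : Smooth 𝕜,
      (coef (T (opOf k (Pi.single i a))) j : ℝ → 𝕜) 0 = τ * ((D ^ (i - j)) a : ℝ → 𝕜) 0) := by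
    intro i j
    by_cases hij : i < k + 1 ∧ j < k + 1
    · obtain ⟨hi, hj⟩ := hij
      obtain ⟨τ, hτ0, hτ⟩ := exists_eq_deriv_of_homogeneous
        ({ toFun := fun a => (coef (T (opOf k (Pi.single i a))) j : ℝ → 𝕜) 0
           map_add' := fun a b => by rw [Pi.single_add, map_add, map_add, map_add]; rfl
           map_smul' := fun r a => by rw [Pi.single_smul, map_smul, map_smul, map_smul]; rfl } :
          Smooth 𝕜 →ₗ[𝕜] 𝕜) i j (fun a b hab => coef_apply_congr T hT _ _ 0 (fun q _ => by
            by_cases hq : q = i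
            · subst hq
              rw [Pi.single_eq_same, Pi.single_eq_same]
              exact hab
            · rw [Pi.single_eq_of_ne hq, Pi.single_eq_of_ne hq]) j)
          (fun a => homogeneous_of_comm lam mu T hT hcomm i j hi hj a)
      exact ⟨τ, fun h => hτ0 (by omega), fun _ _ a => hτ a⟩
    · exact ⟨0, fun _ => rfl, fun hi hj => absurd ⟨hi, hj⟩ hij⟩
  choose t ht0 ht using h1
  refine ⟨t, ht0, LinearMap.ext fun A => ?_⟩
  -- Translations act only on the coefficients, so the same scalars serve at every point.
  have h2 : ∀ i < k + 1, ∀ j < k + 1, ∀ a : Smooth 𝕜, coef (T (opOf k (Pi.single i a))) j =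
      t i j • (D ^ (i - j)) a := by
    intro i hi j hj a
    refine Subtype.ext <| funext fun x => ?_
    have h3 := hcomm (Diffeo.shift x).inv (opOf k (Pi.single i a))
    rw [diffOpAct_shift, ← opOf_coef (T (opOf k (Pi.single i a))), diffOpAct_shift] at h3
    have h4 : (fun r => pull (Diffeo.shift x) ((Pi.single i a : ℕ → Smooth 𝕜) r)) =
        Pi.single i (pull (Diffeo.shift x) a) := by
      funext r
      by_cases hr : r = i
      · subst hr
        rw [Pi.single_eq_same, Pi.single_eq_same]
      · rw [Pi.single_eq_of_ne hr, Pi.single_eq_of_ne hr, map_zero]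
    have h5 := ht i j hi hj (pull (Diffeo.shift x) a)
    rw [← h4, h3, coef_opOf k _ j hj, D_pow_pull_shift] at h5
    change (coef (T (opOf k (Pi.single i a))) j : ℝ → 𝕜) (0 + x) =
      t i j * ((D ^ (i - j)) a : ℝ → 𝕜) (0 + x) at h5
    rw [zero_add] at h5
    exact h5
  have h6 : A = ∑ i ∈ Finset.range (k + 1), opOf k (Pi.single i (coef A i)) := by
    rw [← map_sum]
    conv_lhs => rw [← opOf_coef A]
    refine opOf_congr k _ _ fun j hj => ?_
    simp only [Finset.sum_apply, Pi.single_apply]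
    rw [Finset.sum_ite_eq, if_pos (Finset.mem_range.2 hj)]
  have h7 : T A = opOf k (∑ i ∈ Finset.range (k + 1), coef (T (opOf k (Pi.single i (coef A i))))) := by
    conv_lhs => rw [h6]
    rw [map_sum, map_sum]
    exact Finset.sum_congr rfl fun i _ => (opOf_coef _).symm
  rw [h7]
  refine opOf_congr k _ _ fun j hj => ?_
  rw [Finset.sum_apply]
  exact Finset.sum_congr rfl fun i hi => (h2 i (Finset.mem_range.1 hi) j hj _).symm

/-- The space of matrices of local symmetries. -/
def symMat {K : Type*} [Field K] (k : ℕ) (lam mu : K) : Submodule K (ℕ → ℕ → K) where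
  carrier := {t | (∀ i p, ¬ (p ≤ i ∧ i ≤ k) → t i p = 0) ∧
    ∀ i p l, i < k + 1 → p + l < i → symEq t lam (mu - lam) i p l = 0}
  add_mem' := by
    rintro s t ⟨hs0, hs⟩ ⟨ht0, ht⟩
    refine ⟨fun i p h => by rw [Pi.add_apply, Pi.add_apply, hs0 i p h, ht0 i p h, add_zero],
      fun i p l hi hp => ?_⟩
    have h1 : symEq (s + t) lam (mu - lam) i p l =
        symEq s lam (mu - lam) i p l + symEq t lam (mu - lam) i p l := by
      simp only [symEq, Pi.add_apply, add_mul, mul_add, Finset.sum_add_distrib]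
      ring
    rw [h1, hs i p l hi hp, ht i p l hi hp, add_zero]
  zero_mem' := ⟨fun _ _ _ => rfl, fun _ _ _ _ _ => by simp [symEq]⟩
  smul_mem' := by
    rintro c t ⟨ht0, ht⟩
    refine ⟨fun i p h => by rw [Pi.smul_apply, Pi.smul_apply, ht0 i p h, smul_zero],
      fun i p l hi hp => ?_⟩
    have h1 : symEq (c • t) lam (mu - lam) i p l = c * symEq t lam (mu - lam) i p l := by
      simp only [symEq, Pi.smul_apply, smul_eq_mul, mul_sub, mul_add, Finset.mul_sum]
      congr 1
      · ring
      · exact Finset.sum_congr rfl fun r _ => by ring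
    rw [h1, ht i p l hi hp, mul_zero]

theorem symOf_mem_localSymmetries (k : ℕ) (lam mu : 𝕜) (t : ℕ → ℕ → 𝕜)
    (ht : t ∈ symMat k lam mu) : symOf k t ∈ localSymmetries k lam mu :=
  ⟨supp_symOf k t, symOf_comm k lam mu t (fun i p h => ht.1 i p (by omega)) ht.2⟩

theorem symOf_inj (k : ℕ) (s t : ℕ → ℕ → 𝕜) (hs : ∀ i p, ¬ (p ≤ i ∧ i ≤ k) → s i p = 0)
    (ht : ∀ i p, ¬ (p ≤ i ∧ i ≤ k) → t i p = 0) (h : symOf k s = symOf k t) : s = t := by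
  funext i p
  by_cases hip : p ≤ i ∧ i ≤ k
  · have h1 := LinearMap.congr_fun h (opOf k (Pi.single i (coordS 𝕜 ^ (i - p))))
    rw [symOf_opOf, symOf_opOf] at h1
    have h2 := opOf_inj k _ _ h1 p (by omega)
    have h3 : ∀ t : ℕ → ℕ → 𝕜, matOp (derD 𝕜) t (k + 1)
        (Pi.single i (coordS 𝕜 ^ (i - p))) p = t i p • (D ^ (i - p)) (coordS 𝕜 ^ (i - p)) := by
      intro t
      change ∑ r ∈ Finset.range (k + 1), t r p • (D ^ (r - p))
        ((Pi.single i (coordS 𝕜 ^ (i - p)) : ℕ → Smooth 𝕜) r) = _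
      rw [Finset.sum_eq_single i (fun r _ hr => by
        rw [Pi.single_eq_of_ne hr, map_zero, smul_zero])
        (fun h => absurd (Finset.mem_range.2 (by omega)) h), Pi.single_eq_same]
    rw [h3, h3] at h2
    have h4 := congrArg (fun v : Smooth 𝕜 => (v : ℝ → 𝕜) 0) h2
    change s i p * ((D ^ (i - p)) (coordS 𝕜 ^ (i - p)) : ℝ → 𝕜) 0 =
      t i p * ((D ^ (i - p)) (coordS 𝕜 ^ (i - p)) : ℝ → 𝕜) 0 at h4
    rw [D_pow_coordS_pow_zero, if_pos rfl] at h4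
    exact mul_right_cancel₀ (by exact_mod_cast Nat.factorial_ne_zero _) h4
  · rw [hs i p hip, ht i p hip]

theorem symOf_add (k : ℕ) (s t : ℕ → ℕ → 𝕜) : symOf k (s + t) = symOf k s + symOf k t := by
  refine LinearMap.ext fun A => ?_
  rw [← opOf_coef A, LinearMap.add_apply, symOf_opOf, symOf_opOf, symOf_opOf, ← map_add]
  congr 1
  funext j
  simp [matOp, add_smul, Finset.sum_add_distrib]

theorem symOf_smul (k : ℕ) (c : 𝕜) (t : ℕ → ℕ → 𝕜) : symOf k (c • t) = c • symOf k t := by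
  refine LinearMap.ext fun A => ?_
  rw [← opOf_coef A, LinearMap.smul_apply, symOf_opOf, symOf_opOf, ← map_smul]
  congr 1
  funext j
  simp [matOp, mul_smul, Finset.smul_sum]

theorem exists_mem_symMat {k : ℕ} (lam mu : 𝕜) (T : Module.End 𝕜 (DiffOp 𝕜 k))
    (hT : T ∈ localSymmetries k lam mu) : ∃ t ∈ symMat k lam mu, symOf k t = T := by
  obtain ⟨hT, hcomm⟩ := hT
  obtain ⟨t, ht0, rfl⟩ := exists_symOf_eq lam mu T hT hcomm
  exact ⟨t, ⟨ht0, fun i p l hi hpl => symEq_of_comm k lam mu t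
          (fun i p h => ht0 i p (by omega)) hcomm i p l hi hpl⟩, rfl⟩

/-- The local symmetry with a given matrix. -/
noncomputable def symMatMap (k : ℕ) (lam mu : 𝕜) :
    symMat k lam mu →ₗ[𝕜] localSymmetries k lam mu where
  toFun t := ⟨symOf k t.1, symOf_mem_localSymmetries k lam mu t.1 t.2⟩
  map_add' s t := Subtype.ext (symOf_add k s.1 t.1)
  map_smul' c t := Subtype.ext (symOf_smul k c t.1)

theorem symMatMap_bijective (k : ℕ) (lam mu : 𝕜) : Function.Bijective (symMatMap k lam mu) := by
  refine ⟨fun s t h => Subtype.ext (symOf_inj k s.1 t.1 s.2.1 t.2.1 (congrArg Subtype.val h)), ?_⟩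
  rintro ⟨T, hT⟩
  obtain ⟨t, ht, h⟩ := exists_mem_symMat lam mu T hT
  exact ⟨⟨t, ht⟩, Subtype.ext h⟩

/-- From here on the problem is linear algebra over the field: counting solutions of the equations
`symEq`. -/
theorem rank_localSymmetries (k : ℕ) (lam mu : 𝕜) :
    Module.rank 𝕜 (localSymmetries k lam mu) = Module.rank 𝕜 (symMat k lam mu) :=
  (LinearEquiv.ofBijective _ (symMatMap_bijective k lam mu)).rank_eq.symm

end CircleDensity

/-! ### Rank bounds by functionals, and stabilisation in the order -/

namespace CircleDensity

variable {K : Type*} [Field K]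

theorem rank_le_of_functionals {V : Type*} [AddCommGroup V] [Module K V] (W : Submodule K V)
    {n : ℕ} (f : Fin n → V →ₗ[K] K) (h : ∀ t ∈ W, (∀ s, f s t = 0) → t = 0) :
    Module.rank K W ≤ n := by
  have h1 : Function.Injective ((LinearMap.pi f).comp W.subtype) := by
    rw [← LinearMap.ker_eq_bot, LinearMap.ker_eq_bot']
    rintro ⟨t, ht⟩ h2
    exact Subtype.ext (h t ht fun s => congrFun h2 s)
  simpa using LinearMap.lift_rank_le_of_injective _ h1

theorem le_rank_of_functionals {V : Type*} [AddCommGroup V] [Module K V] (W : Submodule K V)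
    {n : ℕ} (e : Fin n → V) (he : ∀ s, e s ∈ W) (f : Fin n → V →ₗ[K] K)
    (h : ∀ g : Fin n → K, (∀ s, ∑ r, g r * f s (e r) = 0) → ∀ r, g r = 0) :
    (n : Cardinal) ≤ Module.rank K W := by
  have h1 : LinearIndependent K (fun s => (⟨e s, he s⟩ : W)) := by
    rw [Fintype.linearIndependent_iff]
    intro g hg
    refine h g fun s => ?_
    have h2 := congrArg (fun w : W => f s w.1) hg
    simpa using h2
  simpa using h1.cardinal_lift_le_rank

/-- The `(i, j)` entry of a matrix. -/
def entry (i j : ℕ) : (ℕ → ℕ → K) →ₗ[K] K := LinearMap.proj j ∘ₗ LinearMap.proj i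

theorem entry_apply (i j : ℕ) (t : ℕ → ℕ → K) : entry i j t = t i j := rfl

theorem eq_zero_of_mem_symMat {k : ℕ} {lam mu : K} {t : ℕ → ℕ → K} (ht : t ∈ symMat k lam mu)
    (h : ∀ i ≤ k, ∀ j ≤ i, t i j = 0) : t = 0 := by
  funext i j
  by_cases hij : j ≤ i ∧ i ≤ k
  · exact h i hij.2 j hij.1
  · exact ht.1 i j hij

theorem symEq_congr (s t : ℕ → ℕ → K) (lam delta : K) (i p l : ℕ) (h : ∀ r ≤ i, s r = t r) :
    symEq s lam delta i p l = symEq t lam delta i p l := by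
  unfold symEq
  rw [h i le_rfl]
  congr 1
  exact Finset.sum_congr rfl fun r hr => by rw [h r (Finset.mem_range.1 hr).le]

theorem mask_mem_symMat (k : ℕ) (lam mu : K) (t : ℕ → ℕ → K) (ht : ∀ i p, i < p → t i p = 0)
    (heq : ∀ i p l, i < k + 1 → p + l < i → symEq t lam (mu - lam) i p l = 0) :
    (fun i p => if i ≤ k then t i p else 0) ∈ symMat k lam mu := by
  refine ⟨fun i p h => ?_, fun i p l hi hpl => ?_⟩
  · change (if i ≤ k then t i p else 0) = 0
    split_ifs with hi
    · exact ht i p (by omega)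
    · rfl
  · rw [symEq_congr _ t lam _ i p l fun r hr => ?_, heq i p l hi hpl]
    funext q
    rw [if_pos (by omega)]

/-- Truncation of matrices to operators of lower order. -/
def truncate (k : ℕ) (lam mu : K) : symMat (k + 1) lam mu →ₗ[K] symMat k lam mu where
  toFun t := ⟨fun i p => if i ≤ k then t.1 i p else 0,
    mask_mem_symMat k lam mu t.1 (fun i p h => t.2.1 i p (by omega))
      fun i p l hi hpl => t.2.2 i p l (by omega) hpl⟩
  map_add' s t := by
    ext i p
    by_cases h : i ≤ k <;> simp [h]
  map_smul' c t := by
    ext i p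
    by_cases h : i ≤ k <;> simp [h]

theorem rank_symMat_succ_le_of_injective (k : ℕ) (lam mu : K)
    (h : ∀ t ∈ symMat (k + 1) lam mu, (∀ i ≤ k, ∀ p, t i p = 0) → t = 0) :
    Module.rank K (symMat (k + 1) lam mu) ≤ Module.rank K (symMat k lam mu) := by
  refine LinearMap.rank_le_of_injective (truncate k lam mu) ?_
  rw [← LinearMap.ker_eq_bot, LinearMap.ker_eq_bot']
  rintro ⟨t, ht⟩ h2
  refine Subtype.ext (h t ht fun i hi p => ?_)
  have h3 := congrFun (congrFun (congrArg Subtype.val h2) i) p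
  simpa [truncate, hi] using h3

theorem varCoeff_zero (w : K) (n : ℕ) : varCoeff w n 0 = w := rfl

theorem varCoeff_one (w : K) (n : ℕ) : varCoeff w n 1 = 1 + w * n := by simp [varCoeff]

theorem varCoeff_two [CharZero K] (w : K) (n : ℕ) :
    varCoeff w n 2 = n + w * (n * (n - 1) / 2) := by
  simp [varCoeff, Nat.cast_choose_two]

theorem varCoeff_pred [CharZero K] (w : K) (n : ℕ) :
    varCoeff w (n + 2) (n + 1) = (n + 2) * (n + 1) / 2 + w * (n + 2) := by
  have h1 : (n + 2).choose n = (n + 2).choose 2 := by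
    rw [← Nat.choose_symm (show n ≤ n + 2 by omega)]
    congr 1
    omega
  have h2 : (n + 2).choose (n + 1) = n + 2 := by
    rw [show n + 2 = (n + 1) + 1 from rfl, Nat.choose_succ_self_right]
  simp only [varCoeff, h1, h2, Nat.cast_choose_two]
  push_cast
  ring

/-- There are no invariants which vanish on the operators of order less than `m + 4`. -/
theorem eq_zero_of_truncate_eq_zero [CharZero K] (m : ℕ) (lam mu : K) (t : ℕ → ℕ → K)
    (ht : t ∈ symMat (m + 4) lam mu) (h0 : ∀ i ≤ m + 3, ∀ p, t i p = 0) : t = 0 := by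
  set e := mu - lam - ((m + 4 : ℕ) : K) with he
  -- Only the last row survives, so each equation relates just two of its entries.
  have hE : ∀ p l, p + l < m + 4 → t (m + 4) p * varCoeff e (m + 4 - p) l +
      t (m + 4) (m + 4 - l) * varCoeff lam (m + 4 - l) p = 0 := by
    intro p l hpl
    have h1 := ht.2 (m + 4) p l (by omega) hpl
    rwa [symEq, Finset.sum_eq_zero (fun r hr => by
      rw [h0 r (by have := Finset.mem_range.1 hr; omega), mul_zero, zero_mul]), sub_zero] at h1
  obtain ⟨q, hq⟩ : ∃ q : K, q = m := ⟨_, rfl⟩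
  have hpos : ∀ n : ℕ, q + (n + 1) ≠ 0 := fun n => by
    rw [hq]
    exact_mod_cast (show m + (n + 1) ≠ 0 by omega)
  have hq1 : q + 1 ≠ 0 := by simpa using hpos 0
  have hq3 : q + 3 ≠ 0 := by have := hpos 2; norm_num at this; exact this
  have hq4 : q + 4 ≠ 0 := by have := hpos 3; norm_num at this; exact this
  have hq5 : q + 5 ≠ 0 := by have := hpos 4; norm_num at this; exact this
  have hq6 : q + 6 ≠ 0 := by have := hpos 5; norm_num at this; exact this
  -- Equations with l = 0, 1, 2 compare an entry of the last row with the entries in columns m + 4,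
  -- m + 3, m + 2 respectively.
  have a0 := hE 0 0 (by omega)
  have a1 := hE 1 0 (by omega)
  have a2 := hE 2 0 (by omega)
  have a3 := hE (m + 3) 0 (by omega)
  have b0 := hE 0 1 (by omega)
  have b1 := hE 1 1 (by omega)
  have b2 := hE 2 1 (by omega)
  have b3 := hE (m + 2) 1 (by omega)
  have c0 := hE 0 2 (by omega)
  have c1 := hE 1 2 (by omega)
  have s1 : m + 4 - 1 = m + 3 := by omega
  have s2 : m + 4 - 2 = m + 2 := by omega
  have s3 : m + 4 - (m + 2) = 2 := by omega
  have v1 : varCoeff lam (m + 4) (m + 3) = (q + 4) * (q + 3) / 2 + lam * (q + 4) := by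
    rw [varCoeff_pred lam (m + 2), hq]; push_cast; ring
  have v2 : varCoeff lam (m + 3) (m + 2) = (q + 3) * (q + 2) / 2 + lam * (q + 3) := by
    rw [varCoeff_pred lam (m + 1), hq]; push_cast; ring
  simp only [Nat.sub_zero, s1, s2, s3, varCoeff_zero, varCoeff_one, varCoeff_two, v1, v2]
    at a0 a1 a2 a3 b0 b1 b2 b3 c0 c1
  push_cast at a0 a1 a2 a3 b0 b1 b2 b3 c0 c1
  simp only [← hq] at a0 a1 a2 b0 b1 b2 b3 c0 c1
  generalize t (m + 4) 0 = x0 at a0 b0 c0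
  generalize t (m + 4) 1 = x1 at a1 b1 c1
  generalize t (m + 4) 2 = x2 at a2 b2
  -- For e = 0 the equations read X lam = 0 and X (1 + (q + 4) lam) = 0, with X the diagonal entry.
  have hlast : e = 0 → t (m + 4) (m + 4) = 0 := by
    intro h
    rw [h] at a0 a1
    linear_combination a1 - (q + 4) * a0
  have hX : t (m + 4) (m + 4) = 0 := by
    by_cases he0 : e = 0
    · exact hlast he0
    by_contra hX
    generalize t (m + 4) (m + 4) = X at a0 a1 a2 a3 hX
    generalize t (m + 4) (m + 3) = y at a3 b0 b1 b2
    obtain ⟨c, hc⟩ : ∃ c, c = (q + 4) * (q + 3) / 2 + lam * (q + 4) := ⟨_, rfl⟩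
    rw [← hc] at a3
    -- Eliminating the other entries between the equations with l = 0 and l = 1 for p = 0, 1, 2,
    -- then dividing by X, leaves three conditions on `lam` and e alone.
    have A0 : lam * (1 + e * (q + 4) + c) = 0 := mul_left_cancel₀ hX (by
      linear_combination (1 + e * (q + 4)) * a0 + lam * a3 - e * b0)
    have A1 : (1 + lam * (q + 4)) * (1 + e * (q + 3)) + c * (1 + lam * (q + 3)) = 0 :=
      mul_left_cancel₀ hX (by
        linear_combination (1 + e * (q + 3)) * a1 + (1 + lam * (q + 3)) * a3 - e * b1)
    have A2 : ((q + 4) + lam * ((q + 4) * (q + 3) / 2)) * (1 + e * (q + 2)) +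
        c * ((q + 3) + lam * ((q + 3) * (q + 2) / 2)) = 0 :=
      mul_left_cancel₀ hX (by
        linear_combination (1 + e * (q + 2)) * a2 +
          ((q + 3) + lam * ((q + 3) * (q + 2) / 2)) * a3 - e * b2)
    -- The three conditions are inconsistent: `lam = 0` leads to (q+4)(q+5) = 0, and otherwise e =
    -- lam = 1 leads to (q+5)(q+6) = 0, impossible for q = m.
    by_cases hl : lam = 0
    · subst hl
      have : (q + 4) * (q + 5) = 0 := by
        linear_combination 2 * (q + 3) * A2 - 2 * (q + 4) * (q + 2) * A1 - 2 * hc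
      exact mul_ne_zero hq4 hq5 this
    · have B := (mul_eq_zero.1 A0).resolve_left hl
      have h1 : 1 + (q + 4) * lam + c = 0 := by
        linear_combination (q + 4) * A1 - (1 + lam * (q + 4)) * (q + 3) * B
      have h2 : e = lam := mul_left_cancel₀ hq4 (by linear_combination B - h1)
      have h3 : lam = 1 := by
        rw [h2] at A2
        linear_combination ((q + 3) + lam * ((q + 3) * (q + 2) / 2)) * h1 - A2
      rw [h3] at hc h1
      have : (q + 5) * (q + 6) = 0 := by linear_combination 2 * h1 - 2 * hc
      exact mul_ne_zero hq5 hq6 this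
  -- With X = 0, the equations with l = 0 finish the case e ≠ 0. For e = 0 they are void; the same
  -- elimination between l = 1 and l = 2 kills the entry in column m + 3, and then l = 1 says that
  -- each remaining entry is zero.
  have hall : ∀ p < m + 4, t (m + 4) p = 0 := by
    by_cases he0 : e = 0
    · have hY : t (m + 4) (m + 3) = 0 := by
        by_contra hY
        rw [he0] at b0 b1 b3 c0 c1
        simp only [zero_mul, add_zero, mul_one] at b0 b1 b3 c0 c1
        generalize t (m + 4) (m + 3) = Y at b0 b1 b3 hY
        generalize t (m + 4) (m + 2) = z at b3 c0 c1
        obtain ⟨c, hc⟩ : ∃ c, c = (q + 3) * (q + 2) / 2 + lam * (q + 3) := ⟨_, rfl⟩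
        rw [← hc] at b3
        have A0 : lam * ((q + 4) + c) = 0 := mul_left_cancel₀ hY (by
          linear_combination (q + 4) * b0 + lam * b3 - c0)
        have A1 : (q + 3) * (1 + lam * (q + 3)) + c * (1 + lam * (q + 2)) = 0 :=
          mul_left_cancel₀ hY (by
            linear_combination (q + 3) * b1 + (1 + lam * (q + 2)) * b3 - c1)
        by_cases hl : lam = 0
        · subst hl
          have : (q + 3) * (q + 4) = 0 := by linear_combination 2 * A1 - 2 * hc
          exact mul_ne_zero hq3 hq4 this
        · have B := (mul_eq_zero.1 A0).resolve_left hl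
          have h3 : lam = 1 := by
            linear_combination A1 - (1 + lam * (q + 2)) * B
          rw [h3] at hc
          have : (q + 4) * (q + 5) = 0 := by linear_combination 2 * B - 2 * hc
          exact mul_ne_zero hq4 hq5 this
      intro p hp
      rcases Nat.lt_or_ge p (m + 3) with hp3 | hp3
      · have h1 := hE p 1 (by omega)
        rw [s1, hY, he0, varCoeff_one] at h1
        simpa using h1
      · rw [show p = m + 3 by omega, hY]
    · intro p hp
      have h1 := hE p 0 (by omega)
      rw [Nat.sub_zero, hX, zero_mul, add_zero, varCoeff_zero] at h1
      exact (mul_eq_zero.1 h1).resolve_right he0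
  refine eq_zero_of_mem_symMat ht fun i hi j hj => ?_
  rcases Nat.lt_or_ge i (m + 4) with h | h
  · exact h0 i (by omega) j
  · have : i = m + 4 := by omega
    subst this
    rcases Nat.lt_or_ge j (m + 4) with h | h
    · exact hall j h
    · rw [show j = m + 4 by omega, hX]

theorem rank_symMat_add_le [CharZero K] (m n : ℕ) (lam mu : K) :
    Module.rank K (symMat (m + 3 + n) lam mu) ≤ Module.rank K (symMat (m + 3) lam mu) := by
  induction n with
  | zero => exact le_rfl
  | succ n ih =>
    refine le_trans ?_ ih
    have h := rank_symMat_succ_le_of_injective (m + n + 3) lam mu fun t ht h =>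
      eq_zero_of_truncate_eq_zero (m + n) lam mu t ht h
    rw [show m + 3 + n = m + n + 3 by omega, show m + 3 + (n + 1) = m + n + 3 + 1 by omega]
    exact h

theorem rank_symMat_le_of_le [CharZero K] {k n : ℕ} (hk : 3 ≤ k) (hn : k ≤ n) (lam mu : K) :
    Module.rank K (symMat n lam mu) ≤ Module.rank K (symMat k lam mu) := by
  obtain ⟨m, rfl⟩ : ∃ m, k = m + 3 := ⟨k - 3, by omega⟩
  obtain ⟨r, rfl⟩ : ∃ r, n = m + 3 + r := ⟨n - (m + 3), by omega⟩
  exact rank_symMat_add_le m r lam mu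

end CircleDensity

/-! ### The equations written out in orders one to five -/

namespace CircleDensity

variable {K : Type*} [Field K]

section

variable (t : ℕ → ℕ → K) (lam d : K)

theorem symEq_1_0_0 :
    symEq t lam d 1 0 0 =
      t 1 0 * (d - 1) + t 1 1 * lam - lam * t 0 0 := by
  simp [symEq, varCoeff]

theorem symEq_2_0_0 :
    symEq t lam d 2 0 0 =
      t 2 0 * (d - 2) + t 2 2 * lam - lam * t 0 0 - (1 + 2 * lam) * t 1 0 := by
  simp [symEq, varCoeff, Finset.sum_range_succ, Nat.choose]
  ring

theorem symEq_2_0_1 :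
    symEq t lam d 2 0 1 =
      t 2 0 * (1 + 2 * (d - 2)) + t 2 1 * lam - (1 + 2 * lam) * t 1 0 := by
  simp [symEq, varCoeff, Finset.sum_range_succ, Nat.choose]
  ring

/-- Triangularity matters only when l = 0 and p > 0: for r < p the truncated r - p is 0 and its
binomial coefficient over 0 is 1, so entries above the diagonal enter the sum. -/
theorem symEq_2_1_0 (ht : ∀ i p, i < p → t i p = 0) :
    symEq t lam d 2 1 0 =
      t 2 1 * (d - 2) + t 2 2 * (1 + 2 * lam) - (1 + 2 * lam) * t 1 1 := by
  simp [symEq, varCoeff, Finset.sum_range_succ, Nat.choose, ht]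
  ring

theorem symEq_3_0_0 :
    symEq t lam d 3 0 0 =
      t 3 0 * (d - 3) + t 3 3 * lam - lam * t 0 0 - (1 + 3 * lam) * t 1 0 - (3 + 3 * lam) * t 2 0 := by
  simp [symEq, varCoeff, Finset.sum_range_succ, Nat.choose]
  ring

theorem symEq_3_0_1 :
    symEq t lam d 3 0 1 =
      t 3 0 * (1 + 3 * (d - 3)) + t 3 2 * lam - (1 + 3 * lam) * t 1 0 - (3 + 3 * lam) * t 2 0 * 2 := by
  simp [symEq, varCoeff, Finset.sum_range_succ, Nat.choose]
  ring

theorem symEq_3_0_2 :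
    symEq t lam d 3 0 2 =
      t 3 0 * (3 + 3 * (d - 3)) + t 3 1 * lam - (3 + 3 * lam) * t 2 0 := by
  simp [symEq, varCoeff, Finset.sum_range_succ, Nat.choose]
  ring

theorem symEq_3_1_0 (ht : ∀ i p, i < p → t i p = 0) :
    symEq t lam d 3 1 0 =
      t 3 1 * (d - 3) + t 3 3 * (1 + 3 * lam) - (1 + 3 * lam) * t 1 1 - (3 + 3 * lam) * t 2 1 := by
  simp [symEq, varCoeff, Finset.sum_range_succ, Nat.choose, ht]
  ring

theorem symEq_3_1_1 :
    symEq t lam d 3 1 1 =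
      t 3 1 * (1 + 2 * (d - 3)) + t 3 2 * (1 + 2 * lam) - (3 + 3 * lam) * t 2 1 := by
  simp [symEq, varCoeff, Finset.sum_range_succ, Nat.choose]
  ring

theorem symEq_3_2_0 (ht : ∀ i p, i < p → t i p = 0) :
    symEq t lam d 3 2 0 =
      t 3 2 * (d - 3) + t 3 3 * (3 + 3 * lam) - (3 + 3 * lam) * t 2 2 := by
  simp [symEq, varCoeff, Finset.sum_range_succ, Nat.choose, ht]
  ring

theorem symEq_4_0_0 :
    symEq t lam d 4 0 0 =
      t 4 0 * (d - 4) + t 4 4 * lam - lam * t 0 0 - (1 + 4 * lam) * t 1 0 - (4 + 6 * lam) * t 2 0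
       - (6 + 4 * lam) * t 3 0 := by
  simp [symEq, varCoeff, Finset.sum_range_succ, Nat.choose]
  ring

theorem symEq_4_0_1 :
    symEq t lam d 4 0 1 =
      t 4 0 * (1 + 4 * (d - 4)) + t 4 3 * lam - (1 + 4 * lam) * t 1 0 - (4 + 6 * lam) * t 2 0 * 2
       - (6 + 4 * lam) * t 3 0 * 3 := by
  simp [symEq, varCoeff, Finset.sum_range_succ, Nat.choose]
  ring

theorem symEq_4_0_2 :
    symEq t lam d 4 0 2 =
      t 4 0 * (4 + 6 * (d - 4)) + t 4 2 * lam - (4 + 6 * lam) * t 2 0 - (6 + 4 * lam) * t 3 0 * 3 := by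
  simp [symEq, varCoeff, Finset.sum_range_succ, Nat.choose]
  ring

theorem symEq_4_0_3 :
    symEq t lam d 4 0 3 =
      t 4 0 * (6 + 4 * (d - 4)) + t 4 1 * lam - (6 + 4 * lam) * t 3 0 := by
  simp [symEq, varCoeff, Finset.sum_range_succ, Nat.choose]
  ring

theorem symEq_4_1_0 (ht : ∀ i p, i < p → t i p = 0) :
    symEq t lam d 4 1 0 =
      t 4 1 * (d - 4) + t 4 4 * (1 + 4 * lam) - (1 + 4 * lam) * t 1 1 - (4 + 6 * lam) * t 2 1 - (6
       + 4 * lam) * t 3 1 := by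
  simp [symEq, varCoeff, Finset.sum_range_succ, Nat.choose, ht]
  ring

theorem symEq_4_1_1 :
    symEq t lam d 4 1 1 =
      t 4 1 * (1 + 3 * (d - 4)) + t 4 3 * (1 + 3 * lam) - (4 + 6 * lam) * t 2 1 - (6 + 4 * lam) *
       t 3 1 * 2 := by
  simp [symEq, varCoeff, Finset.sum_range_succ, Nat.choose]
  ring

theorem symEq_4_1_2 :
    symEq t lam d 4 1 2 =
      t 4 1 * (3 + 3 * (d - 4)) + t 4 2 * (1 + 2 * lam) - (6 + 4 * lam) * t 3 1 := by
  simp [symEq, varCoeff, Finset.sum_range_succ, Nat.choose]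
  ring

theorem symEq_4_2_0 (ht : ∀ i p, i < p → t i p = 0) :
    symEq t lam d 4 2 0 =
      t 4 2 * (d - 4) + t 4 4 * (4 + 6 * lam) - (4 + 6 * lam) * t 2 2 - (6 + 4 * lam) * t 3 2 := by
  simp [symEq, varCoeff, Finset.sum_range_succ, Nat.choose, ht]
  ring

theorem symEq_4_2_1 :
    symEq t lam d 4 2 1 =
      t 4 2 * (1 + 2 * (d - 4)) + t 4 3 * (3 + 3 * lam) - (6 + 4 * lam) * t 3 2 := by
  simp [symEq, varCoeff, Finset.sum_range_succ, Nat.choose]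
  ring

theorem symEq_4_3_0 (ht : ∀ i p, i < p → t i p = 0) :
    symEq t lam d 4 3 0 =
      t 4 3 * (d - 4) + t 4 4 * (6 + 4 * lam) - (6 + 4 * lam) * t 3 3 := by
  simp [symEq, varCoeff, Finset.sum_range_succ, Nat.choose, ht]
  ring

theorem symEq_5_0_0 :
    symEq t lam d 5 0 0 =
      t 5 0 * (d - 5) + t 5 5 * lam - lam * t 0 0 - (1 + 5 * lam) * t 1 0 - (5 + 10 * lam) * t 2 0
       - (10 + 10 * lam) * t 3 0 - (10 + 5 * lam) * t 4 0 := by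
  simp [symEq, varCoeff, Finset.sum_range_succ, Nat.choose]
  ring

theorem symEq_5_0_1 :
    symEq t lam d 5 0 1 =
      t 5 0 * (1 + 5 * (d - 5)) + t 5 4 * lam - (1 + 5 * lam) * t 1 0 - (5 + 10 * lam) * t 2 0 * 2
       - (10 + 10 * lam) * t 3 0 * 3 - (10 + 5 * lam) * t 4 0 * 4 := by
  simp [symEq, varCoeff, Finset.sum_range_succ, Nat.choose]
  ring

theorem symEq_5_0_4 :
    symEq t lam d 5 0 4 =
      t 5 0 * (10 + 5 * (d - 5)) + t 5 1 * lam - (10 + 5 * lam) * t 4 0 := by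
  simp [symEq, varCoeff, Finset.sum_range_succ, Nat.choose]
  ring

theorem symEq_5_1_0 (ht : ∀ i p, i < p → t i p = 0) :
    symEq t lam d 5 1 0 =
      t 5 1 * (d - 5) + t 5 5 * (1 + 5 * lam) - (1 + 5 * lam) * t 1 1 - (5 + 10 * lam) * t 2 1 -
       (10 + 10 * lam) * t 3 1 - (10 + 5 * lam) * t 4 1 := by
  simp [symEq, varCoeff, Finset.sum_range_succ, Nat.choose, ht]
  ring

theorem symEq_5_1_1 :
    symEq t lam d 5 1 1 =
      t 5 1 * (1 + 4 * (d - 5)) + t 5 4 * (1 + 4 * lam) - (5 + 10 * lam) * t 2 1 - (10 + 10 * lam)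
       * t 3 1 * 2 - (10 + 5 * lam) * t 4 1 * 3 := by
  simp [symEq, varCoeff, Finset.sum_range_succ, Nat.choose]
  ring

theorem symEq_5_1_2 :
    symEq t lam d 5 1 2 =
      t 5 1 * (4 + 6 * (d - 5)) + t 5 3 * (1 + 3 * lam) - (10 + 10 * lam) * t 3 1 - (10 + 5 * lam)
       * t 4 1 * 3 := by
  simp [symEq, varCoeff, Finset.sum_range_succ, Nat.choose]
  ring

theorem symEq_5_2_0 (ht : ∀ i p, i < p → t i p = 0) :
    symEq t lam d 5 2 0 =
      t 5 2 * (d - 5) + t 5 5 * (5 + 10 * lam) - (5 + 10 * lam) * t 2 2 - (10 + 10 * lam) * t 3 2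
       - (10 + 5 * lam) * t 4 2 := by
  simp [symEq, varCoeff, Finset.sum_range_succ, Nat.choose, ht]
  ring

theorem symEq_5_2_1 :
    symEq t lam d 5 2 1 =
      t 5 2 * (1 + 3 * (d - 5)) + t 5 4 * (4 + 6 * lam) - (10 + 10 * lam) * t 3 2 - (10 + 5 * lam)
       * t 4 2 * 2 := by
  simp [symEq, varCoeff, Finset.sum_range_succ, Nat.choose]
  ring

theorem symEq_5_3_0 (ht : ∀ i p, i < p → t i p = 0) :
    symEq t lam d 5 3 0 =
      t 5 3 * (d - 5) + t 5 5 * (10 + 10 * lam) - (10 + 10 * lam) * t 3 3 - (10 + 5 * lam) * t 4 3 := by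
  simp [symEq, varCoeff, Finset.sum_range_succ, Nat.choose, ht]
  ring

theorem symEq_5_3_1 :
    symEq t lam d 5 3 1 =
      t 5 3 * (1 + 2 * (d - 5)) + t 5 4 * (6 + 4 * lam) - (10 + 5 * lam) * t 4 3 := by
  simp [symEq, varCoeff, Finset.sum_range_succ, Nat.choose]
  ring

theorem symEq_5_4_0 (ht : ∀ i p, i < p → t i p = 0) :
    symEq t lam d 5 4 0 =
      t 5 4 * (d - 5) + t 5 5 * (10 + 5 * lam) - (10 + 5 * lam) * t 4 4 := by
  simp [symEq, varCoeff, Finset.sum_range_succ, Nat.choose, ht]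
  ring

end

end CircleDensity

/-! ### Invariants that exist in every order -/

namespace CircleDensity

variable {K : Type*} [Field K]

/-- An n-th finite difference annihilates a polynomial of degree m < n, here r ↦ (r choose m). -/
theorem sum_neg_one_pow_choose_mul_choose (n m : ℕ) (h : m < n) :
    ∑ r ∈ Finset.range (n + 1), (n.choose r : K) * (-1) ^ r * (r.choose m) = 0 := by
  have h1 := fwdDiff_iter_choose_zero m n
  rw [fwdDiff_iter_eq_sum_shift, if_neg (by omega)] at h1
  have h2 : ∑ r ∈ Finset.range (n + 1), (n.choose r : ℤ) * (-1) ^ r * (r.choose m) = 0 := by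
    have h3 : ∀ r ∈ Finset.range (n + 1), (n.choose r : ℤ) * (-1) ^ r * (r.choose m) =
        (-1) ^ n * (((-1) ^ (n - r) * (n.choose r : ℤ)) • ((0 + r • 1).choose m : ℤ)) := by
      intro r hr
      have h4 : (-1 : ℤ) ^ n * (-1) ^ (n - r) = (-1) ^ r := by
        rw [← pow_add, show n + (n - r) = r + 2 * (n - r) by
          have := Finset.mem_range.1 hr; omega, pow_add, pow_mul]
        simp
      rw [← h4]
      simp
      ring
    rw [Finset.sum_congr rfl h3, ← Finset.mul_sum, h1, mul_zero]
  exact_mod_cast congrArg (Int.cast : ℤ → K) h2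

/-- A closed form without case distinction, valid also at r = 0. -/
theorem varCoeff_eq_choose_succ (w : K) (n r : ℕ) :
    varCoeff w n r = (n + 1).choose r + (w - 1) * n.choose r := by
  cases r with
  | zero => simp [varCoeff]
  | succ r =>
    rw [varCoeff, Nat.choose_succ_succ]
    push_cast
    ring

/-- The sum is made of truncations of two vanishing alternating sums, of lengths i + 1 and i + 2, so
it equals minus their last terms. -/
theorem sum_varCoeff_mul_choose (lam : K) (i m : ℕ) (h : m < i) :
    ∑ r ∈ Finset.range i, varCoeff lam i r * (-1) ^ r * (r.choose m) =
      (-1) ^ i * varCoeff (1 - lam - i) i m := by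
  have h1 := sum_neg_one_pow_choose_mul_choose (K := K) i m h
  have h2 := sum_neg_one_pow_choose_mul_choose (K := K) (i + 1) m (by omega)
  rw [Finset.sum_range_succ] at h1
  rw [Finset.sum_range_succ, Finset.sum_range_succ] at h2
  have h3 : ∑ r ∈ Finset.range i, varCoeff lam i r * (-1) ^ r * (r.choose m : K) =
      ∑ r ∈ Finset.range i, ((i + 1).choose r : K) * (-1) ^ r * (r.choose m) +
      (lam - 1) * ∑ r ∈ Finset.range i, (i.choose r : K) * (-1) ^ r * (r.choose m) := by
    rw [Finset.mul_sum, ← Finset.sum_add_distrib]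
    refine Finset.sum_congr rfl fun r _ => ?_
    rw [varCoeff_eq_choose_succ]
    ring
  rw [h3, varCoeff_eq_choose_succ]
  rw [Nat.choose_succ_self_right, Nat.choose_self, pow_succ] at h2
  rw [Nat.choose_self] at h1
  push_cast at h1 h2
  linear_combination h2 + (lam - 1) * h1

/-- The matrix of the identity. -/
def oneMat : ℕ → ℕ → K := fun i j => if i = j then 1 else 0

/-- The matrix of the map sending `A` to the value of its conjugate operator at `1`. -/
def constMat : ℕ → ℕ → K := fun i j => if j = 0 then (-1) ^ i else 0

/-- The matrix of the projection to the coefficient of order zero. -/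
def coeffMat : ℕ → ℕ → K := fun i j => if i = 0 ∧ j = 0 then 1 else 0

/-- The matrix of the conjugation of operators. -/
def adjMat : ℕ → ℕ → K := fun i j => (-1) ^ i * i.choose j

theorem symEq_oneMat (lam d : K) (i p l : ℕ) (h : p + l < i) : symEq oneMat lam d i p l = 0 := by
  have h1 : ∀ r ∈ Finset.range i, r ≠ p →
      varCoeff lam i r * (oneMat r p : K) * ((r - p).choose l : K) = 0 := fun r _ hr => by
    rw [oneMat, if_neg hr, mul_zero, zero_mul]
  rw [symEq, Finset.sum_eq_single p h1 (fun h => absurd (Finset.mem_range.2 (by omega)) h),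
    oneMat, if_neg (by omega), oneMat, oneMat, if_pos rfl]
  cases l with
  | zero => simp
  | succ l => simp [show ¬ i = i - (l + 1) by omega]

/-- A ↦ A*(1) is natural when mu = 1, as A* is then applied to functions. Only column zero is
involved, and its equation is `sum_varCoeff_mul_choose` since 1 - lam - i = δ - i. -/
theorem symEq_constMat (lam : K) (i p l : ℕ) (h : p + l < i) :
    symEq constMat lam (1 - lam) i p l = 0 := by
  have h0 : (constMat i (i - l) : K) = 0 := by rw [constMat, if_neg (by omega)]
  rw [symEq, h0, zero_mul, add_zero, sub_eq_zero]
  cases p with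
  | zero =>
    have h1 := sum_varCoeff_mul_choose lam i l (by omega)
    simpa [constMat] using h1.symm
  | succ p => simp [constMat]

/-- For lam = 0 the constant function 1 is an invariant density, so A ↦ A(1) is equivariant. -/
theorem symEq_coeffMat (d : K) (i p l : ℕ) (h : p + l < i) :
    symEq coeffMat 0 d i p l = 0 := by
  rw [symEq, Finset.sum_eq_zero]
  · simp [coeffMat, show i ≠ 0 by omega]
  · intro r _
    cases r with
    | zero => simp [varCoeff]
    | succ r => simp [coeffMat]

theorem choose_mul_choose_sub (i p l : ℕ) :
    i.choose p * (i - p).choose l = i.choose (p + l) * (p + l).choose p := by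
  rw [Nat.choose_mul (Nat.le_add_right p l), Nat.add_sub_cancel_left]

/-- The identity behind the invariance of conjugation. Pascal's rule and the four ways of rewriting
a product of two binomials reduce it to a common form. -/
theorem choose_add_mul_choose_succ (i p l : ℕ) :
    (p + l).choose p * (i + 1).choose (p + l) + i.choose (p + l) * (p + l).choose p =
      i.choose p * (i - p + 1).choose l + i.choose l * (i - l + 1).choose p := by
  cases l with
  | zero => simp [add_comm]
  | succ l =>
    cases p with
    | zero => simp [add_comm]
    | succ p =>
      have h1 := choose_mul_choose_sub i (p + 1) l
      have h2 := choose_mul_choose_sub i (p + 1) (l + 1)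
      have h3 := choose_mul_choose_sub i (l + 1) p
      have h4 := choose_mul_choose_sub i (l + 1) (p + 1)
      have h5 : (p + 1 + (l + 1)).choose (p + 1) =
          (p + 1 + l).choose p + (p + 1 + l).choose (p + 1) :=
        Nat.choose_succ_succ _ _
      have h6 : (l + 1 + p).choose (l + 1) = (p + 1 + l).choose p := by
        rw [show l + 1 + p = p + 1 + l by omega, ← Nat.choose_symm (show p ≤ p + 1 + l by omega)]
        congr 1
        omega
      have h7 : (l + 1 + (p + 1)).choose (l + 1) = (p + 1 + (l + 1)).choose (p + 1) := by
        rw [show l + 1 + (p + 1) = p + 1 + (l + 1) by omega,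
          ← Nat.choose_symm (show p + 1 ≤ p + 1 + (l + 1) by omega)]
        congr 1
        omega
      have h8 : (i + 1).choose (p + 1 + (l + 1)) =
        i.choose (p + 1 + l) + i.choose (p + 1 + (l + 1)) := Nat.choose_succ_succ _ _
      rw [h7, show l + 1 + (p + 1) = p + 1 + (l + 1) by omega] at h4
      rw [h6, show l + 1 + p = p + 1 + l by omega] at h3
      rw [Nat.choose_succ_succ (i - (p + 1)), Nat.choose_succ_succ (i - (l + 1)), h8]
      simp only [mul_add, h1, h2, h3, h4]
      rw [h5]
      ring

/-- Rewriting the product of binomials makes the sum an instance of `sum_varCoeff_mul_choose` with m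
= p + l; what is left is `choose_add_mul_choose_succ`. -/
theorem symEq_adjMat (lam : K) (i p l : ℕ) (h : p + l < i) :
    symEq adjMat lam (1 - 2 * lam) i p l = 0 := by
  have h1 : ∀ r ∈ Finset.range i, varCoeff lam i r * (adjMat r p : K) * ((r - p).choose l : K) =
      ((p + l).choose p : K) * (varCoeff lam i r * (-1) ^ r * (r.choose (p + l) : K)) := by
    intro r _
    have h2 := congrArg (Nat.cast : ℕ → K) (choose_mul_choose_sub r p l)
    push_cast at h2
    rw [adjMat]
    linear_combination varCoeff lam i r * (-1) ^ r * h2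
  rw [symEq, Finset.sum_congr rfl h1, ← Finset.mul_sum, sum_varCoeff_mul_choose lam i _ h, adjMat,
    adjMat, Nat.choose_symm (show l ≤ i by omega)]
  simp only [varCoeff_eq_choose_succ]
  have h3 := congrArg (Nat.cast : ℕ → K) (choose_add_mul_choose_succ i p l)
  have h4 := congrArg (Nat.cast : ℕ → K) (choose_mul_choose_sub i p l)
  have h5 := congrArg (Nat.cast : ℕ → K) (choose_mul_choose_sub i l p)
  rw [add_comm l p, ← Nat.choose_symm (show l ≤ p + l by omega), Nat.add_sub_cancel] at h5
  push_cast at h3 h4 h5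
  linear_combination (-1) ^ i * ((-2 * lam - i) * h4 + (lam - 1) * h5 - h3)

theorem symEq_shift (t : ℕ → ℕ → K) (d : K) (i p l : ℕ) :
    symEq t 0 d (i + 1) (p + 1) l =
      symEq (fun i p => t (i + 1) (p + 1)) 1 (d - 1) i p l +
      t (i + 1) (i + 1 - l) * varCoeff 0 (i + 1 - l) (p + 1) -
      t (i + 1) (i - l + 1) * varCoeff 1 (i - l) p := by
  have h1 : ∀ r, varCoeff (0 : K) (i + 1) (r + 1) = varCoeff 1 i r := fun r => by
    rw [varCoeff_eq_choose_succ 1, varCoeff]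
    simp
  have h0 : varCoeff (0 : K) (i + 1) 0 = 0 := rfl
  rw [symEq, symEq, Finset.sum_range_succ']
  simp only [h1, h0, zero_mul, add_zero, Nat.add_sub_add_right]
  rw [show d - 1 - (i : K) = d - ((i + 1 : ℕ) : K) by push_cast; ring]
  ring

/-- For lam = 0 every operator is a_0 + B∂ with B acting on densities of weight 1. The entries
outside column zero satisfy the equations for B, of order one less and with lam = 1. -/
theorem symEq_shift_of_lt (t : ℕ → ℕ → K) (d : K) (i p l : ℕ) (h : p + l < i) :
    symEq t 0 d (i + 1) (p + 1) l = symEq (fun i p => t (i + 1) (p + 1)) 1 (d - 1) i p l := by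
  have h1 : varCoeff (0 : K) (i + 1 - l) (p + 1) = varCoeff 1 (i - l) p := by
    rw [varCoeff_eq_choose_succ 1, varCoeff, show i + 1 - l = i - l + 1 by omega]
    simp
  rw [symEq_shift, h1, show i + 1 - l = i - l + 1 by omega]
  ring

/-- Shift a matrix by one, the new row and the new column being zero. -/
def shiftMat (s : ℕ → ℕ → K) : ℕ → ℕ → K
  | 0, _ => 0
  | _ + 1, 0 => 0
  | i + 1, p + 1 => s i p

/-- An invariant S for B gives the invariant A ↦ S(B)∂ for A = a_0 + B∂. The equations of column
zero are trivial because lam = 0. -/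
theorem symEq_shiftMat (s : ℕ → ℕ → K) (d : K)
    (hs : ∀ i p l, p + l < i → symEq s 1 (d - 1) i p l = 0) (i p l : ℕ) (h : p + l < i) :
    symEq (shiftMat s) 0 d i p l = 0 := by
  obtain ⟨i, rfl⟩ : ∃ m, i = m + 1 := ⟨i - 1, by omega⟩
  have h0 : ∀ r, (shiftMat s r 0 : K) = 0 := fun r => by cases r <;> rfl
  cases p with
  | zero => simp [symEq, h0, varCoeff]
  | succ p => rw [symEq_shift_of_lt _ _ _ _ _ (by omega)]; exact hs i p l (by omega)

end CircleDensity

/-! ### Lower bounds from the invariants of every order -/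

namespace CircleDensity

variable {K : Type*} [Field K]

theorem le_rank_of_det_ne_zero {V : Type*} [AddCommGroup V] [Module K V] (W : Submodule K V)
    {n : ℕ} (e : Fin n → V) (he : ∀ s, e s ∈ W) (f : Fin n → V →ₗ[K] K)
    (h : (Matrix.of fun s r => f s (e r)).det ≠ 0) : (n : Cardinal) ≤ Module.rank K W := by
  refine le_rank_of_functionals W e he f fun g hg => ?_
  have h1 : (Matrix.of fun s r => f s (e r)).mulVec g = 0 := by
    funext s
    simpa [Matrix.mulVec, dotProduct, mul_comm] using hg s
  exact congrFun (Matrix.eq_zero_of_mulVec_eq_zero h h1)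

/-- The restriction of a matrix to the rows of index at most `k`. -/
def mask (k : ℕ) (t : ℕ → ℕ → K) : ℕ → ℕ → K := fun i p => if i ≤ k then t i p else 0

theorem mask_mem (k : ℕ) {lam mu : K} {t : ℕ → ℕ → K} (ht : ∀ i p, i < p → t i p = 0)
    (heq : ∀ i p l, p + l < i → symEq t lam (mu - lam) i p l = 0) : mask k t ∈ symMat k lam mu :=
  mask_mem_symMat k lam mu t ht fun i p l _ h => heq i p l h

theorem oneMat_mem (k : ℕ) (lam mu : K) : mask k oneMat ∈ symMat k lam mu :=
  mask_mem k (fun _ _ h => if_neg h.ne) fun i p l h => symEq_oneMat lam _ i p l h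

theorem constMat_mem (k : ℕ) (lam : K) : mask k constMat ∈ symMat k lam 1 :=
  mask_mem k (fun i p h => if_neg (by omega)) fun i p l h => symEq_constMat lam i p l h

theorem coeffMat_mem (k : ℕ) (mu : K) : mask k coeffMat ∈ symMat k 0 mu :=
  mask_mem k (fun i p h => if_neg (by omega)) fun i p l h => symEq_coeffMat _ i p l h

theorem adjMat_of_lt (i p : ℕ) (h : i < p) : (adjMat i p : K) = 0 := by
  rw [adjMat, Nat.choose_eq_zero_of_lt h, Nat.cast_zero, mul_zero]

theorem adjMat_mem (k : ℕ) {lam mu : K} (h : lam + mu = 1) : mask k adjMat ∈ symMat k lam mu := by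
  have h1 : mu - lam = 1 - 2 * lam := by linear_combination h
  refine mask_mem k adjMat_of_lt fun i p l h => ?_
  rw [h1]
  exact symEq_adjMat lam i p l h

theorem shiftMat_of_lt {s : ℕ → ℕ → K} (hs : ∀ i p, i < p → s i p = 0) (i p : ℕ) (h : i < p) :
    shiftMat s i p = 0 := by
  cases i with
  | zero => rfl
  | succ i =>
    cases p with
    | zero => rfl
    | succ p => exact hs i p (by omega)

/-- Here B maps weight 1 to weight 0. These weights add up to one, so B can be conjugated. -/
theorem shift_adjMat_mem (k : ℕ) : mask k (shiftMat adjMat) ∈ symMat k (0 : K) 0 := by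
  refine mask_mem k (shiftMat_of_lt adjMat_of_lt) (symEq_shiftMat _ _ fun i p l h => ?_)
  rw [show (0 : K) - 0 - 1 = 1 - 2 * 1 by ring]
  exact symEq_adjMat 1 i p l h

/-- Here B takes values in densities of weight 1, so B*(1) is defined. -/
theorem shift_constMat_mem (k : ℕ) : mask k (shiftMat constMat) ∈ symMat k (0 : K) 1 := by
  refine mask_mem k (shiftMat_of_lt fun i p h => if_neg (by omega))
    (symEq_shiftMat _ _ fun i p l h => ?_)
  rw [show (1 : K) - 0 - 1 = 1 - 1 by ring]
  exact symEq_constMat 1 i p l h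

/-- For A on densities of weight 1, A∂ maps weight 0 to weight 1 and can be conjugated. Dropping the
term of order zero and cancelling ∂ on the right gives an operator of the original kind. -/
theorem adjMat_succ_mem (k : ℕ) :
    mask k (fun i p => adjMat (i + 1) (p + 1)) ∈ symMat k (1 : K) 1 := by
  refine mask_mem k (fun i p h => adjMat_of_lt _ _ (by omega)) fun i p l h => ?_
  have h1 := symEq_shift_of_lt (adjMat (K := K)) 1 i p l h
  rw [← h1, show (1 : K) = 1 - 2 * 0 by ring]
  exact symEq_adjMat 0 (i + 1) (p + 1) l (by omega)

theorem one_le_rank (k : ℕ) (lam mu : K) : 1 ≤ Module.rank K (symMat k lam mu) := by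
  have h := le_rank_of_det_ne_zero (symMat k lam mu) ![mask k oneMat]
    (by simp [oneMat_mem]) ![entry 0 0] (by simp [entry_apply, mask, oneMat])
  exact_mod_cast h

theorem two_le_rank_of_lam_eq_zero {k : ℕ} (hk : 1 ≤ k) (mu : K) :
    2 ≤ Module.rank K (symMat k 0 mu) := by
  have h := le_rank_of_det_ne_zero (symMat k 0 mu) ![mask k oneMat, mask k coeffMat]
    (by simp [Fin.forall_fin_two, oneMat_mem, coeffMat_mem]) ![entry 0 0, entry 1 1]
    (by simp [Matrix.det_fin_two, entry_apply, mask, oneMat, coeffMat, hk])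
  exact_mod_cast h

theorem two_le_rank_of_mu_eq_one {k : ℕ} (hk : 1 ≤ k) (lam : K) :
    2 ≤ Module.rank K (symMat k lam 1) := by
  have h := le_rank_of_det_ne_zero (symMat k lam 1) ![mask k oneMat, mask k constMat]
    (by simp [Fin.forall_fin_two, oneMat_mem, constMat_mem]) ![entry 0 0, entry 1 1]
    (by simp [Matrix.det_fin_two, entry_apply, mask, oneMat, constMat, hk])
  exact_mod_cast h

theorem two_le_rank_of_add_eq_one [CharZero K] {k : ℕ} (hk : 1 ≤ k) {lam mu : K}
    (hl : lam + mu = 1) : 2 ≤ Module.rank K (symMat k lam mu) := by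
  have h := le_rank_of_det_ne_zero (symMat k lam mu) ![mask k oneMat, mask k adjMat]
    (by simp [Fin.forall_fin_two, oneMat_mem, adjMat_mem k hl]) ![entry 0 0, entry 1 1]
    (by
      simp [Matrix.det_fin_two, entry_apply, mask, oneMat, adjMat, hk]
      norm_num)
  exact_mod_cast h

theorem three_le_rank_zero_zero [CharZero K] {k : ℕ} (hk : 2 ≤ k) :
    3 ≤ Module.rank K (symMat k (0 : K) 0) := by
  have h := le_rank_of_det_ne_zero (symMat k (0 : K) 0)
    ![mask k oneMat, mask k coeffMat, mask k (shiftMat adjMat)]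
    (by simp [Fin.forall_fin_succ, oneMat_mem, coeffMat_mem, shift_adjMat_mem])
    ![entry 0 0, entry 1 1, entry 2 2]
    (by
      simp [Matrix.det_fin_three, entry_apply, mask, oneMat, coeffMat, shiftMat, adjMat, hk,
        show 1 ≤ k by omega])
  exact_mod_cast h

theorem three_le_rank_one_one [CharZero K] {k : ℕ} (hk : 2 ≤ k) :
    3 ≤ Module.rank K (symMat k (1 : K) 1) := by
  have h := le_rank_of_det_ne_zero (symMat k (1 : K) 1)
    ![mask k oneMat, mask k constMat, mask k (fun i p => adjMat (i + 1) (p + 1))]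
    (by simp [Fin.forall_fin_succ, oneMat_mem, constMat_mem, adjMat_succ_mem])
    ![entry 0 0, entry 1 1, entry 2 2]
    (by
      simp [Matrix.det_fin_three, entry_apply, mask, oneMat, constMat, adjMat, hk,
        show 1 ≤ k by omega]
      norm_num)
  exact_mod_cast h

theorem three_le_rank_zero_one :
    3 ≤ Module.rank K (symMat 1 (0 : K) 1) := by
  have h := le_rank_of_det_ne_zero (symMat 1 (0 : K) 1)
    ![mask 1 oneMat, mask 1 coeffMat, mask 1 constMat]
    (by simp [Fin.forall_fin_succ, oneMat_mem, coeffMat_mem, constMat_mem])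
    ![entry 0 0, entry 1 0, entry 1 1]
    (by simp [Matrix.det_fin_three, entry_apply, mask, oneMat, coeffMat, constMat])
  exact_mod_cast h

theorem four_le_rank_zero_one [CharZero K] :
    4 ≤ Module.rank K (symMat 2 (0 : K) 1) := by
  have h := le_rank_of_functionals (symMat 2 (0 : K) 1)
    ![mask 2 coeffMat, mask 2 constMat, mask 2 oneMat, mask 2 adjMat]
    (by simp [Fin.forall_fin_succ, oneMat_mem, coeffMat_mem, constMat_mem, adjMat_mem])
    ![entry 0 0, entry 1 0, entry 1 1, entry 2 2] (fun g hg => by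
      have h0 := hg 0
      have h1 := hg 1
      have h2 := hg 2
      have h3 := hg 3
      simp [Fin.sum_univ_succ, entry_apply, mask, oneMat, coeffMat, constMat, adjMat]
        at h0 h1 h2 h3
      have e2 : 2 * g 2 = 0 := by linear_combination h2 + h3
      have e2 : g 2 = 0 := by simpa using e2
      have e3 : g 3 = 0 := by linear_combination h3 - e2
      have e1 : g 1 = 0 := by linear_combination -h1 - e3
      have e0 : g 0 = 0 := by linear_combination h0 - e1 - e2 - e3
      simp [Fin.forall_fin_succ, e0, e1, e2, e3])
  exact_mod_cast h

/-- The weights (0,1) satisfy all the conditions lam = 0, mu = 1 and lam + mu = 1, and with B*(1)∂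
this makes five invariants. They are independent only from order three on. -/
theorem five_le_rank_zero_one [CharZero K] {k : ℕ} (hk : 3 ≤ k) :
    5 ≤ Module.rank K (symMat k (0 : K) 1) := by
  have h := le_rank_of_functionals (symMat k (0 : K) 1)
    ![mask k coeffMat, mask k constMat, mask k (shiftMat constMat), mask k oneMat, mask k adjMat]
    (by simp [Fin.forall_fin_succ, oneMat_mem, coeffMat_mem, constMat_mem, adjMat_mem,
      shift_constMat_mem])
    ![entry 0 0, entry 1 0, entry 1 1, entry 2 2, entry 3 3] (fun g hg => by
      have h0 := hg 0
      have h1 := hg 1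
      have h2 := hg 2
      have h3 := hg 3
      have h4 := hg 4
      simp [Fin.sum_univ_succ, entry_apply, mask, oneMat, coeffMat, constMat, adjMat, shiftMat, hk,
        show 1 ≤ k by omega, show 2 ≤ k by omega] at h0 h1 h2 h3 h4
      have e3 : 2 * g 3 = 0 := by linear_combination h3 + h4
      have e3 : g 3 = 0 := by simpa using e3
      have e4 : g 4 = 0 := by linear_combination h3 - e3
      have e2 : g 2 = 0 := by linear_combination h2 - e3 + e4
      have e1 : g 1 = 0 := by linear_combination -h1 - e4
      have e0 : g 0 = 0 := by linear_combination h0 - e1 - e3 - e4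
      simp [Fin.forall_fin_succ, e0, e1, e2, e3, e4])
  exact_mod_cast h

/-- The lower triangular matrix with given rows. -/
def lowMat (v : List (List K)) : ℕ → ℕ → K :=
  fun i p => if p ≤ i then (v.getD i []).getD p 0 else 0

theorem lowMat_of_lt (v : List (List K)) (i p : ℕ) (h : i < p) : lowMat v i p = 0 :=
  if_neg (by omega)

theorem lowMat_mem {k : ℕ} {lam mu : K} {v : List (List K)} (hv : v.length = k + 1)
    (h : ∀ i p l, i < k + 1 → p + l < i → symEq (lowMat v) lam (mu - lam) i p l = 0) :
    lowMat v ∈ symMat k lam mu := by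
  refine ⟨fun i p hip => ?_, h⟩
  by_cases hp : p ≤ i
  · have h1 : v.getD i [] = [] := List.getD_eq_default _ _ (by omega)
    rw [lowMat, if_pos hp, h1]
    rfl
  · exact if_neg hp

theorem forall_lt_three {P : ℕ → ℕ → ℕ → Prop} (h1 : P 1 0 0) (h2 : P 2 0 0) (h3 : P 2 0 1)
    (h4 : P 2 1 0) (i p l : ℕ) (hi : i < 3) (h : p + l < i) : P i p l := by
  interval_cases i
  · omega
  · obtain ⟨rfl, rfl⟩ : p = 0 ∧ l = 0 := by omega
    exact h1
  · obtain ⟨rfl, rfl⟩ | ⟨rfl, rfl⟩ | ⟨rfl, rfl⟩ :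
      (p = 0 ∧ l = 0) ∨ (p = 0 ∧ l = 1) ∨ (p = 1 ∧ l = 0) := by omega
    exacts [h2, h3, h4]

theorem forall_lt_four {P : ℕ → ℕ → ℕ → Prop} (h : ∀ i p l, i < 3 → p + l < i → P i p l)
    (h1 : P 3 0 0) (h2 : P 3 0 1) (h3 : P 3 0 2) (h4 : P 3 1 0) (h5 : P 3 1 1) (h6 : P 3 2 0)
    (i p l : ℕ) (hi : i < 4) (hpl : p + l < i) : P i p l := by
  rcases Nat.lt_or_ge i 3 with h0 | h0
  · exact h i p l h0 hpl
  · obtain rfl : i = 3 := by omega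
    obtain ⟨rfl, rfl⟩ | ⟨rfl, rfl⟩ | ⟨rfl, rfl⟩ | ⟨rfl, rfl⟩ | ⟨rfl, rfl⟩ | ⟨rfl, rfl⟩ :
      (p = 0 ∧ l = 0) ∨ (p = 0 ∧ l = 1) ∨ (p = 0 ∧ l = 2) ∨ (p = 1 ∧ l = 0) ∨ (p = 1 ∧ l = 1) ∨
        (p = 2 ∧ l = 0) := by omega
    exacts [h1, h2, h3, h4, h5, h6]

theorem forall_lt_five {P : ℕ → ℕ → ℕ → Prop} (h : ∀ i p l, i < 4 → p + l < i → P i p l)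
    (h1 : P 4 0 0) (h2 : P 4 0 1) (h3 : P 4 0 2) (h4 : P 4 0 3) (h5 : P 4 1 0) (h6 : P 4 1 1)
    (h7 : P 4 1 2) (h8 : P 4 2 0) (h9 : P 4 2 1) (h10 : P 4 3 0)
    (i p l : ℕ) (hi : i < 5) (hpl : p + l < i) : P i p l := by
  rcases Nat.lt_or_ge i 4 with h0 | h0
  · exact h i p l h0 hpl
  · obtain rfl : i = 4 := by omega
    obtain ⟨rfl, rfl⟩ | ⟨rfl, rfl⟩ | ⟨rfl, rfl⟩ | ⟨rfl, rfl⟩ | ⟨rfl, rfl⟩ | ⟨rfl, rfl⟩ |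
        ⟨rfl, rfl⟩ | ⟨rfl, rfl⟩ | ⟨rfl, rfl⟩ | ⟨rfl, rfl⟩ :
      (p = 0 ∧ l = 0) ∨ (p = 0 ∧ l = 1) ∨ (p = 0 ∧ l = 2) ∨ (p = 0 ∧ l = 3) ∨ (p = 1 ∧ l = 0) ∨
        (p = 1 ∧ l = 1) ∨ (p = 1 ∧ l = 2) ∨ (p = 2 ∧ l = 0) ∨ (p = 2 ∧ l = 1) ∨
        (p = 3 ∧ l = 0) := by omega
    exacts [h1, h2, h3, h4, h5, h6, h7, h8, h9, h10]

end CircleDensity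

/-! ### Invariants special to low order -/

namespace CircleDensity

variable {K : Type*} [Field K]

attribute [local simp] symEq_1_0_0 symEq_2_0_0 symEq_2_0_1 symEq_3_0_0 symEq_3_0_1
  symEq_3_0_2 symEq_3_1_1 symEq_4_0_0 symEq_4_0_1 symEq_4_0_2 symEq_4_0_3
  symEq_4_1_1 symEq_4_1_2 symEq_4_2_1

theorem two_le_rank {V : Type*} [AddCommGroup V] [Module K V] {W : Submodule K V} {e₀ e₁ : V}
    (h₀ : e₀ ∈ W) (h₁ : e₁ ∈ W) (f₀ f₁ : V →ₗ[K] K) (h : f₀ e₀ * f₁ e₁ - f₀ e₁ * f₁ e₀ ≠ 0) :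
    2 ≤ Module.rank K W := by
  have h := le_rank_of_det_ne_zero W ![e₀, e₁] (by simp [Fin.forall_fin_two, h₀, h₁]) ![f₀, f₁]
    (by simpa [Matrix.det_fin_two] using h)
  exact_mod_cast h

theorem three_le_rank {V : Type*} [AddCommGroup V] [Module K V] {W : Submodule K V}
    {e₀ e₁ e₂ : V} (h₀ : e₀ ∈ W) (h₁ : e₁ ∈ W) (h₂ : e₂ ∈ W) (f₀ f₁ f₂ : V →ₗ[K] K)
    (h : f₀ e₀ * f₁ e₁ - f₀ e₁ * f₁ e₀ ≠ 0 ∧ f₀ e₂ = 0 ∧ f₁ e₂ = 0 ∧ f₂ e₂ ≠ 0) :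
    3 ≤ Module.rank K W := by
  obtain ⟨h, h₀₂, h₁₂, h₂₂⟩ := h
  have h := le_rank_of_det_ne_zero W ![e₀, e₁, e₂] (by simp [Fin.forall_fin_succ, h₀, h₁, h₂])
    ![f₀, f₁, f₂] (by
      have h3 := mul_ne_zero h h₂₂
      rw [Matrix.det_fin_three]
      simp only [Matrix.of_apply, Matrix.cons_val, h₀₂, h₁₂]
      intro h4
      exact h3 (by linear_combination h4))
  exact_mod_cast h

/-- In order one a_1 is a density of weight δ - 1, and the extra invariant is its first transvectant
with φ, namely (δ - 1) a_1 φ' - lam a_1' φ. -/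
theorem two_le_rank_one {lam : K} (hl : lam ≠ 0) (mu : K) :
    2 ≤ Module.rank K (symMat 1 lam mu) := by
  have h1 : lowMat [[0], [-lam, mu - lam - 1]] ∈ symMat 1 lam mu := by
    refine lowMat_mem rfl fun i p l hi hpl => ?_
    obtain ⟨rfl, rfl, rfl⟩ : i = 1 ∧ p = 0 ∧ l = 0 := by omega
    simp [lowMat]
    ring
  exact two_le_rank (oneMat_mem 1 _ _) h1 (entry 0 0) (entry 1 0)
    (by simp [entry_apply, mask, oneMat, lowMat, hl])

/-- The transvectant (δ - 1) f φ' - lam f' φ, now with f = (δ - 2) a_1 + (2 lam + 1) a_2'. -/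
theorem two_le_rank_two {lam mu : K} (hl : lam ≠ 0) (h2 : mu - lam = 2 → 2 * lam + 1 ≠ 0) :
    2 ≤ Module.rank K (symMat 2 lam mu) := by
  obtain ⟨d, hd⟩ : ∃ d, mu - lam = d := ⟨_, rfl⟩
  have h1 : lowMat [[0], [-lam * (d - 2), (d - 1) * (d - 2)],
      [-lam * (2 * lam + 1), (2 * lam + 1) * (d - 1), 0]] ∈ symMat 2 lam mu := by
    refine lowMat_mem rfl ?_
    rw [hd]
    apply forall_lt_three <;>
      simp [lowMat, symEq_2_1_0 _ _ _ (lowMat_of_lt _)] <;> ring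
  rw [hd] at h2
  -- At δ = 2 the density f reduces to (2 lam + 1) a_2', so the invariant must be detected in row
  -- two.
  by_cases h : d = 2
  · refine two_le_rank (oneMat_mem 2 _ _) h1 (entry 0 0) (entry 2 1) ?_
    have h3 := h2 h
    simp [entry_apply, mask, oneMat, lowMat, h]
    norm_num [h3]
  · refine two_le_rank (oneMat_mem 2 _ _) h1 (entry 0 0) (entry 1 0) ?_
    simp [entry_apply, mask, oneMat, lowMat, hl, sub_ne_zero.2 h]

/-- Here 1 + 2 lam = 0, which decouples rows one and two, so each carries its own transvectant. -/
theorem three_le_rank_two_neg_half [CharZero K] :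
    3 ≤ Module.rank K (symMat 2 (-1 / 2 : K) (3 / 2)) := by
  have hd : (3 / 2 - -1 / 2 : K) = 2 := by norm_num
  have h1 : lowMat [[0], [1 / 2, 1], [0, 0, 0]] ∈ symMat 2 (-1 / 2 : K) (3 / 2) := by
    refine lowMat_mem rfl ?_
    rw [hd]
    apply forall_lt_three <;>
      norm_num [lowMat, symEq_2_1_0 _ _ _ (lowMat_of_lt _)]
  have h2 : lowMat [[0], [0, 0], [1 / 2, 1, 0]] ∈ symMat 2 (-1 / 2 : K) (3 / 2) := by
    refine lowMat_mem rfl ?_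
    rw [hd]
    apply forall_lt_three <;>
      norm_num [lowMat, symEq_2_1_0 _ _ _ (lowMat_of_lt _)]
  exact three_le_rank (oneMat_mem 2 _ _) h1 h2 (entry 0 0) (entry 1 0) (entry 2 1)
    (by norm_num [entry_apply, mask, oneMat, lowMat])

/-- Writing A = a_0 + B∂, the third invariant is, up to sign, the one of `two_le_rank_one` applied
to B. -/
theorem three_le_rank_two_of_lam_eq_zero (mu : K) : 3 ≤ Module.rank K (symMat 2 0 mu) := by
  have h1 : lowMat [[0], [0, 0], [0, 1, 2 - mu]] ∈ symMat 2 0 mu := by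
    refine lowMat_mem rfl ?_
    apply forall_lt_three <;>
      simp [lowMat, symEq_2_1_0 _ _ _ (lowMat_of_lt _)]
  exact three_le_rank (oneMat_mem 2 _ _) (coeffMat_mem 2 _) h1 (entry 0 0) (entry 1 1) (entry 2 1)
    (by simp [entry_apply, mask, oneMat, coeffMat, lowMat])

/-- Conjugation exchanges (lam, mu) with (1 - mu, 1 - lam); the third invariant is the one of the
case lam = 0 transported in this way. -/
theorem three_le_rank_two_of_mu_eq_one (lam : K) : 3 ≤ Module.rank K (symMat 2 lam 1) := by
  have h1 : lowMat [[0], [0, 0], [lam, 2 * lam + 1, 1 + lam]] ∈ symMat 2 lam 1 := by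
    refine lowMat_mem rfl ?_
    apply forall_lt_three <;>
      simp [lowMat, symEq_2_1_0 _ _ _ (lowMat_of_lt _)] <;> ring
  -- This combination has the value 2 (1 + lam) - (2 lam + 1) = 1 on the third invariant, whatever
  -- `lam` is.
  exact three_le_rank (oneMat_mem 2 _ _) (constMat_mem 2 _) h1 (entry 0 0) (entry 1 1) ((2 : K) • entry 2 2 - entry 2 1)
    (by
      simp [entry_apply, mask, oneMat, constMat, lowMat]
      ring_nf
      simp)

/-- On the hyperbola the density f of `two_le_rank_two` can be completed by a multiple of a_3'':
what remains of the equations of order three are multiples of the equation of the curve. -/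
theorem two_le_rank_three_of_hyperbola [CharZero K] {lam mu : K} (hl : lam ≠ 0)
    (h2 : mu - lam ≠ 2) (hh : (3 * lam + 1) * (3 * mu - 4) = -1) :
    2 ≤ Module.rank K (symMat 3 lam mu) := by
  obtain ⟨d, hd⟩ : ∃ d, mu - lam = d := ⟨_, rfl⟩
  have hh : 3 * lam * lam + 3 * lam * d - 3 * lam + d - 1 = 0 := by
    rw [← hd]
    linear_combination hh / 3
  have h1 : lowMat [[0], [-lam * (d - 2), (d - 1) * (d - 2)],
      [-lam * (2 * lam + 1), (2 * lam + 1) * (d - 1), 0],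
      [(3 * (1 + lam) * lam * (2 * lam + 1) + (1 + 3 * lam) * lam * (d - 2) +
          lam * (2 * (1 + 3 * lam) * (d - 1) * (d - 2) +
            3 * (1 + lam) * (2 * lam + 1) * (d - 1))) / 2,
        -(2 * (1 + 3 * lam) * (d - 1) * (d - 2) + 3 * (1 + lam) * (2 * lam + 1) * (d - 1)), 0, 0]]
      ∈ symMat 3 lam mu := by
    refine lowMat_mem rfl ?_
    rw [hd]
    refine forall_lt_four (forall_lt_three ?_ ?_ ?_ ?_) ?_ ?_ ?_ ?_ ?_ ?_ <;>
      simp [lowMat, symEq_2_1_0 _ _ _ (lowMat_of_lt _), symEq_3_1_0 _ _ _ (lowMat_of_lt _),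
        symEq_3_2_0 _ _ _ (lowMat_of_lt _)]
    · ring
    · ring
    · ring
    · ring
    · linear_combination lam * (d - 1) * (d - 2) * hh
    · linear_combination lam * (3 * d - 2) * (d - 2) * hh
    · linear_combination lam * (3 * d - 2) * (d - 2) * hh
    · linear_combination -2 * (d - 1) * (d - 2) * hh
    · linear_combination -4 * (d - 1) * (d - 2) * hh
  exact two_le_rank (oneMat_mem 3 _ _) h1 (entry 0 0) (entry 1 0)
    (by
      rw [hd] at h2
      simp [entry_apply, mask, oneMat, lowMat, hl, sub_ne_zero.2 h2])

/-- For δ = 2 the coefficient a_2 in order two is a function and a_2' a density of weight 1. In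
order three f = a_2' - 3 (1 + lam) a_3'' plays its role, and the invariant is f φ' - lam f' φ. -/
theorem lowMat_mem_three_of_sub_eq_two {lam mu : K} (h2 : mu - lam = 2) :
    lowMat [[0], [0, 0], [-lam, 1, 0], [3 * lam * (1 + lam), -(3 + 3 * lam), 0, 0]]
      ∈ symMat 3 lam mu := by
  refine lowMat_mem rfl ?_
  rw [h2]
  refine forall_lt_four (forall_lt_three ?_ ?_ ?_ ?_) ?_ ?_ ?_ ?_ ?_ ?_ <;>
      simp [lowMat, symEq_2_1_0 _ _ _ (lowMat_of_lt _), symEq_3_1_0 _ _ _ (lowMat_of_lt _),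
        symEq_3_2_0 _ _ _ (lowMat_of_lt _)] <;> ring

theorem two_le_rank_three_of_sub_eq_two {lam mu : K} (h2 : mu - lam = 2) :
    2 ≤ Module.rank K (symMat 3 lam mu) :=
  two_le_rank (oneMat_mem 3 _ _) (lowMat_mem_three_of_sub_eq_two h2) (entry 0 0) (entry 2 1)
    (by simp [entry_apply, mask, oneMat, lowMat])

theorem three_le_rank_three_neg_half [CharZero K] :
    3 ≤ Module.rank K (symMat 3 (-1 / 2 : K) (3 / 2)) := by
  have hd : (3 / 2 - -1 / 2 : K) = 2 := by norm_num
  exact three_le_rank (oneMat_mem 3 _ _) (adjMat_mem 3 (by norm_num)) (lowMat_mem_three_of_sub_eq_two hd) (entry 0 0) (entry 3 3) (entry 2 1)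
    (by norm_num [entry_apply, mask, oneMat, adjMat, lowMat])

/-- Again an invariant of B where A = a_0 + B∂: up to sign, the one of `two_le_rank_two` for the
weights 1 and mu. -/
theorem three_le_rank_three_of_lam_eq_zero [CharZero K] (mu : K) :
    3 ≤ Module.rank K (symMat 3 0 mu) := by
  have h1 : lowMat [[0], [0, 0], [0, mu - 3, -(mu - 2) * (mu - 3)], [0, 3, -3 * (mu - 2), 0]]
      ∈ symMat 3 0 mu := by
    refine lowMat_mem rfl ?_
    refine forall_lt_four (forall_lt_three ?_ ?_ ?_ ?_) ?_ ?_ ?_ ?_ ?_ ?_ <;>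
      simp [lowMat, symEq_2_1_0 _ _ _ (lowMat_of_lt _), symEq_3_1_0 _ _ _ (lowMat_of_lt _),
        symEq_3_2_0 _ _ _ (lowMat_of_lt _)] <;> ring
  exact three_le_rank (oneMat_mem 3 _ _) (coeffMat_mem 3 _) h1 (entry 0 0) (entry 1 1) (entry 3 1)
    (by simp [entry_apply, mask, oneMat, coeffMat, lowMat])

/-- Up to sign, the conjugate of the invariant of the case lam = 0. -/
theorem three_le_rank_three_of_mu_eq_one [CharZero K] (lam : K) :
    3 ≤ Module.rank K (symMat 3 lam 1) := by
  have h1 : lowMat [[0], [0, 0], [lam * (2 + lam), (2 * lam + 1) * (2 + lam), (1 + lam) * (2 + lam)],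
      [-3 * lam * (1 + lam), -3 * (lam + 1) * (2 * lam + 1), -3 * (lam + 1) ^ 2, 0]]
      ∈ symMat 3 lam 1 := by
    refine lowMat_mem rfl ?_
    refine forall_lt_four (forall_lt_three ?_ ?_ ?_ ?_) ?_ ?_ ?_ ?_ ?_ ?_ <;>
      simp [lowMat, symEq_2_1_0 _ _ _ (lowMat_of_lt _), symEq_3_1_0 _ _ _ (lowMat_of_lt _),
        symEq_3_2_0 _ _ _ (lowMat_of_lt _)] <;> ring
  -- The combination has the value 3 lam (2 + lam) - 3 (lam + 1)^2 = -3 on the third invariant,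
  -- whatever `lam` is.
  exact three_le_rank (oneMat_mem 3 _ _) (constMat_mem 3 _) h1 (entry 0 0) (entry 1 1) ((3 : K) • entry 2 0 + entry 3 2)
    (by
      simp [entry_apply, mask, oneMat, constMat, lowMat]
      ring_nf
      simp)

/-- The density f gains the term (4 + 6 lam) a_4'''. The fourth row keeps the form of a transvectant
because the quadratic relation says -lam (4 + 6 lam) = 3 + 2 lam. -/
theorem two_le_rank_four_of_sub_eq_two {lam mu : K} (h2 : mu - lam = 2)
    (h3 : 2 * lam ^ 2 + 2 * lam + 1 = 0) : 2 ≤ Module.rank K (symMat 4 lam mu) := by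
  have h1 : lowMat [[0], [0, 0], [-lam, 1, 0], [3 * lam * (1 + lam), -(3 + 3 * lam), 0, 0],
      [3 + 2 * lam, 4 + 6 * lam, 0, 0, 0]] ∈ symMat 4 lam mu := by
    refine lowMat_mem rfl ?_
    rw [h2]
    refine forall_lt_five (forall_lt_four (forall_lt_three ?_ ?_ ?_ ?_) ?_ ?_ ?_ ?_ ?_ ?_)
      ?_ ?_ ?_ ?_ ?_ ?_ ?_ ?_ ?_ ?_ <;>
      simp [lowMat, symEq_2_1_0 _ _ _ (lowMat_of_lt _), symEq_3_1_0 _ _ _ (lowMat_of_lt _),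
        symEq_3_2_0 _ _ _ (lowMat_of_lt _), symEq_4_1_0 _ _ _ (lowMat_of_lt _),
        symEq_4_2_0 _ _ _ (lowMat_of_lt _), symEq_4_3_0 _ _ _ (lowMat_of_lt _)]
    · ring
    · ring
    · ring
    · ring
    · ring
    · linear_combination (-6 * lam - 6) * h3
    · linear_combination (-18 * lam - 21) * h3
    · linear_combination (-18 * lam - 24) * h3
    · linear_combination (-6 * lam - 6) * h3
    · linear_combination 6 * h3
    · linear_combination 12 * h3
    · linear_combination 6 * h3
  exact two_le_rank (oneMat_mem 4 _ _) h1 (entry 0 0) (entry 2 1)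
    (by simp [entry_apply, mask, oneMat, lowMat])

/-- The third invariant is 3 f ∂² + 2 f' ∂ - f'' with f = 7 a_2 - 9 a_3' + 10 a_4''. -/
theorem three_le_rank_four_neg_quarter_one [CharZero K] :
    3 ≤ Module.rank K (symMat 4 (-1 / 4 : K) 1) := by
  have h1 : lowMat [[0], [0, 0], [-7, 14, 21], [9, -18, -27, 0], [-10, 20, 30, 0, 0]]
      ∈ symMat 4 (-1 / 4 : K) 1 := by
    refine lowMat_mem rfl ?_
    refine forall_lt_five (forall_lt_four (forall_lt_three ?_ ?_ ?_ ?_) ?_ ?_ ?_ ?_ ?_ ?_)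
      ?_ ?_ ?_ ?_ ?_ ?_ ?_ ?_ ?_ ?_ <;>
      norm_num [lowMat, symEq_2_1_0 _ _ _ (lowMat_of_lt _), symEq_3_1_0 _ _ _ (lowMat_of_lt _),
        symEq_3_2_0 _ _ _ (lowMat_of_lt _), symEq_4_1_0 _ _ _ (lowMat_of_lt _),
        symEq_4_2_0 _ _ _ (lowMat_of_lt _), symEq_4_3_0 _ _ _ (lowMat_of_lt _)]
  exact three_le_rank (oneMat_mem 4 _ _) (constMat_mem 4 _) h1 (entry 0 0) (entry 1 1) (entry 2 2)
    (by norm_num [entry_apply, mask, oneMat, constMat, lowMat])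

/-- The third invariant is f ∂² + 3 f' ∂ + 2 f'' with f = a_3' + 2 a_4''. -/
theorem three_le_rank_four_neg_two_one [CharZero K] :
    3 ≤ Module.rank K (symMat 4 (-2 : K) 1) := by
  have h1 : lowMat [[0], [0, 0], [0, 0, 0], [2, 3, 1, 0], [4, 6, 2, 0, 0]]
      ∈ symMat 4 (-2 : K) 1 := by
    refine lowMat_mem rfl ?_
    refine forall_lt_five (forall_lt_four (forall_lt_three ?_ ?_ ?_ ?_) ?_ ?_ ?_ ?_ ?_ ?_)
      ?_ ?_ ?_ ?_ ?_ ?_ ?_ ?_ ?_ ?_ <;>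
      norm_num [lowMat, symEq_2_1_0 _ _ _ (lowMat_of_lt _), symEq_3_1_0 _ _ _ (lowMat_of_lt _),
        symEq_3_2_0 _ _ _ (lowMat_of_lt _), symEq_4_1_0 _ _ _ (lowMat_of_lt _),
        symEq_4_2_0 _ _ _ (lowMat_of_lt _), symEq_4_3_0 _ _ _ (lowMat_of_lt _)]
  exact three_le_rank (oneMat_mem 4 _ _) (constMat_mem 4 _) h1 (entry 0 0) (entry 1 1) (entry 3 2)
    (by norm_num [entry_apply, mask, oneMat, constMat, lowMat])

/-- The third invariant is 3 f ∂² + 4 f' ∂ with f = 7 a_2 - 12 a_3' + 16 a_4''. Conjugation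
exchanges these weights with (-1/4, 1). -/
theorem three_le_rank_four_zero_five_quarters [CharZero K] :
    3 ≤ Module.rank K (symMat 4 (0 : K) (5 / 4)) := by
  have h1 : lowMat [[0], [0, 0], [0, 28, 21], [0, -48, -36, 0], [0, 64, 48, 0, 0]]
      ∈ symMat 4 (0 : K) (5 / 4) := by
    refine lowMat_mem rfl ?_
    refine forall_lt_five (forall_lt_four (forall_lt_three ?_ ?_ ?_ ?_) ?_ ?_ ?_ ?_ ?_ ?_)
      ?_ ?_ ?_ ?_ ?_ ?_ ?_ ?_ ?_ ?_ <;>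
      norm_num [lowMat, symEq_2_1_0 _ _ _ (lowMat_of_lt _), symEq_3_1_0 _ _ _ (lowMat_of_lt _),
        symEq_3_2_0 _ _ _ (lowMat_of_lt _), symEq_4_1_0 _ _ _ (lowMat_of_lt _),
        symEq_4_2_0 _ _ _ (lowMat_of_lt _), symEq_4_3_0 _ _ _ (lowMat_of_lt _)]
  exact three_le_rank (oneMat_mem 4 _ _) (coeffMat_mem 4 _) h1 (entry 0 0) (entry 1 1) (entry 2 1)
    (by norm_num [entry_apply, mask, oneMat, coeffMat, lowMat])

/-- The third invariant is f ∂² - f' ∂ with f = a_3' - 6 a_4''. Conjugation exchanges these weights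
with (-2, 1). -/
theorem three_le_rank_four_zero_three [CharZero K] :
    3 ≤ Module.rank K (symMat 4 (0 : K) 3) := by
  have h1 : lowMat [[0], [0, 0], [0, 0, 0], [0, -1, 1, 0], [0, 6, -6, 0, 0]]
      ∈ symMat 4 (0 : K) 3 := by
    refine lowMat_mem rfl ?_
    refine forall_lt_five (forall_lt_four (forall_lt_three ?_ ?_ ?_ ?_) ?_ ?_ ?_ ?_ ?_ ?_)
      ?_ ?_ ?_ ?_ ?_ ?_ ?_ ?_ ?_ ?_ <;>
      norm_num [lowMat, symEq_2_1_0 _ _ _ (lowMat_of_lt _), symEq_3_1_0 _ _ _ (lowMat_of_lt _),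
        symEq_3_2_0 _ _ _ (lowMat_of_lt _), symEq_4_1_0 _ _ _ (lowMat_of_lt _),
        symEq_4_2_0 _ _ _ (lowMat_of_lt _), symEq_4_3_0 _ _ _ (lowMat_of_lt _)]
  exact three_le_rank (oneMat_mem 4 _ _) (coeffMat_mem 4 _) h1 (entry 0 0) (entry 1 1) (entry 3 2)
    (by norm_num [entry_apply, mask, oneMat, coeffMat, lowMat])

/-- A point common to the hyperbola and lam + mu = 1. The third invariant is the transvectant 2 f ∂
+ f' with f = a_1 - a_2' + 3 a_3'' - 5 a_4'''. -/
theorem three_le_rank_four_neg_two_thirds [CharZero K] :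
    3 ≤ Module.rank K (symMat 4 (-2 / 3 : K) (5 / 3)) := by
  have h1 : lowMat [[0], [1, 2], [-1, -2, 0], [3, 6, 0, 0], [-5, -10, 0, 0, 0]]
      ∈ symMat 4 (-2 / 3 : K) (5 / 3) := by
    refine lowMat_mem rfl ?_
    refine forall_lt_five (forall_lt_four (forall_lt_three ?_ ?_ ?_ ?_) ?_ ?_ ?_ ?_ ?_ ?_)
      ?_ ?_ ?_ ?_ ?_ ?_ ?_ ?_ ?_ ?_ <;>
      norm_num [lowMat, symEq_2_1_0 _ _ _ (lowMat_of_lt _), symEq_3_1_0 _ _ _ (lowMat_of_lt _),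
        symEq_3_2_0 _ _ _ (lowMat_of_lt _), symEq_4_1_0 _ _ _ (lowMat_of_lt _),
        symEq_4_2_0 _ _ _ (lowMat_of_lt _), symEq_4_3_0 _ _ _ (lowMat_of_lt _)]
  exact three_le_rank (oneMat_mem 4 _ _) (adjMat_mem 4 (by norm_num)) h1 (entry 0 0) (entry 3 3) (entry 1 1)
    (by norm_num [entry_apply, mask, oneMat, adjMat, lowMat])

end CircleDensity

/-! ### Upper bounds in orders two and three at special weights -/

namespace CircleDensity

variable {K : Type*} [Field K]

theorem eq_zero_of_symEq_eq {k : ℕ} {lam mu : K} {t : ℕ → ℕ → K} (ht : t ∈ symMat k lam mu)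
    {i p l : ℕ} {c : K} (h : symEq t lam (mu - lam) i p l = c) (hi : i < k + 1 := by norm_num)
    (hpl : p + l < i := by norm_num) : c = 0 :=
  h.symm.trans (ht.2 i p l hi hpl)

/-- Pattern of all the upper bounds: as many entries, or combinations of them, as the claimed
dimension are set to zero, and the remaining entries follow one by one by elimination. A factor
cancelled on the way is a pivot, and its zeros are the weights to be excluded. -/
theorem rank_two_le_of_lam_eq_zero [CharZero K] {mu : K} (h1 : mu ≠ 1) :
    Module.rank K (symMat 2 0 mu) ≤ 3 := by
  have h := rank_le_of_functionals (symMat 2 0 mu)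
    ![entry 0 0, entry 1 1, entry 2 1] fun t ht hf => ?_
  · exact_mod_cast h
  have hu : ∀ i p, i < p → t i p = 0 := fun i p h => ht.1 i p (by omega)
  have z00 : t 0 0 = 0 := hf 0
  have z11 : t 1 1 = 0 := hf 1
  have z21 : t 2 1 = 0 := hf 2
  have e100 := eq_zero_of_symEq_eq ht (symEq_1_0_0 t _ _)
  have e200 := eq_zero_of_symEq_eq ht (symEq_2_0_0 t _ _)
  have e201 := eq_zero_of_symEq_eq ht (symEq_2_0_1 t _ _)
  have e210 := eq_zero_of_symEq_eq ht (symEq_2_1_0 t _ _ hu)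
  have z10 : t 1 0 = 0 := by
    refine (mul_eq_zero.1 ?_).resolve_left (sub_ne_zero.2 h1)
    linear_combination e100
  have z22 : t 2 2 = 0 := by linear_combination e210 + (2 - mu) * z21 + z11
  have z20 : t 2 0 = 0 := by linear_combination e201 - 2 * e200 - z10
  refine eq_zero_of_mem_symMat ht fun i hi j hj => ?_
  interval_cases i <;> interval_cases j <;> assumption

theorem rank_two_le_of_mu_eq_one [CharZero K] {lam : K} (hl : lam ≠ 0) :
    Module.rank K (symMat 2 lam 1) ≤ 3 := by
  have h := rank_le_of_functionals (symMat 2 lam 1)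
    ![entry 0 0, entry 1 1, (2 : K) • entry 2 2 - entry 2 1] fun t ht hf => ?_
  · exact_mod_cast h
  have hu : ∀ i p, i < p → t i p = 0 := fun i p h => ht.1 i p (by omega)
  have z00 : t 0 0 = 0 := hf 0
  have z11 : t 1 1 = 0 := hf 1
  have w : 2 * t 2 2 - t 2 1 = 0 := hf 2
  have e100 := eq_zero_of_symEq_eq ht (symEq_1_0_0 t _ _)
  have e200 := eq_zero_of_symEq_eq ht (symEq_2_0_0 t _ _)
  have e201 := eq_zero_of_symEq_eq ht (symEq_2_0_1 t _ _)
  have e210 := eq_zero_of_symEq_eq ht (symEq_2_1_0 t _ _ hu)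
  have z10 : t 1 0 = 0 := by
    refine (mul_eq_zero.1 ?_).resolve_left hl
    linear_combination -e100 + lam * z11 + (-lam) * z00
  have z22 : t 2 2 = 0 := by linear_combination -e210 + (1 + lam) * w + (-1 - 2 * lam) * z11
  have z21 : t 2 1 = 0 := by linear_combination -w + 2 * z22
  have z20 : t 2 0 = 0 := by
    linear_combination e201 - 2 * e200 + (-lam) * z21 + (-1 - 2 * lam) * z10 + (2 * lam) * z22 +
      (-2 * lam) * z00
  refine eq_zero_of_mem_symMat ht fun i hi j hj => ?_
  interval_cases i <;> interval_cases j <;> assumption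

theorem rank_two_le_of_sub_eq_two [CharZero K] {lam : K} (hl : lam ≠ 0) (h1 : lam ≠ -1) (h2 : lam
    ≠ -(1 / 2)) :
    Module.rank K (symMat 2 lam (lam + 2)) ≤ 2 := by
  have h := rank_le_of_functionals (symMat 2 lam (lam + 2))
    ![entry 0 0, entry 2 1] fun t ht hf => ?_
  · exact_mod_cast h
  have hu : ∀ i p, i < p → t i p = 0 := fun i p h => ht.1 i p (by omega)
  have z00 : t 0 0 = 0 := hf 0
  have z21 : t 2 1 = 0 := hf 1
  have e100 := eq_zero_of_symEq_eq ht (symEq_1_0_0 t _ _)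
  have e200 := eq_zero_of_symEq_eq ht (symEq_2_0_0 t _ _)
  have e201 := eq_zero_of_symEq_eq ht (symEq_2_0_1 t _ _)
  have e210 := eq_zero_of_symEq_eq ht (symEq_2_1_0 t _ _ hu)
  have z11 : t 1 1 = 0 := by
    -- The pivot is lam (lam + 1)(lam + 1/2); on the line mu = lam + 2 its zeros are the points with
    -- lam = 0, with mu = 1 and with lam + mu = 1.
    refine (mul_eq_zero.1 ?_).resolve_left (mul_ne_zero (mul_ne_zero hl (sub_ne_zero.2 h1)) (sub_ne_zero.2 h2))
    linear_combination (1 / 4 + (1 / 2) * lam) * e200 + ((-1 / 4) * lam) * e210 + (1 / 4 + lam +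
      lam ^ 2) * e100 + ((1 / 2) * lam + (3 / 2) * lam ^ 2 + lam ^ 3) * z00
  have z10 : t 1 0 = 0 := by linear_combination e100 + (-lam) * z11 + lam * z00
  have z22 : t 2 2 = 0 := by
    linear_combination e210 - 2 * e200 + (1 + 2 * lam) * z11 + (-2 * lam) * z00 + (-2 - 4 * lam) *
      z10
  have z20 : t 2 0 = 0 := by linear_combination e201 + (-lam) * z21 + (1 + 2 * lam) * z10
  refine eq_zero_of_mem_symMat ht fun i hi j hj => ?_
  interval_cases i <;> interval_cases j <;> assumption

theorem rank_two_le_neg_half [CharZero K] :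
    Module.rank K (symMat 2 (-1 / 2 : K) (3 / 2)) ≤ 3 := by
  have h := rank_le_of_functionals (symMat 2 (-1 / 2 : K) (3 / 2))
    ![entry 0 0, entry 1 0, entry 2 1] fun t ht hf => ?_
  · exact_mod_cast h
  have hu : ∀ i p, i < p → t i p = 0 := fun i p h => ht.1 i p (by omega)
  have z00 : t 0 0 = 0 := hf 0
  have z10 : t 1 0 = 0 := hf 1
  have z21 : t 2 1 = 0 := hf 2
  have e100 := eq_zero_of_symEq_eq ht (symEq_1_0_0 t _ _)
  have e200 := eq_zero_of_symEq_eq ht (symEq_2_0_0 t _ _)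
  have e201 := eq_zero_of_symEq_eq ht (symEq_2_0_1 t _ _)
  have z11 : t 1 1 = 0 := by linear_combination -2 * e100 + 2 * z10 + z00
  have z22 : t 2 2 = 0 := by linear_combination -2 * e200 + z00
  have z20 : t 2 0 = 0 := by linear_combination e201 + (1 / 2) * z21
  refine eq_zero_of_mem_symMat ht fun i hi j hj => ?_
  interval_cases i <;> interval_cases j <;> assumption

theorem rank_two_le_zero_one [CharZero K] :
    Module.rank K (symMat 2 (0 : K) 1) ≤ 4 := by
  have h := rank_le_of_functionals (symMat 2 (0 : K) 1)
    ![entry 0 0, entry 1 0, entry 1 1, entry 2 2] fun t ht hf => ?_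
  · exact_mod_cast h
  have hu : ∀ i p, i < p → t i p = 0 := fun i p h => ht.1 i p (by omega)
  have z00 : t 0 0 = 0 := hf 0
  have z10 : t 1 0 = 0 := hf 1
  have z11 : t 1 1 = 0 := hf 2
  have z22 : t 2 2 = 0 := hf 3
  have e200 := eq_zero_of_symEq_eq ht (symEq_2_0_0 t _ _)
  have e210 := eq_zero_of_symEq_eq ht (symEq_2_1_0 t _ _ hu)
  have z21 : t 2 1 = 0 := by linear_combination -e210 + z22 - z11
  have z20 : t 2 0 = 0 := by linear_combination -e200 - z10
  refine eq_zero_of_mem_symMat ht fun i hi j hj => ?_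
  interval_cases i <;> interval_cases j <;> assumption

theorem rank_three_le_of_lam_eq_zero [CharZero K] {mu : K} (h1 : mu ≠ 1) :
    Module.rank K (symMat 3 0 mu) ≤ 3 := by
  have h := rank_le_of_functionals (symMat 3 0 mu)
    ![entry 0 0, entry 1 1, entry 3 1] fun t ht hf => ?_
  · exact_mod_cast h
  have hu : ∀ i p, i < p → t i p = 0 := fun i p h => ht.1 i p (by omega)
  have z00 : t 0 0 = 0 := hf 0
  have z11 : t 1 1 = 0 := hf 1
  have z31 : t 3 1 = 0 := hf 2
  have e100 := eq_zero_of_symEq_eq ht (symEq_1_0_0 t _ _)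
  have e210 := eq_zero_of_symEq_eq ht (symEq_2_1_0 t _ _ hu)
  have e300 := eq_zero_of_symEq_eq ht (symEq_3_0_0 t _ _)
  have e301 := eq_zero_of_symEq_eq ht (symEq_3_0_1 t _ _)
  have e302 := eq_zero_of_symEq_eq ht (symEq_3_0_2 t _ _)
  have e310 := eq_zero_of_symEq_eq ht (symEq_3_1_0 t _ _ hu)
  have e311 := eq_zero_of_symEq_eq ht (symEq_3_1_1 t _ _)
  have e320 := eq_zero_of_symEq_eq ht (symEq_3_2_0 t _ _ hu)
  have z10 : t 1 0 = 0 := by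
    refine (mul_eq_zero.1 ?_).resolve_left (sub_ne_zero.2 h1)
    linear_combination e100
  have z22 : t 2 2 = 0 := by
    refine (mul_eq_zero.1 ?_).resolve_left (sub_ne_zero.2 h1)
    linear_combination ((1 / 2) * mu) * e210 + (1 / 3 + (-1 / 6) * mu) * e320 + (1 + (-5 / 6) * mu
      + (1 / 6) * mu ^ 2) * e311 + (2 + (-11 / 3) * mu + 2 * mu ^ 2 + (-1 / 3) * mu ^ 3) * z31 +
      (-1 + (1 / 2) * mu) * e310 + (-1 + mu) * z11
  have z21 : t 2 1 = 0 := by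
    linear_combination (1 / 6) * e320 + (1 / 2 + (-1 / 6) * mu) * e311 + (1 + (-4 / 3) * mu + (1 /
      3) * mu ^ 2) * z31 - (1 / 2) * e310 - (1 / 2) * e210 + z22 - z11
  have z20 : t 2 0 = 0 := by linear_combination -(1 / 3) * e302 - 2 * e300 + e301 - z10
  have z33 : t 3 3 = 0 := by linear_combination e310 + (3 - mu) * z31 + z11 + 3 * z21
  have z32 : t 3 2 = 0 := by linear_combination e311 + (5 - 2 * mu) * z31 + 3 * z21
  have z30 : t 3 0 = 0 := by linear_combination e301 - 3 * e300 - 2 * z10 - 3 * z20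
  refine eq_zero_of_mem_symMat ht fun i hi j hj => ?_
  interval_cases i <;> interval_cases j <;> assumption

theorem rank_three_le_of_mu_eq_one [CharZero K] {lam : K} (hl : lam ≠ 0) :
    Module.rank K (symMat 3 lam 1) ≤ 3 := by
  have h := rank_le_of_functionals (symMat 3 lam 1)
    ![entry 0 0, entry 1 1, (3 : K) • entry 2 0 + entry 3 2] fun t ht hf => ?_
  · exact_mod_cast h
  have hu : ∀ i p, i < p → t i p = 0 := fun i p h => ht.1 i p (by omega)
  have z00 : t 0 0 = 0 := hf 0
  have z11 : t 1 1 = 0 := hf 1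
  have w : 3 * t 2 0 + t 3 2 = 0 := hf 2
  have e100 := eq_zero_of_symEq_eq ht (symEq_1_0_0 t _ _)
  have e200 := eq_zero_of_symEq_eq ht (symEq_2_0_0 t _ _)
  have e201 := eq_zero_of_symEq_eq ht (symEq_2_0_1 t _ _)
  have e210 := eq_zero_of_symEq_eq ht (symEq_2_1_0 t _ _ hu)
  have e300 := eq_zero_of_symEq_eq ht (symEq_3_0_0 t _ _)
  have e301 := eq_zero_of_symEq_eq ht (symEq_3_0_1 t _ _)
  have e310 := eq_zero_of_symEq_eq ht (symEq_3_1_0 t _ _ hu)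
  have e311 := eq_zero_of_symEq_eq ht (symEq_3_1_1 t _ _)
  have e320 := eq_zero_of_symEq_eq ht (symEq_3_2_0 t _ _ hu)
  have z10 : t 1 0 = 0 := by
    refine (mul_eq_zero.1 ?_).resolve_left hl
    linear_combination -e100 + lam * z11 + (-lam) * z00
  have z22 : t 2 2 = 0 := by
    refine (mul_eq_zero.1 ?_).resolve_left hl
    linear_combination (-lam) * e210 + ((-5 / 6) * lam + (-4 / 3) * lam ^ 2 + (-1 / 2) * lam ^ 3)
      * e320 + ((-2 / 3) * lam - lam ^ 2 + (-1 / 3) * lam ^ 3) * w + (5 / 2 + (13 / 2) * lam + (11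
      / 2) * lam ^ 2 + (3 / 2) * lam ^ 3) * e300 + (-1 + (-5 / 2) * lam - 2 * lam ^ 2 + (-1 / 2) *
      lam ^ 3) * e301 + (-1 / 2 + (-9 / 2) * lam + (-11 / 2) * lam ^ 2 + (-3 / 2) * lam ^ 3) *
      e200 + (-1 - lam) * e201 + (-lam - 2 * lam ^ 2) * z11 + (-lam ^ 2 - lam ^ 3) * z10 + (2 *
      lam + 2 * lam ^ 2) * z00
  have z21 : t 2 1 = 0 := by
    linear_combination ((-5 / 6) * lam + (-1 / 2) * lam ^ 2) * e320 + ((-2 / 3) * lam + (-1 / 3) *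
      lam ^ 2) * w + (5 / 2 + 4 * lam + (3 / 2) * lam ^ 2) * e300 + (-1 + (-3 / 2) * lam + (-1 /
      2) * lam ^ 2) * e301 + (-1 / 2 - 4 * lam + (-3 / 2) * lam ^ 2) * e200 - e201 - e210 + (-lam
      ^ 2) * z10 + z22 + (2 * lam) * z00 + (-1 - 2 * lam) * z11
  have z20 : t 2 0 = 0 := by
    linear_combination e201 - 2 * e200 + (-lam) * z21 + (-1 - 2 * lam) * z10 + (2 * lam) * z22 +
      (-2 * lam) * z00
  have z33 : t 3 3 = 0 := by
    linear_combination (-5 / 2 + (-3 / 2) * lam) * e300 + (1 + (1 / 2) * lam) * e301 + (2 / 3 + (1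
      / 3) * lam) * w + (1 / 3 + (1 / 2) * lam) * e320 + ((-5 / 2) * lam + (-3 / 2) * lam ^ 2) *
      z00 + (-3 / 2 + (-11 / 2) * lam - 3 * lam ^ 2) * z10 + (-7 / 2 - 4 * lam + (-3 / 2) * lam ^
      2) * z20 + (1 + (5 / 2) * lam + (3 / 2) * lam ^ 2) * z22
  have z32 : t 3 2 = 0 := by linear_combination w - 3 * z20
  have z31 : t 3 1 = 0 := by
    linear_combination e311 - 2 * e310 + (-1 - 2 * lam) * z32 + (-3 - 3 * lam) * z21 + (2 + 6 *
      lam) * z33 + (-2 - 6 * lam) * z11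
  have z30 : t 3 0 = 0 := by
    linear_combination e301 - 3 * e300 + (-lam) * z32 + (-2 - 6 * lam) * z10 + (-3 - 3 * lam) *
      z20 + (3 * lam) * z33 + (-3 * lam) * z00
  refine eq_zero_of_mem_symMat ht fun i hi j hj => ?_
  interval_cases i <;> interval_cases j <;> assumption

theorem rank_three_le_of_sub_eq_two [CharZero K] {lam : K} (hl : lam ≠ 0) (h1 : lam ≠ -1) (h2 :
    lam ≠ -(1 / 2)) :
    Module.rank K (symMat 3 lam (lam + 2)) ≤ 2 := by
  have h := rank_le_of_functionals (symMat 3 lam (lam + 2))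
    ![entry 0 0, entry 2 1] fun t ht hf => ?_
  · exact_mod_cast h
  have hu : ∀ i p, i < p → t i p = 0 := fun i p h => ht.1 i p (by omega)
  have z00 : t 0 0 = 0 := hf 0
  have z21 : t 2 1 = 0 := hf 1
  have e100 := eq_zero_of_symEq_eq ht (symEq_1_0_0 t _ _)
  have e200 := eq_zero_of_symEq_eq ht (symEq_2_0_0 t _ _)
  have e201 := eq_zero_of_symEq_eq ht (symEq_2_0_1 t _ _)
  have e210 := eq_zero_of_symEq_eq ht (symEq_2_1_0 t _ _ hu)
  have e300 := eq_zero_of_symEq_eq ht (symEq_3_0_0 t _ _)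
  have e302 := eq_zero_of_symEq_eq ht (symEq_3_0_2 t _ _)
  have e310 := eq_zero_of_symEq_eq ht (symEq_3_1_0 t _ _ hu)
  have e311 := eq_zero_of_symEq_eq ht (symEq_3_1_1 t _ _)
  have e320 := eq_zero_of_symEq_eq ht (symEq_3_2_0 t _ _ hu)
  have z11 : t 1 1 = 0 := by
    refine (mul_eq_zero.1 ?_).resolve_left (mul_ne_zero (mul_ne_zero hl (sub_ne_zero.2 h1)) (sub_ne_zero.2 h2))
    linear_combination (1 / 4 + (1 / 2) * lam) * e200 + ((-1 / 4) * lam) * e210 + (1 / 4 + lam +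
      lam ^ 2) * e100 + ((1 / 2) * lam + (3 / 2) * lam ^ 2 + lam ^ 3) * z00
  have z10 : t 1 0 = 0 := by linear_combination e100 + (-lam) * z11 + lam * z00
  have z22 : t 2 2 = 0 := by
    linear_combination e210 - 2 * e200 + (1 + 2 * lam) * z11 + (-2 * lam) * z00 + (-2 - 4 * lam) *
      z10
  have z20 : t 2 0 = 0 := by linear_combination e201 + (-lam) * z21 + (1 + 2 * lam) * z10
  have z33 : t 3 3 = 0 := by
    linear_combination (3 + 6 * lam) * e302 + (-1 / 2 + 6 * lam + 6 * lam ^ 2) * e310 + (1 / 2 - 3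
      * lam) * e311 + (1 / 2 - 2 * lam - 6 * lam ^ 2) * e320 + (9 + 27 * lam + 18 * lam ^ 2) * z20
      + (-1 / 2 + (9 / 2) * lam + 24 * lam ^ 2 + 18 * lam ^ 3) * z11 + (9 * lam + 27 * lam ^ 2 +
      18 * lam ^ 3) * z21 + (3 / 2 + (-9 / 2) * lam - 24 * lam ^ 2 - 18 * lam ^ 3) * z22
  have z32 : t 3 2 = 0 := by
    linear_combination -e320 + (3 + 3 * lam) * z33 + (-3 - 3 * lam) * z22
  have z31 : t 3 1 = 0 := by
    linear_combination -e310 + (1 + 3 * lam) * z33 + (-1 - 3 * lam) * z11 + (-3 - 3 * lam) * z21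
  have z30 : t 3 0 = 0 := by
    linear_combination -e300 + lam * z33 + (-lam) * z00 + (-1 - 3 * lam) * z10 + (-3 - 3 * lam) *
      z20
  refine eq_zero_of_mem_symMat ht fun i hi j hj => ?_
  interval_cases i <;> interval_cases j <;> assumption

theorem rank_three_le_neg_half [CharZero K] :
    Module.rank K (symMat 3 (-1 / 2 : K) (3 / 2)) ≤ 3 := by
  have h := rank_le_of_functionals (symMat 3 (-1 / 2 : K) (3 / 2))
    ![entry 0 0, entry 3 3, entry 2 1] fun t ht hf => ?_
  · exact_mod_cast h
  have hu : ∀ i p, i < p → t i p = 0 := fun i p h => ht.1 i p (by omega)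
  have z00 : t 0 0 = 0 := hf 0
  have z33 : t 3 3 = 0 := hf 1
  have z21 : t 2 1 = 0 := hf 2
  have e100 := eq_zero_of_symEq_eq ht (symEq_1_0_0 t _ _)
  have e200 := eq_zero_of_symEq_eq ht (symEq_2_0_0 t _ _)
  have e201 := eq_zero_of_symEq_eq ht (symEq_2_0_1 t _ _)
  have e300 := eq_zero_of_symEq_eq ht (symEq_3_0_0 t _ _)
  have e302 := eq_zero_of_symEq_eq ht (symEq_3_0_2 t _ _)
  have e310 := eq_zero_of_symEq_eq ht (symEq_3_1_0 t _ _ hu)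
  have e320 := eq_zero_of_symEq_eq ht (symEq_3_2_0 t _ _ hu)
  have z11 : t 1 1 = 0 := by linear_combination 2 * e310 - 4 * e302 + z33 - 6 * e201
  have z10 : t 1 0 = 0 := by linear_combination e100 + (1 / 2) * z11 - (1 / 2) * z00
  have z22 : t 2 2 = 0 := by linear_combination -2 * e200 + z00
  have z20 : t 2 0 = 0 := by linear_combination e201 + (1 / 2) * z21
  have z32 : t 3 2 = 0 := by linear_combination -e320 + (3 / 2) * z33 - (3 / 2) * z22
  have z31 : t 3 1 = 0 := by linear_combination -2 * e302 - 3 * z20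
  have z30 : t 3 0 = 0 := by
    linear_combination -e300 - (1 / 2) * z33 + (1 / 2) * z00 + (1 / 2) * z10 - (3 / 2) * z20
  refine eq_zero_of_mem_symMat ht fun i hi j hj => ?_
  interval_cases i <;> interval_cases j <;> assumption

theorem rank_three_le_neg_two_thirds [CharZero K] :
    Module.rank K (symMat 3 (-2 / 3 : K) (5 / 3)) ≤ 3 := by
  have h := rank_le_of_functionals (symMat 3 (-2 / 3 : K) (5 / 3))
    ![entry 0 0, entry 3 3, entry 1 1] fun t ht hf => ?_
  · exact_mod_cast h
  have hu : ∀ i p, i < p → t i p = 0 := fun i p h => ht.1 i p (by omega)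
  have z00 : t 0 0 = 0 := hf 0
  have z33 : t 3 3 = 0 := hf 1
  have z11 : t 1 1 = 0 := hf 2
  have e100 := eq_zero_of_symEq_eq ht (symEq_1_0_0 t _ _)
  have e200 := eq_zero_of_symEq_eq ht (symEq_2_0_0 t _ _)
  have e201 := eq_zero_of_symEq_eq ht (symEq_2_0_1 t _ _)
  have e210 := eq_zero_of_symEq_eq ht (symEq_2_1_0 t _ _ hu)
  have e300 := eq_zero_of_symEq_eq ht (symEq_3_0_0 t _ _)
  have e310 := eq_zero_of_symEq_eq ht (symEq_3_1_0 t _ _ hu)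
  have e320 := eq_zero_of_symEq_eq ht (symEq_3_2_0 t _ _ hu)
  have z10 : t 1 0 = 0 := by linear_combination (3 / 4) * e100 + (1 / 2) * z11 - (1 / 2) * z00
  have z22 : t 2 2 = 0 := by
    linear_combination (3 / 8) * e201 - (15 / 8) * e200 + (3 / 4) * e210 + (1 / 2) * z10 + (5 / 4)
      * z00 - (1 / 4) * z11
  have z21 : t 2 1 = 0 := by linear_combination 3 * e210 + z22 - z11
  have z20 : t 2 0 = 0 := by linear_combination 3 * e200 + 2 * z22 - 2 * z00 - z10
  have z32 : t 3 2 = 0 := by linear_combination -(3 / 2) * e320 + (3 / 2) * z33 - (3 / 2) * z22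
  have z31 : t 3 1 = 0 := by
    linear_combination -(3 / 2) * e310 - (3 / 2) * z33 + (3 / 2) * z11 - (3 / 2) * z21
  have z30 : t 3 0 = 0 := by
    linear_combination -(3 / 2) * e300 - z33 + z00 + (3 / 2) * z10 - (3 / 2) * z20
  refine eq_zero_of_mem_symMat ht fun i hi j hj => ?_
  interval_cases i <;> interval_cases j <;> assumption

theorem rank_three_le_of_add_eq_one [CharZero K] {lam : K} (hl : lam ≠ 0) (h1 : lam ≠ -(1 / 2))
    (h2 : lam ≠ -(2 / 3)) :
    Module.rank K (symMat 3 lam (1 - lam)) ≤ 2 := by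
  have h := rank_le_of_functionals (symMat 3 lam (1 - lam))
    ![entry 0 0, entry 3 3] fun t ht hf => ?_
  · exact_mod_cast h
  have hu : ∀ i p, i < p → t i p = 0 := fun i p h => ht.1 i p (by omega)
  have z00 : t 0 0 = 0 := hf 0
  have z33 : t 3 3 = 0 := hf 1
  have e100 := eq_zero_of_symEq_eq ht (symEq_1_0_0 t _ _)
  have e200 := eq_zero_of_symEq_eq ht (symEq_2_0_0 t _ _)
  have e201 := eq_zero_of_symEq_eq ht (symEq_2_0_1 t _ _)
  have e210 := eq_zero_of_symEq_eq ht (symEq_2_1_0 t _ _ hu)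
  have e300 := eq_zero_of_symEq_eq ht (symEq_3_0_0 t _ _)
  have e301 := eq_zero_of_symEq_eq ht (symEq_3_0_1 t _ _)
  have e302 := eq_zero_of_symEq_eq ht (symEq_3_0_2 t _ _)
  have e310 := eq_zero_of_symEq_eq ht (symEq_3_1_0 t _ _ hu)
  have e311 := eq_zero_of_symEq_eq ht (symEq_3_1_1 t _ _)
  have e320 := eq_zero_of_symEq_eq ht (symEq_3_2_0 t _ _ hu)
  have z11 : t 1 1 = 0 := by
    -- The zero lam = -2/3 of the pivot is where the line lam + mu = 1 meets the hyperbola away from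
    -- lam = 0.
    refine (mul_eq_zero.1 ?_).resolve_left (mul_ne_zero hl (sub_ne_zero.2 h2))
    linear_combination (-1 / 2 + (-2 / 3) * lam) * e310 + (1 / 3 + (1 / 3) * lam) * e311 + (1 / 6
      + (1 / 3) * lam) * e320 + ((2 / 3) * lam + lam ^ 2) * z33 + (1 / 2 + (1 / 2) * lam) * e210
  have z10 : t 1 0 = 0 := by
    refine (mul_eq_zero.1 ?_).resolve_left hl
    linear_combination -(1 / 2) * e100 + ((1 / 2) * lam) * z11 + ((-1 / 2) * lam) * z00
  have z22 : t 2 2 = 0 := by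
    refine (mul_eq_zero.1 ?_).resolve_left (mul_ne_zero hl hl)
    linear_combination (1 / 2 + 2 * lam) * e200 + (-1 / 2 - lam) * e201 + ((-1 / 2) * lam) * e210
      + ((1 / 2) * lam + 2 * lam ^ 2) * z00 + (lam + 2 * lam ^ 2) * z10 + ((-1 / 2) * lam - lam ^
      2) * z11
  have z21 : t 2 1 = 0 := by
    -- The zero lam = -1/2 is where the line lam + mu = 1 meets mu - lam = 2.
    refine (mul_eq_zero.1 ?_).resolve_left (sub_ne_zero.2 h1)
    linear_combination -(1 / 2) * e210 + (1 / 2 + lam) * z22 + (-1 / 2 - lam) * z11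
  have z20 : t 2 0 = 0 := by
    linear_combination e201 - 2 * e200 + (-lam) * z21 + (-1 - 2 * lam) * z10 + (2 * lam) * z22 +
      (-2 * lam) * z00
  have z32 : t 3 2 = 0 := by
    linear_combination (1 / 2) * e302 + 3 * e300 - (3 / 2) * e301 - (3 / 4) * e310 + (1 / 2) *
      e311 - (1 / 4) * e320 + (3 / 2 + (3 / 2) * lam) * z20 + (3 / 2) * z33 + (3 * lam) * z00 + (3
      / 2 + (9 / 2) * lam) * z10 + (-3 / 4 + (-9 / 4) * lam) * z11 + (-3 / 4 + (-3 / 4) * lam) *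
      z21 + (-3 / 4 + (-3 / 4) * lam) * z22
  have z31 : t 3 1 = 0 := by
    linear_combination e311 - 2 * e310 + (-1 - 2 * lam) * z32 + (-3 - 3 * lam) * z21 + (2 + 6 *
      lam) * z33 + (-2 - 6 * lam) * z11
  have z30 : t 3 0 = 0 := by
    linear_combination e301 - 3 * e300 + (-lam) * z32 + (-2 - 6 * lam) * z10 + (-3 - 3 * lam) *
      z20 + (3 * lam) * z33 + (-3 * lam) * z00
  refine eq_zero_of_mem_symMat ht fun i hi j hj => ?_
  interval_cases i <;> interval_cases j <;> assumption

theorem rank_three_le_zero_one [CharZero K] :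
    Module.rank K (symMat 3 (0 : K) 1) ≤ 5 := by
  have h := rank_le_of_functionals (symMat 3 (0 : K) 1)
    ![entry 0 0, entry 1 0, entry 1 1, entry 2 2, entry 3 3] fun t ht hf => ?_
  · exact_mod_cast h
  have hu : ∀ i p, i < p → t i p = 0 := fun i p h => ht.1 i p (by omega)
  have z00 : t 0 0 = 0 := hf 0
  have z10 : t 1 0 = 0 := hf 1
  have z11 : t 1 1 = 0 := hf 2
  have z22 : t 2 2 = 0 := hf 3
  have z33 : t 3 3 = 0 := hf 4
  have e200 := eq_zero_of_symEq_eq ht (symEq_2_0_0 t _ _)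
  have e210 := eq_zero_of_symEq_eq ht (symEq_2_1_0 t _ _ hu)
  have e300 := eq_zero_of_symEq_eq ht (symEq_3_0_0 t _ _)
  have e310 := eq_zero_of_symEq_eq ht (symEq_3_1_0 t _ _ hu)
  have e320 := eq_zero_of_symEq_eq ht (symEq_3_2_0 t _ _ hu)
  have z21 : t 2 1 = 0 := by linear_combination -e210 + z22 - z11
  have z20 : t 2 0 = 0 := by linear_combination -e200 - z10
  have z32 : t 3 2 = 0 := by linear_combination -(1 / 2) * e320 + (3 / 2) * z33 - (3 / 2) * z22
  have z31 : t 3 1 = 0 := by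
    linear_combination -(1 / 2) * e310 + (1 / 2) * z33 - (1 / 2) * z11 - (3 / 2) * z21
  have z30 : t 3 0 = 0 := by linear_combination -(1 / 2) * e300 - (1 / 2) * z10 - (3 / 2) * z20
  refine eq_zero_of_mem_symMat ht fun i hi j hj => ?_
  interval_cases i <;> interval_cases j <;> assumption

end CircleDensity

/-! ### Upper bounds in order four at special weights -/

namespace CircleDensity

variable {K : Type*} [Field K]

theorem rank_four_le_of_lam_eq_zero [CharZero K] {mu : K} (h0 : mu ≠ 0) (h1 : mu ≠ 1) (h2 : mu ≠ 5
    / 4) (h3 : mu ≠ 3) :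
    Module.rank K (symMat 4 0 mu) ≤ 2 := by
  have h := rank_le_of_functionals (symMat 4 0 mu)
    ![entry 0 0, entry 1 1] fun t ht hf => ?_
  · exact_mod_cast h
  have hu : ∀ i p, i < p → t i p = 0 := fun i p h => ht.1 i p (by omega)
  have z00 : t 0 0 = 0 := hf 0
  have z11 : t 1 1 = 0 := hf 1
  have e100 := eq_zero_of_symEq_eq ht (symEq_1_0_0 t _ _)
  have e210 := eq_zero_of_symEq_eq ht (symEq_2_1_0 t _ _ hu)
  have e310 := eq_zero_of_symEq_eq ht (symEq_3_1_0 t _ _ hu)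
  have e311 := eq_zero_of_symEq_eq ht (symEq_3_1_1 t _ _)
  have e320 := eq_zero_of_symEq_eq ht (symEq_3_2_0 t _ _ hu)
  have e400 := eq_zero_of_symEq_eq ht (symEq_4_0_0 t _ _)
  have e401 := eq_zero_of_symEq_eq ht (symEq_4_0_1 t _ _)
  have e402 := eq_zero_of_symEq_eq ht (symEq_4_0_2 t _ _)
  have e403 := eq_zero_of_symEq_eq ht (symEq_4_0_3 t _ _)
  have e410 := eq_zero_of_symEq_eq ht (symEq_4_1_0 t _ _ hu)
  have e411 := eq_zero_of_symEq_eq ht (symEq_4_1_1 t _ _)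
  have e412 := eq_zero_of_symEq_eq ht (symEq_4_1_2 t _ _)
  have e421 := eq_zero_of_symEq_eq ht (symEq_4_2_1 t _ _)
  have e430 := eq_zero_of_symEq_eq ht (symEq_4_3_0 t _ _ hu)
  have z10 : t 1 0 = 0 := by
    refine (mul_eq_zero.1 ?_).resolve_left (sub_ne_zero.2 h1)
    linear_combination e100
  have z22 : t 2 2 = 0 := by
    -- The pivot is mu (mu - 1)(mu - 5/4); at each of its zeros there is an additional invariant of
    -- order four.
    refine (mul_eq_zero.1 ?_).resolve_left (mul_ne_zero (mul_ne_zero h0 (sub_ne_zero.2 h1)) (sub_ne_zero.2 h2))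
    linear_combination (-15 / 2 + (19 / 2) * mu + (-9 / 2) * mu ^ 2 + mu ^ 3) * e210 + (-15 + (45
      / 2) * mu + (-21 / 2) * mu ^ 2 + (3 / 2) * mu ^ 3) * e410 + (15 + (-97 / 4) * mu + (109 / 8)
      * mu ^ 2 + (-25 / 8) * mu ^ 3 + (1 / 4) * mu ^ 4) * e411 + (5 / 2 + (-15 / 4) * mu + (7 / 4)
      * mu ^ 2 + (-1 / 4) * mu ^ 3) * e430 + (-5 / 3 + (9 / 4) * mu + (-23 / 24) * mu ^ 2 + (1 /
      8) * mu ^ 3) * e421 + (-35 / 3 + (229 / 12) * mu + (-269 / 24) * mu ^ 2 + (67 / 24) * mu ^ 3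
      + (-1 / 4) * mu ^ 4) * e412 + (45 / 2 + (-123 / 4) * mu + (51 / 4) * mu ^ 2 + (-3 / 2) * mu
      ^ 3) * e310 + (-35 / 2 + (97 / 4) * mu + (-43 / 4) * mu ^ 2 + (3 / 2) * mu ^ 3) * e311 + (-5
      / 2 + (11 / 4) * mu + (-3 / 4) * mu ^ 2) * e320 + ((5 / 4) * mu + (-9 / 4) * mu ^ 2 + mu ^
      3) * z11
  have z21 : t 2 1 = 0 := by
    linear_combination (-5 + 5 * mu - mu ^ 2) * e410 + (5 + (-67 / 12) * mu + (7 / 4) * mu ^ 2 +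
      (-1 / 6) * mu ^ 3) * e411 + (5 / 6 + (-5 / 6) * mu + (1 / 6) * mu ^ 2) * e430 + (-5 / 9 +
      (17 / 36) * mu + (-1 / 12) * mu ^ 2) * e421 + (-35 / 9 + (53 / 12) * mu + (-55 / 36) * mu ^
      2 + (1 / 6) * mu ^ 3) * e412 + (15 / 2 + (-13 / 2) * mu + mu ^ 2) * e310 + (-35 / 6 + (31 /
      6) * mu - mu ^ 2) * e311 + (-5 / 6 + (1 / 2) * mu) * e320 + (-3 + (5 / 3) * mu + (-2 / 3) *
      mu ^ 2) * e210 + (-1 / 2 + (1 / 6) * mu + (-2 / 3) * mu ^ 2) * z11 + (1 / 2 + (-1 / 6) * mu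
      + (2 / 3) * mu ^ 2) * z22
  have z20 : t 2 0 = 0 := by
    linear_combination (1 / 4) * e403 - (5 / 2) * e400 + (3 / 2) * e401 - (3 / 4) * e402 - z10
  have z33 : t 3 3 = 0 := by
    refine (mul_eq_zero.1 ?_).resolve_left (sub_ne_zero.2 h1)
    linear_combination (-5 / 2 + mu) * e310 + (3 / 2 + (-1 / 2) * mu) * e311 + (1 / 2) * e320 +
      (-5 / 2 + mu) * z11 + (-3 + (3 / 2) * mu) * z21 + (3 / 2) * z22
  have z32 : t 3 2 = 0 := by
    -- Here mu = 3 enters: at that weight the entry t_32 remains free in order four.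
    refine (mul_eq_zero.1 ?_).resolve_left (sub_ne_zero.2 h3)
    linear_combination e320 - 3 * z33 + 3 * z22
  have z31 : t 3 1 = 0 := by
    linear_combination e311 - 2 * e310 - z32 - 3 * z21 + 2 * z33 - 2 * z11
  have z30 : t 3 0 = 0 := by
    linear_combination -(1 / 6) * e402 - (5 / 3) * e400 + (2 / 3) * e401 - 2 * z20 - z10
  have z44 : t 4 4 = 0 := by
    linear_combination (-2 + (3 / 5) * mu) * e430 + (6 / 5 + (-3 / 10) * mu) * e421 + (42 / 5 +
      (-9 / 2) * mu + (3 / 5) * mu ^ 2) * e412 + (13 + (-18 / 5) * mu) * e410 + (-58 / 5 + (53 /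
      10) * mu + (-3 / 5) * mu ^ 2) * e411 + (-12 + (18 / 5) * mu) * z33 + (36 / 5 + (-9 / 5) *
      mu) * z32 + (-54 / 5 + 15 * mu + (-18 / 5) * mu ^ 2) * z31 + (13 + (-18 / 5) * mu) * z11 +
      (28 / 5 + (34 / 5) * mu + (-12 / 5) * mu ^ 2) * z21
  have z43 : t 4 3 = 0 := by
    linear_combination (1 / 6) * e421 + (7 / 6 + (-1 / 3) * mu) * e412 + (7 - 2 * mu) * e410 + (-7
      / 2 + mu) * e411 - e430 + z32 + (7 - 2 * mu) * z31 + (-1 + 2 * mu) * z44 + (7 - 2 * mu) *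
      z11 + (14 - 4 * mu) * z21 - 6 * z33
  have z42 : t 4 2 = 0 := by
    linear_combination e412 + 6 * e410 - 3 * e411 + 6 * z31 - 6 * z44 + 6 * z11 + 12 * z21 + 3 *
      z43
  have z41 : t 4 1 = 0 := by
    linear_combination e411 - 3 * e410 - z43 - 8 * z21 - 6 * z31 + 3 * z44 - 3 * z11
  have z40 : t 4 0 = 0 := by linear_combination e401 - 4 * e400 - 3 * z10 - 8 * z20 - 6 * z30
  refine eq_zero_of_mem_symMat ht fun i hi j hj => ?_
  interval_cases i <;> interval_cases j <;> assumption

theorem rank_four_le_of_mu_eq_one [CharZero K] {lam : K} (hl : lam ≠ 0) (h1 : lam ≠ 1) (h2 : lam ≠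
    -(1 / 4)) (h3 : lam ≠ -2) :
    Module.rank K (symMat 4 lam 1) ≤ 2 := by
  have h := rank_le_of_functionals (symMat 4 lam 1)
    ![entry 0 0, entry 1 1] fun t ht hf => ?_
  · exact_mod_cast h
  have hu : ∀ i p, i < p → t i p = 0 := fun i p h => ht.1 i p (by omega)
  have z00 : t 0 0 = 0 := hf 0
  have z11 : t 1 1 = 0 := hf 1
  have e100 := eq_zero_of_symEq_eq ht (symEq_1_0_0 t _ _)
  have e200 := eq_zero_of_symEq_eq ht (symEq_2_0_0 t _ _)
  have e201 := eq_zero_of_symEq_eq ht (symEq_2_0_1 t _ _)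
  have e210 := eq_zero_of_symEq_eq ht (symEq_2_1_0 t _ _ hu)
  have e300 := eq_zero_of_symEq_eq ht (symEq_3_0_0 t _ _)
  have e301 := eq_zero_of_symEq_eq ht (symEq_3_0_1 t _ _)
  have e310 := eq_zero_of_symEq_eq ht (symEq_3_1_0 t _ _ hu)
  have e311 := eq_zero_of_symEq_eq ht (symEq_3_1_1 t _ _)
  have e320 := eq_zero_of_symEq_eq ht (symEq_3_2_0 t _ _ hu)
  have e400 := eq_zero_of_symEq_eq ht (symEq_4_0_0 t _ _)
  have e401 := eq_zero_of_symEq_eq ht (symEq_4_0_1 t _ _)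
  have e402 := eq_zero_of_symEq_eq ht (symEq_4_0_2 t _ _)
  have e410 := eq_zero_of_symEq_eq ht (symEq_4_1_0 t _ _ hu)
  have e411 := eq_zero_of_symEq_eq ht (symEq_4_1_1 t _ _)
  have e420 := eq_zero_of_symEq_eq ht (symEq_4_2_0 t _ _ hu)
  have e421 := eq_zero_of_symEq_eq ht (symEq_4_2_1 t _ _)
  have e430 := eq_zero_of_symEq_eq ht (symEq_4_3_0 t _ _ hu)
  have z10 : t 1 0 = 0 := by
    refine (mul_eq_zero.1 ?_).resolve_left hl
    linear_combination -e100 + lam * z11 + (-lam) * z00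
  have z22 : t 2 2 = 0 := by
    -- The pivot is lam (lam - 1)(lam + 1/4), the one of the case lam = 0 transported by
    -- conjugation, mu ↦ 1 - lam.
    refine (mul_eq_zero.1 ?_).resolve_left (mul_ne_zero (mul_ne_zero hl (sub_ne_zero.2 h1)) (sub_ne_zero.2 h2))
    linear_combination ((-19 / 6) * lam + (-5 / 3) * lam ^ 2) * e210 + (-11 / 12 + (-173 / 24) *
      lam + (-203 / 24) * lam ^ 2 + (-13 / 6) * lam ^ 3) * e400 + (1 / 4 + (47 / 24) * lam + (9 /
      4) * lam ^ 2 + (13 / 24) * lam ^ 3) * e401 + ((-1 / 8) * lam + (-5 / 24) * lam ^ 2 + (-1 /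
      12) * lam ^ 3) * e430 + ((5 / 3) * lam + (55 / 24) * lam ^ 2 + (5 / 8) * lam ^ 3) * e410 +
      ((-5 / 8) * lam + (-5 / 6) * lam ^ 2 + (-5 / 24) * lam ^ 3) * e411 + (1 / 2 + (49 / 12) *
      lam + (23 / 4) * lam ^ 2 + (13 / 6) * lam ^ 3) * e300 + ((-5 / 4) * lam + (-25 / 12) * lam ^
      2 + (-5 / 6) * lam ^ 3) * e310 + (35 / 12 + (29 / 4) * lam + (13 / 3) * lam ^ 2) * e200 +
      (-11 / 4 + (-11 / 4) * lam) * e201 + ((-11 / 4) * lam + (-39 / 8) * lam ^ 2 + (-5 / 8) * lam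
      ^ 3) * z11 + ((5 / 2) * lam + (33 / 8) * lam ^ 2 + (13 / 8) * lam ^ 3) * z00 + ((5 / 2) *
      lam + (33 / 8) * lam ^ 2 + (13 / 8) * lam ^ 3) * z10
  have z21 : t 2 1 = 0 := by
    linear_combination (-11 / 18 + (-151 / 36) * lam + (-13 / 9) * lam ^ 2) * e400 + (1 / 6 + (41
      / 36) * lam + (13 / 36) * lam ^ 2) * e401 + ((-1 / 12) * lam + (-1 / 18) * lam ^ 2) * e430 +
      ((10 / 9) * lam + (5 / 12) * lam ^ 2) * e410 + ((-5 / 12) * lam + (-5 / 36) * lam ^ 2) *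
      e411 + (1 / 3 + (43 / 18) * lam + (13 / 9) * lam ^ 2) * e300 + ((-5 / 6) * lam + (-5 / 9) *
      lam ^ 2) * e310 + (35 / 18 + (26 / 9) * lam) * e200 - (11 / 6) * e201 + (-1 + (-10 / 9) *
      lam) * e210 + ((5 / 3) * lam + (13 / 12) * lam ^ 2) * z00 + ((5 / 3) * lam + (13 / 12) * lam
      ^ 2) * z10 + (-1 + (-17 / 6) * lam + (-5 / 12) * lam ^ 2) * z11 + (1 + (7 / 6) * lam + (-2 /
      3) * lam ^ 2) * z22
  have z20 : t 2 0 = 0 := by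
    linear_combination e201 - 2 * e200 + (-lam) * z21 + (-1 - 2 * lam) * z10 + (2 * lam) * z22 +
      (-2 * lam) * z00
  have z33 : t 3 3 = 0 := by
    refine (mul_eq_zero.1 ?_).resolve_left hl
    linear_combination (5 / 2 + (3 / 2) * lam) * e300 + (-1 + (-1 / 2) * lam) * e301 + ((-1 / 2) *
      lam) * e320 + ((5 / 2) * lam + (3 / 2) * lam ^ 2) * z00 + (3 / 2 + (11 / 2) * lam + 3 * lam
      ^ 2) * z10 + (3 / 2 + 3 * lam + (3 / 2) * lam ^ 2) * z20 + ((-3 / 2) * lam + (-3 / 2) * lam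
      ^ 2) * z22
  have z32 : t 3 2 = 0 := by
    -- The exceptional weight lam = -2 corresponds by conjugation to mu = 3.
    refine (mul_eq_zero.1 ?_).resolve_left (sub_ne_zero.2 h3)
    linear_combination -e320 + (3 + 3 * lam) * z33 + (-3 - 3 * lam) * z22
  have z31 : t 3 1 = 0 := by
    linear_combination e311 - 2 * e310 + (-1 - 2 * lam) * z32 + (-3 - 3 * lam) * z21 + (2 + 6 *
      lam) * z33 + (-2 - 6 * lam) * z11
  have z30 : t 3 0 = 0 := by
    linear_combination e301 - 3 * e300 + (-lam) * z32 + (-2 - 6 * lam) * z10 + (-3 - 3 * lam) *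
      z20 + (3 * lam) * z33 + (-3 * lam) * z00
  have z44 : t 4 4 = 0 := by
    linear_combination (4 + (3 / 2) * lam) * e410 + (-3 / 2 + (-1 / 2) * lam) * e411 + (-1 / 2 +
      (-1 / 5) * lam) * e430 + (-143 / 10 + (-26 / 5) * lam) * e400 + (39 / 10 + (13 / 10) * lam)
      * e401 + (4 + (35 / 2) * lam + 6 * lam ^ 2) * z11 + (10 + 19 * lam + 6 * lam ^ 2) * z21 + (6
      + 7 * lam + 2 * lam ^ 2) * z31 + (-3 + (-16 / 5) * lam + (-4 / 5) * lam ^ 2) * z33 + ((-143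
      / 10) * lam + (-26 / 5) * lam ^ 2) * z00 + (-52 / 5 + (-91 / 2) * lam + (-78 / 5) * lam ^ 2)
      * z10 + (-26 + (-247 / 5) * lam + (-78 / 5) * lam ^ 2) * z20 + (-78 / 5 + (-91 / 5) * lam +
      (-26 / 5) * lam ^ 2) * z30
  have z43 : t 4 3 = 0 := by
    linear_combination -(1 / 6) * e402 - (5 / 3) * e400 + (2 / 3) * e401 + (5 / 6) * e420 - (1 /
      2) * e421 - (5 / 6) * e430 + (-2 - 3 * lam) * z20 + (-1 + (-2 / 3) * lam) * z30 + (5 / 3) *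
      z44 + ((-5 / 3) * lam) * z00 + (-1 - 4 * lam) * z10 + (10 / 3 + 5 * lam) * z22 + (2 + (4 /
      3) * lam) * z32 + (-5 + (-10 / 3) * lam) * z33
  have z42 : t 4 2 = 0 := by
    linear_combination e421 - 2 * e420 + (-3 - 3 * lam) * z43 + (-6 - 4 * lam) * z32 + (8 + 12 *
      lam) * z44 + (-8 - 12 * lam) * z22
  have z41 : t 4 1 = 0 := by
    linear_combination e411 - 3 * e410 + (-1 - 3 * lam) * z43 + (-8 - 12 * lam) * z21 + (-6 - 4 *
      lam) * z31 + (3 + 12 * lam) * z44 + (-3 - 12 * lam) * z11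
  have z40 : t 4 0 = 0 := by
    linear_combination e401 - 4 * e400 + (-lam) * z43 + (-3 - 12 * lam) * z10 + (-8 - 12 * lam) *
      z20 + (-6 - 4 * lam) * z30 + (4 * lam) * z44 + (-4 * lam) * z00
  refine eq_zero_of_mem_symMat ht fun i hi j hj => ?_
  interval_cases i <;> interval_cases j <;> assumption

theorem rank_four_le_of_sub_eq_two [CharZero K] {lam : K} (hl : lam ≠ 0) (h1 : lam ≠ -1) (h2 : lam
    ≠ -(1 / 2)) (h3 : 2 * lam ^ 2 + 2 * lam + 1 ≠ 0) :
    Module.rank K (symMat 4 lam (lam + 2)) ≤ 1 := by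
  have h := rank_le_of_functionals (symMat 4 lam (lam + 2))
    ![entry 0 0] fun t ht hf => ?_
  · exact_mod_cast h
  have h3' : 1 + 2 * lam + 2 * lam ^ 2 ≠ 0 := fun h => h3 (by linear_combination h)
  have hu : ∀ i p, i < p → t i p = 0 := fun i p h => ht.1 i p (by omega)
  have z00 : t 0 0 = 0 := hf 0
  have e100 := eq_zero_of_symEq_eq ht (symEq_1_0_0 t _ _)
  have e200 := eq_zero_of_symEq_eq ht (symEq_2_0_0 t _ _)
  have e201 := eq_zero_of_symEq_eq ht (symEq_2_0_1 t _ _)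
  have e210 := eq_zero_of_symEq_eq ht (symEq_2_1_0 t _ _ hu)
  have e300 := eq_zero_of_symEq_eq ht (symEq_3_0_0 t _ _)
  have e302 := eq_zero_of_symEq_eq ht (symEq_3_0_2 t _ _)
  have e310 := eq_zero_of_symEq_eq ht (symEq_3_1_0 t _ _ hu)
  have e311 := eq_zero_of_symEq_eq ht (symEq_3_1_1 t _ _)
  have e320 := eq_zero_of_symEq_eq ht (symEq_3_2_0 t _ _ hu)
  have e400 := eq_zero_of_symEq_eq ht (symEq_4_0_0 t _ _)
  have e401 := eq_zero_of_symEq_eq ht (symEq_4_0_1 t _ _)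
  have e402 := eq_zero_of_symEq_eq ht (symEq_4_0_2 t _ _)
  have e410 := eq_zero_of_symEq_eq ht (symEq_4_1_0 t _ _ hu)
  have e411 := eq_zero_of_symEq_eq ht (symEq_4_1_1 t _ _)
  have e420 := eq_zero_of_symEq_eq ht (symEq_4_2_0 t _ _ hu)
  have e421 := eq_zero_of_symEq_eq ht (symEq_4_2_1 t _ _)
  have e430 := eq_zero_of_symEq_eq ht (symEq_4_3_0 t _ _ hu)
  have z11 : t 1 1 = 0 := by
    refine (mul_eq_zero.1 ?_).resolve_left (mul_ne_zero (mul_ne_zero hl (sub_ne_zero.2 h1)) (sub_ne_zero.2 h2))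
    linear_combination (1 / 4 + (1 / 2) * lam) * e200 + ((-1 / 4) * lam) * e210 + (1 / 4 + lam +
      lam ^ 2) * e100 + ((1 / 2) * lam + (3 / 2) * lam ^ 2 + lam ^ 3) * z00
  have z10 : t 1 0 = 0 := by linear_combination e100 + (-lam) * z11 + lam * z00
  have z22 : t 2 2 = 0 := by
    linear_combination e210 - 2 * e200 + (1 + 2 * lam) * z11 + (-2 * lam) * z00 + (-2 - 4 * lam) *
      z10
  have z21 : t 2 1 = 0 := by
    -- The entry t_21 is free in order three. The equations of order four multiply it by 2 lam² + 2
    -- lam + 1.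
    refine (mul_eq_zero.1 ?_).resolve_left h3'
    linear_combination -(1 / 3) * e411 + (5 / 6) * e410 + (-1 / 12 + (5 / 12) * lam + (5 / 2) *
      lam ^ 2) * e430 + (10 / 3 + (20 / 3) * lam) * e401 + (-5 - 10 * lam) * e400 + (1 / 18 + (-5
      / 9) * lam) * e421 + (-1 / 12 + (-5 / 3) * lam ^ 2) * e420 + (-1 + (-17 / 3) * lam + (-40 /
      3) * lam ^ 2 + (-20 / 3) * lam ^ 3) * e310 + (1 / 6 + (31 / 9) * lam + (110 / 9) * lam ^ 2 +
      (20 / 3) * lam ^ 3) * e320 + (-15 - 55 * lam - 60 * lam ^ 2 - 20 * lam ^ 3) * e201 + (-5 / 3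
      + (-10 / 3) * lam) * e402 + (-5 + (-40 / 3) * lam + (-20 / 3) * lam ^ 2) * e302 + (-1 / 6 +
      (-16 / 3) * lam + (-91 / 3) * lam ^ 2 + (-140 / 3) * lam ^ 3 - 20 * lam ^ 4) * z11 + (-50 /
      3 - 95 * lam + (-550 / 3) * lam ^ 2 - 140 * lam ^ 3 - 40 * lam ^ 4) * z10 + (-5 * lam - 10 *
      lam ^ 2) * z00 + (1 / 6 + (31 / 3) * lam + (121 / 3) * lam ^ 2 + (140 / 3) * lam ^ 3 + 20 *
      lam ^ 4) * z22
  have z20 : t 2 0 = 0 := by linear_combination e201 + (-lam) * z21 + (1 + 2 * lam) * z10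
  have z33 : t 3 3 = 0 := by
    linear_combination (3 + 6 * lam) * e302 + (-1 / 2 + 6 * lam + 6 * lam ^ 2) * e310 + (1 / 2 - 3
      * lam) * e311 + (1 / 2 - 2 * lam - 6 * lam ^ 2) * e320 + (9 + 27 * lam + 18 * lam ^ 2) * z20
      + (-1 / 2 + (9 / 2) * lam + 24 * lam ^ 2 + 18 * lam ^ 3) * z11 + (9 * lam + 27 * lam ^ 2 +
      18 * lam ^ 3) * z21 + (3 / 2 + (-9 / 2) * lam - 24 * lam ^ 2 - 18 * lam ^ 3) * z22
  have z32 : t 3 2 = 0 := by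
    linear_combination -e320 + (3 + 3 * lam) * z33 + (-3 - 3 * lam) * z22
  have z31 : t 3 1 = 0 := by
    linear_combination -e310 + (1 + 3 * lam) * z33 + (-1 - 3 * lam) * z11 + (-3 - 3 * lam) * z21
  have z30 : t 3 0 = 0 := by
    linear_combination -e300 + lam * z33 + (-lam) * z00 + (-1 - 3 * lam) * z10 + (-3 - 3 * lam) *
      z20
  have z44 : t 4 4 = 0 := by
    linear_combination (2 / 3) * e421 - e420 + 4 * e401 - 14 * e400 - 2 * e411 + 5 * e410 + (-2 +
      (-4 / 3) * lam) * z32 + (-4 - 6 * lam) * z22 + (-10 - 40 * lam) * z10 + (-24 - 36 * lam) *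
      z20 + (-12 - 8 * lam) * z30 + (-14 * lam) * z00 + (12 + 18 * lam) * z21 + (6 + 4 * lam) *
      z31 + (5 + 20 * lam) * z11
  have z43 : t 4 3 = 0 := by
    linear_combination -(1 / 2) * e430 + (3 + 2 * lam) * z44 + (-3 - 2 * lam) * z33
  have z42 : t 4 2 = 0 := by
    linear_combination -(1 / 2) * e420 + (2 + 3 * lam) * z44 + (-2 - 3 * lam) * z22 + (-3 - 2 *
      lam) * z32
  have z41 : t 4 1 = 0 := by
    linear_combination -(1 / 2) * e410 + (1 / 2 + 2 * lam) * z44 + (-1 / 2 - 2 * lam) * z11 + (-2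
      - 3 * lam) * z21 + (-3 - 2 * lam) * z31
  have z40 : t 4 0 = 0 := by
    linear_combination -(1 / 2) * e400 + ((1 / 2) * lam) * z44 + ((-1 / 2) * lam) * z00 + (-1 / 2
      - 2 * lam) * z10 + (-2 - 3 * lam) * z20 + (-3 - 2 * lam) * z30
  refine eq_zero_of_mem_symMat ht fun i hi j hj => ?_
  interval_cases i <;> interval_cases j <;> assumption

theorem rank_four_le_neg_half [CharZero K] :
    Module.rank K (symMat 4 (-1 / 2 : K) (3 / 2)) ≤ 2 := by
  have h := rank_le_of_functionals (symMat 4 (-1 / 2 : K) (3 / 2))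
    ![entry 0 0, entry 3 3] fun t ht hf => ?_
  · exact_mod_cast h
  have hu : ∀ i p, i < p → t i p = 0 := fun i p h => ht.1 i p (by omega)
  have z00 : t 0 0 = 0 := hf 0
  have z33 : t 3 3 = 0 := hf 1
  have e100 := eq_zero_of_symEq_eq ht (symEq_1_0_0 t _ _)
  have e200 := eq_zero_of_symEq_eq ht (symEq_2_0_0 t _ _)
  have e201 := eq_zero_of_symEq_eq ht (symEq_2_0_1 t _ _)
  have e300 := eq_zero_of_symEq_eq ht (symEq_3_0_0 t _ _)
  have e302 := eq_zero_of_symEq_eq ht (symEq_3_0_2 t _ _)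
  have e310 := eq_zero_of_symEq_eq ht (symEq_3_1_0 t _ _ hu)
  have e320 := eq_zero_of_symEq_eq ht (symEq_3_2_0 t _ _ hu)
  have e400 := eq_zero_of_symEq_eq ht (symEq_4_0_0 t _ _)
  have e410 := eq_zero_of_symEq_eq ht (symEq_4_1_0 t _ _ hu)
  have e412 := eq_zero_of_symEq_eq ht (symEq_4_1_2 t _ _)
  have e420 := eq_zero_of_symEq_eq ht (symEq_4_2_0 t _ _ hu)
  have e421 := eq_zero_of_symEq_eq ht (symEq_4_2_1 t _ _)
  have e430 := eq_zero_of_symEq_eq ht (symEq_4_3_0 t _ _ hu)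
  have z11 : t 1 1 = 0 := by linear_combination 2 * e310 - 4 * e302 + z33 - 6 * e201
  have z10 : t 1 0 = 0 := by linear_combination e100 + (1 / 2) * z11 - (1 / 2) * z00
  have z22 : t 2 2 = 0 := by linear_combination -2 * e200 + z00
  have z21 : t 2 1 = 0 := by
    linear_combination (2 / 3) * e421 - e420 + (1 / 2) * e430 - (2 / 3) * e412 + e410 - (8 / 3) *
      e302 + (4 / 3) * e320 - 4 * e201 + z22 - z11
  have z20 : t 2 0 = 0 := by linear_combination e201 + (1 / 2) * z21
  have z32 : t 3 2 = 0 := by linear_combination -e320 + (3 / 2) * z33 - (3 / 2) * z22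
  have z31 : t 3 1 = 0 := by linear_combination -2 * e302 - 3 * z20
  have z30 : t 3 0 = 0 := by
    linear_combination -e300 - (1 / 2) * z33 + (1 / 2) * z00 + (1 / 2) * z10 - (3 / 2) * z20
  have z44 : t 4 4 = 0 := by linear_combination (2 / 3) * e412 - e410 - (4 / 3) * z31 + z11 - z21
  have z43 : t 4 3 = 0 := by linear_combination -(1 / 2) * e430 + 2 * z44 - 2 * z33
  have z42 : t 4 2 = 0 := by
    linear_combination -(1 / 2) * e420 + (1 / 2) * z44 - (1 / 2) * z22 - 2 * z32
  have z41 : t 4 1 = 0 := by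
    linear_combination -(1 / 2) * e410 - (1 / 2) * z44 + (1 / 2) * z11 - (1 / 2) * z21 - 2 * z31
  have z40 : t 4 0 = 0 := by
    linear_combination -(1 / 2) * e400 - (1 / 4) * z44 + (1 / 4) * z00 + (1 / 2) * z10 - (1 / 2) *
      z20 - 2 * z30
  refine eq_zero_of_mem_symMat ht fun i hi j hj => ?_
  interval_cases i <;> interval_cases j <;> assumption

end CircleDensity

/-! ### Upper bounds in order five at special weights -/

namespace CircleDensity

variable {K : Type*} [Field K]

/-- With the equations of order five, t_21 is eliminated with pivot one, so the two roots of the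
quadratic relation are no longer exceptional. -/
theorem rank_five_le_of_sub_eq_two [CharZero K] {lam : K} (hl : lam ≠ 0) (h1 : lam ≠ -1) (h2 : lam
    ≠ -(1 / 2)) :
    Module.rank K (symMat 5 lam (lam + 2)) ≤ 1 := by
  have h := rank_le_of_functionals (symMat 5 lam (lam + 2))
    ![entry 0 0] fun t ht hf => ?_
  · exact_mod_cast h
  have hu : ∀ i p, i < p → t i p = 0 := fun i p h => ht.1 i p (by omega)
  have z00 : t 0 0 = 0 := hf 0
  have e100 := eq_zero_of_symEq_eq ht (symEq_1_0_0 t _ _)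
  have e200 := eq_zero_of_symEq_eq ht (symEq_2_0_0 t _ _)
  have e201 := eq_zero_of_symEq_eq ht (symEq_2_0_1 t _ _)
  have e210 := eq_zero_of_symEq_eq ht (symEq_2_1_0 t _ _ hu)
  have e300 := eq_zero_of_symEq_eq ht (symEq_3_0_0 t _ _)
  have e302 := eq_zero_of_symEq_eq ht (symEq_3_0_2 t _ _)
  have e310 := eq_zero_of_symEq_eq ht (symEq_3_1_0 t _ _ hu)
  have e311 := eq_zero_of_symEq_eq ht (symEq_3_1_1 t _ _)
  have e320 := eq_zero_of_symEq_eq ht (symEq_3_2_0 t _ _ hu)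
  have e400 := eq_zero_of_symEq_eq ht (symEq_4_0_0 t _ _)
  have e401 := eq_zero_of_symEq_eq ht (symEq_4_0_1 t _ _)
  have e402 := eq_zero_of_symEq_eq ht (symEq_4_0_2 t _ _)
  have e410 := eq_zero_of_symEq_eq ht (symEq_4_1_0 t _ _ hu)
  have e411 := eq_zero_of_symEq_eq ht (symEq_4_1_1 t _ _)
  have e420 := eq_zero_of_symEq_eq ht (symEq_4_2_0 t _ _ hu)
  have e421 := eq_zero_of_symEq_eq ht (symEq_4_2_1 t _ _)
  have e430 := eq_zero_of_symEq_eq ht (symEq_4_3_0 t _ _ hu)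
  have e500 := eq_zero_of_symEq_eq ht (symEq_5_0_0 t _ _)
  have e501 := eq_zero_of_symEq_eq ht (symEq_5_0_1 t _ _)
  have e510 := eq_zero_of_symEq_eq ht (symEq_5_1_0 t _ _ hu)
  have e511 := eq_zero_of_symEq_eq ht (symEq_5_1_1 t _ _)
  have e520 := eq_zero_of_symEq_eq ht (symEq_5_2_0 t _ _ hu)
  have e521 := eq_zero_of_symEq_eq ht (symEq_5_2_1 t _ _)
  have e530 := eq_zero_of_symEq_eq ht (symEq_5_3_0 t _ _ hu)
  have e531 := eq_zero_of_symEq_eq ht (symEq_5_3_1 t _ _)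
  have e540 := eq_zero_of_symEq_eq ht (symEq_5_4_0 t _ _ hu)
  have z11 : t 1 1 = 0 := by
    refine (mul_eq_zero.1 ?_).resolve_left (mul_ne_zero (mul_ne_zero hl (sub_ne_zero.2 h1)) (sub_ne_zero.2 h2))
    linear_combination (1 / 4 + (1 / 2) * lam) * e200 + ((-1 / 4) * lam) * e210 + (1 / 4 + lam +
      lam ^ 2) * e100 + ((1 / 2) * lam + (3 / 2) * lam ^ 2 + lam ^ 3) * z00
  have z10 : t 1 0 = 0 := by linear_combination e100 + (-lam) * z11 + lam * z00
  have z22 : t 2 2 = 0 := by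
    linear_combination e210 - 2 * e200 + (1 + 2 * lam) * z11 + (-2 * lam) * z00 + (-2 - 4 * lam) *
      z10
  have z21 : t 2 1 = 0 := by
    linear_combination -(1 / 50) * e531 + (1 / 30) * e530 + (2 / 5) * e501 - (28 / 15) * e500 - (1
      / 5) * e511 + (11 / 15) * e510 + (2 / 25) * e521 - (16 / 75) * e520 + (-12 - 26 * lam) *
      e400 + (11 / 6 + (4 / 3) * lam) * e410 + (1 / 60 + (-1 / 5) * lam + (-11 / 3) * lam ^ 2) *
      e420 + (-19 / 60 + (53 / 60) * lam + (11 / 2) * lam ^ 2) * e430 + (2 / 3 + (8 / 3) * lam) *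
      e300 + (-71 / 30 + (-206 / 15) * lam + (-88 / 3) * lam ^ 2 + (-44 / 3) * lam ^ 3) * e310 +
      (4 / 15 + (356 / 45) * lam + (242 / 9) * lam ^ 2 + (44 / 3) * lam ^ 3) * e320 + (-496 / 45 +
      (-88 / 3) * lam + (-44 / 3) * lam ^ 2) * e302 + (1 / 30 + (2 / 45) * lam) * e311 + (-526 /
      15 + (-1876 / 15) * lam - 132 * lam ^ 2 - 44 * lam ^ 3) * e201 + (-11 / 3 + (-22 / 3) * lam)
      * e402 + (8 + 16 * lam) * e401 + (-1 + (-2 / 3) * lam) * e411 + (1 / 6 - lam) * e421 + (-598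
      / 15 + (-3358 / 15) * lam + (-6212 / 15) * lam ^ 2 - 308 * lam ^ 3 - 88 * lam ^ 4) * z10 +
      ((-66 / 5) * lam + (-70 / 3) * lam ^ 2) * z00 + (1 / 5 + (-17 / 2) * lam + (-326 / 5) * lam
      ^ 2 + (-308 / 3) * lam ^ 3 - 44 * lam ^ 4) * z11 + (-1 / 5 + (217 / 10) * lam + (1328 / 15)
      * lam ^ 2 + (308 / 3) * lam ^ 3 + 44 * lam ^ 4) * z22
  have z20 : t 2 0 = 0 := by linear_combination e201 + (-lam) * z21 + (1 + 2 * lam) * z10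
  have z33 : t 3 3 = 0 := by
    linear_combination (3 + 6 * lam) * e302 + (-1 / 2 + 6 * lam + 6 * lam ^ 2) * e310 + (1 / 2 - 3
      * lam) * e311 + (1 / 2 - 2 * lam - 6 * lam ^ 2) * e320 + (9 + 27 * lam + 18 * lam ^ 2) * z20
      + (-1 / 2 + (9 / 2) * lam + 24 * lam ^ 2 + 18 * lam ^ 3) * z11 + (9 * lam + 27 * lam ^ 2 +
      18 * lam ^ 3) * z21 + (3 / 2 + (-9 / 2) * lam - 24 * lam ^ 2 - 18 * lam ^ 3) * z22
  have z32 : t 3 2 = 0 := by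
    linear_combination -e320 + (3 + 3 * lam) * z33 + (-3 - 3 * lam) * z22
  have z31 : t 3 1 = 0 := by
    linear_combination -e310 + (1 + 3 * lam) * z33 + (-1 - 3 * lam) * z11 + (-3 - 3 * lam) * z21
  have z30 : t 3 0 = 0 := by
    linear_combination -e300 + lam * z33 + (-lam) * z00 + (-1 - 3 * lam) * z10 + (-3 - 3 * lam) *
      z20
  have z44 : t 4 4 = 0 := by
    linear_combination (2 / 3) * e421 - e420 + 4 * e401 - 14 * e400 - 2 * e411 + 5 * e410 + (-2 +
      (-4 / 3) * lam) * z32 + (-4 - 6 * lam) * z22 + (-10 - 40 * lam) * z10 + (-24 - 36 * lam) *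
      z20 + (-12 - 8 * lam) * z30 + (-14 * lam) * z00 + (12 + 18 * lam) * z21 + (6 + 4 * lam) *
      z31 + (5 + 20 * lam) * z11
  have z43 : t 4 3 = 0 := by
    linear_combination -(1 / 2) * e430 + (3 + 2 * lam) * z44 + (-3 - 2 * lam) * z33
  have z42 : t 4 2 = 0 := by
    linear_combination -(1 / 2) * e420 + (2 + 3 * lam) * z44 + (-2 - 3 * lam) * z22 + (-3 - 2 *
      lam) * z32
  have z41 : t 4 1 = 0 := by
    linear_combination -(1 / 2) * e410 + (1 / 2 + 2 * lam) * z44 + (-1 / 2 - 2 * lam) * z11 + (-2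
      - 3 * lam) * z21 + (-3 - 2 * lam) * z31
  have z40 : t 4 0 = 0 := by
    linear_combination -(1 / 2) * e400 + ((1 / 2) * lam) * z44 + ((-1 / 2) * lam) * z00 + (-1 / 2
      - 2 * lam) * z10 + (-2 - 3 * lam) * z20 + (-3 - 2 * lam) * z30
  have z55 : t 5 5 = 0 := by
    linear_combination (3 / 4) * e521 - 2 * e520 + (15 / 2) * e501 - 35 * e500 - 3 * e511 + 11 *
      e510 + (-25 / 2 + (-25 / 2) * lam) * z32 + (-5 + (-5 / 2) * lam) * z42 + (-10 - 20 * lam) *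
      z22 + (-55 / 2 + (-275 / 2) * lam) * z10 + (-100 - 200 * lam) * z20 + (-125 - 125 * lam) *
      z30 + (-50 - 25 * lam) * z40 + (-35 * lam) * z00 + (40 + 80 * lam) * z21 + (50 + 50 * lam) *
      z31 + (20 + 10 * lam) * z41 + (11 + 55 * lam) * z11
  have z54 : t 5 4 = 0 := by
    linear_combination -(1 / 3) * e540 + (10 / 3 + (5 / 3) * lam) * z55 + (-10 / 3 + (-5 / 3) *
      lam) * z44
  have z53 : t 5 3 = 0 := by
    linear_combination -(1 / 3) * e530 + (10 / 3 + (10 / 3) * lam) * z55 + (-10 / 3 + (-10 / 3) *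
      lam) * z33 + (-10 / 3 + (-5 / 3) * lam) * z43
  have z52 : t 5 2 = 0 := by
    linear_combination -(1 / 3) * e520 + (5 / 3 + (10 / 3) * lam) * z55 + (-5 / 3 + (-10 / 3) *
      lam) * z22 + (-10 / 3 + (-10 / 3) * lam) * z32 + (-10 / 3 + (-5 / 3) * lam) * z42
  have z51 : t 5 1 = 0 := by
    linear_combination -(1 / 3) * e510 + (1 / 3 + (5 / 3) * lam) * z55 + (-1 / 3 + (-5 / 3) * lam)
      * z11 + (-5 / 3 + (-10 / 3) * lam) * z21 + (-10 / 3 + (-10 / 3) * lam) * z31 + (-10 / 3 +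
      (-5 / 3) * lam) * z41
  have z50 : t 5 0 = 0 := by
    linear_combination -(1 / 3) * e500 + ((1 / 3) * lam) * z55 + ((-1 / 3) * lam) * z00 + (-1 / 3
      + (-5 / 3) * lam) * z10 + (-5 / 3 + (-10 / 3) * lam) * z20 + (-10 / 3 + (-10 / 3) * lam) *
      z30 + (-10 / 3 + (-5 / 3) * lam) * z40
  refine eq_zero_of_mem_symMat ht fun i hi j hj => ?_
  interval_cases i <;> interval_cases j <;> assumption

theorem rank_five_le_neg_two_thirds [CharZero K] :
    Module.rank K (symMat 5 (-2 / 3 : K) (5 / 3)) ≤ 2 := by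
  have h := rank_le_of_functionals (symMat 5 (-2 / 3 : K) (5 / 3))
    ![entry 0 0, entry 3 3] fun t ht hf => ?_
  · exact_mod_cast h
  have hu : ∀ i p, i < p → t i p = 0 := fun i p h => ht.1 i p (by omega)
  have z00 : t 0 0 = 0 := hf 0
  have z33 : t 3 3 = 0 := hf 1
  have e100 := eq_zero_of_symEq_eq ht (symEq_1_0_0 t _ _)
  have e200 := eq_zero_of_symEq_eq ht (symEq_2_0_0 t _ _)
  have e201 := eq_zero_of_symEq_eq ht (symEq_2_0_1 t _ _)
  have e210 := eq_zero_of_symEq_eq ht (symEq_2_1_0 t _ _ hu)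
  have e300 := eq_zero_of_symEq_eq ht (symEq_3_0_0 t _ _)
  have e310 := eq_zero_of_symEq_eq ht (symEq_3_1_0 t _ _ hu)
  have e320 := eq_zero_of_symEq_eq ht (symEq_3_2_0 t _ _ hu)
  have e400 := eq_zero_of_symEq_eq ht (symEq_4_0_0 t _ _)
  have e401 := eq_zero_of_symEq_eq ht (symEq_4_0_1 t _ _)
  have e410 := eq_zero_of_symEq_eq ht (symEq_4_1_0 t _ _ hu)
  have e420 := eq_zero_of_symEq_eq ht (symEq_4_2_0 t _ _ hu)
  have e430 := eq_zero_of_symEq_eq ht (symEq_4_3_0 t _ _ hu)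
  have e500 := eq_zero_of_symEq_eq ht (symEq_5_0_0 t _ _)
  have e510 := eq_zero_of_symEq_eq ht (symEq_5_1_0 t _ _ hu)
  have e511 := eq_zero_of_symEq_eq ht (symEq_5_1_1 t _ _)
  have e520 := eq_zero_of_symEq_eq ht (symEq_5_2_0 t _ _ hu)
  have e521 := eq_zero_of_symEq_eq ht (symEq_5_2_1 t _ _)
  have e530 := eq_zero_of_symEq_eq ht (symEq_5_3_0 t _ _ hu)
  have e540 := eq_zero_of_symEq_eq ht (symEq_5_4_0 t _ _ hu)
  -- The difference t_11 - t_33 is a combination of the equations once order five is included; this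
  -- removes the third invariant of order four.
  have z11 : t 1 1 = 0 := by
    linear_combination -(3 / 26) * e511 + (87 / 208) * e510 + (15 / 208) * e540 + (103 / 910) *
      e521 - (309 / 1040) * e520 - (15 / 52) * e410 + (103 / 364) * e420 + (105 / 208) * e310 -
      (103 / 208) * e320 + z33
  have z10 : t 1 0 = 0 := by linear_combination (3 / 4) * e100 + (1 / 2) * z11 - (1 / 2) * z00
  have z22 : t 2 2 = 0 := by
    linear_combination (3 / 8) * e201 - (15 / 8) * e200 + (3 / 4) * e210 + (1 / 2) * z10 + (5 / 4)
      * z00 - (1 / 4) * z11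
  have z21 : t 2 1 = 0 := by linear_combination 3 * e210 + z22 - z11
  have z20 : t 2 0 = 0 := by linear_combination 3 * e200 + 2 * z22 - 2 * z00 - z10
  have z32 : t 3 2 = 0 := by linear_combination -(3 / 2) * e320 + (3 / 2) * z33 - (3 / 2) * z22
  have z31 : t 3 1 = 0 := by
    linear_combination -(3 / 2) * e310 - (3 / 2) * z33 + (3 / 2) * z11 - (3 / 2) * z21
  have z30 : t 3 0 = 0 := by
    linear_combination -(3 / 2) * e300 - z33 + z00 + (3 / 2) * z10 - (3 / 2) * z20
  have z44 : t 4 4 = 0 := by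
    linear_combination (15 / 14) * e401 - (51 / 14) * e400 - (3 / 7) * e430 + (30 / 7) * z10 - (10
      / 7) * z30 + (17 / 7) * z00 - (10 / 7) * z33
  have z43 : t 4 3 = 0 := by linear_combination -(3 / 5) * e430 + 2 * z44 - 2 * z33
  have z42 : t 4 2 = 0 := by linear_combination -(3 / 5) * e420 - 2 * z32
  have z41 : t 4 1 = 0 := by linear_combination -(3 / 5) * e410 - z44 + z11 - 2 * z31
  have z40 : t 4 0 = 0 := by
    linear_combination -(3 / 5) * e400 - (2 / 5) * z44 + (2 / 5) * z00 + z10 - 2 * z30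
  have z55 : t 5 5 = 0 := by
    linear_combination (8 / 35) * e521 - (3 / 5) * e520 - (26 / 21) * z32 - (20 / 21) * z42 + z22
  have z54 : t 5 4 = 0 := by linear_combination -(3 / 8) * e540 + (5 / 2) * z55 - (5 / 2) * z44
  have z53 : t 5 3 = 0 := by
    linear_combination -(3 / 8) * e530 + (5 / 4) * z55 - (5 / 4) * z33 - (5 / 2) * z43
  have z52 : t 5 2 = 0 := by
    linear_combination -(3 / 8) * e520 - (5 / 8) * z55 + (5 / 8) * z22 - (5 / 4) * z32 - (5 / 2) *
      z42
  have z51 : t 5 1 = 0 := by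
    linear_combination -(3 / 8) * e510 - (7 / 8) * z55 + (7 / 8) * z11 + (5 / 8) * z21 - (5 / 4) *
      z31 - (5 / 2) * z41
  have z50 : t 5 0 = 0 := by
    linear_combination -(3 / 8) * e500 - (1 / 4) * z55 + (1 / 4) * z00 + (7 / 8) * z10 + (5 / 8) *
      z20 - (5 / 4) * z30 - (5 / 2) * z40
  refine eq_zero_of_mem_symMat ht fun i hi j hj => ?_
  interval_cases i <;> interval_cases j <;> assumption

theorem rank_five_le_zero_five_quarters [CharZero K] :
    Module.rank K (symMat 5 (0 : K) (5 / 4)) ≤ 2 := by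
  have h := rank_le_of_functionals (symMat 5 (0 : K) (5 / 4))
    ![entry 0 0, entry 1 1] fun t ht hf => ?_
  · exact_mod_cast h
  have hu : ∀ i p, i < p → t i p = 0 := fun i p h => ht.1 i p (by omega)
  have z00 : t 0 0 = 0 := hf 0
  have z11 : t 1 1 = 0 := hf 1
  have e100 := eq_zero_of_symEq_eq ht (symEq_1_0_0 t _ _)
  have e200 := eq_zero_of_symEq_eq ht (symEq_2_0_0 t _ _)
  have e210 := eq_zero_of_symEq_eq ht (symEq_2_1_0 t _ _ hu)
  have e300 := eq_zero_of_symEq_eq ht (symEq_3_0_0 t _ _)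
  have e310 := eq_zero_of_symEq_eq ht (symEq_3_1_0 t _ _ hu)
  have e311 := eq_zero_of_symEq_eq ht (symEq_3_1_1 t _ _)
  have e320 := eq_zero_of_symEq_eq ht (symEq_3_2_0 t _ _ hu)
  have e400 := eq_zero_of_symEq_eq ht (symEq_4_0_0 t _ _)
  have e410 := eq_zero_of_symEq_eq ht (symEq_4_1_0 t _ _ hu)
  have e411 := eq_zero_of_symEq_eq ht (symEq_4_1_1 t _ _)
  have e420 := eq_zero_of_symEq_eq ht (symEq_4_2_0 t _ _ hu)
  have e430 := eq_zero_of_symEq_eq ht (symEq_4_3_0 t _ _ hu)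
  have e500 := eq_zero_of_symEq_eq ht (symEq_5_0_0 t _ _)
  have e510 := eq_zero_of_symEq_eq ht (symEq_5_1_0 t _ _ hu)
  have e511 := eq_zero_of_symEq_eq ht (symEq_5_1_1 t _ _)
  have e512 := eq_zero_of_symEq_eq ht (symEq_5_1_2 t _ _)
  have e520 := eq_zero_of_symEq_eq ht (symEq_5_2_0 t _ _ hu)
  have e530 := eq_zero_of_symEq_eq ht (symEq_5_3_0 t _ _ hu)
  have e540 := eq_zero_of_symEq_eq ht (symEq_5_4_0 t _ _ hu)
  have z10 : t 1 0 = 0 := by linear_combination 4 * e100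
  -- The equations of order five force t_22 = t_11, which excludes the third invariant of order
  -- four.
  have z22 : t 2 2 = 0 := by
    linear_combination -(42 / 5) * e512 - (126 / 5) * e510 - (56 / 25) * e530 + (357 / 20) * e511
      + (119 / 25) * e540 + (238 / 5) * e410 - (112 / 5) * e411 - (88 / 5) * e310 - (14 / 5) *
      e311 - (8 / 5) * e320 - (19 / 5) * e210 + z11
  have z21 : t 2 1 = 0 := by linear_combination -(4 / 3) * e210 + (4 / 3) * z22 - (4 / 3) * z11
  have z20 : t 2 0 = 0 := by linear_combination -(4 / 3) * e200 - (4 / 3) * z10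
  have z33 : t 3 3 = 0 := by
    linear_combination (7 / 2) * e311 - 5 * e310 + 2 * e320 - (9 / 2) * z21 - 5 * z11 + 6 * z22
  have z32 : t 3 2 = 0 := by linear_combination -(4 / 7) * e320 + (12 / 7) * z33 - (12 / 7) * z22
  have z31 : t 3 1 = 0 := by
    linear_combination -(4 / 7) * e310 + (4 / 7) * z33 - (4 / 7) * z11 - (12 / 7) * z21
  have z30 : t 3 0 = 0 := by linear_combination -(4 / 7) * e300 - (4 / 7) * z10 - (12 / 7) * z20
  have z44 : t 4 4 = 0 := by
    linear_combination -(11 / 5) * e411 + (29 / 5) * e410 - (4 / 5) * e430 + (72 / 5) * z21 + (42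
      / 5) * z31 + (29 / 5) * z11 - (24 / 5) * z33
  have z43 : t 4 3 = 0 := by
    linear_combination -(4 / 11) * e430 + (24 / 11) * z44 - (24 / 11) * z33
  have z42 : t 4 2 = 0 := by
    linear_combination -(4 / 11) * e420 + (16 / 11) * z44 - (16 / 11) * z22 - (24 / 11) * z32
  have z41 : t 4 1 = 0 := by
    linear_combination -(4 / 11) * e410 + (4 / 11) * z44 - (4 / 11) * z11 - (16 / 11) * z21 - (24
      / 11) * z31
  have z40 : t 4 0 = 0 := by
    linear_combination -(4 / 11) * e400 - (4 / 11) * z10 - (16 / 11) * z20 - (24 / 11) * z30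
  have z55 : t 5 5 = 0 := by
    linear_combination -(15 / 16) * e511 + (7 / 2) * e510 - (1 / 4) * e540 + (205 / 16) * z21 +
      (65 / 4) * z31 + (55 / 8) * z41 + (7 / 2) * z11 - (5 / 2) * z44
  have z54 : t 5 4 = 0 := by linear_combination -(4 / 15) * e540 + (8 / 3) * z55 - (8 / 3) * z44
  have z53 : t 5 3 = 0 := by
    linear_combination -(4 / 15) * e530 + (8 / 3) * z55 - (8 / 3) * z33 - (8 / 3) * z43
  have z52 : t 5 2 = 0 := by
    linear_combination -(4 / 15) * e520 + (4 / 3) * z55 - (4 / 3) * z22 - (8 / 3) * z32 - (8 / 3)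
      * z42
  have z51 : t 5 1 = 0 := by
    linear_combination -(4 / 15) * e510 + (4 / 15) * z55 - (4 / 15) * z11 - (4 / 3) * z21 - (8 /
      3) * z31 - (8 / 3) * z41
  have z50 : t 5 0 = 0 := by
    linear_combination -(4 / 15) * e500 - (4 / 15) * z10 - (4 / 3) * z20 - (8 / 3) * z30 - (8 / 3)
      * z40
  refine eq_zero_of_mem_symMat ht fun i hi j hj => ?_
  interval_cases i <;> interval_cases j <;> assumption

theorem rank_five_le_zero_three [CharZero K] :
    Module.rank K (symMat 5 (0 : K) 3) ≤ 2 := by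
  have h := rank_le_of_functionals (symMat 5 (0 : K) 3)
    ![entry 0 0, entry 1 1] fun t ht hf => ?_
  · exact_mod_cast h
  have hu : ∀ i p, i < p → t i p = 0 := fun i p h => ht.1 i p (by omega)
  have z00 : t 0 0 = 0 := hf 0
  have z11 : t 1 1 = 0 := hf 1
  have e100 := eq_zero_of_symEq_eq ht (symEq_1_0_0 t _ _)
  have e200 := eq_zero_of_symEq_eq ht (symEq_2_0_0 t _ _)
  have e210 := eq_zero_of_symEq_eq ht (symEq_2_1_0 t _ _ hu)
  have e301 := eq_zero_of_symEq_eq ht (symEq_3_0_1 t _ _)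
  have e310 := eq_zero_of_symEq_eq ht (symEq_3_1_0 t _ _ hu)
  have e311 := eq_zero_of_symEq_eq ht (symEq_3_1_1 t _ _)
  have e320 := eq_zero_of_symEq_eq ht (symEq_3_2_0 t _ _ hu)
  have e400 := eq_zero_of_symEq_eq ht (symEq_4_0_0 t _ _)
  have e410 := eq_zero_of_symEq_eq ht (symEq_4_1_0 t _ _ hu)
  have e412 := eq_zero_of_symEq_eq ht (symEq_4_1_2 t _ _)
  have e420 := eq_zero_of_symEq_eq ht (symEq_4_2_0 t _ _ hu)
  have e430 := eq_zero_of_symEq_eq ht (symEq_4_3_0 t _ _ hu)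
  have e500 := eq_zero_of_symEq_eq ht (symEq_5_0_0 t _ _)
  have e510 := eq_zero_of_symEq_eq ht (symEq_5_1_0 t _ _ hu)
  have e511 := eq_zero_of_symEq_eq ht (symEq_5_1_1 t _ _)
  have e520 := eq_zero_of_symEq_eq ht (symEq_5_2_0 t _ _ hu)
  have e521 := eq_zero_of_symEq_eq ht (symEq_5_2_1 t _ _)
  have e530 := eq_zero_of_symEq_eq ht (symEq_5_3_0 t _ _ hu)
  have e540 := eq_zero_of_symEq_eq ht (symEq_5_4_0 t _ _ hu)
  have z10 : t 1 0 = 0 := by linear_combination (1 / 2) * e100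
  have z22 : t 2 2 = 0 := by
    linear_combination -(1 / 12) * e320 + (1 / 4) * e310 + (3 / 4) * e210 + z11
  have z21 : t 2 1 = 0 := by linear_combination e210 - z22 + z11
  have z20 : t 2 0 = 0 := by linear_combination e200 + z10
  have z33 : t 3 3 = 0 := by linear_combination e310 + z11 + 3 * z21
  -- This is the entry that carries the third invariant of order four; order five determines it from
  -- rows one and two.
  have z32 : t 3 2 = 0 := by
    linear_combination -(1 / 90) * e521 + (1 / 36) * e520 + (1 / 180) * e540 + (1 / 18) * e511 -
      (7 / 36) * e510 + (5 / 18) * e410 - (1 / 18) * e420 + (5 / 6) * e311 - (1 / 12) * z22 + (35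
      / 12) * z21 + (1 / 12) * z11
  have z31 : t 3 1 = 0 := by linear_combination e311 - z32 + 3 * z21
  have z30 : t 3 0 = 0 := by linear_combination e301 + z10 + 6 * z20
  have z44 : t 4 4 = 0 := by
    linear_combination (1 / 4) * e420 + (1 / 4) * e412 + z22 + (3 / 2) * z32 + (3 / 2) * z31
  have z43 : t 4 3 = 0 := by linear_combination -e430 + 6 * z44 - 6 * z33
  have z42 : t 4 2 = 0 := by linear_combination e412 + 6 * z31
  have z41 : t 4 1 = 0 := by linear_combination -e410 + z44 - z11 - 4 * z21 - 6 * z31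
  have z40 : t 4 0 = 0 := by linear_combination -e400 - z10 - 4 * z20 - 6 * z30
  have z55 : t 5 5 = 0 := by
    linear_combination (2 / 3) * e511 - (7 / 3) * e510 + (1 / 3) * e540 - (25 / 3) * z21 - 10 *
      z31 - (10 / 3) * z41 - (7 / 3) * z11 + (10 / 3) * z44
  have z54 : t 5 4 = 0 := by linear_combination -(1 / 2) * e540 + 5 * z55 - 5 * z44
  have z53 : t 5 3 = 0 := by linear_combination -(1 / 2) * e530 + 5 * z55 - 5 * z33 - 5 * z43
  have z52 : t 5 2 = 0 := by
    linear_combination -(1 / 2) * e520 + (5 / 2) * z55 - (5 / 2) * z22 - 5 * z32 - 5 * z42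
  have z51 : t 5 1 = 0 := by
    linear_combination -(1 / 2) * e510 + (1 / 2) * z55 - (1 / 2) * z11 - (5 / 2) * z21 - 5 * z31 -
      5 * z41
  have z50 : t 5 0 = 0 := by
    linear_combination -(1 / 2) * e500 - (1 / 2) * z10 - (5 / 2) * z20 - 5 * z30 - 5 * z40
  refine eq_zero_of_mem_symMat ht fun i hi j hj => ?_
  interval_cases i <;> interval_cases j <;> assumption

theorem rank_five_le_neg_quarter_one [CharZero K] :
    Module.rank K (symMat 5 (-1 / 4 : K) 1) ≤ 2 := by
  have h := rank_le_of_functionals (symMat 5 (-1 / 4 : K) 1)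
    ![entry 0 0, entry 1 1] fun t ht hf => ?_
  · exact_mod_cast h
  have hu : ∀ i p, i < p → t i p = 0 := fun i p h => ht.1 i p (by omega)
  have z00 : t 0 0 = 0 := hf 0
  have z11 : t 1 1 = 0 := hf 1
  have e100 := eq_zero_of_symEq_eq ht (symEq_1_0_0 t _ _)
  have e200 := eq_zero_of_symEq_eq ht (symEq_2_0_0 t _ _)
  have e210 := eq_zero_of_symEq_eq ht (symEq_2_1_0 t _ _ hu)
  have e300 := eq_zero_of_symEq_eq ht (symEq_3_0_0 t _ _)
  have e301 := eq_zero_of_symEq_eq ht (symEq_3_0_1 t _ _)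
  have e310 := eq_zero_of_symEq_eq ht (symEq_3_1_0 t _ _ hu)
  have e320 := eq_zero_of_symEq_eq ht (symEq_3_2_0 t _ _ hu)
  have e400 := eq_zero_of_symEq_eq ht (symEq_4_0_0 t _ _)
  have e401 := eq_zero_of_symEq_eq ht (symEq_4_0_1 t _ _)
  have e410 := eq_zero_of_symEq_eq ht (symEq_4_1_0 t _ _ hu)
  have e420 := eq_zero_of_symEq_eq ht (symEq_4_2_0 t _ _ hu)
  have e430 := eq_zero_of_symEq_eq ht (symEq_4_3_0 t _ _ hu)
  have e500 := eq_zero_of_symEq_eq ht (symEq_5_0_0 t _ _)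
  have e501 := eq_zero_of_symEq_eq ht (symEq_5_0_1 t _ _)
  have e510 := eq_zero_of_symEq_eq ht (symEq_5_1_0 t _ _ hu)
  have e511 := eq_zero_of_symEq_eq ht (symEq_5_1_1 t _ _)
  have e520 := eq_zero_of_symEq_eq ht (symEq_5_2_0 t _ _ hu)
  have e530 := eq_zero_of_symEq_eq ht (symEq_5_3_0 t _ _ hu)
  have e540 := eq_zero_of_symEq_eq ht (symEq_5_4_0 t _ _ hu)
  have z10 : t 1 0 = 0 := by linear_combination 4 * e100 + z11 - z00
  -- Order five fixes t_22, which detects the third invariant of order four.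
  have z22 : t 2 2 = 0 := by
    linear_combination (147 / 80) * e501 - (3479 / 400) * e500 - (49 / 400) * e540 - (189 / 160) *
      e511 + (441 / 100) * e510 + (343 / 80) * e400 - (441 / 160) * e410 - (279 / 80) * e300 - (9
      / 10) * e310 + (161 / 80) * e301 - (23 / 80) * e320 + (67 / 80) * e200 + (9 / 8) * e210 +
      (353 / 200) * z10 + (353 / 200) * z00 - (153 / 200) * z11
  have z21 : t 2 1 = 0 := by linear_combination -(4 / 3) * e210 + (2 / 3) * z22 - (2 / 3) * z11
  have z20 : t 2 0 = 0 := by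
    linear_combination -(4 / 3) * e200 - (1 / 3) * z22 + (1 / 3) * z00 - (2 / 3) * z10
  have z33 : t 3 3 = 0 := by
    linear_combination (7 / 2) * e301 - (17 / 2) * e300 - (1 / 2) * e320 - (5 / 4) * z10 - (27 /
      8) * z20 + (17 / 8) * z00 - (9 / 8) * z22
  have z32 : t 3 2 = 0 := by linear_combination -(4 / 7) * e320 + (9 / 7) * z33 - (9 / 7) * z22
  have z31 : t 3 1 = 0 := by
    linear_combination -(4 / 7) * e310 + (1 / 7) * z33 - (1 / 7) * z11 - (9 / 7) * z21
  have z30 : t 3 0 = 0 := by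
    linear_combination -(4 / 7) * e300 - (1 / 7) * z33 + (1 / 7) * z00 - (1 / 7) * z10 - (9 / 7) *
      z20
  have z44 : t 4 4 = 0 := by
    linear_combination (11 / 5) * e401 - 8 * e400 - (1 / 5) * e430 - 9 * z20 - 7 * z30 + 2 * z00 -
      z33
  have z43 : t 4 3 = 0 := by
    linear_combination -(4 / 11) * e430 + (20 / 11) * z44 - (20 / 11) * z33
  have z42 : t 4 2 = 0 := by
    linear_combination -(4 / 11) * e420 + (10 / 11) * z44 - (10 / 11) * z22 - (20 / 11) * z32
  have z41 : t 4 1 = 0 := by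
    linear_combination -(4 / 11) * e410 - (10 / 11) * z21 - (20 / 11) * z31
  have z40 : t 4 0 = 0 := by
    linear_combination -(4 / 11) * e400 - (1 / 11) * z44 + (1 / 11) * z00 - (10 / 11) * z20 - (20
      / 11) * z30
  have z55 : t 5 5 = 0 := by
    linear_combination (15 / 14) * e511 - 4 * e510 - (205 / 28) * z21 - (195 / 14) * z31 - (55 /
      8) * z41 + z11
  have z54 : t 5 4 = 0 := by linear_combination -(4 / 15) * e540 + (7 / 3) * z55 - (7 / 3) * z44
  have z53 : t 5 3 = 0 := by
    linear_combination -(4 / 15) * e530 + 2 * z55 - 2 * z33 - (7 / 3) * z43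
  have z52 : t 5 2 = 0 := by
    linear_combination -(4 / 15) * e520 + (2 / 3) * z55 - (2 / 3) * z22 - 2 * z32 - (7 / 3) * z42
  have z51 : t 5 1 = 0 := by
    linear_combination -(4 / 15) * e510 - (1 / 15) * z55 + (1 / 15) * z11 - (2 / 3) * z21 - 2 *
      z31 - (7 / 3) * z41
  have z50 : t 5 0 = 0 := by
    linear_combination -(4 / 15) * e500 - (1 / 15) * z55 + (1 / 15) * z00 + (1 / 15) * z10 - (2 /
      3) * z20 - 2 * z30 - (7 / 3) * z40
  refine eq_zero_of_mem_symMat ht fun i hi j hj => ?_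
  interval_cases i <;> interval_cases j <;> assumption

theorem rank_five_le_neg_two_one [CharZero K] :
    Module.rank K (symMat 5 (-2 : K) 1) ≤ 2 := by
  have h := rank_le_of_functionals (symMat 5 (-2 : K) 1)
    ![entry 0 0, entry 1 1] fun t ht hf => ?_
  · exact_mod_cast h
  have hu : ∀ i p, i < p → t i p = 0 := fun i p h => ht.1 i p (by omega)
  have z00 : t 0 0 = 0 := hf 0
  have z11 : t 1 1 = 0 := hf 1
  have e100 := eq_zero_of_symEq_eq ht (symEq_1_0_0 t _ _)
  have e200 := eq_zero_of_symEq_eq ht (symEq_2_0_0 t _ _)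
  have e210 := eq_zero_of_symEq_eq ht (symEq_2_1_0 t _ _ hu)
  have e300 := eq_zero_of_symEq_eq ht (symEq_3_0_0 t _ _)
  have e301 := eq_zero_of_symEq_eq ht (symEq_3_0_1 t _ _)
  have e311 := eq_zero_of_symEq_eq ht (symEq_3_1_1 t _ _)
  have e320 := eq_zero_of_symEq_eq ht (symEq_3_2_0 t _ _ hu)
  have e400 := eq_zero_of_symEq_eq ht (symEq_4_0_0 t _ _)
  have e410 := eq_zero_of_symEq_eq ht (symEq_4_1_0 t _ _ hu)
  have e412 := eq_zero_of_symEq_eq ht (symEq_4_1_2 t _ _)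
  have e420 := eq_zero_of_symEq_eq ht (symEq_4_2_0 t _ _ hu)
  have e430 := eq_zero_of_symEq_eq ht (symEq_4_3_0 t _ _ hu)
  have e500 := eq_zero_of_symEq_eq ht (symEq_5_0_0 t _ _)
  have e504 := eq_zero_of_symEq_eq ht (symEq_5_0_4 t _ _)
  have e510 := eq_zero_of_symEq_eq ht (symEq_5_1_0 t _ _ hu)
  have e511 := eq_zero_of_symEq_eq ht (symEq_5_1_1 t _ _)
  have e520 := eq_zero_of_symEq_eq ht (symEq_5_2_0 t _ _ hu)
  have e530 := eq_zero_of_symEq_eq ht (symEq_5_3_0 t _ _ hu)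
  have e540 := eq_zero_of_symEq_eq ht (symEq_5_4_0 t _ _ hu)
  have z10 : t 1 0 = 0 := by linear_combination (1 / 2) * e100 + z11 - z00
  have z22 : t 2 2 = 0 := by
    linear_combination -(1 / 6) * e320 + (1 / 4) * e300 - (3 / 4) * e200 + z00 + z10
  have z21 : t 2 1 = 0 := by linear_combination e210 + 3 * z22 - 3 * z11
  have z20 : t 2 0 = 0 := by linear_combination e200 + 2 * z22 - 2 * z00 - 3 * z10
  have z33 : t 3 3 = 0 := by
    linear_combination -(1 / 2) * e300 + z00 + (5 / 2) * z10 + (3 / 2) * z20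
  -- Order five fixes t_32, which detects the third invariant of order four.
  have z32 : t 3 2 = 0 := by
    linear_combination (1 / 60) * e511 - (7 / 120) * e504 - (7 / 120) * e540 - (1 / 3) * e311 + (3
      / 4) * z21
  have z31 : t 3 1 = 0 := by linear_combination e311 + 3 * z32 - 3 * z21
  have z30 : t 3 0 = 0 := by linear_combination e301 + 2 * z32 - 5 * z10 - 6 * z20
  have z44 : t 4 4 = 0 := by
    linear_combination -(1 / 8) * e420 + (1 / 24) * e412 + z22 + (1 / 4) * z32 - (1 / 12) * z31
  have z43 : t 4 3 = 0 := by linear_combination -e430 - 2 * z44 + 2 * z33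
  have z42 : t 4 2 = 0 := by linear_combination -(1 / 3) * e412 + (2 / 3) * z31
  have z41 : t 4 1 = 0 := by linear_combination -e410 - 7 * z44 + 7 * z11 + 8 * z21 + 2 * z31
  have z40 : t 4 0 = 0 := by
    linear_combination -e400 - 2 * z44 + 2 * z00 + 7 * z10 + 8 * z20 + 2 * z30
  have z55 : t 5 5 = 0 := by
    linear_combination -(1 / 9) * e510 + (1 / 9) * e504 + z11 + (5 / 3) * z21 + (10 / 9) * z31
  have z54 : t 5 4 = 0 := by linear_combination -(1 / 2) * e540
  have z53 : t 5 3 = 0 := by linear_combination -(1 / 2) * e530 - 5 * z55 + 5 * z33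
  have z52 : t 5 2 = 0 := by
    linear_combination -(1 / 2) * e520 - (15 / 2) * z55 + (15 / 2) * z22 + 5 * z32
  have z51 : t 5 1 = 0 := by linear_combination -(1 / 2) * e504
  have z50 : t 5 0 = 0 := by
    linear_combination -(1 / 2) * e500 - z55 + z00 + (9 / 2) * z10 + (15 / 2) * z20 + 5 * z30
  refine eq_zero_of_mem_symMat ht fun i hi j hj => ?_
  interval_cases i <;> interval_cases j <;> assumption

end CircleDensity

/-! ### Upper bounds on the hyperbola -/

namespace CircleDensity

variable {K : Type*} [Field K]

/-- As 3 lam + 1 ≠ 0, the curve determines δ rationally in `lam`, and multiples of `hh` eliminate δ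
from the equations. The pivot 1 + 3 lam + 3 lam² equals -(3 lam + 1)(δ - 2), so it vanishes only
where the curve meets mu - lam = 2; the values lam = 0 and lam = -2/3 are those with lam + mu = 1.
-/
theorem rank_three_le_of_hyperbola [CharZero K] {lam mu : K} (hl : lam ≠ 0) (hq : lam ≠ -(2 / 3))
    (hs : lam ≠ -(1 / 3)) (hh : (3 * lam + 1) * (mu - lam) = 1 + 3 * lam - 3 * lam ^ 2) (h3 : 1 + 3
    * lam + 3 * lam ^ 2 ≠ 0) :
    Module.rank K (symMat 3 lam mu) ≤ 2 := by
  have h := rank_le_of_functionals (symMat 3 lam mu)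
    ![entry 0 0, entry 1 0] fun t ht hf => ?_
  · exact_mod_cast h
  have hu : ∀ i p, i < p → t i p = 0 := fun i p h => ht.1 i p (by omega)
  have z00 : t 0 0 = 0 := hf 0
  have z10 : t 1 0 = 0 := hf 1
  have e100 := eq_zero_of_symEq_eq ht (symEq_1_0_0 t _ _)
  have e200 := eq_zero_of_symEq_eq ht (symEq_2_0_0 t _ _)
  have e201 := eq_zero_of_symEq_eq ht (symEq_2_0_1 t _ _)
  have e210 := eq_zero_of_symEq_eq ht (symEq_2_1_0 t _ _ hu)
  have e300 := eq_zero_of_symEq_eq ht (symEq_3_0_0 t _ _)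
  have e301 := eq_zero_of_symEq_eq ht (symEq_3_0_1 t _ _)
  have e302 := eq_zero_of_symEq_eq ht (symEq_3_0_2 t _ _)
  have e310 := eq_zero_of_symEq_eq ht (symEq_3_1_0 t _ _ hu)
  have e311 := eq_zero_of_symEq_eq ht (symEq_3_1_1 t _ _)
  have e320 := eq_zero_of_symEq_eq ht (symEq_3_2_0 t _ _ hu)
  have z11 : t 1 1 = 0 := by
    refine (mul_eq_zero.1 ?_).resolve_left (mul_ne_zero hl (sub_ne_zero.2 hs))
    linear_combination (1 / 3 + lam) * e100 + (lam ^ 2) * z10 - ((1 / 3) * t 1 0) * hh + ((1 / 3)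
      * lam + lam ^ 2) * z00
  have z22 : t 2 2 = 0 := by
    refine (mul_eq_zero.1 ?_).resolve_left (mul_ne_zero (mul_ne_zero hl hl) (sub_ne_zero.2 hs))
    linear_combination (1 / 6 + lam + 2 * lam ^ 2 + (3 / 2) * lam ^ 3) * e201 + (-1 / 6 - lam +
      (-5 / 2) * lam ^ 2 - 3 * lam ^ 3) * e200 + ((1 / 6) * lam + lam ^ 2 + (3 / 2) * lam ^ 3) *
      e210 - ((1 / 6 + (1 / 2) * lam) * t 2 0 + ((1 / 6) * lam + (1 / 2) * lam ^ 2) * t 2 1) * hh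
      + ((-1 / 2) * lam ^ 2 + (-5 / 2) * lam ^ 3 - 3 * lam ^ 4) * z10 + ((-1 / 6) * lam - lam ^ 2
      + (-5 / 2) * lam ^ 3 - 3 * lam ^ 4) * z00 + ((1 / 6) * lam + (4 / 3) * lam ^ 2 + (7 / 2) *
      lam ^ 3 + 3 * lam ^ 4) * z11
  have z21 : t 2 1 = 0 := by
    refine (mul_eq_zero.1 ?_).resolve_left h3
    linear_combination (-1 - 3 * lam) * e210 - (-t 2 1) * hh + (-1 - 5 * lam - 6 * lam ^ 2) * z11
      + (1 + 5 * lam + 6 * lam ^ 2) * z22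
  have z20 : t 2 0 = 0 := by
    linear_combination (1 + 9 * lam + 18 * lam ^ 2) * e200 + (-2 - 9 * lam - 9 * lam ^ 2) * e201 -
      (-3 * t 2 0) * hh + (-lam - 9 * lam ^ 2 - 18 * lam ^ 3) * z22 + (lam + 9 * lam ^ 2 + 18 *
      lam ^ 3) * z00 + (-1 - 2 * lam + 9 * lam ^ 2 + 18 * lam ^ 3) * z10 + (2 * lam + 9 * lam ^ 2
      + 9 * lam ^ 3) * z21
  have z33 : t 3 3 = 0 := by
    refine (mul_eq_zero.1 ?_).resolve_left (mul_ne_zero (mul_ne_zero hl (sub_ne_zero.2 hq)) (sub_ne_zero.2 hs))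
    linear_combination (-2 / 9 + (-4 / 3) * lam + (-7 / 3) * lam ^ 2 - lam ^ 3) * e301 + (5 / 9 +
      (10 / 3) * lam + 6 * lam ^ 2 + 3 * lam ^ 3) * e300 + ((-1 / 9) * lam + (-2 / 3) * lam ^ 2 -
      lam ^ 3) * e320 - ((-1 / 9 + (-1 / 3) * lam) * t 3 0 + ((-1 / 9) * lam + (-1 / 3) * lam ^ 2)
      * t 3 2) * hh + (1 / 3 + 3 * lam + (29 / 3) * lam ^ 2 + 13 * lam ^ 3 + 6 * lam ^ 4) * z10 +
      (1 / 3 + (7 / 3) * lam + 6 * lam ^ 2 + 7 * lam ^ 3 + 3 * lam ^ 4) * z20 + ((5 / 9) * lam +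
      (10 / 3) * lam ^ 2 + 6 * lam ^ 3 + 3 * lam ^ 4) * z00 + ((-1 / 3) * lam + (-7 / 3) * lam ^ 2
      - 5 * lam ^ 3 - 3 * lam ^ 4) * z22
  have z32 : t 3 2 = 0 := by
    linear_combination (-1 / 2 + (15 / 2) * lam + (63 / 2) * lam ^ 2 + (27 / 2) * lam ^ 3) * e320
      + (-15 / 4 + (-27 / 2) * lam + (-27 / 4) * lam ^ 2) * e302 + (-45 / 2 - 81 * lam + (-81 / 2)
      * lam ^ 2) * e300 + (45 / 4 + (81 / 2) * lam + (81 / 4) * lam ^ 2) * e301 + ((-15 / 2) * lam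
      - 27 * lam ^ 2 + (-27 / 2) * lam ^ 3) * e310 + ((15 / 4) * lam + (27 / 2) * lam ^ 2 + (27 /
      4) * lam ^ 3) * e311 - ((-1 / 2 + 9 * lam + (9 / 2) * lam ^ 2) * t 3 2) * hh + (3 / 2 + 9 *
      lam + (27 / 2) * lam ^ 2) * z33 + (-3 / 2 + 21 * lam + 117 * lam ^ 2 + 135 * lam ^ 3 + (81 /
      2) * lam ^ 4) * z22 + (-45 / 4 + (-207 / 4) * lam + (-243 / 4) * lam ^ 2 + (-81 / 4) * lam ^
      3) * z20 + ((-45 / 2) * lam - 81 * lam ^ 2 + (-81 / 2) * lam ^ 3) * z00 + (-45 / 4 + (-297 /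
      4) * lam + (-567 / 4) * lam ^ 2 + (-243 / 4) * lam ^ 3) * z10 + ((-45 / 4) * lam + (-207 /
      4) * lam ^ 2 + (-243 / 4) * lam ^ 3 + (-81 / 4) * lam ^ 4) * z21 + ((-15 / 2) * lam + (-99 /
      2) * lam ^ 2 + (-189 / 2) * lam ^ 3 + (-81 / 2) * lam ^ 4) * z11
  have z31 : t 3 1 = 0 := by
    linear_combination (7 + 27 * lam + 18 * lam ^ 2) * e310 + (-5 - 18 * lam - 9 * lam ^ 2) * e311
      - (-3 * t 3 1) * hh + (-7 - 48 * lam - 99 * lam ^ 2 - 54 * lam ^ 3) * z33 + (6 + 33 * lam +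
      54 * lam ^ 2 + 27 * lam ^ 3) * z21 + (7 + 48 * lam + 99 * lam ^ 2 + 54 * lam ^ 3) * z11 + (5
      + 28 * lam + 45 * lam ^ 2 + 18 * lam ^ 3) * z32
  have z30 : t 3 0 = 0 := by
    linear_combination (12 + 45 * lam + 27 * lam ^ 2) * e300 + (-5 - 18 * lam - 9 * lam ^ 2) *
      e301 - (-3 * t 3 0) * hh + (-12 * lam - 45 * lam ^ 2 - 27 * lam ^ 3) * z33 + (12 * lam + 45
      * lam ^ 2 + 27 * lam ^ 3) * z00 + (7 + 48 * lam + 99 * lam ^ 2 + 54 * lam ^ 3) * z10 + (6 +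
      33 * lam + 54 * lam ^ 2 + 27 * lam ^ 3) * z20 + (5 * lam + 18 * lam ^ 2 + 9 * lam ^ 3) * z32
  refine eq_zero_of_mem_symMat ht fun i hi j hj => ?_
  interval_cases i <;> interval_cases j <;> assumption

/-- The equations of order four determine every entry from t_00. Points with δ = 2 need not be
excluded, because t_21 is now obtained with a constant pivot. -/
theorem rank_four_le_of_hyperbola [CharZero K] {lam mu : K} (hl : lam ≠ 0) (hq : lam ≠ -(2 / 3))
    (hs : lam ≠ -(1 / 3)) (hh : (3 * lam + 1) * (mu - lam) = 1 + 3 * lam - 3 * lam ^ 2) :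
    Module.rank K (symMat 4 lam mu) ≤ 1 := by
  have h := rank_le_of_functionals (symMat 4 lam mu)
    ![entry 0 0] fun t ht hf => ?_
  · exact_mod_cast h
  have hu : ∀ i p, i < p → t i p = 0 := fun i p h => ht.1 i p (by omega)
  have z00 : t 0 0 = 0 := hf 0
  have e100 := eq_zero_of_symEq_eq ht (symEq_1_0_0 t _ _)
  have e200 := eq_zero_of_symEq_eq ht (symEq_2_0_0 t _ _)
  have e201 := eq_zero_of_symEq_eq ht (symEq_2_0_1 t _ _)
  have e210 := eq_zero_of_symEq_eq ht (symEq_2_1_0 t _ _ hu)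
  have e300 := eq_zero_of_symEq_eq ht (symEq_3_0_0 t _ _)
  have e301 := eq_zero_of_symEq_eq ht (symEq_3_0_1 t _ _)
  have e302 := eq_zero_of_symEq_eq ht (symEq_3_0_2 t _ _)
  have e310 := eq_zero_of_symEq_eq ht (symEq_3_1_0 t _ _ hu)
  have e311 := eq_zero_of_symEq_eq ht (symEq_3_1_1 t _ _)
  have e320 := eq_zero_of_symEq_eq ht (symEq_3_2_0 t _ _ hu)
  have e400 := eq_zero_of_symEq_eq ht (symEq_4_0_0 t _ _)
  have e401 := eq_zero_of_symEq_eq ht (symEq_4_0_1 t _ _)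
  have e402 := eq_zero_of_symEq_eq ht (symEq_4_0_2 t _ _)
  have e403 := eq_zero_of_symEq_eq ht (symEq_4_0_3 t _ _)
  have e410 := eq_zero_of_symEq_eq ht (symEq_4_1_0 t _ _ hu)
  have e411 := eq_zero_of_symEq_eq ht (symEq_4_1_1 t _ _)
  have e412 := eq_zero_of_symEq_eq ht (symEq_4_1_2 t _ _)
  have e420 := eq_zero_of_symEq_eq ht (symEq_4_2_0 t _ _ hu)
  have e421 := eq_zero_of_symEq_eq ht (symEq_4_2_1 t _ _)
  have e430 := eq_zero_of_symEq_eq ht (symEq_4_3_0 t _ _ hu)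
  have z11 : t 1 1 = 0 := by
    refine (mul_eq_zero.1 ?_).resolve_left (mul_ne_zero (mul_ne_zero hl (sub_ne_zero.2 hq)) (sub_ne_zero.2 hs))
    linear_combination (41 / 225 + (38 / 45) * lam + (-167 / 225) * lam ^ 2 + (-568 / 75) * lam ^
      3 - 8 * lam ^ 4) * e100 + (4 / 75 + (182 / 75) * lam + (324 / 25) * lam ^ 2 + (1538 / 75) *
      lam ^ 3 + (152 / 25) * lam ^ 4) * e401 + (-1 / 15 - 4 * lam + (-106 / 5) * lam ^ 2 + (-481 /
      15) * lam ^ 3 - 8 * lam ^ 4) * e400 + (1 / 100 + (97 / 900) * lam + (739 / 900) * lam ^ 2 +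
      (929 / 300) * lam ^ 3 + 4 * lam ^ 4) * e430 + (-3 / 100 + (41 / 150) * lam + (1039 / 450) *
      lam ^ 2 + (411 / 100) * lam ^ 3 + (34 / 25) * lam ^ 4) * e412 + (-1 / 50 + (178 / 225) * lam
      + (9 / 2) * lam ^ 2 + (162 / 25) * lam ^ 3 + (48 / 25) * lam ^ 4) * e410 + (3 / 100 + (-1 /
      2) * lam + (-511 / 150) * lam ^ 2 + (-1673 / 300) * lam ^ 3 - 2 * lam ^ 4) * e411 + (-1 /
      100 + (-143 / 450) * lam + (-1601 / 900) * lam ^ 2 + (-814 / 225) * lam ^ 3 + (-196 / 75) *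
      lam ^ 4) * e420 + ((17 / 75) * lam + (322 / 225) * lam ^ 2 + (121 / 45) * lam ^ 3 + (98 /
      75) * lam ^ 4) * e421 + (4 / 25 + (128 / 25) * lam + (6548 / 225) * lam ^ 2 + (4024 / 75) *
      lam ^ 3 + (608 / 25) * lam ^ 4) * e300 + (1 / 50 + (44 / 225) * lam + (449 / 450) * lam ^ 2
      + (41 / 15) * lam ^ 3 + (72 / 25) * lam ^ 4) * e310 + (-1 / 30 + (-166 / 675) * lam + (-269
      / 450) * lam ^ 2 + (-12 / 25) * lam ^ 3) * e311 + (1 / 75 + (52 / 675) * lam + (-71 / 135) *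
      lam ^ 2 + (-854 / 225) * lam ^ 3 + (-424 / 75) * lam ^ 4) * e320 + (2 / 75 + (-2 / 9) * lam
      + (-154 / 75) * lam ^ 2 + (-358 / 75) * lam ^ 3 - 4 * lam ^ 4) * e201 + ((-151 / 150) * lam
      + (-1663 / 225) * lam ^ 2 + (-103 / 6) * lam ^ 3 + (-304 / 25) * lam ^ 4) * e210 + (-4 / 75
      + (-217 / 225) * lam + (-154 / 25) * lam ^ 2 + (-1051 / 75) * lam ^ 3 + (-208 / 25) * lam ^
      4) * e200 + (1 / 75 + (1 / 25) * lam) * e403 + (-1 / 30 + (-16 / 15) * lam + (-141 / 25) *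
      lam ^ 2 + (-1369 / 150) * lam ^ 3 + (-68 / 25) * lam ^ 4) * e402 + (-3 / 25 + (-178 / 75) *
      lam + (-2873 / 225) * lam ^ 2 + (-1786 / 75) * lam ^ 3 + (-272 / 25) * lam ^ 4) * e301 + (2
      / 25 + (22 / 75) * lam + (4 / 25) * lam ^ 2) * e302 - ((41 / 225 + (67 / 225) * lam + (-368
      / 225) * lam ^ 2 + (-8 / 3) * lam ^ 3) * t 1 0 + ((-8 / 15) * lam + (-8 / 5) * lam ^ 2) * t
      4 0 + (1 / 100 + (7 / 90) * lam + (529 / 900) * lam ^ 2 + (4 / 3) * lam ^ 3) * t 4 3 + (-1 /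
      50 + (77 / 450) * lam + (52 / 75) * lam ^ 2) * t 4 1 + (-1 / 100 + (149 / 900) * lam + (44 /
      75) * lam ^ 2) * t 4 2 + (1 / 25 + (-31 / 25) * lam + (-1126 / 225) * lam ^ 2 + (-208 / 75)
      * lam ^ 3) * t 3 0 + (-7 / 150 + (-211 / 1350) * lam + (61 / 225) * lam ^ 2 + (24 / 25) *
      lam ^ 3) * t 3 1 + (1 / 75 + (1 / 27) * lam + (-86 / 135) * lam ^ 2 + (-424 / 225) * lam ^
      3) * t 3 2 + ((-317 / 225) * lam + (-151 / 25) * lam ^ 2 + (-136 / 25) * lam ^ 3) * t 2 0 +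
      ((-151 / 150) * lam + (-1967 / 450) * lam ^ 2 + (-304 / 75) * lam ^ 3) * t 2 1) * hh + ((2 /
      9) * lam + lam ^ 2 + lam ^ 3) * z00
  have z10 : t 1 0 = 0 := by
    refine (mul_eq_zero.1 ?_).resolve_left hl
    linear_combination (-11 / 12 - 14 * lam + (-75 / 2) * lam ^ 2 + (-45 / 4) * lam ^ 3) * e401 +
      (-5 / 12 + 40 * lam + (555 / 4) * lam ^ 2 + 45 * lam ^ 3) * e400 + (-4 / 3 + (-101 / 4) *
      lam - 158 * lam ^ 2 + (-1641 / 4) * lam ^ 3 + (-765 / 2) * lam ^ 4) * e430 + (9 / 2 + (229 /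
      6) * lam + (233 / 2) * lam ^ 2 + (255 / 2) * lam ^ 3) * e412 + (11 / 3 + (-71 / 12) * lam -
      94 * lam ^ 2 + (-927 / 4) * lam ^ 3 - 306 * lam ^ 4) * e410 + (-19 / 4 + (-319 / 12) * lam +
      (-215 / 4) * lam ^ 2 + (-65 / 4) * lam ^ 3 + 102 * lam ^ 4) * e411 + (13 / 12 + (71 / 2) *
      lam + (2741 / 12) * lam ^ 2 + 548 * lam ^ 3 + 459 * lam ^ 4) * e420 + (1 / 4 + (-139 / 12) *
      lam + (-1183 / 12) * lam ^ 2 + (-1045 / 4) * lam ^ 3 + (-459 / 2) * lam ^ 4) * e421 + (-15 /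
      2 - 50 * lam + (-195 / 2) * lam ^ 2 - 45 * lam ^ 3) * e300 + (-1 / 6 + (236 / 3) * lam +
      (2383 / 6) * lam ^ 2 + 615 * lam ^ 3 + 408 * lam ^ 4) * e310 + (25 / 9 + (-35 / 3) * lam +
      (-248 / 3) * lam ^ 2 - 68 * lam ^ 3) * e311 + (-47 / 18 + (-659 / 9) * lam + (-2825 / 6) *
      lam ^ 2 - 1130 * lam ^ 3 - 918 * lam ^ 4) * e320 + (-19 / 6 + (13 / 2) * lam + (245 / 2) *
      lam ^ 2 + (549 / 2) * lam ^ 3 + 153 * lam ^ 4) * e201 + (-7 / 2 + (-151 / 2) * lam + (-683 /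
      2) * lam ^ 2 + (-777 / 2) * lam ^ 3 + 153 * lam ^ 4) * e210 + (7 / 2 - 13 * lam + (-337 / 2)
      * lam ^ 2 - 396 * lam ^ 3 - 306 * lam ^ 4) * e200 + (-17 / 12 + (-17 / 4) * lam) * e403 +
      (17 / 12 + (17 / 4) * lam) * e402 + (17 / 2 + (187 / 6) * lam + 17 * lam ^ 2) * e301 + (-17
      / 2 + (-187 / 6) * lam - 17 * lam ^ 2) * e302 + (-37 / 12 + (67 / 6) * lam + (773 / 4) * lam
      ^ 2 + 498 * lam ^ 3 + 306 * lam ^ 4) * e100 - ((-5 / 4 + (-15 / 4) * lam) * t 4 0 + (-4 / 3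
      + (-85 / 4) * lam + (-377 / 4) * lam ^ 2 + (-255 / 2) * lam ^ 3) * t 4 3 + (35 / 12 + (241 /
      12) * lam + 34 * lam ^ 2) * t 4 1 + (19 / 12 + (91 / 12) * lam + (17 / 2) * lam ^ 2) * t 4 2
      + (-15 / 2 + (-55 / 2) * lam - 15 * lam ^ 2) * t 3 0 + (97 / 18 + (235 / 6) * lam + (343 /
      3) * lam ^ 2 + 136 * lam ^ 3) * t 3 1 + (-47 / 18 + (-1177 / 18) * lam + (-824 / 3) * lam ^
      2 - 306 * lam ^ 3) * t 3 2 + (-17 / 6 + (17 / 2) * lam + 51 * lam ^ 2) * t 2 0 + (-7 / 2 -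
      65 * lam + (-293 / 2) * lam ^ 2 + 51 * lam ^ 3) * t 2 1 + (-37 / 12 + (245 / 12) * lam + 132
      * lam ^ 2 + 102 * lam ^ 3) * t 1 0) * hh + ((-15 / 2) * lam + (-71 / 6) * lam ^ 2 + 66 * lam
      ^ 3 + 102 * lam ^ 4) * z00 + ((15 / 2) * lam + (71 / 6) * lam ^ 2 - 66 * lam ^ 3 - 102 * lam
      ^ 4) * z11
  have z22 : t 2 2 = 0 := by
    refine (mul_eq_zero.1 ?_).resolve_left (mul_ne_zero hl (sub_ne_zero.2 hs))
    linear_combination (-1 / 9 + (-1 / 3) * lam) * e403 + (-10 / 9 + (-10 / 3) * lam) * e400 + (2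
      / 9 + (2 / 3) * lam) * e401 + (7 / 9 + (29 / 9) * lam + (13 / 3) * lam ^ 2 + 3 * lam ^ 3 - 6
      * lam ^ 4) * e410 + (-1 / 6 + (-5 / 9) * lam + (-4 / 3) * lam ^ 2 + (-17 / 6) * lam ^ 3 + 2
      * lam ^ 4) * e411 + (1 / 9 + (1 / 3) * lam) * e402 + (-11 / 18 + (-25 / 6) * lam + (-145 /
      18) * lam ^ 2 + (-1 / 6) * lam ^ 3 + 9 * lam ^ 4) * e420 + (1 / 3 + (41 / 18) * lam + (40 /
      9) * lam ^ 2 + (1 / 3) * lam ^ 3 + (-9 / 2) * lam ^ 4) * e421 + (-1 / 6 + (-8 / 9) * lam +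
      (-1 / 3) * lam ^ 2 + (5 / 2) * lam ^ 3) * e412 + (5 / 18 + (7 / 3) * lam + (17 / 3) * lam ^
      2 + lam ^ 3 + (-15 / 2) * lam ^ 4) * e430 + (2 / 3 + (22 / 9) * lam + (4 / 3) * lam ^ 2) *
      e301 + (-22 / 9 + (-98 / 9) * lam + (-104 / 9) * lam ^ 2 + 8 * lam ^ 4) * e310 + (29 / 27 +
      (38 / 9) * lam + (26 / 9) * lam ^ 2 + (-1 / 3) * lam ^ 3) * e311 + (37 / 27 + (263 / 27) *
      lam + (175 / 9) * lam ^ 2 + (5 / 3) * lam ^ 3 - 18 * lam ^ 4) * e320 + (-2 / 3 + (-22 / 9) *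
      lam + (-4 / 3) * lam ^ 2) * e302 + (7 / 6 + (16 / 3) * lam + (37 / 6) * lam ^ 2 - 6 * lam ^
      4) * e200 + (-17 / 18 + (-14 / 3) * lam + (-16 / 3) * lam ^ 2 + (3 / 2) * lam ^ 3 + 3 * lam
      ^ 4) * e201 + (5 / 3 + (53 / 6) * lam + (25 / 3) * lam ^ 2 + (-17 / 2) * lam ^ 3 + 3 * lam ^
      4) * e210 - ((-2 / 9 + (-4 / 9) * lam + (2 / 3) * lam ^ 2) * t 4 1 + (1 / 18 + (2 / 9) * lam
      + (1 / 6) * lam ^ 2) * t 4 2 + (5 / 18 + (3 / 2) * lam + (7 / 6) * lam ^ 2 + (-5 / 2) * lam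
      ^ 3) * t 4 3 + (-8 / 27 + (-14 / 9) * lam + (-10 / 9) * lam ^ 2 + (8 / 3) * lam ^ 3) * t 3 1
      + (37 / 27 + (152 / 27) * lam + (23 / 9) * lam ^ 2 - 6 * lam ^ 3) * t 3 2 + (-13 / 18 + (-11
      / 6) * lam + lam ^ 2) * t 2 0 + (5 / 3 + (23 / 6) * lam + (-19 / 6) * lam ^ 2 + lam ^ 3) * t
      2 1) * hh + ((1 / 18) * lam + 2 * lam ^ 2 + (37 / 6) * lam ^ 3 - 6 * lam ^ 5) * z00 + ((-2 /
      3) * lam + (1 / 6) * lam ^ 2 + (43 / 6) * lam ^ 3 - 6 * lam ^ 5) * z10 + ((5 / 18) * lam -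
      lam ^ 2 + (-37 / 6) * lam ^ 3 + 6 * lam ^ 5) * z11
  have z21 : t 2 1 = 0 := by
    linear_combination (-12 - 99 * lam - 297 * lam ^ 2 - 324 * lam ^ 3) * e210 + (-3 / 2 + (-27 /
      2) * lam + (-69 / 2) * lam ^ 2 + (-9 / 2) * lam ^ 3 + 54 * lam ^ 4) * e411 + (-1 - 9 * lam -
      45 * lam ^ 2 - 135 * lam ^ 3 - 162 * lam ^ 4) * e410 + (-3 / 2 - 21 * lam - 108 * lam ^ 2 -
      243 * lam ^ 3 + (-405 / 2) * lam ^ 4) * e430 + (5 / 2 + (45 / 2) * lam + (135 / 2) * lam ^ 2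
      + (135 / 2) * lam ^ 3) * e412 + (5 / 2 + (65 / 2) * lam + (309 / 2) * lam ^ 2 + (639 / 2) *
      lam ^ 3 + 243 * lam ^ 4) * e420 + (-1 - 14 * lam + (-141 / 2) * lam ^ 2 - 153 * lam ^ 3 +
      (-243 / 2) * lam ^ 4) * e421 + (12 + 96 * lam + 276 * lam ^ 2 + 360 * lam ^ 3 + 216 * lam ^
      4) * e310 + (-5 - 35 * lam - 75 * lam ^ 2 - 45 * lam ^ 3) * e311 + (-7 - 81 * lam - 351 *
      lam ^ 2 - 675 * lam ^ 3 - 486 * lam ^ 4) * e320 - ((-12 - 63 * lam - 108 * lam ^ 2) * t 2 1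
      + (2 + 12 * lam + 18 * lam ^ 2) * t 4 1 + (-3 / 2 + (-33 / 2) * lam + (-117 / 2) * lam ^ 2 +
      (-135 / 2) * lam ^ 3) * t 4 3 + (1 / 2 + 3 * lam + (9 / 2) * lam ^ 2) * t 4 2 + (2 + 20 *
      lam + 66 * lam ^ 2 + 72 * lam ^ 3) * t 3 1 + (-7 - 60 * lam - 171 * lam ^ 2 - 162 * lam ^ 3)
      * t 3 2) * hh + (-1 - 4 * lam - 12 * lam ^ 2 - 45 * lam ^ 3 - 54 * lam ^ 4) * z11 + (1 + 4 *
      lam + 12 * lam ^ 2 + 45 * lam ^ 3 + 54 * lam ^ 4) * z22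
  have z20 : t 2 0 = 0 := by
    linear_combination (1 + 9 * lam + 18 * lam ^ 2) * e200 + (-2 - 9 * lam - 9 * lam ^ 2) * e201 -
      (-3 * t 2 0) * hh + (-lam - 9 * lam ^ 2 - 18 * lam ^ 3) * z22 + (lam + 9 * lam ^ 2 + 18 *
      lam ^ 3) * z00 + (-1 - 2 * lam + 9 * lam ^ 2 + 18 * lam ^ 3) * z10 + (2 * lam + 9 * lam ^ 2
      + 9 * lam ^ 3) * z21
  have z33 : t 3 3 = 0 := by
    refine (mul_eq_zero.1 ?_).resolve_left (mul_ne_zero (mul_ne_zero hl (sub_ne_zero.2 hq)) (sub_ne_zero.2 hs))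
    linear_combination (-2 / 9 + (-4 / 3) * lam + (-7 / 3) * lam ^ 2 - lam ^ 3) * e301 + (5 / 9 +
      (10 / 3) * lam + 6 * lam ^ 2 + 3 * lam ^ 3) * e300 + ((-1 / 9) * lam + (-2 / 3) * lam ^ 2 -
      lam ^ 3) * e320 - ((-1 / 9 + (-1 / 3) * lam) * t 3 0 + ((-1 / 9) * lam + (-1 / 3) * lam ^ 2)
      * t 3 2) * hh + (1 / 3 + 3 * lam + (29 / 3) * lam ^ 2 + 13 * lam ^ 3 + 6 * lam ^ 4) * z10 +
      (1 / 3 + (7 / 3) * lam + 6 * lam ^ 2 + 7 * lam ^ 3 + 3 * lam ^ 4) * z20 + ((5 / 9) * lam +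
      (10 / 3) * lam ^ 2 + 6 * lam ^ 3 + 3 * lam ^ 4) * z00 + ((-1 / 3) * lam + (-7 / 3) * lam ^ 2
      - 5 * lam ^ 3 - 3 * lam ^ 4) * z22
  have z32 : t 3 2 = 0 := by
    linear_combination (-1 / 2 + (15 / 2) * lam + (63 / 2) * lam ^ 2 + (27 / 2) * lam ^ 3) * e320
      + (-15 / 4 + (-27 / 2) * lam + (-27 / 4) * lam ^ 2) * e302 + (-45 / 2 - 81 * lam + (-81 / 2)
      * lam ^ 2) * e300 + (45 / 4 + (81 / 2) * lam + (81 / 4) * lam ^ 2) * e301 + ((-15 / 2) * lam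
      - 27 * lam ^ 2 + (-27 / 2) * lam ^ 3) * e310 + ((15 / 4) * lam + (27 / 2) * lam ^ 2 + (27 /
      4) * lam ^ 3) * e311 - ((-1 / 2 + 9 * lam + (9 / 2) * lam ^ 2) * t 3 2) * hh + (3 / 2 + 9 *
      lam + (27 / 2) * lam ^ 2) * z33 + (-3 / 2 + 21 * lam + 117 * lam ^ 2 + 135 * lam ^ 3 + (81 /
      2) * lam ^ 4) * z22 + (-45 / 4 + (-207 / 4) * lam + (-243 / 4) * lam ^ 2 + (-81 / 4) * lam ^
      3) * z20 + ((-45 / 2) * lam - 81 * lam ^ 2 + (-81 / 2) * lam ^ 3) * z00 + (-45 / 4 + (-297 /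
      4) * lam + (-567 / 4) * lam ^ 2 + (-243 / 4) * lam ^ 3) * z10 + ((-45 / 4) * lam + (-207 /
      4) * lam ^ 2 + (-243 / 4) * lam ^ 3 + (-81 / 4) * lam ^ 4) * z21 + ((-15 / 2) * lam + (-99 /
      2) * lam ^ 2 + (-189 / 2) * lam ^ 3 + (-81 / 2) * lam ^ 4) * z11
  have z31 : t 3 1 = 0 := by
    linear_combination (7 + 27 * lam + 18 * lam ^ 2) * e310 + (-5 - 18 * lam - 9 * lam ^ 2) * e311
      - (-3 * t 3 1) * hh + (-7 - 48 * lam - 99 * lam ^ 2 - 54 * lam ^ 3) * z33 + (6 + 33 * lam +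
      54 * lam ^ 2 + 27 * lam ^ 3) * z21 + (7 + 48 * lam + 99 * lam ^ 2 + 54 * lam ^ 3) * z11 + (5
      + 28 * lam + 45 * lam ^ 2 + 18 * lam ^ 3) * z32
  have z30 : t 3 0 = 0 := by
    linear_combination (12 + 45 * lam + 27 * lam ^ 2) * e300 + (-5 - 18 * lam - 9 * lam ^ 2) *
      e301 - (-3 * t 3 0) * hh + (-12 * lam - 45 * lam ^ 2 - 27 * lam ^ 3) * z33 + (12 * lam + 45
      * lam ^ 2 + 27 * lam ^ 3) * z00 + (7 + 48 * lam + 99 * lam ^ 2 + 54 * lam ^ 3) * z10 + (6 +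
      33 * lam + 54 * lam ^ 2 + 27 * lam ^ 3) * z20 + (5 * lam + 18 * lam ^ 2 + 9 * lam ^ 3) * z32
  have z44 : t 4 4 = 0 := by
    refine (mul_eq_zero.1 ?_).resolve_left (sub_ne_zero.2 hs)
    linear_combination (-7 / 10 + (-39 / 10) * lam + (-27 / 5) * lam ^ 2) * e421 + (17 / 15 + (31
      / 5) * lam + (42 / 5) * lam ^ 2) * e420 + (-3 / 5 + (-18 / 5) * lam + (-27 / 5) * lam ^ 2) *
      e430 + (-1 / 10 + (-7 / 10) * lam + (-6 / 5) * lam ^ 2) * e412 + (-3 / 5 + (-21 / 5) * lam +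
      (-36 / 5) * lam ^ 2) * e410 + (3 / 10 + (21 / 10) * lam + (18 / 5) * lam ^ 2) * e411 - ((-4
      / 15 + (-4 / 5) * lam) * t 4 2 + (-3 / 5 + (-9 / 5) * lam) * t 4 3) * hh + (13 / 5 + (233 /
      15) * lam + (136 / 5) * lam ^ 2 + 12 * lam ^ 3) * z32 + (68 / 15 + (158 / 5) * lam + (354 /
      5) * lam ^ 2 + (252 / 5) * lam ^ 3) * z22 + (-18 / 5 - 24 * lam + (-234 / 5) * lam ^ 2 +
      (-108 / 5) * lam ^ 3) * z33 + (-3 / 5 + (-23 / 5) * lam - 10 * lam ^ 2 + (-24 / 5) * lam ^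
      3) * z31 + (-6 / 5 + (-51 / 5) * lam - 27 * lam ^ 2 + (-108 / 5) * lam ^ 3) * z21 + (-3 / 5
      + (-33 / 5) * lam - 24 * lam ^ 2 + (-144 / 5) * lam ^ 3) * z11
  have z43 : t 4 3 = 0 := by
    linear_combination (-1 / 3 + (42 / 5) * lam + (162 / 5) * lam ^ 2 + (63 / 5) * lam ^ 3) * e430
      + (-18 / 5 + (-61 / 5) * lam + (-21 / 5) * lam ^ 2) * e402 + (-36 - 122 * lam - 42 * lam ^
      2) * e400 + (72 / 5 + (244 / 5) * lam + (84 / 5) * lam ^ 2) * e401 + ((-36 / 5) * lam +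
      (-122 / 5) * lam ^ 2 + (-42 / 5) * lam ^ 3) * e420 + ((18 / 5) * lam + (61 / 5) * lam ^ 2 +
      (21 / 5) * lam ^ 3) * e421 - ((-1 / 3 + (47 / 5) * lam + (21 / 5) * lam ^ 2) * t 4 3) * hh +
      (2 + (236 / 15) * lam + (174 / 5) * lam ^ 2 + (84 / 5) * lam ^ 3) * z44 + (-2 + (736 / 15) *
      lam + 228 * lam ^ 2 + (1026 / 5) * lam ^ 3 + (252 / 5) * lam ^ 4) * z33 + (-216 / 5 + (-1056
      / 5) * lam - 270 * lam ^ 2 + (-378 / 5) * lam ^ 3) * z20 + (-108 / 5 + (-438 / 5) * lam - 74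
      * lam ^ 2 + (-84 / 5) * lam ^ 3) * z30 + (-36 * lam - 122 * lam ^ 2 - 42 * lam ^ 3) * z00 +
      (-108 / 5 + (-798 / 5) * lam - 318 * lam ^ 2 + (-504 / 5) * lam ^ 3) * z10 + ((-144 / 5) *
      lam + (-704 / 5) * lam ^ 2 - 180 * lam ^ 3 + (-252 / 5) * lam ^ 4) * z22 + ((-108 / 5) * lam
      + (-438 / 5) * lam ^ 2 - 74 * lam ^ 3 + (-84 / 5) * lam ^ 4) * z32
  have z42 : t 4 2 = 0 := by
    linear_combination (13 + 45 * lam + 18 * lam ^ 2) * e420 + (-8 - 27 * lam - 9 * lam ^ 2) *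
      e421 - (-3 * t 4 2) * hh + (-52 - 258 * lam - 342 * lam ^ 2 - 108 * lam ^ 3) * z44 + (52 +
      258 * lam + 342 * lam ^ 2 + 108 * lam ^ 3) * z22 + (30 + 128 * lam + 126 * lam ^ 2 + 36 *
      lam ^ 3) * z32 + (24 + 105 * lam + 108 * lam ^ 2 + 27 * lam ^ 3) * z43
  have z41 : t 4 1 = 0 := by
    linear_combination (21 + 72 * lam + 27 * lam ^ 2) * e410 + (-8 - 27 * lam - 9 * lam ^ 2) *
      e411 - (-3 * t 4 1) * hh + (-21 - 156 * lam - 315 * lam ^ 2 - 108 * lam ^ 3) * z44 + (52 +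
      258 * lam + 342 * lam ^ 2 + 108 * lam ^ 3) * z21 + (30 + 128 * lam + 126 * lam ^ 2 + 36 *
      lam ^ 3) * z31 + (21 + 156 * lam + 315 * lam ^ 2 + 108 * lam ^ 3) * z11 + (8 + 51 * lam + 90
      * lam ^ 2 + 27 * lam ^ 3) * z43
  have z40 : t 4 0 = 0 := by
    linear_combination (29 + 99 * lam + 36 * lam ^ 2) * e400 + (-8 - 27 * lam - 9 * lam ^ 2) *
      e401 - (-3 * t 4 0) * hh + (-29 * lam - 99 * lam ^ 2 - 36 * lam ^ 3) * z44 + (29 * lam + 99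
      * lam ^ 2 + 36 * lam ^ 3) * z00 + (21 + 156 * lam + 315 * lam ^ 2 + 108 * lam ^ 3) * z10 +
      (52 + 258 * lam + 342 * lam ^ 2 + 108 * lam ^ 3) * z20 + (30 + 128 * lam + 126 * lam ^ 2 +
      36 * lam ^ 3) * z30 + (8 * lam + 27 * lam ^ 2 + 9 * lam ^ 3) * z43
  refine eq_zero_of_mem_symMat ht fun i hi j hj => ?_
  interval_cases i <;> interval_cases j <;> assumption

end CircleDensity

/-! ### Upper bounds for generic weights -/

namespace CircleDensity

variable {K : Type*} [Field K]

theorem rank_zero_le [CharZero K] (lam mu : K) : Module.rank K (symMat 0 lam mu) ≤ 1 := by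
  have h := rank_le_of_functionals (symMat 0 lam mu) ![entry 0 0] fun t ht hf => ?_
  · exact_mod_cast h
  have z00 : t 0 0 = 0 := hf 0
  refine eq_zero_of_mem_symMat ht fun i hi j hj => ?_
  interval_cases i
  interval_cases j
  exact z00

theorem rank_one_le_of_lam_ne_zero [CharZero K] {lam : K} (hl : lam ≠ 0) (mu : K) :
    Module.rank K (symMat 1 lam mu) ≤ 2 := by
  have h := rank_le_of_functionals (symMat 1 lam mu) ![entry 0 0, entry 1 0] fun t ht hf => ?_
  · exact_mod_cast h
  have z00 : t 0 0 = 0 := hf 0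
  have z10 : t 1 0 = 0 := hf 1
  have e100 := eq_zero_of_symEq_eq ht (symEq_1_0_0 t _ _)
  have z11 : t 1 1 = 0 := by
    refine (mul_eq_zero.1 ?_).resolve_left hl
    linear_combination e100 - (mu - lam - 1) * z10 + lam * z00
  refine eq_zero_of_mem_symMat ht fun i hi j hj => ?_
  interval_cases i <;> interval_cases j <;> assumption

theorem rank_one_le_of_lam_eq_zero [CharZero K] {mu : K} (h1 : mu ≠ 1) :
    Module.rank K (symMat 1 0 mu) ≤ 2 := by
  have h := rank_le_of_functionals (symMat 1 0 mu) ![entry 0 0, entry 1 1] fun t ht hf => ?_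
  · exact_mod_cast h
  have z00 : t 0 0 = 0 := hf 0
  have z11 : t 1 1 = 0 := hf 1
  have e100 := eq_zero_of_symEq_eq ht (symEq_1_0_0 t _ _)
  have z10 : t 1 0 = 0 := by
    refine (mul_eq_zero.1 ?_).resolve_left (sub_ne_zero.2 h1)
    linear_combination e100
  refine eq_zero_of_mem_symMat ht fun i hi j hj => ?_
  interval_cases i <;> interval_cases j <;> assumption

theorem rank_one_le [CharZero K] (lam mu : K) : Module.rank K (symMat 1 lam mu) ≤ 3 := by
  have h := rank_le_of_functionals (symMat 1 lam mu)
    ![entry 0 0, entry 1 0, entry 1 1] fun t ht hf => ?_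
  · exact_mod_cast h
  have z00 : t 0 0 = 0 := hf 0
  have z10 : t 1 0 = 0 := hf 1
  have z11 : t 1 1 = 0 := hf 2
  refine eq_zero_of_mem_symMat ht fun i hi j hj => ?_
  interval_cases i <;> interval_cases j <;> assumption

theorem rank_two_le [CharZero K] {lam mu : K} (hl : lam ≠ 0) (hm : mu ≠ 1) (h2 : mu - lam ≠ 2) :
    Module.rank K (symMat 2 lam mu) ≤ 2 := by
  have h := rank_le_of_functionals (symMat 2 lam mu) ![entry 0 0, entry 1 0] fun t ht hf => ?_
  · exact_mod_cast h
  have hu : ∀ i p, i < p → t i p = 0 := fun i p h => ht.1 i p (by omega)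
  have z00 : t 0 0 = 0 := hf 0
  have z10 : t 1 0 = 0 := hf 1
  have e100 := eq_zero_of_symEq_eq ht (symEq_1_0_0 t _ _)
  have e200 := eq_zero_of_symEq_eq ht (symEq_2_0_0 t _ _)
  have e201 := eq_zero_of_symEq_eq ht (symEq_2_0_1 t _ _)
  have e210 := eq_zero_of_symEq_eq ht (symEq_2_1_0 t _ _ hu)
  rw [z00, z10] at e100 e200
  rw [z10] at e201
  have z11 : t 1 1 = 0 := by
    refine (mul_eq_zero.1 ?_).resolve_left hl
    linear_combination e100
  have z22 : t 2 2 = 0 := by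
    refine (mul_eq_zero.1 ?_).resolve_left
      (mul_ne_zero (mul_ne_zero two_ne_zero hl) (sub_ne_zero.2 hm))
    linear_combination lam * e210 - (mu - lam - 2) * e201 + (2 * (mu - lam) - 3) * e200 +
      (1 + 2 * lam) * e100
  have z20 : t 2 0 = 0 := by
    refine (mul_eq_zero.1 ?_).resolve_left (sub_ne_zero.2 h2)
    linear_combination e200 - lam * z22
  have z21 : t 2 1 = 0 := by
    refine (mul_eq_zero.1 ?_).resolve_left hl
    linear_combination e201 - (2 * (mu - lam) - 3) * z20
  refine eq_zero_of_mem_symMat ht fun i hi j hj => ?_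
  interval_cases i <;> interval_cases j <;> assumption

/-- The pivots are the equations of the special curves: lam, mu - 1, δ - 2, lam + mu - 1 and the
hyperbola, whose equation is three times the polynomial in `hq`. -/
theorem rank_three_le [CharZero K] {lam mu : K} (hl : lam ≠ 0) (hm : mu ≠ 1) (h2 : mu - lam ≠ 2)
    (hlm : lam + mu ≠ 1) (hh : (3 * lam + 1) * (3 * mu - 4) ≠ -1) :
    Module.rank K (symMat 3 lam mu) ≤ 1 := by
  have h := rank_le_of_functionals (symMat 3 lam mu) ![entry 0 0] fun t ht hf => ?_
  · exact_mod_cast h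
  have hu : ∀ i p, i < p → t i p = 0 := fun i p h => ht.1 i p (by omega)
  have z00 : t 0 0 = 0 := hf 0
  have e100 := eq_zero_of_symEq_eq ht (symEq_1_0_0 t _ _)
  have e200 := eq_zero_of_symEq_eq ht (symEq_2_0_0 t _ _)
  have e201 := eq_zero_of_symEq_eq ht (symEq_2_0_1 t _ _)
  have e210 := eq_zero_of_symEq_eq ht (symEq_2_1_0 t _ _ hu)
  have e300 := eq_zero_of_symEq_eq ht (symEq_3_0_0 t _ _)
  have e301 := eq_zero_of_symEq_eq ht (symEq_3_0_1 t _ _)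
  have e302 := eq_zero_of_symEq_eq ht (symEq_3_0_2 t _ _)
  have e310 := eq_zero_of_symEq_eq ht (symEq_3_1_0 t _ _ hu)
  have e311 := eq_zero_of_symEq_eq ht (symEq_3_1_1 t _ _)
  have e320 := eq_zero_of_symEq_eq ht (symEq_3_2_0 t _ _ hu)
  obtain ⟨d, hd⟩ : ∃ d, d = mu - lam := ⟨_, rfl⟩
  rw [← hd] at e100 e200 e201 e210 e300 e301 e302 e310 e311 e320 h2
  rw [z00] at e100 e200 e300
  have hq : 3 * lam * lam + 3 * lam * d - 3 * lam + d - 1 ≠ 0 := fun h =>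
    hh (by rw [hd] at h; linear_combination 3 * h)
  obtain rfl : mu = lam + d := by rw [hd]; ring
  have hm : lam + d - 1 ≠ 0 := sub_ne_zero.2 hm
  have hlm : lam + (lam + d) - 1 ≠ 0 := sub_ne_zero.2 hlm
  have z22 : t 2 2 = 0 := by
    refine (mul_eq_zero.1 ?_).resolve_left (mul_ne_zero (mul_ne_zero two_ne_zero hl) hm)
    linear_combination lam * e210 - (d - 2) * e201 + (2 * d - 3) * e200 + (1 + 2 * lam) * e100
  -- Off the hyperbola the diagonal entries t_11 and t_33 agree.
  have h13 : (3 * lam * lam + 3 * lam * d - 3 * lam + d - 1) * (t 1 1 - t 3 3) = 0 := by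
    linear_combination (-e320 + (d - 3) * e311 + (-2 * lam - 2 * d + 5) * e310 +
      (2 * d - 6) * e302 + (-2 * d + 6) * e301 - 4 * e300 - 3 * e210 + (-6 * lam - 3 * d) * e201 +
      (6 * lam + 6 * d - 3) * e200 + e100 -
      6 * lam * (lam + d - 1) * z22) / 2
  have h13 := (mul_eq_zero.1 h13).resolve_left hq
  -- A relation between t_10 and t_33. Inserting it and t_11 = t_33 into the equation of order one
  -- leaves lam (mu - 1)(lam + mu - 1) t_33 = 0.
  have h10 : 2 * (3 * lam * lam + 3 * lam * d - 3 * lam + d - 1) * t 1 0 =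
      lam * t 3 3 * (3 * (lam + d) - 5) := by
    linear_combination -lam * e310 + (d - 3) * e302 + (-3 * d + 6) * e300 +
      (-3 * lam - 3) * e201 + (-3 * lam - 1) * e100
  have z33 : t 3 3 = 0 := by
    refine (mul_eq_zero.1 ?_).resolve_left (mul_ne_zero (mul_ne_zero hl hm) hlm)
    linear_combination (2 * (3 * lam * lam + 3 * lam * d - 3 * lam + d - 1) * e100 -
      (d - 1) * h10 -
      2 * (3 * lam * lam + 3 * lam * d - 3 * lam + d - 1) * lam * h13) / 3
  have z11 : t 1 1 = 0 := by linear_combination h13 + z33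
  have z10 : t 1 0 = 0 := by
    refine (mul_eq_zero.1 ?_).resolve_left (mul_ne_zero two_ne_zero hq)
    linear_combination h10 + lam * (3 * (lam + d) - 5) * z33
  have z20 : t 2 0 = 0 := by
    refine (mul_eq_zero.1 ?_).resolve_left (sub_ne_zero.2 h2)
    linear_combination e200 - lam * z22 + (1 + 2 * lam) * z10
  have z21 : t 2 1 = 0 := by
    refine (mul_eq_zero.1 ?_).resolve_left hl
    linear_combination e201 - (2 * d - 3) * z20 + (1 + 2 * lam) * z10
  simp only [z10, z11, z20, z21, z33] at e300 e301 e302 e310 e311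
  have z32 : t 3 2 = 0 := by
    refine (mul_eq_zero.1 ?_).resolve_left (mul_ne_zero hl hm)
    linear_combination lam / 2 * e311 + (5 / 2 - d) * e302 + (d - 3 / 2) * e301 - e300
  have z31 : t 3 1 = 0 := by linear_combination e311 - 2 * e310 - (1 + 2 * lam) * z32
  have z30 : t 3 0 = 0 := by linear_combination e301 - 3 * e300 - lam * z32
  refine eq_zero_of_mem_symMat ht fun i hi j hj => ?_
  interval_cases i <;> interval_cases j <;> assumption

end CircleDensity

/-! ### Assembling the rows of the table -/

namespace CircleDensity

variable {K : Type*} [Field K] [CharZero K]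

/-- The dimension does not increase from order three on, so for k ≥ 5 the upper bound in order five
is enough; only the lower bound has to be supplied for every such k. -/
theorem rank_eq_row {lam mu : K} {d₁ d₂ d₃ d₄ d₅ : ℕ}
    (h₁ : Module.rank K (symMat 1 lam mu) = d₁) (h₂ : Module.rank K (symMat 2 lam mu) = d₂)
    (h₃ : Module.rank K (symMat 3 lam mu) = d₃) (h₄ : Module.rank K (symMat 4 lam mu) = d₄)
    (h₅ : Module.rank K (symMat 5 lam mu) ≤ d₅)
    (h : ∀ k, 5 ≤ k → (d₅ : Cardinal) ≤ Module.rank K (symMat k lam mu)) (k : ℕ) :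
    Module.rank K (symMat k lam mu) = row 1 d₁ d₂ d₃ d₄ d₅ k := by
  match k with
  | 0 => exact le_antisymm (by simpa [row] using rank_zero_le lam mu)
          (by simpa [row] using one_le_rank 0 lam mu)
  | 1 => exact h₁
  | 2 => exact h₂
  | 3 => exact h₃
  | 4 => exact h₄
  | k + 5 =>
    exact le_antisymm
      ((rank_symMat_le_of_le (by norm_num) (by omega) lam mu).trans h₅) (h _ (by omega))

theorem rank_one_eq {lam mu : K} (h : ¬ (lam = 0 ∧ mu = 1)) :
    Module.rank K (symMat 1 lam mu) = 2 := by
  by_cases hl : lam = 0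
  · subst hl
    exact le_antisymm (rank_one_le_of_lam_eq_zero fun h1 => h ⟨rfl, h1⟩)
      (two_le_rank_of_lam_eq_zero le_rfl mu)
  · exact le_antisymm (rank_one_le_of_lam_ne_zero hl mu) (two_le_rank_one hl mu)

theorem rank_two_eq {lam mu : K} (hl : lam ≠ 0) (hm : mu ≠ 1)
    (h : ¬ (lam = -(1 / 2) ∧ mu - lam = 2)) : Module.rank K (symMat 2 lam mu) = 2 := by
  refine le_antisymm ?_ (two_le_rank_two hl fun h2 h3 => h ⟨by linear_combination h3 / 2, h2⟩)
  by_cases h2 : mu - lam = 2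
  · obtain rfl : mu = lam + 2 := by linear_combination h2
    exact rank_two_le_of_sub_eq_two hl (fun h1 => hm (by rw [h1]; norm_num))
      (fun h1 => h ⟨h1, h2⟩)
  · exact rank_two_le hl hm h2

theorem rank_eq_row_of_lam_eq_zero {mu : K} (hm : mu ≠ 1) {d₄ d₅ : ℕ}
    (h₄ : Module.rank K (symMat 4 0 mu) = d₄) (h₅ : Module.rank K (symMat 5 0 mu) ≤ d₅)
    (h : ∀ k, 5 ≤ k → (d₅ : Cardinal) ≤ Module.rank K (symMat k 0 mu)) (k : ℕ) :
    Module.rank K (symMat k 0 mu) = row 1 2 3 3 d₄ d₅ k :=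
  rank_eq_row (by exact_mod_cast rank_one_eq fun h => hm h.2)
    (by exact_mod_cast le_antisymm (rank_two_le_of_lam_eq_zero hm)
            (three_le_rank_two_of_lam_eq_zero mu))
    (by exact_mod_cast le_antisymm (rank_three_le_of_lam_eq_zero hm)
            (three_le_rank_three_of_lam_eq_zero mu)) h₄ h₅ h k

theorem rank_eq_row_of_mu_eq_one {lam : K} (hl : lam ≠ 0) {d₄ d₅ : ℕ}
    (h₄ : Module.rank K (symMat 4 lam 1) = d₄) (h₅ : Module.rank K (symMat 5 lam 1) ≤ d₅)
    (h : ∀ k, 5 ≤ k → (d₅ : Cardinal) ≤ Module.rank K (symMat k lam 1)) (k : ℕ) :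
    Module.rank K (symMat k lam 1) = row 1 2 3 3 d₄ d₅ k :=
  rank_eq_row (by exact_mod_cast rank_one_eq fun h => hl h.1)
    (by exact_mod_cast le_antisymm (rank_two_le_of_mu_eq_one hl)
            (three_le_rank_two_of_mu_eq_one lam))
    (by exact_mod_cast le_antisymm (rank_three_le_of_mu_eq_one hl)
            (three_le_rank_three_of_mu_eq_one lam)) h₄ h₅ h k

theorem rank_generic {lam mu : K} (hl : lam ≠ 0) (hm : mu ≠ 1) (hlm : lam + mu ≠ 1)
    (hh : (3 * lam + 1) * (3 * mu - 4) ≠ -1) (h2 : mu - lam ≠ 2) (k : ℕ) :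
    Module.rank K (symMat k lam mu) = row 1 2 2 1 1 1 k := by
  have h3 := rank_three_le hl hm h2 hlm hh
  have h4 := (rank_symMat_le_of_le le_rfl (show 3 ≤ 4 by norm_num) lam mu).trans h3
  have h5 := (rank_symMat_le_of_le le_rfl (show 3 ≤ 5 by norm_num) lam mu).trans h3
  exact rank_eq_row (by exact_mod_cast rank_one_eq fun h => hl h.1)
    (by exact_mod_cast rank_two_eq hl hm fun h => h2 h.2)
    (by exact_mod_cast le_antisymm h3 (one_le_rank 3 lam mu))
    (by exact_mod_cast le_antisymm h4 (one_le_rank 4 lam mu)) (by exact_mod_cast h5)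
    (fun k _ => by exact_mod_cast one_le_rank k lam mu) k

theorem rank_of_lam_eq_zero {mu : K} (h0 : mu ≠ 0) (h1 : mu ≠ 1) (h2 : mu ≠ 5 / 4) (h3 : mu ≠ 3)
    (k : ℕ) : Module.rank K (symMat k 0 mu) = row 1 2 3 3 2 2 k := by
  have h4 := rank_four_le_of_lam_eq_zero h0 h1 h2 h3
  have h5 := (rank_symMat_le_of_le (show 3 ≤ 4 by norm_num) (show 4 ≤ 5 by norm_num) 0 mu).trans h4
  exact rank_eq_row_of_lam_eq_zero h1
    (by exact_mod_cast le_antisymm h4 (two_le_rank_of_lam_eq_zero (by norm_num) mu))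
    (by exact_mod_cast h5)
    (fun k hk => by exact_mod_cast two_le_rank_of_lam_eq_zero (by omega) mu) k

theorem rank_of_mu_eq_one {lam : K} (h0 : lam ≠ 0) (h1 : lam ≠ 1) (h2 : lam ≠ -(1 / 4))
    (h3 : lam ≠ -2) (k : ℕ) : Module.rank K (symMat k lam 1) = row 1 2 3 3 2 2 k := by
  have h4 := rank_four_le_of_mu_eq_one h0 h1 h2 h3
  have h5 := (rank_symMat_le_of_le (show 3 ≤ 4 by norm_num) (show 4 ≤ 5 by norm_num) lam 1).trans h4
  exact rank_eq_row_of_mu_eq_one h0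
    (by exact_mod_cast le_antisymm h4 (two_le_rank_of_mu_eq_one (by norm_num) lam))
    (by exact_mod_cast h5)
    (fun k hk => by exact_mod_cast two_le_rank_of_mu_eq_one (by omega) lam) k

theorem rank_of_add_eq_one {lam mu : K} (hlm : lam + mu = 1) (h0 : lam ≠ 0)
    (h1 : lam ≠ -(1 / 2)) (h2 : lam ≠ -(2 / 3)) (k : ℕ) :
    Module.rank K (symMat k lam mu) = row 1 2 2 2 2 2 k := by
  have hm : mu ≠ 1 := fun h => h0 (by linear_combination hlm - h)
  obtain rfl : mu = 1 - lam := by linear_combination hlm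
  have h3 := rank_three_le_of_add_eq_one h0 h1 h2
  have h4 := (rank_symMat_le_of_le le_rfl (show 3 ≤ 4 by norm_num) lam (1 - lam)).trans h3
  have h5 := (rank_symMat_le_of_le le_rfl (show 3 ≤ 5 by norm_num) lam (1 - lam)).trans h3
  exact rank_eq_row (by exact_mod_cast rank_one_eq fun h => h0 h.1)
    (by exact_mod_cast rank_two_eq h0 hm fun h => h1 h.1)
    (by exact_mod_cast le_antisymm h3 (two_le_rank_of_add_eq_one (by norm_num) hlm))
    (by exact_mod_cast le_antisymm h4 (two_le_rank_of_add_eq_one (by norm_num) hlm))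
    (by exact_mod_cast h5)
    (fun k hk => by exact_mod_cast two_le_rank_of_add_eq_one (by omega) hlm) k

theorem rank_of_hyperbola {lam mu : K} (hh : (3 * lam + 1) * (3 * mu - 4) = -1)
    (h2 : mu - lam ≠ 2) (hl : lam ≠ 0) (hm : mu ≠ 1) (hlm : lam + mu ≠ 1) (k : ℕ) :
    Module.rank K (symMat k lam mu) = row 1 2 2 2 1 1 k := by
  have hs : lam ≠ -(1 / 3) := fun h => by
    rw [h] at hh
    norm_num at hh
  -- At lam = -2/3 the curve gives mu = 5/3, a point of lam + mu = 1.
  have hq : lam ≠ -(2 / 3) := fun h => hlm (by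
    rw [h] at hh ⊢
    linear_combination -hh / 3)
  have hd : (3 * lam + 1) * (mu - lam) = 1 + 3 * lam - 3 * lam ^ 2 := by linear_combination hh / 3
  -- On the curve this quadratic is -(3 lam + 1)(mu - lam - 2).
  have h3 : 1 + 3 * lam + 3 * lam ^ 2 ≠ 0 := fun h => by
    have hs' : 3 * lam + 1 ≠ 0 := fun h => hs (by linear_combination h / 3)
    exact h2 (mul_left_cancel₀ hs' (by linear_combination hd - h))
  have h4 := rank_four_le_of_hyperbola hl hq hs hd
  have h5 := (rank_symMat_le_of_le (show 3 ≤ 4 by norm_num) (show 4 ≤ 5 by norm_num) lam mu).trans h4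
  exact rank_eq_row (by exact_mod_cast rank_one_eq fun h => hl h.1)
    (by exact_mod_cast rank_two_eq hl hm fun h => h2 h.2)
    (by exact_mod_cast le_antisymm (rank_three_le_of_hyperbola hl hq hs hd h3)
            (two_le_rank_three_of_hyperbola hl h2 hh))
    (by exact_mod_cast le_antisymm h4 (one_le_rank 4 lam mu)) (by exact_mod_cast h5)
    (fun k _ => by exact_mod_cast one_le_rank k lam mu) k

theorem rank_of_sub_eq_two {lam : K} (hl : lam ≠ 0) (h1 : lam ≠ -1) (h2 : lam ≠ -(1 / 2)) {d₄ : ℕ}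
    (h₄ : Module.rank K (symMat 4 lam (lam + 2)) = d₄) (k : ℕ) :
    Module.rank K (symMat k lam (lam + 2)) = row 1 2 2 2 d₄ 1 k := by
  have hm : lam + 2 ≠ 1 := fun h => h1 (by linear_combination h)
  exact rank_eq_row (by exact_mod_cast rank_one_eq fun h => hl h.1)
    (by exact_mod_cast rank_two_eq hl hm fun h => h2 h.1)
    (by exact_mod_cast le_antisymm (rank_three_le_of_sub_eq_two hl h1 h2)
            (two_le_rank_three_of_sub_eq_two (by ring))) h₄
    (by exact_mod_cast rank_five_le_of_sub_eq_two hl h1 h2)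
    (fun k _ => by exact_mod_cast one_le_rank k lam _) k

theorem rank_of_sub_eq_two_of_quadratic_ne {lam mu : K} (h : mu - lam = 2) (hl : lam ≠ 0)
    (hm : mu ≠ 1) (hlm : lam + mu ≠ 1) (h3 : 2 * lam ^ 2 + 2 * lam + 1 ≠ 0) (k : ℕ) :
    Module.rank K (symMat k lam mu) = row 1 2 2 2 1 1 k := by
  obtain rfl : mu = lam + 2 := by linear_combination h
  have h1 : lam ≠ -1 := fun h => hm (by linear_combination h)
  have h2 : lam ≠ -(1 / 2) := fun h => hlm (by linear_combination 2 * h)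
  exact rank_of_sub_eq_two hl h1 h2 (by
    exact_mod_cast le_antisymm (rank_four_le_of_sub_eq_two hl h1 h2 h3) (one_le_rank 4 _ _)) k

theorem rank_of_sub_eq_two_of_quadratic_eq {lam mu : K} (h : mu - lam = 2)
    (h3 : 2 * lam ^ 2 + 2 * lam + 1 = 0) (k : ℕ) :
    Module.rank K (symMat k lam mu) = row 1 2 2 2 2 1 k := by
  obtain rfl : mu = lam + 2 := by linear_combination h
  have hl : lam ≠ 0 := by
    rintro rfl
    norm_num at h3
  have h1 : lam ≠ -1 := by
    rintro rfl
    norm_num at h3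
  have h2 : lam ≠ -(1 / 2) := by
    rintro rfl
    norm_num at h3
  have h4 := (rank_symMat_le_of_le le_rfl (show 3 ≤ 4 by norm_num) lam (lam + 2)).trans
    (rank_three_le_of_sub_eq_two hl h1 h2)
  exact rank_of_sub_eq_two hl h1 h2 (by
    exact_mod_cast le_antisymm h4 (two_le_rank_four_of_sub_eq_two h h3)) k

theorem rank_of_lam_eq_zero_of_three_le {mu : K} (hm : mu ≠ 1)
    (h4 : 3 ≤ Module.rank K (symMat 4 0 mu)) (h5 : Module.rank K (symMat 5 0 mu) ≤ 2) (k : ℕ) :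
    Module.rank K (symMat k 0 mu) = row 1 2 3 3 3 2 k :=
  rank_eq_row_of_lam_eq_zero hm
    (by exact_mod_cast le_antisymm ((rank_symMat_le_of_le le_rfl (by norm_num) 0 mu).trans
            (rank_three_le_of_lam_eq_zero hm)) h4) (by exact_mod_cast h5)
    (fun k hk => by exact_mod_cast two_le_rank_of_lam_eq_zero (by omega) mu) k

theorem rank_of_mu_eq_one_of_three_le {lam : K} (hl : lam ≠ 0)
    (h4 : 3 ≤ Module.rank K (symMat 4 lam 1)) (h5 : Module.rank K (symMat 5 lam 1) ≤ 2) (k : ℕ) :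
    Module.rank K (symMat k lam 1) = row 1 2 3 3 3 2 k :=
  rank_eq_row_of_mu_eq_one hl
    (by exact_mod_cast le_antisymm ((rank_symMat_le_of_le le_rfl (by norm_num) lam 1).trans
            (rank_three_le_of_mu_eq_one hl)) h4) (by exact_mod_cast h5)
    (fun k hk => by exact_mod_cast two_le_rank_of_mu_eq_one (by omega) lam) k

theorem rank_zero_zero (k : ℕ) : Module.rank K (symMat k (0 : K) 0) = row 1 2 3 3 3 3 k := by
  have h3 := rank_three_le_of_lam_eq_zero (show (0 : K) ≠ 1 by norm_num)
  have h4 := (rank_symMat_le_of_le le_rfl (show 3 ≤ 4 by norm_num) (0 : K) 0).trans h3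
  have h5 := (rank_symMat_le_of_le le_rfl (show 3 ≤ 5 by norm_num) (0 : K) 0).trans h3
  exact rank_eq_row_of_lam_eq_zero (by norm_num)
    (by exact_mod_cast le_antisymm h4 (three_le_rank_zero_zero (by norm_num)))
    (by exact_mod_cast h5)
    (fun k hk => by exact_mod_cast three_le_rank_zero_zero (by omega)) k

theorem rank_one_one (k : ℕ) : Module.rank K (symMat k (1 : K) 1) = row 1 2 3 3 3 3 k := by
  have h3 := rank_three_le_of_mu_eq_one (show (1 : K) ≠ 0 by norm_num)
  have h4 := (rank_symMat_le_of_le le_rfl (show 3 ≤ 4 by norm_num) (1 : K) 1).trans h3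
  have h5 := (rank_symMat_le_of_le le_rfl (show 3 ≤ 5 by norm_num) (1 : K) 1).trans h3
  exact rank_eq_row_of_mu_eq_one (by norm_num)
    (by exact_mod_cast le_antisymm h4 (three_le_rank_one_one (by norm_num)))
    (by exact_mod_cast h5)
    (fun k hk => by exact_mod_cast three_le_rank_one_one (by omega)) k

theorem rank_neg_two_thirds (k : ℕ) :
    Module.rank K (symMat k (-2 / 3 : K) (5 / 3)) = row 1 2 2 3 3 2 k := by
  have h3 := rank_three_le_neg_two_thirds (K := K)
  have h4 := rank_symMat_le_of_le le_rfl (show 3 ≤ 4 by norm_num) (-2 / 3 : K) (5 / 3)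
  have h4' := three_le_rank_four_neg_two_thirds (K := K)
  exact rank_eq_row (by exact_mod_cast rank_one_eq (by norm_num))
    (by exact_mod_cast rank_two_eq (by norm_num) (by norm_num) (by norm_num))
    (by exact_mod_cast le_antisymm h3 (h4'.trans h4))
    (by exact_mod_cast le_antisymm (h4.trans h3) h4')
    (by exact_mod_cast rank_five_le_neg_two_thirds)
    (fun k hk => by exact_mod_cast two_le_rank_of_add_eq_one (by omega) (by norm_num)) k

theorem rank_neg_half (k : ℕ) :
    Module.rank K (symMat k (-1 / 2 : K) (3 / 2)) = row 1 2 3 3 2 2 k := by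
  have hlm : (-1 / 2 : K) + 3 / 2 = 1 := by norm_num
  have h4 := rank_four_le_neg_half (K := K)
  have h5 := (rank_symMat_le_of_le (show 3 ≤ 4 by norm_num) (show 4 ≤ 5 by norm_num)
    (-1 / 2 : K) (3 / 2)).trans h4
  exact rank_eq_row (by exact_mod_cast rank_one_eq (by norm_num))
    (by exact_mod_cast le_antisymm rank_two_le_neg_half three_le_rank_two_neg_half)
    (by exact_mod_cast le_antisymm rank_three_le_neg_half three_le_rank_three_neg_half)
    (by exact_mod_cast le_antisymm h4 (two_le_rank_of_add_eq_one (by norm_num) hlm))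
    (by exact_mod_cast h5)
    (fun k hk => by exact_mod_cast two_le_rank_of_add_eq_one (by omega) hlm) k

theorem rank_zero_one (k : ℕ) : Module.rank K (symMat k (0 : K) 1) = row 1 3 4 5 5 5 k := by
  have h3 := rank_three_le_zero_one (K := K)
  have h4 := (rank_symMat_le_of_le le_rfl (show 3 ≤ 4 by norm_num) (0 : K) 1).trans h3
  have h5 := (rank_symMat_le_of_le le_rfl (show 3 ≤ 5 by norm_num) (0 : K) 1).trans h3
  exact rank_eq_row
    (by exact_mod_cast le_antisymm (rank_one_le (0 : K) 1) three_le_rank_zero_one)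
    (by exact_mod_cast le_antisymm rank_two_le_zero_one four_le_rank_zero_one)
    (by exact_mod_cast le_antisymm h3 (five_le_rank_zero_one le_rfl))
    (by exact_mod_cast le_antisymm h4 (five_le_rank_zero_one (by norm_num)))
    (by exact_mod_cast h5)
    (fun k hk => by exact_mod_cast five_le_rank_zero_one (by omega)) k

end CircleDensity

open CircleDensity in
theorem theorem6p6 (𝕜 : Type*) [RCLike 𝕜] (lam mu : 𝕜) (k : ℕ) :
    -- generic weights
    (lam ≠ 0 → mu ≠ 1 → lam + mu ≠ 1 → (3 * lam + 1) * (3 * mu - 4) ≠ -1 → mu - lam ≠ 2 →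
      Module.rank 𝕜 (localSymmetries k lam mu) = row 1 2 2 1 1 1 k) ∧
    -- `lam = 0` or `mu = 1`, generic
    (lam = 0 ∨ mu = 1 →
      (lam, mu) ∉ ({(-1 / 4, 1), (-2, 1), (0, 5 / 4), (0, 3), (0, 0), (1, 1), (0, 1)} :
        Set (𝕜 × 𝕜)) →
      Module.rank 𝕜 (localSymmetries k lam mu) = row 1 2 3 3 2 2 k) ∧
    -- `lam + mu = 1`, generic
    (lam + mu = 1 →
      (lam, mu) ∉ ({(-2 / 3, 5 / 3), (-1 / 2, 3 / 2), (0, 1)} : Set (𝕜 × 𝕜)) →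
      Module.rank 𝕜 (localSymmetries k lam mu) = row 1 2 2 2 2 2 k) ∧
    -- the hyperbola or the line `mu - lam = 2`, generic
    ((3 * lam + 1) * (3 * mu - 4) = -1 ∨ mu - lam = 2 →
      lam ≠ 0 → mu ≠ 1 → lam + mu ≠ 1 →
      ¬ (mu - lam = 2 ∧ 2 * lam ^ 2 + 2 * lam + 1 = 0) →
      Module.rank 𝕜 (localSymmetries k lam mu) = row 1 2 2 2 1 1 k) ∧
    -- the two points of the line `mu - lam = 2` with `lam = (-1 ± i) / 2`
    (mu - lam = 2 → 2 * lam ^ 2 + 2 * lam + 1 = 0 →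
      Module.rank 𝕜 (localSymmetries k lam mu) = row 1 2 2 2 2 1 k) ∧
    ((lam, mu) ∈ ({(-1 / 4, 1), (-2, 1), (0, 5 / 4), (0, 3)} : Set (𝕜 × 𝕜)) →
      Module.rank 𝕜 (localSymmetries k lam mu) = row 1 2 3 3 3 2 k) ∧
    ((lam, mu) ∈ ({(0, 0), (1, 1)} : Set (𝕜 × 𝕜)) →
      Module.rank 𝕜 (localSymmetries k lam mu) = row 1 2 3 3 3 3 k) ∧
    ((lam, mu) = (-2 / 3, 5 / 3) →
      Module.rank 𝕜 (localSymmetries k lam mu) = row 1 2 2 3 3 2 k) ∧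
    ((lam, mu) = (-1 / 2, 3 / 2) →
      Module.rank 𝕜 (localSymmetries k lam mu) = row 1 2 3 3 2 2 k) ∧
    ((lam, mu) = (0, 1) →
      Module.rank 𝕜 (localSymmetries k lam mu) = row 1 3 4 5 5 5 k) := by
  rw [rank_localSymmetries]
  refine ⟨fun hl hm hlm hh h2 => rank_generic hl hm hlm hh h2 k, fun h hn => ?_,
    fun hlm hn => ?_, fun h hl hm hlm h3 => ?_,
    fun h2 h3 => rank_of_sub_eq_two_of_quadratic_eq h2 h3 k, fun h => ?_, fun h => ?_,
    fun h => ?_, fun h => ?_, fun h => ?_⟩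
  · simp only [Set.mem_insert_iff, Set.mem_singleton_iff, Prod.mk.injEq, not_or] at hn
    obtain ⟨n1, n2, n3, n4, n5, n6, n7⟩ := hn
    rcases h with rfl | rfl
    · exact rank_of_lam_eq_zero (fun h => n5 ⟨rfl, h⟩) (fun h => n7 ⟨rfl, h⟩)
        (fun h => n3 ⟨rfl, h⟩) (fun h => n4 ⟨rfl, h⟩) k
    · exact rank_of_mu_eq_one (fun h => n7 ⟨h, rfl⟩) (fun h => n6 ⟨h, rfl⟩)
        (fun h => n1 ⟨by rw [h]; norm_num, rfl⟩) (fun h => n2 ⟨h, rfl⟩) k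
  · simp only [Set.mem_insert_iff, Set.mem_singleton_iff, Prod.mk.injEq, not_or] at hn
    obtain ⟨n1, n2, n3⟩ := hn
    exact rank_of_add_eq_one hlm (fun h => n3 ⟨h, by linear_combination hlm - h⟩)
      (fun h => n2 ⟨by rw [h]; norm_num, by linear_combination hlm - h⟩)
      (fun h => n1 ⟨by rw [h]; norm_num, by linear_combination hlm - h⟩) k
  -- Points common to the curve and the line are treated on the line, where the row of dimensions is
  -- the same.
  · by_cases h2 : mu - lam = 2
    · exact rank_of_sub_eq_two_of_quadratic_ne h2 hl hm hlm (fun h => h3 ⟨h2, h⟩) k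
    · exact rank_of_hyperbola (h.resolve_right h2) h2 hl hm hlm k
  · simp only [Set.mem_insert_iff, Set.mem_singleton_iff, Prod.mk.injEq] at h
    rcases h with ⟨rfl, rfl⟩ | ⟨rfl, rfl⟩ | ⟨rfl, rfl⟩ | ⟨rfl, rfl⟩
    · exact rank_of_mu_eq_one_of_three_le (by norm_num) three_le_rank_four_neg_quarter_one
        rank_five_le_neg_quarter_one k
    · exact rank_of_mu_eq_one_of_three_le (by norm_num) three_le_rank_four_neg_two_one
        rank_five_le_neg_two_one k
    · exact rank_of_lam_eq_zero_of_three_le (by norm_num) three_le_rank_four_zero_five_quarters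
        rank_five_le_zero_five_quarters k
    · exact rank_of_lam_eq_zero_of_three_le (by norm_num) three_le_rank_four_zero_three
        rank_five_le_zero_three k
  · simp only [Set.mem_insert_iff, Set.mem_singleton_iff, Prod.mk.injEq] at h
    rcases h with ⟨rfl, rfl⟩ | ⟨rfl, rfl⟩
    · exact rank_zero_zero k
    · exact rank_one_one k
  · obtain ⟨rfl, rfl⟩ := Prod.mk.inj h
    exact rank_neg_two_thirds k
  · obtain ⟨rfl, rfl⟩ := Prod.mk.inj h
    exact rank_neg_half k
  · obtain ⟨rfl, rfl⟩ := Prod.mk.inj h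
    exact rank_zero_one k
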